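/- **Notation.** Let $n\in\mathbb N$, $\kappa>1$, $h\ge 1$, $\langle\xi\rangle_h=(h^2+|\xi|^2)^{1/2}$, and $D=-i\partial$. Put $\hat u(\xi)=\int e^{-iy\cdot\xi}u(y)\,dy$ and $p(x,D)u(x)=\mathrm{op}(p)u(x)=(2\pi)^{-n}\int e^{ix\cdot\xi}p(x,\xi)\hat u(\xi)\,d\xi$. For a real-valued symbol $a$, the adjoint $\{a(x,D)\}^*$ is given by the oscillatory integral $$\{a(x,D)\}^*u(x)=\lim_{\varepsilon\to0^+}(2\pi)^{-n}\iint e^{i(x-y)\cdot\xi}a(y,\xi)\chi(\varepsilon y,\varepsilon\xi)u(y)\,dy\,d\xi ,$$ with the integral in $y$ taken first, where $\chi\in\mathcal S_\kappa(\mathbb R^{2n})$ is any function with $\chi(0,0)=1$. Here $\mathcal S_\kappa(\mathbb R^{d})$ (resp. $\Sigma_\kappa(\mathbb R^{d})$) is the Gelfand–Shilov space of all $f\in C^\infty(\mathbb R^d)$ such that for some (resp. every) $B>0$ there is $C>0$ with $|x^\beta\partial^\alpha f(x)|\le CB^{|\alpha|+|\beta|}\alpha!^\kappa\beta!^\kappa$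 for all $\alpha,\beta,x$. A symbol $r\in C^\infty(\mathbb R^{2n})$ is called $\kappa$-regularizing if $|\partial^\alpha_\xi\partial^\beta_xr(x,\xi)|\le C^{|\alpha+\beta|+1}\alpha!^\kappa\beta!^\kappa e^{-c|\xi|^{1/\kappa}}$ for some $C,c>0$ and all $\alpha,\beta,x,\xi$. **Theorem** (conjugation theorem). Let $n\in\mathbb N$ and $\kappa>1$. There are $C_\kappa,c_\kappa>0$, depending only on $\kappa$ and $n$, such that for every $A>0$ there are $\tilde\delta>0$ and $h_0=h_0(A)\ge1$, depending only on $A,\kappa,n$, with the following property. Let $\rho_0\le\tilde\delta A^{-1/\kappa}$, $h\ge h_0$, $m\in\mathbb R$, let $p\in C^\infty(\mathbb R^{2n})$ be a complex-valued symbol satisfying $$|\partial_\xi^\alpha\partial_x^\beta p(x,\xi)|\le C_A A^{|\alpha+\beta|}\alpha!^\kappa\beta!^\kappa\langle\xi\rangle_h^{m-|\alpha|}\qquad\text{for all }\alpha,\beta,x,\xi,$$ and let $\Lambda\in C^\infty(\mathbb R^{2n})$ be real-valued with $$|\partial_\xi^\alpha\Lambda(x,\xi)|\le\rho_0A^{|\alpha|}\alpha!^\kappa\langle\xi\rangle_h^{\frac1\kappa-|\alpha|},\qquad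 |\partial_\xi^\alpha\partial_x^\beta\Lambda(x,\xi)|\le\rho_0A^{|\alpha+\beta|}\alpha!^\kappa\beta!^\kappa\langle\xi\rangle_h^{-|\alpha|}\ \text{ for }\beta\ne0 .$$ Then for every $N\in\mathbb N_0$ there are $r_N,r_\infty\in C^\infty(\mathbb R^{2n})$ such that, as operators on $\Sigma_\kappa(\mathbb R^n)$ (with all terms well defined), $$e^\Lambda(x,D)\,p(x,D)\,\{e^{-\Lambda}(x,D)\}^*=p(x,D)+\mathrm{op}\Big(\sum_{1\le|\alpha+\beta|<N}\frac1{\alpha!\beta!}\partial_\xi^\alpha\{\partial_\xi^\beta e^{\Lambda}\,D_x^\beta p\,D_x^\alpha e^{-\Lambda}\}\Big)+r_N(x,D)+r_\infty(x,D),$$ and, for all $\alpha,\beta,x,\xi$, $$|\partial_\xi^\alpha\partial_x^\beta r_N(x,\xi)|\le C\,(C_\kappa A)^{|\alpha+\beta|+2N}\alpha!^\kappa\beta!^\kappa N!^{2\kappa-1}\langle\xi\rangle_h^{m-(1-\frac1\kappa)N-|\alpha|},$$ $$|\partial_\xi^\alpha\partial_x^\beta r_\infty(x,\xi)|\le C\,(C_\kappa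 A)^{|\alpha+\beta|+2N}\alpha!^\kappa\beta!^\kappa N!^{2\kappa-1}e^{-c_\kappa A^{-1/\kappa}\langle\xi\rangle_h^{1/\kappa}},$$ where the constant $C>0$ depends only on $\rho_0,A,\kappa,n,m,C_A$ (and not on $h,N,\alpha,\beta$, nor otherwise on $p,\Lambda$). In particular, $r_\infty$ is $\kappa$-regularizing. -/

import Mathlib

open MeasureTheory Filter Topology
open scoped ContDiff Nat

noncomputable section

namespace GevreyConj

/-- The Euclidean space of dimension `n`. -/
abbrev E (n : ℕ) : Type := EuclideanSpace ℝ (Fin n)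

/-- Multi-indices in dimension `n`. -/
abbrev MIdx (n : ℕ) : Type := Fin n → ℕ

/-- The length of a multi-index. -/
def len {n : ℕ} (α : MIdx n) : ℕ := ∑ i, α i

/-- The factorial of a multi-index, as a real number. -/
def mfact {n : ℕ} (α : MIdx n) : ℝ := ∏ i, ((α i)! : ℝ)

/-- The partial derivative in the `i`-th coordinate. -/
def pderiv {n : ℕ} {F : Type} [NormedAddCommGroup F] [NormedSpace ℝ F] (i : Fin n)
    (f : E n → F) : E n → F :=
  fun x => fderiv ℝ f x (EuclideanSpace.single i 1)

/-- The iterated partial derivative `∂^α`. -/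
def mderiv {n : ℕ} {F : Type} [NormedAddCommGroup F] [NormedSpace ℝ F] (α : MIdx n)
    (f : E n → F) : E n → F :=
  (List.finRange n).foldr (fun i g => (pderiv i)^[α i] g) f

/-- `∂_ξ^α a` for a function `a (x, ξ)`, written in curried form. -/
def dξ {n : ℕ} {F : Type} [NormedAddCommGroup F] [NormedSpace ℝ F] (α : MIdx n)
    (a : E n → E n → F) : E n → E n → F :=
  fun x ξ => mderiv α (fun η => a x η) ξ

/-- `∂_x^β a` for a function `a (x, ξ)`, written in curried form. -/
def dx {n : ℕ} {F : Type} [NormedAddCommGroup F] [NormedSpace ℝ F] (β : MIdx n)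
    (a : E n → E n → F) : E n → E n → F :=
  fun x ξ => mderiv β (fun y => a y ξ) x

/-- `D_x^β a`, where `D = -i ∂`. -/
def Dx {n : ℕ} (β : MIdx n) (a : E n → E n → ℂ) : E n → E n → ℂ :=
  fun x ξ => (-Complex.I) ^ len β * dx β a x ξ

/-- Smoothness of `a (x, ξ)` jointly in both variables. -/
def Smooth₂ {n : ℕ} {F : Type} [NormedAddCommGroup F] [NormedSpace ℝ F]
    (a : E n → E n → F) : Prop :=
  ContDiff ℝ ∞ (fun z : E n × E n => a z.1 z.2)

/-- The weight `⟨ξ⟩_h = (h² + |ξ|²)^{1/2}`. -/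
def jap {n : ℕ} (h : ℝ) (ξ : E n) : ℝ := Real.sqrt (h ^ 2 + ‖ξ‖ ^ 2)

/-- `p` is a smooth symbol with
`|∂_ξ^α ∂_x^β p| ≤ C A^{|α+β|} α!^κ β!^κ ⟨ξ⟩_h^{m-|α|}`. -/
def IsGevreySymbol {n : ℕ} (κ A C m h : ℝ) (p : E n → E n → ℂ) : Prop :=
  Smooth₂ p ∧ ∀ (α β : MIdx n) (x ξ : E n),
    ‖dξ α (dx β p) x ξ‖ ≤
      C * A ^ (len α + len β) * mfact α ^ κ * mfact β ^ κ * jap h ξ ^ (m - (len α : ℝ))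

/-- The hypotheses on the real-valued phase `Λ`: order `1/κ`, and order `0` as soon as at least
one `x`-derivative falls on `Λ`. -/
def IsAdmissiblePhase {n : ℕ} (κ A ρ₀ h : ℝ) (Λ : E n → E n → ℝ) : Prop :=
  Smooth₂ Λ ∧
  (∀ (α : MIdx n) (x ξ : E n),
    |dξ α Λ x ξ| ≤ ρ₀ * A ^ len α * mfact α ^ κ * jap h ξ ^ (1 / κ - (len α : ℝ))) ∧
  (∀ (α β : MIdx n) (x ξ : E n), β ≠ 0 →
    |dξ α (dx β Λ) x ξ| ≤
      ρ₀ * A ^ (len α + len β) * mfact α ^ κ * mfact β ^ κ * jap h ξ ^ (-(len α : ℝ)))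

/-- The class `𝒦_r` of symbols of `r`-regularizing operators. -/
def IsRegularizing {n : ℕ} (r : ℝ) (p : E n → E n → ℂ) : Prop :=
  Smooth₂ p ∧ ∃ C > 0, ∃ c > 0, ∀ (α β : MIdx n) (x ξ : E n),
    ‖dξ α (dx β p) x ξ‖ ≤
      C ^ (len α + len β + 1) * mfact α ^ r * mfact β ^ r * Real.exp (-c * ‖ξ‖ ^ (1 / r))

/-- The monomial `x^β`. -/
def monom {n : ℕ} (β : MIdx n) (x : E n) : ℝ := ∏ i, x i ^ β i

/-- The Gelfand-Shilov space `Σ_θ(ℝⁿ)` (the projective one). -/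
def IsSigma {n : ℕ} (θ : ℝ) (u : E n → ℂ) : Prop :=
  ContDiff ℝ ∞ u ∧ ∀ A > 0, ∃ C : ℝ, ∀ (α β : MIdx n) (x : E n),
    |monom β x| * ‖mderiv α u x‖ ≤ C * A ^ (len α + len β) * mfact α ^ θ * mfact β ^ θ

/-- The Gelfand-Shilov space `𝒮_θ(ℝ²ⁿ)` (the inductive one), for functions of `(y, ξ)` in curried
form; multi-indices of length `2n` are written as pairs. -/
def IsGelfandShilov₂ {n : ℕ} (θ : ℝ) (χ : E n → E n → ℂ) : Prop :=
  Smooth₂ χ ∧ ∃ A > 0, ∃ C : ℝ, ∀ (α β γ δ : MIdx n) (y ξ : E n),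
    |monom γ ξ * monom δ y| * ‖dξ α (dx β χ) y ξ‖ ≤
      C * A ^ (len α + len β + len γ + len δ) *
        mfact α ^ θ * mfact β ^ θ * mfact γ ^ θ * mfact δ ^ θ

/-- The character `e^{i x·ξ}`. -/
def chr {n : ℕ} (x ξ : E n) : ℂ := Complex.exp (Complex.I * (inner ℝ x ξ : ℝ))

/-- The Fourier transform `û(ξ) = ∫ e^{-i y·ξ} u(y) dy`. -/
def ft {n : ℕ} (u : E n → ℂ) (ξ : E n) : ℂ := ∫ y, chr (-y) ξ * u y

/-- The constant `(2π)^{-n}` of the normalised measure `đξ`. -/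
def cst (n : ℕ) : ℂ := ((2 * Real.pi : ℂ) ^ n)⁻¹

/-- `w = a(x,D) u`, i.e. `w(x) = ∫ e^{i x·ξ} a(x,ξ) û(ξ) đξ`, all integrals being absolutely
convergent. -/
def IsOp {n : ℕ} (a : E n → E n → ℂ) (u w : E n → ℂ) : Prop :=
  Integrable u ∧ ∀ x, Integrable (fun ξ => chr x ξ * a x ξ * ft u ξ) ∧
    w x = cst n * ∫ ξ, chr x ξ * a x ξ * ft u ξ

/-- The integrand `e^{i (x-y)·ξ} a(y,ξ) χ(εy,εξ) u(y)` of the regularised oscillatory integral. -/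
def adjIntegrand {n : ℕ} (a : E n → E n → ℝ) (χ : E n → E n → ℂ) (u : E n → ℂ) (ε : ℝ)
    (x y ξ : E n) : ℂ :=
  chr (x - y) ξ * (a y ξ : ℂ) * χ (ε • y) (ε • ξ) * u y

/-- `w = {a(x,D)}^* u` for a real-valued symbol `a`, as the oscillatory integral
`w(x) = lim_{ε → 0} ∬ e^{i (x-y)·ξ} a(y,ξ) χ(εy,εξ) u(y) dy đξ`,
for every cut-off `χ ∈ 𝒮_θ(ℝ²ⁿ)` with `χ(0,0) = 1`. -/
def IsAdjOp {n : ℕ} (θ : ℝ) (a : E n → E n → ℝ) (u w : E n → ℂ) : Prop :=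
  ∀ χ : E n → E n → ℂ, IsGelfandShilov₂ θ χ → χ 0 0 = 1 → ∀ x : E n,
    (∀ᶠ ε : ℝ in 𝓝[>] 0,
      (∀ ξ, Integrable (fun y => adjIntegrand a χ u ε x y ξ)) ∧
      Integrable (fun ξ => ∫ y, adjIntegrand a χ u ε x y ξ)) ∧
    Tendsto (fun ε : ℝ => cst n * ∫ ξ, ∫ y, adjIntegrand a χ u ε x y ξ) (𝓝[>] 0) (𝓝 (w x))

/-- The real-valued symbol `e^Λ`. -/
def expSym {n : ℕ} (Λ : E n → E n → ℝ) : E n → E n → ℝ := fun x ξ => Real.exp (Λ x ξ)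

/-- A real-valued symbol, seen as a complex-valued one. -/
def toC {n : ℕ} (a : E n → E n → ℝ) : E n → E n → ℂ := fun x ξ => (a x ξ : ℂ)

/-- The pairs `(α, β)` of multi-indices with `1 ≤ |α+β| < N`. -/
def pairs (n N : ℕ) : Finset (MIdx n × MIdx n) :=
  ((Fintype.piFinset fun _ : Fin n => Finset.range N) ×ˢ
    (Fintype.piFinset fun _ : Fin n => Finset.range N)).filter
      fun q => 1 ≤ len q.1 + len q.2 ∧ len q.1 + len q.2 < N

/-- The symbol
`∑_{1 ≤ |α+β| < N} 1/(α!β!) ∂_ξ^α {∂_ξ^β e^Λ · D_x^β p · D_x^α e^{-Λ}}`. -/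
def expansion {n : ℕ} (Λ : E n → E n → ℝ) (p : E n → E n → ℂ) (N : ℕ) : E n → E n → ℂ :=
  fun x ξ => ∑ q ∈ pairs n N, ((1 / (mfact q.1 * mfact q.2) : ℝ) : ℂ) *
    dξ q.1 (fun y η => dξ q.2 (toC (expSym Λ)) y η * Dx q.2 p y η *
      Dx q.1 (toC (expSym (-Λ))) y η) x ξ

end GevreyConj

end

set_option linter.unusedSectionVars false

noncomputable section

namespace GevreyConj

open Finset (range sum_nonneg sum_mul sum_le_sum mem_range sum_eq_zero single_le_sum mul_sum induction_on sum_insert sum_congr mem_univ univ sum_const card_univ piAntidiag mem_filter mem_piAntidiag)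
open Real (rpow_pos_of_pos one_le_rpow mul_rpow rpow_natCast rpow_mul norm_eq_abs contDiff_exp exp_pos exp_add rpow_one rpow_le_rpow one_le_exp rpow_add rpow_neg norm_of_nonneg div_rpow exp_neg rpow_le_rpow_of_exponent_le one_rpow exp_le_exp smoothTransition rpow_nonneg sqrt_nonneg exp_zero exp)
open Nat (factorial_pos cast_one cast_nonneg multinomial)
open Complex (ofRealCLM ofRealCLM_apply norm_I norm_real ofReal_zero real_smul I)
open Function (iterate_succ_apply' comp_def uncurry uncurry_def)
open List (finRange foldr_cons map_cons prod_cons)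
open EuclideanSpace (single basisFun proj)
open Sum (elim elim_inl elim_inr)
open Prod (norm_def fst_sum snd_sum norm_mk mk_add_mk)
open Fintype (sum_sum_type card_sum card_fin piFinset)
open ContinuousLinearMap (inl inr fst snd comp_apply flip_apply opNorm_le_bound norm_id_le id_apply)
open ContinuousMultilinearMap (compContinuousLinearMapL)
open Module (finrank)
open Set (Icc indicator_of_mem indicator_of_notMem)
open Metric (closedBall)
open HasCompactSupport (of_support_subset_isCompact)

notation "C∞" => ContDiff ℝ ∞
notation "pos!" => by positivity
notation "lin!" => by linarith
notation "fun!" => by fun_prop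
notation "num!" => by norm_num
notation "mono!" => by gcongr
notation "E²" n:max => E n × E n
notation "𝒟" => iteratedFDeriv ℝ
variable {n : ℕ} {κ γ R ρ M m h s c t β C r x b N ε B A l L K y R' κ' M' γ' t' C₁ K' K₁ K₂ K₃ : ℝ} {Λ : E² n → ℝ} {p : E² n → ℂ}

section GevreyCalculus

variable {U U' F : Type} [NormedAddCommGroup U] [NormedSpace ℝ U]
  [NormedAddCommGroup U'] [NormedSpace ℝ U'] [NormedAddCommGroup F] [NormedSpace ℝ F]

/-- All total derivatives of `f` at `u` satisfy `‖D^k f(u)‖ ≤ M R^k k!^κ`. -/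
def GB (κ : ℝ) (f : U → F) (u : U) (M R : ℝ) : Prop :=
  ∀ k : ℕ, ‖𝒟 k f u‖ ≤ M * R ^ k * (k ! : ℝ) ^ κ

/-- The truncated weighted sum of the normalised derivatives of `f` at `u`. -/
def jet (κ ρ : ℝ) (K : ℕ) (f : U → F) (u : U) : ℝ :=
  ∑ k ∈ range K, ‖𝒟 k f u‖ * ρ ^ k / (k ! : ℝ) ^ κ

lemma fact_pos (k : ℕ) : (0 : ℝ) < (k ! : ℝ) := by exact_mod_cast k.factorial_pos

lemma fact_rpow_pos (k : ℕ) (κ : ℝ) : (0 : ℝ) < (k ! : ℝ) ^ κ := rpow_pos_of_pos (fact_pos k) _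

lemma one_le_fact (k : ℕ) : (1 : ℝ) ≤ (k ! : ℝ) := by exact_mod_cast k.factorial_pos

lemma one_le_fact_rpow (k : ℕ) (hκ : 0 ≤ κ) : (1 : ℝ) ≤ (k ! : ℝ) ^ κ :=
  one_le_rpow (one_le_fact k) hκ

lemma rpow_eq_mul_rpow_sub_one (hx : 0 < x) (κ : ℝ) : x ^ κ = x * x ^ (κ - 1) := by
  rw [Real.rpow_sub_one hx.ne']; field_simp

lemma choose_mul_fact_rpow_le (hκ : 1 ≤ κ) {i k : ℕ} (hi : i ≤ k) :
    (k.choose i : ℝ) * ((i ! : ℝ) ^ κ * ((k - i)! : ℝ) ^ κ) ≤ (k ! : ℝ) ^ κ := by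
  have h := Nat.choose_mul_factorial_mul_factorial hi
  have h' : (k.choose i : ℝ) * ((i ! : ℝ) * ((k - i)! : ℝ)) = (k ! : ℝ) := by
    rw [← h]; push_cast; ring
  have hle : ((i ! : ℝ) * ((k - i)! : ℝ)) ≤ (k ! : ℝ) := by
    rw [← h']
    refine le_mul_of_one_le_left pos! ?_
    exact_mod_cast Nat.choose_pos hi
  rw [← mul_rpow pos! pos!,
    rpow_eq_mul_rpow_sub_one (mul_pos (fact_pos i) (fact_pos (k - i))), ← mul_assoc, h',
    rpow_eq_mul_rpow_sub_one (fact_pos k)]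
  gcongr

lemma fact_add_rpow_le (hκ : 0 ≤ κ) (i k : ℕ) :
    ((i + k)! : ℝ) ^ κ ≤ ((2 : ℝ) ^ κ) ^ (i + k) * ((i ! : ℝ) ^ κ * (k ! : ℝ) ^ κ) := by
  have h : ((i + k)! : ℝ) ≤ 2 ^ (i + k) * ((i ! : ℝ) * (k ! : ℝ)) := by
    have h1 := Nat.choose_mul_factorial_mul_factorial (Nat.le_add_right i k)
    rw [Nat.add_sub_cancel_left] at h1
    have h2 : ((i + k).choose i : ℝ) ≤ 2 ^ (i + k) := by exact_mod_cast Nat.choose_le_two_pow _ _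
    have h3 : ((i + k)! : ℝ) = ((i + k).choose i : ℝ) * ((i ! : ℝ) * (k ! : ℝ)) := by
      rw [← h1]; push_cast; ring
    rw [h3]; gcongr
  calc ((i + k)! : ℝ) ^ κ ≤ (2 ^ (i + k) * ((i ! : ℝ) * (k ! : ℝ))) ^ κ := mono!
    _ = _ := by
      rw [mul_rpow pos! pos!, mul_rpow pos! pos!,
        ← rpow_natCast, ← rpow_natCast, ← rpow_mul num!,
        ← rpow_mul num!, mul_comm κ]

lemma fact_mul_fact_rpow_le (hκ : 0 ≤ κ) (i k : ℕ) :
    (i ! : ℝ) ^ κ * (k ! : ℝ) ^ κ ≤ ((i + k)! : ℝ) ^ κ := by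
  rw [← mul_rpow pos! pos!]
  gcongr
  exact_mod_cast Nat.le_of_dvd (factorial_pos _) (Nat.factorial_mul_factorial_dvd_factorial_add i k)

lemma jet_nonneg (hρ : 0 ≤ ρ) (K : ℕ) (f : U → F) (u : U) : 0 ≤ jet κ ρ K f u :=
  sum_nonneg fun k _ => pos!

lemma jet_mul_le {𝔸 : Type} [NormedRing 𝔸] [NormedAlgebra ℝ 𝔸] (hκ : 1 ≤ κ) (hρ : 0 ≤ ρ)
    (K : ℕ) {f g : U → 𝔸} (hf : C∞ f) (hg : C∞ g) (u : U) :
    jet κ ρ K (fun v => f v * g v) u ≤ jet κ ρ K f u * jet κ ρ K g u := by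
  set a : ℕ → ℝ := fun i => ‖𝒟 i f u‖ * ρ ^ i / (i ! : ℝ) ^ κ
  set b : ℕ → ℝ := fun i => ‖𝒟 i g u‖ * ρ ^ i / (i ! : ℝ) ^ κ
  have ha : ∀ i, 0 ≤ a i := fun i => pos!
  have hb : ∀ i, 0 ≤ b i := fun i => pos!
  have key : ∀ k, ‖𝒟 k (fun v => f v * g v) u‖ * ρ ^ k / (k ! : ℝ) ^ κ ≤
      ∑ i ∈ range (k + 1), a i * b (k - i) := by
    intro k
    have h := norm_iteratedFDeriv_mul_le hf hg u (n := k) (mod_cast le_top)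
    rw [div_le_iff₀ (fact_rpow_pos k κ), sum_mul]
    refine (mul_le_mul_of_nonneg_right h pos!).trans ?_
    rw [sum_mul]
    refine sum_le_sum fun i hi => ?_
    have hi' := Nat.lt_succ_iff.mp (mem_range.mp hi)
    have hc := choose_mul_fact_rpow_le hκ hi'
    have e : (k.choose i : ℝ) * ‖𝒟 i f u‖ * ‖𝒟 (k - i) g u‖ * ρ ^ k =
        a i * b (k - i) * ((k.choose i : ℝ) * ((i ! : ℝ) ^ κ * ((k - i)! : ℝ) ^ κ)) := by
      have h3 : ρ ^ k = ρ ^ i * ρ ^ (k - i) := by rw [← pow_add, Nat.add_sub_cancel' hi']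
      simp only [a, b, h3]
      field_simp
    rw [e]
    exact mul_le_mul_of_nonneg_left hc (mul_nonneg (ha _) (hb _))
  calc jet κ ρ K (fun v => f v * g v) u
      ≤ ∑ k ∈ range K, ∑ i ∈ range (k + 1), a i * b (k - i) :=
        sum_le_sum fun k _ => key k
    _ = ∑ i ∈ range K, ∑ j ∈ range (K - i), a i * b j :=
        Finset.sum_range_diag_flip K fun i j => a i * b j
    _ ≤ ∑ i ∈ range K, ∑ j ∈ range K, a i * b j := by
        refine sum_le_sum fun i _ => Finset.sum_le_sum_of_subset_of_nonneg ?_ ?_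
        · exact Finset.range_mono (Nat.sub_le _ _)
        · exact fun j _ _ => mul_nonneg (ha _) (hb _)
    _ = (∑ i ∈ range K, a i) * ∑ j ∈ range K, b j := by rw [Finset.sum_mul_sum]

lemma jet_const_one_le (K : ℕ) (u : U) : jet κ ρ K (fun _ : U => (1 : ℝ)) u ≤ 1 := by
  unfold jet
  rcases K with _ | K
  · simp
  · rw [Finset.sum_range_succ', sum_eq_zero]
    · simp
    · intro k _
      rw [iteratedFDeriv_const_of_ne (by omega)]
      simp

lemma jet_pow_le (hκ : 1 ≤ κ) (hρ : 0 ≤ ρ) (K : ℕ) {f : U → ℝ} (hf : C∞ f)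
    (u : U) (j : ℕ) : jet κ ρ K (fun v => f v ^ j) u ≤ jet κ ρ K f u ^ j := by
  induction j with
  | zero => simpa using jet_const_one_le K u
  | succ j ih =>
    simp only [pow_succ]
    refine (jet_mul_le hκ hρ K (hf.pow j) hf u).trans ?_
    exact mul_le_mul_of_nonneg_right ih (jet_nonneg hρ _ _ _)

lemma le_jet (hρ : 0 ≤ ρ) {k K : ℕ} (hk : k < K) (f : U → F) (u : U) :
    ‖𝒟 k f u‖ * ρ ^ k ≤ jet κ ρ K f u * (k ! : ℝ) ^ κ := by
  rw [← div_le_iff₀ (fact_rpow_pos k κ)]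
  exact single_le_sum (f := fun k => ‖𝒟 k f u‖ * ρ ^ k / (k ! : ℝ) ^ κ)
    (fun i _ => pos!) (mem_range.mpr hk)

lemma GB_of_jet (hρ : 0 < ρ) {f : U → F} {u : U} (h : ∀ K, jet κ ρ K f u ≤ M) :
    GB κ f u M ρ⁻¹ := by
  intro k
  have h1 := (le_jet hρ.le (Nat.lt_succ_self k) f u).trans
    (mul_le_mul_of_nonneg_right (h (k + 1)) (fact_rpow_pos k κ).le)
  rw [← le_div_iff₀ pos!] at h1
  refine h1.trans_eq ?_
  rw [inv_pow]; field_simp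

lemma sum_half_pow_le (K : ℕ) : ∑ k ∈ range K, ((1 : ℝ) / 2) ^ k ≤ 2 := by
  have h := Summable.sum_le_tsum (range K) (fun i _ => pos!) summable_geometric_two
  rwa [tsum_geometric_two] at h

lemma GB.nonneg {f : U → F} {u : U} (h : GB κ f u M R) : 0 ≤ M := by
  have := (norm_nonneg _).trans (h 0)
  simpa using this

lemma GB.norm_le {f : U → F} {u : U} (h : GB κ f u M R) : ‖f u‖ ≤ M := by
  simpa using h 0

lemma GB.mono {f : U → F} {u : U} (h : GB κ f u M R) (hR : 0 ≤ R) (hM : M ≤ M')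
    (hR' : R ≤ R') : GB κ f u M' R' := fun k => (h k).trans (by
  have := h.nonneg
  have := this.trans hM
  gcongr)

lemma GB.congr {f g : U → F} {u : U} (h : GB κ f u M R) (hfg : f =ᶠ[𝓝 u] g) :
    GB κ g u M R := fun k => by rw [← (hfg.iteratedFDeriv ℝ k).eq_of_nhds]; exact h k

/-- A geometric bound of the derivatives of positive order controls the jets without constant term. -/
lemma jet_sub_const_le (hM : 0 ≤ M) (hR : 0 < R) (hL : 2 ≤ L) {f : U → F} {u : U}
    (hf : C∞ f)
    (h : ∀ k, 1 ≤ k → ‖𝒟 k f u‖ ≤ M * R ^ k * (k ! : ℝ) ^ κ) (K : ℕ) :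
    jet κ ((R * L)⁻¹) K (fun v => f v - f u) u ≤ 2 * M / L := by
  have hL0 : 0 < L := lin!
  unfold jet
  rcases K with _ | K
  · simp; positivity
  · rw [Finset.sum_range_succ']
    have h0 : ‖𝒟 0 (fun v => f v - f u) u‖ = 0 := by simp
    rw [h0]
    have hk : ∀ k ∈ range K,
        ‖𝒟 (k + 1) (fun v => f v - f u) u‖ * (R * L)⁻¹ ^ (k + 1) / ((k + 1)! : ℝ) ^ κ
          ≤ (M / L) * (1 / 2) ^ k := by
      intro k _
      have e : 𝒟 (k + 1) (fun v => f v - f u) u = 𝒟 (k + 1) f u := by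
        rw [fun_iteratedFDeriv_sub_apply (hf.contDiffAt.of_le (mod_cast le_top)) contDiffAt_const,
          iteratedFDeriv_const_of_ne (by omega)]
        simp
      rw [e, div_le_iff₀ (fact_rpow_pos _ κ)]
      have h2 : ‖𝒟 (k + 1) f u‖ * (R * L)⁻¹ ^ (k + 1) ≤
          M * (L⁻¹) ^ (k + 1) * ((k + 1)! : ℝ) ^ κ := by
        refine (mul_le_mul_of_nonneg_right (h (k + 1) (by omega)) pos!).trans_eq ?_
        rw [inv_pow, mul_pow, inv_pow]; field_simp
      refine h2.trans ?_
      have h2a : (L⁻¹) ^ (k + 1) ≤ L⁻¹ * (1 / 2) ^ k := by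
        rw [pow_succ, mul_comm]
        have : L⁻¹ ≤ 1 / 2 := by rw [inv_le_comm₀ hL0 num!]; norm_num; exact hL
        gcongr
      calc M * (L⁻¹) ^ (k + 1) * ((k + 1)! : ℝ) ^ κ ≤ M * (L⁻¹ * (1 / 2) ^ k) * ((k + 1)! : ℝ) ^ κ := by
            gcongr
        _ = _ := by rw [div_eq_mul_inv]; ring
    refine (add_le_add_left (sum_le_sum hk) _).trans ?_
    rw [← mul_sum]
    have h4 := sum_half_pow_le K
    calc M / L * ∑ k ∈ range K, (1 / 2 : ℝ) ^ k + 0 * (R * L)⁻¹ ^ 0 / ((0)! : ℝ) ^ κ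
        ≤ M / L * 2 + 0 := by gcongr; simp
      _ = _ := by ring

lemma GB.jet_le (hR : 0 < R) {f : U → F} {u : U} (h : GB κ f u M R) (K : ℕ) :
    jet κ ((2 * R)⁻¹) K f u ≤ 2 * M := by
  have hM := h.nonneg
  unfold jet
  calc _ ≤ ∑ k ∈ range K, M * (1 / 2 : ℝ) ^ k := by
        refine sum_le_sum fun k _ => ?_
        rw [div_le_iff₀ (fact_rpow_pos _ κ)]
        refine (mul_le_mul_of_nonneg_right (h k) pos!).trans_eq ?_
        rw [inv_pow, mul_pow, one_div, inv_pow]; field_simp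
    _ = M * ∑ k ∈ range K, (1 / 2 : ℝ) ^ k := by rw [mul_sum]
    _ ≤ M * 2 := by gcongr; exact sum_half_pow_le K
    _ = _ := by ring

lemma succ_le_two_pow (k : ℕ) : ((k : ℝ) + 1) ≤ 2 ^ k := by
  have : k + 1 ≤ 2 ^ k := Nat.lt_two_pow_self
  exact_mod_cast this

lemma GB.mul {𝔸 : Type} [NormedRing 𝔸] [NormedAlgebra ℝ 𝔸] (hκ : 1 ≤ κ) (hR : 0 ≤ R)
    {f g : U → 𝔸} (hf : C∞ f) (hg : C∞ g) {u : U}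
    (h : GB κ f u M R) (h' : GB κ g u N R) : GB κ (fun v => f v * g v) u (M * N) (2 * R) := by
  intro k
  have hM := h.nonneg
  have hN := h'.nonneg
  refine (norm_iteratedFDeriv_mul_le hf hg u (n := k) (mod_cast le_top)).trans ?_
  calc _ ≤ ∑ i ∈ range (k + 1), M * N * R ^ k * (k ! : ℝ) ^ κ := by
        refine sum_le_sum fun i hi => ?_
        have hi' := Nat.lt_succ_iff.mp (mem_range.mp hi)
        have hc := choose_mul_fact_rpow_le hκ hi'
        have h3 : R ^ k = R ^ i * R ^ (k - i) := by rw [← pow_add, Nat.add_sub_cancel' hi']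
        calc _ ≤ (k.choose i : ℝ) * (M * R ^ i * (i ! : ℝ) ^ κ) * (N * R ^ (k - i) * ((k - i)! : ℝ) ^ κ) := by
              gcongr
              · exact h i
              · exact h' _
          _ = M * N * R ^ k * ((k.choose i : ℝ) * ((i ! : ℝ) ^ κ * ((k - i)! : ℝ) ^ κ)) := by
              rw [h3]; ring
          _ ≤ _ := mono!
    _ = M * N * R ^ k * (k ! : ℝ) ^ κ * ((k : ℝ) + 1) := by simp; ring
    _ ≤ M * N * R ^ k * (k ! : ℝ) ^ κ * 2 ^ k := by gcongr; exact succ_le_two_pow k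
    _ = _ := by rw [mul_pow]; ring

lemma GB.zero_mul {𝔸 : Type} [NormedRing 𝔸] [NormedAlgebra ℝ 𝔸]
    {f g : U → 𝔸} (hf : C∞ f) (hg : C∞ g) {u : U}
    (h : GB κ f u 0 R) : GB κ (fun v => f v * g v) u 0 R := by
  intro k
  refine (norm_iteratedFDeriv_mul_le hf hg u (n := k) (mod_cast le_top)).trans ?_
  rw [sum_eq_zero]
  · simp
  · intro i _
    have := h i
    rw [MulZeroClass.zero_mul, MulZeroClass.zero_mul] at this
    rw [le_antisymm this (norm_nonneg _)]
    simp

lemma GB.add {f g : U → F} (hf : C∞ f) (hg : C∞ g) {u : U}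
    (h : GB κ f u M R) (h' : GB κ g u N R) : GB κ (fun v => f v + g v) u (M + N) R := by
  intro k
  rw [fun_iteratedFDeriv_add_apply (hf.contDiffAt.of_le (mod_cast le_top))
    (hg.contDiffAt.of_le (mod_cast le_top))]
  refine (norm_add_le _ _).trans ((add_le_add (h k) (h' k)).trans_eq ?_)
  ring

lemma GB.sub {f g : U → F} (hf : C∞ f) (hg : C∞ g) {u : U}
    (h : GB κ f u M R) (h' : GB κ g u N R) : GB κ (fun v => f v - g v) u (M + N) R := by
  intro k
  rw [fun_iteratedFDeriv_sub_apply (hf.contDiffAt.of_le (mod_cast le_top))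
    (hg.contDiffAt.of_le (mod_cast le_top))]
  refine (norm_sub_le _ _).trans ((add_le_add (h k) (h' k)).trans_eq ?_)
  ring

lemma GB_const (hR : 0 ≤ R) (c : F) (u : U) : GB κ (fun _ => c) u ‖c‖ R := by
  intro k
  rcases Nat.eq_zero_or_pos k with rfl | hk
  · simp
  · rw [iteratedFDeriv_const_of_ne (by omega)]
    simp; positivity

lemma GB.sum (hR : 0 ≤ R) {ι : Type} (s : Finset ι) {f : ι → U → F} {M : ι → ℝ}
    (hf : ∀ i ∈ s, C∞ (f i)) {u : U}
    (h : ∀ i ∈ s, GB κ (f i) u (M i) R) : GB κ (fun v => ∑ i ∈ s, f i v) u (∑ i ∈ s, M i) R := by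
  classical
  induction s using induction_on with
  | empty => simpa using GB_const hR (0 : F) u
  | insert a s ha ih =>
    simp only [sum_insert ha]
    refine GB.add (hf a (by simp)) (ContDiff.sum fun i hi => hf i (by simp [hi])) (h a (by simp)) ?_
    exact ih (fun i hi => hf i (by simp [hi])) (fun i hi => h i (by simp [hi]))

lemma GB.const_smul {𝔸 : Type} [NormedField 𝔸] [NormedAlgebra ℝ 𝔸] {f : U → 𝔸}
    (hf : C∞ f) {u : U}
    (h : GB κ f u M R) (c : 𝔸) : GB κ (fun v => c * f v) u (‖c‖ * M) R := by
  intro k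
  have := iteratedFDeriv_const_smul_apply (i := k) (a := c) (f := f) (x := u)
    (hf.contDiffAt.of_le (mod_cast le_top))
  have e : (fun v => c * f v) = c • f := rfl
  rw [e, this, norm_smul, mul_assoc, mul_assoc]
  gcongr
  rw [← mul_assoc]
  exact h k

lemma iteratedFDeriv_comp_affine {f : U → F} (hf : C∞ f) (a : U) (T : U' →L[ℝ] U) (u : U')
    (k : ℕ) : 𝒟 k (fun v => f (a + T v)) u =
      (𝒟 k f (a + T u)).compContinuousLinearMap fun _ => T := by
  have h1 : C∞ (fun z => f (a + z)) := hf.comp (contDiff_const.add contDiff_id)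
  have h2 := T.iteratedFDeriv_comp_right h1 u (i := k) (mod_cast le_top)
  rw [iteratedFDeriv_comp_add_left] at h2
  exact h2

lemma norm_iteratedFDeriv_comp_affine_le {f : U → F} (hf : C∞ f) (a : U) (T : U' →L[ℝ] U)
    (u : U') (k : ℕ) : ‖𝒟 k (fun v => f (a + T v)) u‖ ≤
      ‖𝒟 k f (a + T u)‖ * ‖T‖ ^ k := by
  rw [iteratedFDeriv_comp_affine hf]
  refine (ContinuousMultilinearMap.norm_compContinuousLinearMap_le _ _).trans_eq ?_
  simp

lemma GB.comp_affine (hR : 0 ≤ R) {f : U → F} (hf : C∞ f) {a : U}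
    {T : U' →L[ℝ] U} (hT : ‖T‖ ≤ t) {u : U'} (h : GB κ f (a + T u) M R) :
    GB κ (fun v => f (a + T v)) u M (t * R) := by
  intro k
  have hM := h.nonneg
  refine (norm_iteratedFDeriv_comp_affine_le hf a T u k).trans ?_
  calc _ ≤ (M * R ^ k * (k ! : ℝ) ^ κ) * t ^ k := by gcongr; exact h k
    _ = _ := by rw [mul_pow]; ring

lemma GB.ofReal {f : U → ℝ} (hf : C∞ f) {u : U} (h : GB κ f u M R) :
    GB κ (fun v => (f v : ℂ)) u M R := by
  intro k
  refine (ofRealCLM.norm_iteratedFDeriv_comp_left (N := ∞) hf.contDiffAt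
    (mod_cast le_top)).trans ?_
  rw [Complex.ofRealCLM_norm, one_mul]
  exact h k

end GevreyCalculus

section GevreyComposition

variable {U F : Type} [NormedAddCommGroup U] [NormedSpace ℝ U]
  [NormedAddCommGroup F] [NormedSpace ℝ F]

lemma iteratedDeriv_taylor_poly (c : ℕ → ℝ) (t₀ : ℝ) (k i : ℕ) (hi : i ≤ k) :
    iteratedDeriv i (fun t : ℝ => ∑ j ∈ range (k + 1), c j / (j ! : ℝ) * (t - t₀) ^ j) t₀ =
      c i := by
  rw [iteratedDeriv_fun_sum (fun j _ => fun!)]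
  have : ∀ j ∈ range (k + 1),
      iteratedDeriv i (fun t : ℝ => c j / (j ! : ℝ) * (t - t₀) ^ j) t₀ = if j = i then c i else 0 := by
    intro j _
    rw [iteratedDeriv_const_mul_field]
    have h1 := congrFun (iteratedDeriv_comp_sub_const i (fun t : ℝ => t ^ j) t₀) t₀
    rw [h1, sub_self, iteratedDeriv_fun_pow_zero]
    by_cases h : j = i
    · subst h
      simp; field_simp
    · simp [h, Ne.symm h]
  rw [sum_congr rfl this, Finset.sum_ite_eq' (range (k + 1)) i]
  simp [Nat.lt_succ_of_le hi]

/-- The derivatives of a composition are controlled by those of the powers of the inner function. -/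
lemma norm_iteratedFDeriv_comp_le_sum {ϕ : ℝ → ℝ} {g : U → ℝ} (hϕ : C∞ ϕ)
    (hg : C∞ g) (p : U) (k : ℕ) :
    ‖𝒟 k (fun u => ϕ (g u)) p‖ ≤ ∑ j ∈ range (k + 1),
      |iteratedDeriv j ϕ (g p)| / (j ! : ℝ) * ‖𝒟 k (fun u => (g u - g p) ^ j) p‖ := by
  set c : ℕ → ℝ := fun j => iteratedDeriv j ϕ (g p)
  set T : ℝ → ℝ := fun t => ∑ j ∈ range (k + 1), c j / (j ! : ℝ) * (t - g p) ^ j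
  have hT : C∞ T := fun!
  have hd := hϕ.sub hT
  have h0 : ∀ i ≤ k, ‖𝒟 i (fun t => ϕ t - T t) (g p)‖ ≤ 0 := by
    intro i hi
    rw [norm_iteratedFDeriv_eq_norm_iteratedDeriv]
    have : iteratedDeriv i (fun t => ϕ t - T t) (g p) = iteratedDeriv i ϕ (g p) - iteratedDeriv i T (g p) :=
      iteratedDeriv_sub (hϕ.contDiffAt.of_le (mod_cast le_top))
        (hT.contDiffAt.of_le (mod_cast le_top))
    rw [this, iteratedDeriv_taylor_poly c (g p) k i hi]
    simp [c]
  set B : ℝ := 1 + ∑ i ∈ range (k + 1), ‖𝒟 i g p‖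
  have hB : ∀ i, 1 ≤ i → i ≤ k → ‖𝒟 i g p‖ ≤ B ^ i := by
    intro i hi hik
    have h1 : ‖𝒟 i g p‖ ≤ ∑ i ∈ range (k + 1), ‖𝒟 i g p‖ :=
      single_le_sum (f := fun i => ‖𝒟 i g p‖) (fun _ _ => norm_nonneg _)
        (mem_range.mpr (by omega))
    have hs : 0 ≤ ∑ i ∈ range (k + 1), ‖𝒟 i g p‖ :=
      sum_nonneg fun _ _ => norm_nonneg _
    calc _ ≤ B := by simp only [B]; linarith
      _ ≤ B ^ i := le_self_pow₀ (by simp only [B]; linarith) (by omega)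
  have h1 := norm_iteratedFDeriv_comp_le hd hg (n := k) (mod_cast le_top) p h0 hB
  have h2 : 𝒟 k ((fun t => ϕ t - T t) ∘ g) p = 0 := by
    have : ‖𝒟 k ((fun t => ϕ t - T t) ∘ g) p‖ ≤ 0 := by simpa using h1
    simpa using this
  have h3 : (fun u => ϕ (g u)) = fun u => ((fun t => ϕ t - T t) ∘ g) u + (T ∘ g) u := by
    funext u; simp
  rw [h3, fun_iteratedFDeriv_add_apply ((hd.comp hg).contDiffAt.of_le (mod_cast le_top))
    ((hT.comp hg).contDiffAt.of_le (mod_cast le_top)), h2, zero_add]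
  have h7 : T ∘ g = fun u => ∑ j ∈ range (k + 1), c j / (j ! : ℝ) * (g u - g p) ^ j := rfl
  rw [h7]
  have h4 : ∀ j ∈ range (k + 1), ContDiffAt ℝ k (fun u => c j / (j ! : ℝ) * (g u - g p) ^ j) p := by
    intro j _
    have : C∞ (fun u => c j / (j ! : ℝ) * (g u - g p) ^ j) := fun!
    exact this.contDiffAt.of_le (mod_cast le_top)
  rw [iteratedFDeriv_fun_sum_apply h4]
  refine (norm_sum_le _ _).trans (sum_le_sum fun j _ => ?_)
  have h5 : C∞ (fun u => (g u - g p) ^ j) := fun!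
  have h6 := iteratedFDeriv_const_smul_apply (i := k) (a := c j / (j ! : ℝ))
    (f := fun u => (g u - g p) ^ j) (x := p) (h5.contDiffAt.of_le (mod_cast le_top))
  have e : (fun u => c j / (j ! : ℝ) * (g u - g p) ^ j) = (c j / (j ! : ℝ)) • fun u => (g u - g p) ^ j := rfl
  rw [e, h6, norm_smul, norm_div, norm_eq_abs, norm_eq_abs, abs_of_pos (fact_pos j)]

lemma GB.exp (hκ : 1 ≤ κ) (hR : 0 < R) (hm : 0 ≤ m) {g : U → ℝ} (hg : C∞ g) {p : U}
    (h : ∀ k, 1 ≤ k → ‖𝒟 k g p‖ ≤ m * R ^ k * (k ! : ℝ) ^ κ) :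
    GB κ (fun u => exp (g u)) p (exp (g p + m)) (2 * R) := by
  intro k
  have hj := jet_sub_const_le hm hR le_rfl hg h
  have hm' : 2 * m / 2 = m := by ring
  rw [hm'] at hj
  have hg' : C∞ (fun v => g v - g p) := hg.sub contDiff_const
  have hρ : 0 < (R * 2)⁻¹ := pos!
  refine (norm_iteratedFDeriv_comp_le_sum contDiff_exp hg p k).trans ?_
  have hb : ∀ j, ‖𝒟 k (fun u => (g u - g p) ^ j) p‖ ≤ m ^ j * ((2 * R) ^ k * (k ! : ℝ) ^ κ) := by
    intro j
    have h1 := le_jet (κ := κ) hρ.le (Nat.lt_succ_self k) (fun u => (g u - g p) ^ j) p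
    have h2 := (jet_pow_le hκ hρ.le (k + 1) hg' p j).trans
      (pow_le_pow_left₀ (jet_nonneg hρ.le _ _ _) (hj (k + 1)) j)
    have h3 := h1.trans (mul_le_mul_of_nonneg_right h2 (fact_rpow_pos k κ).le)
    rw [← le_div_iff₀ pos!] at h3
    refine h3.trans_eq ?_
    rw [inv_pow, mul_comm R 2]; field_simp
  calc _ ≤ ∑ j ∈ range (k + 1), (Real.exp (g p) * ((2 * R) ^ k * (k ! : ℝ) ^ κ)) * (m ^ j / (j ! : ℝ)) := by
        refine sum_le_sum fun j _ => ?_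
        have : iteratedDeriv j Real.exp (g p) = Real.exp (g p) := by
          rw [iteratedDeriv_eq_iterate, Real.iter_deriv_exp]
        rw [this, abs_of_pos (exp_pos _)]
        calc _ ≤ Real.exp (g p) / (j ! : ℝ) * (m ^ j * ((2 * R) ^ k * (k ! : ℝ) ^ κ)) := by
              gcongr; exact hb j
          _ = _ := by ring
    _ = (Real.exp (g p) * ((2 * R) ^ k * (k ! : ℝ) ^ κ)) * ∑ j ∈ range (k + 1), m ^ j / (j ! : ℝ) := by
        rw [mul_sum]
    _ ≤ (Real.exp (g p) * ((2 * R) ^ k * (k ! : ℝ) ^ κ)) * Real.exp m := by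
        gcongr; exact Real.sum_le_exp_of_nonneg hm _
    _ = _ := by rw [exp_add]; ring

/-- Composition of a Gevrey function of order `κ` with an analytic inner function. -/
lemma GB.comp_gevrey (hκ : 1 ≤ κ) (hR : 0 < R) (hM : 0 ≤ M) (hC : 0 ≤ C) (hB : 0 ≤ B)
    (hL : 2 ≤ L) (hLB : 4 * M * B ≤ L) {ϕ : ℝ → ℝ} {g : U → ℝ} (hϕ : C∞ ϕ)
    (hg : C∞ g) {p : U}
    (hd : ∀ j, |iteratedDeriv j ϕ (g p)| ≤ C * B ^ j * (j ! : ℝ) ^ κ)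
    (h : ∀ k, 1 ≤ k → ‖𝒟 k g p‖ ≤ M * R ^ k * (k ! : ℝ)) :
    GB κ (fun u => ϕ (g u)) p (2 * C) (R * L) := by
  intro k
  have hL0 : 0 < L := lin!
  have hj := jet_sub_const_le (κ := 1) hM hR hL hg (fun k hk => by simpa using h k hk)
  have hg' : C∞ (fun v => g v - g p) := hg.sub contDiff_const
  have hρ : 0 < (R * L)⁻¹ := pos!
  set m := 2 * M / L
  have hBm : B * m ≤ 1 / 2 := by
    simp only [m]; rw [← mul_div_assoc, div_le_iff₀ hL0]; linarith
  refine (norm_iteratedFDeriv_comp_le_sum hϕ hg p k).trans ?_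
  have hb : ∀ j, ‖𝒟 k (fun u => (g u - g p) ^ j) p‖ ≤ m ^ j * ((R * L) ^ k * (k ! : ℝ)) := by
    intro j
    have h1 := le_jet (κ := 1) hρ.le (Nat.lt_succ_self k) (fun u => (g u - g p) ^ j) p
    have h2 := (jet_pow_le le_rfl hρ.le (k + 1) hg' p j).trans
      (pow_le_pow_left₀ (jet_nonneg hρ.le _ _ _) (hj (k + 1)) j)
    have h3 := h1.trans (mul_le_mul_of_nonneg_right h2 (fact_rpow_pos k 1).le)
    rw [← le_div_iff₀ pos!, rpow_one] at h3
    refine h3.trans_eq ?_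
    rw [inv_pow]; field_simp
  calc _ ≤ ∑ j ∈ range (k + 1), (C * ((R * L) ^ k * (k ! : ℝ) ^ κ)) * (1 / 2 : ℝ) ^ j := by
        refine sum_le_sum fun j hjk => ?_
        have hjk' := Nat.lt_succ_iff.mp (mem_range.mp hjk)
        have hf : (j ! : ℝ) ^ (κ - 1) ≤ (k ! : ℝ) ^ (κ - 1) := by
          refine rpow_le_rpow pos! ?_ lin!
          exact_mod_cast Nat.factorial_le hjk'
        have hj0 := fact_pos j
        calc |iteratedDeriv j ϕ (g p)| / (j ! : ℝ) * ‖𝒟 k (fun u => (g u - g p) ^ j) p‖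
            ≤ (C * B ^ j * (j ! : ℝ) ^ κ) / (j ! : ℝ) * (m ^ j * ((R * L) ^ k * (k ! : ℝ))) := by
              gcongr
              · exact hd j
              · exact hb j
          _ = C * (R * L) ^ k * (k ! : ℝ) * (j ! : ℝ) ^ (κ - 1) * (B * m) ^ j := by
              rw [rpow_eq_mul_rpow_sub_one hj0 κ, mul_pow B m]; field_simp
          _ ≤ C * (R * L) ^ k * (k ! : ℝ) * (k ! : ℝ) ^ (κ - 1) * (1 / 2) ^ j := mono!
          _ = _ := by rw [rpow_eq_mul_rpow_sub_one (fact_pos k) κ]; ring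
    _ = (C * ((R * L) ^ k * (k ! : ℝ) ^ κ)) * ∑ j ∈ range (k + 1), (1 / 2 : ℝ) ^ j := by
        rw [mul_sum]
    _ ≤ (C * ((R * L) ^ k * (k ! : ℝ) ^ κ)) * 2 := by gcongr; exact sum_half_pow_le _
    _ = _ := by ring

/-- The inverse of a nowhere vanishing function. -/
lemma GB.inv {𝔸 : Type} [NormedField 𝔸] [NormedAlgebra ℝ 𝔸] (hκ : 1 ≤ κ) (hR : 0 < R)
    (hM : 0 ≤ M) (hL : 2 ≤ L) (hLM : 4 * M ≤ L) {f g : U → 𝔸} (hf : C∞ f)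
    (hg : C∞ g) {p : U} (hfg : (fun u => f u * g u) =ᶠ[𝓝 p] fun _ => 1)
    (h : ∀ k, 1 ≤ k → ‖𝒟 k f p‖ ≤ (M * ‖f p‖) * R ^ k * (k ! : ℝ) ^ κ) :
    GB κ g p (2 * ‖f p‖⁻¹) (R * L) := by
  have hL0 : 0 < L := lin!
  have hj := jet_sub_const_le (κ := κ) pos! hR hL hf h
  have hρ : 0 < (R * L)⁻¹ := pos!
  have hf' : C∞ (fun v => f v - f p) := hf.sub contDiff_const
  have h1 := hfg.eq_of_nhds
  have hfp := left_ne_zero_of_mul_eq_one h1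
  have hfp' := norm_pos_iff.mpr hfp
  have key : ∀ K, jet κ (R * L)⁻¹ K g p ≤ 2 * ‖f p‖⁻¹ := by
    intro K
    have hle : jet κ (R * L)⁻¹ K g p * ‖f p‖ ≤ 1 + jet κ (R * L)⁻¹ K (fun v => (f v - f p) * g v) p := by
      have ht : ∀ k, ‖𝒟 k g p‖ * ‖f p‖ ≤ ‖𝒟 k (fun _ : U => (1 : 𝔸)) p‖ +
          ‖𝒟 k (fun v => (f v - f p) * g v) p‖ := by
        intro k
        have e1 := iteratedFDeriv_const_smul_apply (i := k) (a := f p)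
          (f := g) (x := p) (hg.contDiffAt.of_le (mod_cast le_top))
        have e2 : (f p • g) =ᶠ[𝓝 p] fun v => (fun _ : U => (1 : 𝔸)) v - (f v - f p) * g v := by
          filter_upwards [hfg] with v hv
          rw [← hv]
          simp [sub_mul]
        have e3 := (e2.iteratedFDeriv ℝ k).eq_of_nhds
        rw [e1, fun_iteratedFDeriv_sub_apply contDiffAt_const
          ((hf'.mul hg).contDiffAt.of_le (mod_cast le_top))] at e3
        rw [mul_comm, ← norm_smul, e3]
        exact norm_sub_le _ _
      have hone : jet κ (R * L)⁻¹ K (fun _ : U => (1 : 𝔸)) p ≤ 1 := by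
        unfold jet
        rcases K with _ | K
        · simp
        · rw [Finset.sum_range_succ', sum_eq_zero]
          · simp
          · intro k _
            rw [iteratedFDeriv_const_of_ne (by omega)]
            simp
      refine le_trans ?_ (add_le_add_left hone _)
      unfold jet
      rw [sum_mul, ← Finset.sum_add_distrib]
      refine sum_le_sum fun k _ => ?_
      calc _ = (‖𝒟 k g p‖ * ‖f p‖) * ((R * L)⁻¹ ^ k / (k ! : ℝ) ^ κ) := by ring
        _ ≤ _ := mul_le_mul_of_nonneg_right (ht k) pos!
        _ = _ := by ring
    have h2 := jet_mul_le hκ hρ.le K hf' hg p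
    have h3 : jet κ (R * L)⁻¹ K (fun v => (f v - f p) * g v) p ≤
        (1 / 2 * ‖f p‖) * jet κ (R * L)⁻¹ K g p := by
      refine h2.trans (mul_le_mul_of_nonneg_right ((hj K).trans ?_) (jet_nonneg hρ.le _ _ _))
      rw [div_le_iff₀ hL0]
      nlinarith
    have h4 : jet κ (R * L)⁻¹ K g p * ‖f p‖ ≤ 2 := by nlinarith
    rw [← div_eq_mul_inv, le_div_iff₀ hfp']
    exact h4
  have := GB_of_jet hρ key
  rwa [inv_inv] at this

/-- A lower Gevrey order allows an arbitrary constant. -/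
lemma exists_gevrey_upgrade (hκ : κ' < κ) (hR : 0 ≤ R) (hR' : 0 < R') :
    ∃ C : ℝ, 1 ≤ C ∧ ∀ k : ℕ, R ^ k * (k ! : ℝ) ^ κ' ≤ C * R' ^ k * (k ! : ℝ) ^ κ := by
  set δ := κ - κ'
  have hδ : 0 < δ := by simp only [δ]; linarith
  set x := (R / R') ^ (1 / δ)
  have hx : 0 ≤ x := pos!
  refine ⟨exp x ^ δ, one_le_rpow (one_le_exp hx) hδ.le, fun k => ?_⟩
  have h1 : x ^ k ≤ exp x * (k ! : ℝ) := by
    rw [← div_le_iff₀ (fact_pos k)]; exact Real.pow_div_factorial_le_exp x hx k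
  have h2 : (R / R') ^ k ≤ exp x ^ δ * (k ! : ℝ) ^ δ := by
    rw [← mul_rpow (exp_pos x).le (fact_pos k).le]
    have h3 : (R / R') ^ k = (x ^ k) ^ δ := by
      have h0 : 0 ≤ R / R' := pos!
      simp only [x]
      rw [← rpow_natCast, ← rpow_natCast, ← rpow_mul h0, ← rpow_mul h0]
      congr 1
      field_simp
    rw [h3]
    exact rpow_le_rpow pos! h1 hδ.le
  have h4 : (k ! : ℝ) ^ κ = (k ! : ℝ) ^ δ * (k ! : ℝ) ^ κ' := by
    rw [← rpow_add (fact_pos k)]; simp [δ]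
  have h5 : R ^ k = (R / R') ^ k * R' ^ k := by rw [div_pow]; field_simp
  rw [h4, h5]
  calc _ ≤ (exp x ^ δ * (k ! : ℝ) ^ δ) * R' ^ k * (k ! : ℝ) ^ κ' := mono!
    _ = _ := by ring

/-- The directional derivative. -/
def dd (v : U) (f : U → F) : U → F := fun x => fderiv ℝ f x v

lemma contDiff_dd {f : U → F} (hf : C∞ f) (v : U) : C∞ (dd v f) :=
  (hf.fderiv_right (m := ∞) (by simp)).clm_apply contDiff_const

lemma contDiff_dd_iterate {f : U → F} (hf : C∞ f) (v : U) (j : ℕ) :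
    C∞ ((dd v)^[j] f) := by
  induction j with
  | zero => exact hf
  | succ j ih => rw [iterate_succ_apply']; exact contDiff_dd ih v

lemma norm_iteratedFDeriv_dd_le {f : U → F} (hf : C∞ f) (v p : U) (k : ℕ) :
    ‖𝒟 k (dd v f) p‖ ≤ ‖v‖ * ‖𝒟 (k + 1) f p‖ := by
  rw [← norm_iteratedFDeriv_fderiv]
  exact norm_iteratedFDeriv_clm_apply_const (N := ∞)
    (hf.fderiv_right (m := ∞) (by simp)).contDiffAt (mod_cast le_top)

lemma norm_iteratedFDeriv_dd_iterate_le {f : U → F} (hf : C∞ f) (v p : U) (k j : ℕ) :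
    ‖𝒟 k ((dd v)^[j] f) p‖ ≤ ‖v‖ ^ j * ‖𝒟 (k + j) f p‖ := by
  induction j generalizing k with
  | zero => simp
  | succ j ih =>
    rw [iterate_succ_apply']
    refine (norm_iteratedFDeriv_dd_le (contDiff_dd_iterate hf v j) v p k).trans ?_
    have := ih (k + 1)
    rw [add_assoc, add_comm 1 j] at this
    calc _ ≤ ‖v‖ * (‖v‖ ^ j * ‖𝒟 (k + (j + 1)) f p‖) := mono!
      _ = _ := by ring

lemma fact_succ_rpow_le (hκ : 0 ≤ κ) (k : ℕ) :
    ((k + 1)! : ℝ) ^ κ ≤ ((2 : ℝ) ^ κ) ^ k * (k ! : ℝ) ^ κ := by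
  rw [Nat.factorial_succ]
  push_cast
  rw [mul_rpow pos! pos!, ← rpow_natCast, ← rpow_mul num!,
    mul_comm κ, rpow_mul num!, rpow_natCast]
  gcongr
  exact succ_le_two_pow k

lemma GB.dd (hκ : 0 ≤ κ) (hR : 0 ≤ R) {f : U → F} (hf : C∞ f) {p : U}
    (h : GB κ f p M R) (v : U) : GB κ (dd v f) p (‖v‖ * (M * R)) ((2 : ℝ) ^ κ * R) := by
  intro k
  have hM := h.nonneg
  refine (norm_iteratedFDeriv_dd_le hf v p k).trans ?_
  calc _ ≤ ‖v‖ * (M * R ^ (k + 1) * ((k + 1)! : ℝ) ^ κ) := by gcongr; exact h _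
    _ ≤ ‖v‖ * (M * R ^ (k + 1) * (((2 : ℝ) ^ κ) ^ k * (k ! : ℝ) ^ κ)) := by
        gcongr; exact fact_succ_rpow_le hκ k
    _ = _ := by rw [mul_pow, pow_succ]; ring

lemma dd_comm {f : U → F} (hf : C∞ f) (v w : U) : dd v (dd w f) = dd w (dd v f) := by
  funext x
  have h2 : IsSymmSndFDerivAt ℝ f x := by
    refine hf.contDiffAt.isSymmSndFDerivAt ?_
    rw [minSmoothness_of_isRCLikeNormedField]
    exact ENat.LEInfty.out
  have hd : DifferentiableAt ℝ (fderiv ℝ f) x :=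
    ((hf.fderiv_right (m := ∞) (by simp)).differentiable (by simp)).differentiableAt
  have e : ∀ v w : U, dd v (dd w f) x = fderiv ℝ (fderiv ℝ f) x v w := by
    intro v w
    unfold dd
    rw [fderiv_clm_apply hd (differentiableAt_const w)]
    simp
  rw [e, e]
  exact h2.eq v w

lemma dd_add {f g : U → F} (hf : C∞ f) (hg : C∞ g) (v : U) :
    dd v (fun x => f x + g x) = fun x => dd v f x + dd v g x := by
  funext x
  unfold dd
  rw [fderiv_fun_add (hf.differentiable (by simp) x) (hg.differentiable (by simp) x)]
  rfl

lemma dd_mul {𝔸 : Type} [NormedCommRing 𝔸] [NormedAlgebra ℝ 𝔸] {f g : U → 𝔸} (hf : C∞ f)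
    (hg : C∞ g) (v : U) :
    dd v (fun x => f x * g x) = fun x => dd v f x * g x + f x * dd v g x := by
  funext x
  unfold dd
  rw [fderiv_fun_mul (hf.differentiable (by simp) x) (hg.differentiable (by simp) x)]
  simp only [_root_.add_apply, _root_.smul_apply, smul_eq_mul]
  ring

lemma dd_comp_affine {U' : Type} [NormedAddCommGroup U'] [NormedSpace ℝ U'] {f : U → F}
    (hf : C∞ f) (a : U) (T : U' →L[ℝ] U) (v : U') :
    dd v (fun u => f (a + T u)) = fun u => dd (T v) f (a + T u) := by
  funext u
  unfold dd
  have h1 : HasFDerivAt (fun u => a + T u) T u := T.hasFDerivAt.const_add a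
  have h2 := (hf.differentiable (by simp) (a + T u)).hasFDerivAt.comp u h1
  have h3 : fderiv ℝ (fun u => f (a + T u)) u = (fderiv ℝ f (a + T u)).comp T := h2.fderiv
  rw [h3]; rfl

lemma dd_smul_dir (c : ℝ) (v : U) (f : U → F) : dd (c • v) f = fun x => c • dd v f x := by
  funext x; simp [dd]

end GevreyComposition

section MultiIndices

variable {U U' F : Type} [NormedAddCommGroup U] [NormedSpace ℝ U] [NormedAddCommGroup U']
  [NormedSpace ℝ U'] [NormedAddCommGroup F] [NormedSpace ℝ F]

/-- The iterated directional derivative along the family `v`. -/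
def mdd (v : Fin n → U) (α : MIdx n) (f : U → F) : U → F :=
  (finRange n).foldr (fun i g => (dd (v i))^[α i] g) f

lemma mderiv_eq_mdd (α : MIdx n) (f : E n → F) :
    mderiv α f = mdd (fun i => single i 1) α f := rfl

lemma foldr_dd_induction {P : (U → F) → Prop} (v : Fin n → U) (α : MIdx n)
    (hP : ∀ g i, P g → P (dd (v i) g)) (l : List (Fin n)) {f : U → F} (hf : P f) :
    P (l.foldr (fun i g => (dd (v i))^[α i] g) f) := by
  have hit : ∀ (g : U → F) (i : Fin n) (k : ℕ), P g → P ((dd (v i))^[k] g) := by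
    intro g i k hg
    induction k with
    | zero => exact hg
    | succ k ih => rw [iterate_succ_apply']; exact hP _ _ ih
  induction l with
  | nil => exact hf
  | cons i l ih => exact hit _ _ _ ih

lemma contDiff_foldr_dd (v : Fin n → U) (α : MIdx n) (l : List (Fin n)) {f : U → F}
    (hf : C∞ f) : C∞ (l.foldr (fun i g => (dd (v i))^[α i] g) f) :=
  foldr_dd_induction (P := fun f => C∞ f) v α (fun _ _ hg => contDiff_dd hg _) l hf

lemma contDiff_mdd (v : Fin n → U) (α : MIdx n) {f : U → F} (hf : C∞ f) :
    C∞ (mdd v α f) := contDiff_foldr_dd v α _ hf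

lemma dd_iterate_comm {f : U → F} (hf : C∞ f) (v w : U) (k : ℕ) :
    dd w ((dd v)^[k] f) = (dd v)^[k] (dd w f) := by
  induction k with
  | zero => rfl
  | succ k ih =>
    rw [iterate_succ_apply', iterate_succ_apply',
      dd_comm (contDiff_dd_iterate hf v k), ih]

lemma dd_foldr_comm (v : Fin n → U) (α : MIdx n) (l : List (Fin n)) {f : U → F}
    (hf : C∞ f) (w : U) : dd w (l.foldr (fun i g => (dd (v i))^[α i] g) f) =
      l.foldr (fun i g => (dd (v i))^[α i] g) (dd w f) := by
  induction l with
  | nil => rfl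
  | cons i l ih =>
    rw [foldr_cons, foldr_cons, dd_iterate_comm (contDiff_foldr_dd v α l hf), ih]

lemma dd_mdd_comm (v : Fin n → U) (α : MIdx n) {f : U → F} (hf : C∞ f) (w : U) :
    dd w (mdd v α f) = mdd v α (dd w f) := dd_foldr_comm v α _ hf w

lemma foldr_dd_congr (v : Fin n → U) {α α' : MIdx n} (l : List (Fin n))
    (h : ∀ i ∈ l, α i = α' i) (f : U → F) :
    l.foldr (fun i g => (dd (v i))^[α i] g) f = l.foldr (fun i g => (dd (v i))^[α' i] g) f := by
  induction l with
  | nil => rfl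
  | cons i l ih =>
    rw [foldr_cons, foldr_cons, ih fun j hj => h j (by simp [hj]), h i (by simp)]

lemma dd_foldr_add_single (v : Fin n → U) (α : MIdx n) (l : List (Fin n)) (hl : l.Nodup) (i : Fin n)
    (hi : i ∈ l) {f : U → F} (hf : C∞ f) :
    dd (v i) (l.foldr (fun i g => (dd (v i))^[α i] g) f) =
      l.foldr (fun j g => (dd (v j))^[(α + Pi.single i 1 : MIdx n) j] g) f := by
  induction l with
  | nil => simp at hi
  | cons j l ih =>
    rw [foldr_cons, foldr_cons]
    rw [List.nodup_cons] at hl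
    by_cases hji : j = i
    · subst hji
      rw [← iterate_succ_apply' (dd (v j)), foldr_dd_congr v l (α' := α + Pi.single j 1)]
      · simp
      · intro k hk
        have : k ≠ j := fun h => hl.1 (h ▸ hk)
        simp [this]
    · have hi' : i ∈ l := by simpa [Ne.symm hji] using hi
      rw [dd_iterate_comm (contDiff_foldr_dd v α l hf), ih hl.2 hi']
      simp [hji]

lemma dd_mdd (v : Fin n → U) (α : MIdx n) (i : Fin n) {f : U → F} (hf : C∞ f) :
    dd (v i) (mdd v α f) = mdd v (α + Pi.single i 1) f :=
  dd_foldr_add_single v α _ (List.nodup_finRange n) i (List.mem_finRange i) hf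

lemma mdd_zero (v : Fin n → U) (f : U → F) : mdd v 0 f = f := by
  unfold mdd
  generalize finRange n = l
  induction l with
  | nil => rfl
  | cons i l ih => rw [foldr_cons, ih]; rfl

lemma len_add_single (α : MIdx n) (i : Fin n) : len (α + Pi.single i 1) = len α + 1 := by
  simp [len, Finset.sum_add_distrib]

lemma mfact_add_single (α : MIdx n) (i : Fin n) :
    mfact (α + Pi.single i 1) = (α i + 1 : ℝ) * mfact α := by
  unfold mfact
  rw [← Finset.mul_prod_erase _ _ (mem_univ i), ← Finset.mul_prod_erase univ (fun i => ((α i)! : ℝ)) (mem_univ i)]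
  have : ∀ j ∈ univ.erase i, (((α + Pi.single i 1 : MIdx n) j)! : ℝ) = ((α j)! : ℝ) := by
    intro j hj
    have : j ≠ i := (Finset.mem_erase.mp hj).1
    simp [this]
  rw [Finset.prod_congr rfl this]
  simp [Nat.factorial_succ]
  ring

/-- Induction on multi-indices. -/
lemma midx_induction {P : MIdx n → Prop} (h0 : P 0) (h1 : ∀ α i, P α → P (α + Pi.single i 1)) (α : MIdx n) :
    P α := by
  generalize hk : len α = k
  induction k generalizing α with
  | zero =>
    have : α = 0 := by
      funext i
      have := (Finset.sum_eq_zero_iff.mp hk) i (mem_univ i)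
      simpa using this
    exact this ▸ h0
  | succ k ih =>
    have : ∃ i, α i ≠ 0 := by
      by_contra hcon
      push Not at hcon
      simp [len, hcon] at hk
    obtain ⟨i, hi⟩ := this
    have e : α = (α - Pi.single i 1) + Pi.single i 1 := by
      funext j
      by_cases hj : j = i
      · subst hj; simp; omega
      · simp [hj]
    rw [e] at hk ⊢
    rw [len_add_single] at hk
    exact h1 _ _ (ih _ (by omega))

lemma mfact_pos (α : MIdx n) : 0 < mfact α := Finset.prod_pos fun _ _ => fact_pos _

lemma mfact_zero : mfact (0 : MIdx n) = 1 := by simp [mfact]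

lemma len_zero : len (0 : MIdx n) = 0 := by simp [len]

lemma mfact_le_fact_len (α : MIdx n) : mfact α ≤ ((len α)! : ℝ) := by
  unfold mfact len
  rw [← Nat.cast_prod]
  exact_mod_cast Nat.le_of_dvd (factorial_pos _) (Nat.prod_factorial_dvd_factorial_sum _ _)

lemma fact_len_rpow_le (hκ : 0 ≤ κ) (α : MIdx n) :
    ((len α)! : ℝ) ^ κ ≤ (((2 : ℝ) ^ κ) ^ n) ^ len α * mfact α ^ κ := by
  have h2 : (1 : ℝ) ≤ 2 ^ κ := one_le_rpow num! hκ
  have key : ∀ s : Finset (Fin n), ((∑ i ∈ s, α i)! : ℝ) ^ κ ≤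
      (((2 : ℝ) ^ κ) ^ s.card) ^ (∑ i ∈ s, α i) * (∏ i ∈ s, ((α i)! : ℝ)) ^ κ := by
    intro s
    induction s using induction_on with
    | empty => simp
    | insert a s ha ih =>
      rw [sum_insert ha, Finset.prod_insert ha, Finset.card_insert_of_notMem ha]
      refine (fact_add_rpow_le hκ _ _).trans ?_
      have hp : (0 : ℝ) ≤ ∏ i ∈ s, ((α i)! : ℝ) := Finset.prod_nonneg fun _ _ => (fact_pos _).le
      rw [mul_rpow (fact_pos _).le hp]
      calc _ ≤ ((2 : ℝ) ^ κ) ^ (α a + ∑ i ∈ s, α i) * (((α a)! : ℝ) ^ κ *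
            ((((2 : ℝ) ^ κ) ^ s.card) ^ (α a + ∑ i ∈ s, α i) * (∏ i ∈ s, ((α i)! : ℝ)) ^ κ)) := by
            gcongr
            refine ih.trans ?_
            gcongr
            · exact one_le_pow₀ h2
            · omega
        _ = _ := by rw [pow_succ, mul_pow]; ring
  simpa [len, mfact] using key univ

lemma norm_iteratedFDeriv_mdd_le {v : Fin n → U} (hv : ∀ i, ‖v i‖ ≤ 1) (α : MIdx n) {f : U → F}
    (hf : C∞ f) (p : U) (k : ℕ) :
    ‖𝒟 k (mdd v α f) p‖ ≤ ‖𝒟 (k + len α) f p‖ := by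
  induction α using midx_induction generalizing k with
  | h0 => rw [mdd_zero, len_zero, add_zero]
  | h1 α i ih =>
    rw [← dd_mdd v α i hf, len_add_single]
    refine (norm_iteratedFDeriv_dd_le (contDiff_mdd v α hf) _ p k).trans ?_
    have := ih (k + 1)
    rw [add_assoc, add_comm 1] at this
    exact (mul_le_of_le_one_left (norm_nonneg _) (hv i)).trans this

lemma mdd_comp_affine {f : U → F} (hf : C∞ f) (a : U) (T : U' →L[ℝ] U) (v : Fin n → U')
    (α : MIdx n) :
    mdd v α (fun u => f (a + T u)) = fun u => mdd (fun i => T (v i)) α f (a + T u) := by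
  have hc : C∞ (fun u => f (a + T u)) := fun!
  induction α using midx_induction with
  | h0 => simp [mdd_zero]
  | h1 α i ih =>
    rw [← dd_mdd v α i hc, ih, dd_comp_affine (contDiff_mdd _ α hf), ← dd_mdd (fun i => T (v i)) α i hf]

lemma mdd_smul_dir (c : ℝ) (v : Fin n → U) (α : MIdx n) {f : U → F} (hf : C∞ f) :
    mdd (fun i => c • v i) α f = fun x => c ^ len α • mdd v α f x := by
  induction α using midx_induction with
  | h0 => simp [mdd_zero, len_zero]
  | h1 α i ih =>
    rw [← dd_mdd (fun i => c • v i) α i hf, ih, dd_smul_dir, len_add_single, ← dd_mdd v α i hf]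
    funext x
    have hd := (contDiff_mdd v α hf).differentiable (by simp) x
    unfold dd
    rw [fderiv_fun_const_smul hd]
    simp [pow_succ', smul_smul]

lemma mdd_add {f g : U → F} (v : Fin n → U) (α : MIdx n) (hf : C∞ f) (hg : C∞ g) :
    mdd v α (fun x => f x + g x) = fun x => mdd v α f x + mdd v α g x := by
  induction α using midx_induction with
  | h0 => simp [mdd_zero]
  | h1 α i ih =>
    rw [← dd_mdd v α i (hf.add hg), ih, dd_add (contDiff_mdd v α hf) (contDiff_mdd v α hg),
      dd_mdd v α i hf, dd_mdd v α i hg]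

lemma exists_mdd_of_word (v w : Fin n → U) {f : U → F} (hf : C∞ f) (p : U) (k : ℕ)
    (r : Fin k → Fin n ⊕ Fin n) : ∃ α β : MIdx n, len α + len β = k ∧
      𝒟 k f p (fun j => elim v w (r j)) = mdd w α (mdd v β f) p := by
  induction k generalizing f with
  | zero => exact ⟨0, 0, by simp [len_zero], by simp [mdd_zero]⟩
  | succ k ih =>
    rw [iteratedFDeriv_succ_apply_right]
    have hd := hf.fderiv_right (m := ∞) (by simp)
    have e := iteratedFDeriv_clm_apply_const_apply hd (i := k) (mod_cast le_top) (x := p)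
      (u := elim v w (r (Fin.last k))) (m := fun j => elim v w (r j.castSucc))
    have e' : (𝒟 k (fderiv ℝ f) p (Fin.init fun j => elim v w (r j)))
        (elim v w (r (Fin.last k))) =
        𝒟 k (dd (elim v w (r (Fin.last k))) f) p
          (fun j => elim v w (r j.castSucc)) := e.symm
    rw [e']
    obtain ⟨α, β, h1, h2⟩ := ih (contDiff_dd hf (elim v w (r (Fin.last k)))) (fun j => r j.castSucc)
    rw [h2]
    rcases r (Fin.last k) with i | i
    · refine ⟨α, β + Pi.single i 1, by rw [len_add_single]; omega, ?_⟩
      simp only [elim_inl]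
      rw [← dd_mdd_comm v β hf, dd_mdd v β i hf]
    · refine ⟨α + Pi.single i 1, β, by rw [len_add_single]; omega, ?_⟩
      simp only [elim_inr]
      rw [← dd_mdd_comm v β hf, ← dd_mdd_comm w α (contDiff_mdd v β hf), dd_mdd w α i (contDiff_mdd v β hf)]

/-- The coordinate directions of the first variable. -/
def ex (i : Fin n) : E² n := (single i 1, 0)

/-- The coordinate directions of the second variable. -/
def eξ (i : Fin n) : E² n := (0, single i 1)

lemma norm_ex_le (i : Fin n) : ‖(ex i : E² n)‖ ≤ 1 := by simp [ex, norm_def]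

lemma norm_eξ_le (i : Fin n) : ‖(eξ i : E² n)‖ ≤ 1 := by simp [eξ, norm_def]

lemma prod_eq_sum (u : E² n) : u = ∑ s : Fin n ⊕ Fin n,
    (elim (fun i => u.1 i) (fun i => u.2 i) s : ℝ) • (elim ex eξ s : E² n) := by
  rw [sum_sum_type]
  simp only [elim_inl, elim_inr, ex, eξ]
  have h : ∀ x : E n, ∑ i, x i • (single i (1 : ℝ) : E n) = x := by
    intro x
    have := (basisFun (Fin n) ℝ).sum_repr x
    simpa using this
  ext1
  · rw [Prod.fst_add, fst_sum, fst_sum]; simp [h]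
  · rw [Prod.snd_add, snd_sum, snd_sum]; simp [h]

lemma opNorm_le_of_words {k : ℕ} (hB : 0 ≤ B)
    (L : ContinuousMultilinearMap ℝ (fun _ : Fin k => E² n) F)
    (h : ∀ r : Fin k → Fin n ⊕ Fin n, ‖L fun j => elim ex eξ (r j)‖ ≤ B) :
    ‖L‖ ≤ B * (2 * n : ℝ) ^ k := by
  refine L.opNorm_le_bound pos! fun u => ?_
  set c : Fin k → Fin n ⊕ Fin n → ℝ := fun j => elim (fun i => (u j).1 i) (fun i => (u j).2 i)
  have hc : ∀ j s, ‖c j s‖ ≤ ‖u j‖ := by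
    intro j s
    rcases s with i | i
    · exact (PiLp.norm_apply_le (u j).1 i).trans (norm_fst_le _)
    · exact (PiLp.norm_apply_le (u j).2 i).trans (norm_snd_le _)
  have e : L u = ∑ r : Fin k → Fin n ⊕ Fin n, (∏ j, c j (r j)) • L fun j => elim ex eξ (r j) := by
    conv_lhs => rw [show u = fun j => ∑ s, c j s • (elim ex eξ s : E² n) from
      funext fun j => prod_eq_sum (u j)]
    rw [L.map_sum]
    exact sum_congr rfl fun r _ => L.map_smul_univ _ _
  rw [e]
  calc _ ≤ ∑ r : Fin k → Fin n ⊕ Fin n, B * ∏ j, ‖u j‖ := by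
        refine norm_sum_le_of_le _ fun r _ => ?_
        rw [norm_smul, norm_prod, mul_comm]
        gcongr
        · exact h r
        · exact hc _ _
    _ = _ := by
        rw [sum_const]
        simp [card_sum, ← two_mul]
        ring

/-- Bounds of the mixed partial derivatives at a point give bounds of the total derivatives. -/
lemma GB_of_mdd (hκ : 0 ≤ κ) (hA : 0 ≤ A) (hM : 0 ≤ M) {f : E² n → F} (hf : C∞ f)
    {p : E² n} (h : ∀ α β : MIdx n, ‖mdd eξ α (mdd ex β f) p‖ ≤
      M * A ^ (len α + len β) * mfact α ^ κ * mfact β ^ κ) :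
    GB κ f p M ((2 * n + 1) * A) := by
  intro k
  have h1 : ∀ r : Fin k → Fin n ⊕ Fin n, ‖𝒟 k f p fun j => elim ex eξ (r j)‖ ≤
      M * A ^ k * (k ! : ℝ) ^ κ := by
    intro r
    obtain ⟨α, β, hk, e⟩ := exists_mdd_of_word ex eξ hf p k r
    rw [e]
    refine (h α β).trans ?_
    rw [← hk, mul_assoc _ (mfact α ^ κ)]
    gcongr
    refine le_trans ?_ (fact_mul_fact_rpow_le hκ _ _)
    have := mfact_pos α
    have := mfact_pos β
    gcongr <;> exact mfact_le_fact_len _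
  refine (opNorm_le_of_words pos! _ h1).trans ?_
  have : ((2 * n : ℝ)) ^ k ≤ (2 * n + 1) ^ k := by gcongr; linarith
  calc _ ≤ M * A ^ k * (k ! : ℝ) ^ κ * (2 * n + 1 : ℝ) ^ k := mono!
    _ = _ := by rw [mul_pow]; ring

/-- Bounds of the total derivatives give bounds of the mixed partial derivatives. -/
lemma GB.mdd_le (hκ : 0 ≤ κ) (hR : 0 ≤ R) {f : E² n → F} (hf : C∞ f)
    {p : E² n} (h : GB κ f p M R) (α β : MIdx n) : ‖mdd eξ α (mdd ex β f) p‖ ≤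
      M * (((2 : ℝ) ^ κ) ^ (n + 1) * R) ^ (len α + len β) * mfact α ^ κ * mfact β ^ κ := by
  have hM := h.nonneg
  have h1 := norm_iteratedFDeriv_mdd_le norm_eξ_le α (contDiff_mdd ex β hf) p 0
  rw [norm_iteratedFDeriv_zero] at h1
  have h2 := norm_iteratedFDeriv_mdd_le norm_ex_le β hf p (0 + len α)
  rw [zero_add] at h1 h2
  refine (h1.trans (h2.trans (h _))).trans ?_
  calc M * R ^ (len α + len β) * ((len α + len β)! : ℝ) ^ κ
      ≤ M * R ^ (len α + len β) * (((2 : ℝ) ^ κ) ^ (len α + len β) *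
        (((((2 : ℝ) ^ κ) ^ n) ^ len α * mfact α ^ κ) * ((((2 : ℝ) ^ κ) ^ n) ^ len β * mfact β ^ κ))) := by
        have := mfact_pos α
        refine mul_le_mul_of_nonneg_left ((fact_add_rpow_le hκ _ _).trans ?_) pos!
        exact mul_le_mul_of_nonneg_left (mul_le_mul (fact_len_rpow_le hκ _) (fact_len_rpow_le hκ _)
          pos! pos!) pos!
    _ = _ := by rw [mul_pow, pow_succ ((2 : ℝ) ^ κ) n, mul_pow, pow_add, pow_add, pow_add]; ring

/-- A function of `(x, ξ)` in uncurried form. -/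
def unc (a : E n → E n → F) : E² n → F := fun z => a z.1 z.2

lemma mderiv_section {G : U → F} (hG : C∞ G) (a : U) (T : E n →L[ℝ] U) (α : MIdx n) :
    mderiv α (fun y => G (a + T y)) =
      fun y => mdd (fun i => T (single i 1)) α G (a + T y) := by
  rw [mderiv_eq_mdd, mdd_comp_affine hG]

lemma dx_eq {a : E n → E n → F} (ha : C∞ (unc a)) (β : MIdx n) (x ξ : E n) :
    dx β a x ξ = mdd ex β (unc a) (x, ξ) := by
  have h := congrFun (mderiv_section ha ((0, ξ) : E² n) (inl ℝ (E n) (E n)) β) x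
  rw [show (ex : Fin n → E² n) = fun i => (single i 1, 0) from rfl]
  simpa [unc, dx] using h

lemma dξ_eq {a : E n → E n → F} (ha : C∞ (unc a)) (α : MIdx n) (x ξ : E n) :
    dξ α a x ξ = mdd eξ α (unc a) (x, ξ) := by
  have h := congrFun (mderiv_section ha ((x, 0) : E² n) (inr ℝ (E n) (E n)) α) ξ
  rw [show (eξ : Fin n → E² n) = fun i => (0, single i 1) from rfl]
  simpa [unc, dξ] using h

lemma unc_dx {a : E n → E n → F} (ha : C∞ (unc a)) (β : MIdx n) :
    unc (dx β a) = mdd ex β (unc a) := funext fun z => dx_eq ha β z.1 z.2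

lemma unc_dξ {a : E n → E n → F} (ha : C∞ (unc a)) (α : MIdx n) :
    unc (dξ α a) = mdd eξ α (unc a) := funext fun z => dξ_eq ha α z.1 z.2

lemma dξ_dx_eq {a : E n → E n → F} (ha : C∞ (unc a)) (α β : MIdx n) (x ξ : E n) :
    dξ α (dx β a) x ξ = mdd eξ α (mdd ex β (unc a)) (x, ξ) := by
  have h : C∞ (unc (dx β a)) := by rw [unc_dx ha]; exact contDiff_mdd _ _ ha
  rw [dξ_eq h, unc_dx ha]

/-- The anisotropic dilation `(x, ξ) ↦ (x, b ξ)`. -/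
def scl (n : ℕ) (b : ℝ) : E² n →L[ℝ] E² n :=
  (fst ℝ (E n) (E n)).prod (b • snd ℝ (E n) (E n))

lemma scl_apply (b : ℝ) (u : E² n) : scl n b u = (u.1, b • u.2) := rfl

lemma scl_ex (b : ℝ) (i : Fin n) : scl n b (ex i) = ex i := by simp [scl, ex]

lemma scl_eξ (b : ℝ) (i : Fin n) : scl n b (eξ i) = b • eξ i := by simp [scl, eξ]

lemma mdd_scl {f : E² n → F} (hf : C∞ f) (b : ℝ) (q u : E² n) (α β : MIdx n) :
    mdd eξ α (mdd ex β fun u => f (q + scl n b u)) u = b ^ len α • mdd eξ α (mdd ex β f) (q + scl n b u) := by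
  rw [mdd_comp_affine hf]
  simp only [scl_ex]
  rw [mdd_comp_affine (contDiff_mdd _ β hf)]
  simp only [scl_eξ]
  rw [mdd_smul_dir b eξ α (contDiff_mdd ex β hf)]

lemma GB_scl_of_bound (hκ : 0 ≤ κ) (hA : 0 ≤ A) (hM : 0 ≤ M) (hb : 0 < b) {f : E² n → F}
    (hf : C∞ f) {q : E² n} (h : ∀ α β : MIdx n, ‖mdd eξ α (mdd ex β f) q‖ ≤
      M * A ^ (len α + len β) * mfact α ^ κ * mfact β ^ κ * b ^ (-(len α : ℝ))) :
    GB κ (fun u => f (q + scl n b u)) 0 M ((2 * n + 1) * A) := by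
  refine GB_of_mdd hκ hA hM fun! fun α β => ?_
  rw [mdd_scl hf, norm_smul, map_zero, add_zero]
  calc _ ≤ ‖b ^ len α‖ * (M * A ^ (len α + len β) * mfact α ^ κ * mfact β ^ κ * b ^ (-(len α : ℝ))) := by
        gcongr; exact h α β
    _ = _ := by
        rw [rpow_neg hb.le, rpow_natCast, norm_of_nonneg pos!]
        field_simp

lemma bound_of_GB_scl (hκ : 0 ≤ κ) (hR : 0 ≤ R) (hb : 0 < b) {f : E² n → F}
    (hf : C∞ f) {q : E² n} (h : GB κ (fun u => f (q + scl n b u)) 0 M R) (α β : MIdx n) :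
    ‖mdd eξ α (mdd ex β f) q‖ ≤
      M * (((2 : ℝ) ^ κ) ^ (n + 1) * R) ^ (len α + len β) * mfact α ^ κ * mfact β ^ κ *
        b ^ (-(len α : ℝ)) := by
  have h1 := h.mdd_le hκ hR fun! α β
  rw [mdd_scl hf, norm_smul, map_zero, add_zero, norm_of_nonneg pos!] at h1
  rw [rpow_neg hb.le, rpow_natCast, ← div_eq_mul_inv, le_div_iff₀ pos!, mul_comm]
  exact h1

end MultiIndices

section ParametricIntegrals

variable {U X F : Type} [NormedAddCommGroup U] [NormedSpace ℝ U] [MeasurableSpace X]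
  [NormedAddCommGroup F] [NormedSpace ℝ F] [CompleteSpace F]

/-- Smoothness of parameter integrals, with the formula for all derivatives. -/
lemma contDiff_integral_and_iteratedFDeriv {μ : Measure X} {f : U → X → F}
    (hf : ∀ X, C∞ fun u => f u X)
    (hm : ∀ k u, AEStronglyMeasurable (fun X => 𝒟 k (fun v => f v X) u) μ)
    (hb : ∀ k u₀, ∃ G : X → ℝ, Integrable G μ ∧
      ∀ᶠ u in 𝓝 u₀, ∀ X, ‖𝒟 k (fun v => f v X) u‖ ≤ G X) :
    C∞ (fun u => ∫ X, f u X ∂μ) ∧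
      ∀ k u, 𝒟 k (fun u => ∫ X, f u X ∂μ) u =
        ∫ X, 𝒟 k (fun v => f v X) u ∂μ := by
  have hint : ∀ k u, Integrable (fun X => 𝒟 k (fun v => f v X) u) μ := by
    intro k u
    obtain ⟨G, hG, hGb⟩ := hb k u
    exact hG.mono' (hm k u) (.of_forall fun X => hGb.self_of_nhds X)
  set p : U → FormalMultilinearSeries ℝ U F := fun u k => ∫ X, 𝒟 k (fun v => f v X) u ∂μ
  have hder : ∀ (k : ℕ) u, HasFDerivAt (fun u => p u k) (p u (k + 1)).curryLeft u := by
    intro k u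
    obtain ⟨G, hG, hGb⟩ := hb (k + 1) u
    set L := continuousMultilinearCurryLeftEquiv ℝ (fun _ : Fin (k + 1) => U) F
    have h := hasFDerivAt_integral_of_dominated_of_fderiv_le (𝕜 := ℝ) (μ := μ) (x₀ := u) (bound := G)
      (F := fun v X => 𝒟 k (fun v => f v X) v)
      (F' := fun v X => L (𝒟 (k + 1) (fun v => f v X) v)) hGb
      (.of_forall fun v => hm k v) (hint k u)
      (L.continuous.comp_aestronglyMeasurable (hm (k + 1) u))
      (.of_forall fun X v hv => by
        rw [LinearIsometryEquiv.norm_map]; exact hv X) hG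
      (.of_forall fun X v _ => by
        have h1 : DifferentiableAt ℝ (𝒟 k fun v => f v X) v :=
          (hf X).differentiable_iteratedFDeriv (m := k) (by exact_mod_cast ENat.natCast_lt_top k) v
        have h2 := h1.hasFDerivAt
        rw [fderiv_iteratedFDeriv] at h2
        exact h2)
    have e : ∫ X, L (𝒟 (k + 1) (fun v => f v X) u) ∂μ = (p u (k + 1)).curryLeft := by
      exact ContinuousLinearMap.integral_comp_comm (𝕜 := ℝ) (E := U [×(k + 1)]→L[ℝ] F)
        (Fₗ := U →L[ℝ] U [×k]→L[ℝ] F)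
        (ContinuousLinearEquiv.toContinuousLinearMap (L.toContinuousLinearEquiv)) (hint (k + 1) u)
    rw [e] at h
    exact h
  have hT : HasFTaylorSeriesUpTo ∞ (fun u => ∫ X, f u X ∂μ) p := by
    constructor
    · intro u
      have hL : ∫ X, f u X ∂μ = (continuousMultilinearCurryFin0 ℝ U F) (p u 0) := by
        have := (continuousMultilinearCurryFin0 ℝ U F).toContinuousLinearEquiv.integral_comp_comm (μ := μ)
          (fun X => 𝒟 0 (fun v => f v X) u)
        refine Eq.trans ?_ this
        rfl
      rw [hL]; rfl
    · intro m _ u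
      exact hder m u
    · intro m _
      exact continuous_iff_continuousAt.mpr fun u => (hder m u).continuousAt
  refine ⟨hT.contDiff, fun k u => ?_⟩
  exact (hT.eq_iteratedFDeriv (mod_cast le_top) u).symm

lemma continuous_iteratedFDeriv_section {W : Type} [NormedAddCommGroup W] [NormedSpace ℝ W]
    {G : W × U → F} (hG : C∞ G) (k : ℕ) :
    Continuous fun z : W × U => 𝒟 k (fun u => G (z.1, u)) z.2 := by
  have e : (fun z : W × U => 𝒟 k (fun u => G (z.1, u)) z.2) = fun z =>
      compContinuousLinearMapL
        (fun _ : Fin k => inr ℝ W U) (𝒟 k G z) := by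
    funext z
    have := iteratedFDeriv_comp_affine hG ((z.1, 0) : W × U) (inr ℝ W U) z.2 k
    simpa using this
  rw [e]
  exact (ContinuousLinearMap.continuous _).comp (hG.continuous_iteratedFDeriv (mod_cast le_top))

lemma norm_iteratedFDeriv_section_le {W : Type} [NormedAddCommGroup W] [NormedSpace ℝ W]
    {G : W × U → F} (hG : C∞ G) (k : ℕ) (w : W) (u : U) :
    ‖𝒟 k (fun u => G (w, u)) u‖ ≤ ‖𝒟 k G (w, u)‖ := by
  have h := norm_iteratedFDeriv_comp_affine_le hG ((w, 0) : W × U) (inr ℝ W U) u k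
  have h1 : ‖inr ℝ W U‖ ^ k ≤ 1 :=
    pow_le_one₀ (norm_nonneg _) (ContinuousLinearMap.norm_inr_le_one ℝ W U)
  simp at h
  exact h.trans (mul_le_of_le_one_right (norm_nonneg _) h1)

end ParametricIntegrals

section Decay

/-- Factorial bounds of all moments give exponential decay. -/
lemma le_exp_of_moments {q j : ℝ} (hκ : 1 ≤ κ) (hq : 0 ≤ q) (hR : 0 < R) (hj : 0 ≤ j)
    (h : ∀ M : ℕ, q ^ M * j ≤ B * R ^ M * (M ! : ℝ) ^ κ) :
    j ≤ 2 ^ κ * B * exp (-(1 / 2) * (q / R) ^ (1 / κ)) := by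
  have hκ0 : 0 < κ := lin!
  have hB : 0 ≤ B := by have := h 0; simp at this; linarith
  rcases hj.eq_or_lt with rfl | hj
  · positivity
  set x := (q / R) ^ (1 / κ)
  set t := (B / j) ^ (1 / κ)
  have ht : 0 ≤ t := pos!
  have h1 : ∀ M : ℕ, x ^ M / (M ! : ℝ) ≤ t := by
    intro M
    have h2 : (x ^ M / (M ! : ℝ)) ^ κ ≤ B / j := by
      have h3 : (x ^ M) ^ κ = (q / R) ^ M := by
        have h0 : 0 ≤ q / R := pos!
        simp only [x]
        rw [← rpow_natCast, ← rpow_natCast, ← rpow_mul h0, ← rpow_mul h0]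
        congr 1; field_simp
      rw [div_rpow pos! pos!, h3, div_pow, div_div,
        div_le_div_iff₀ (by have := fact_rpow_pos M κ; positivity) hj]
      linarith [h M]
    calc x ^ M / (M ! : ℝ) = ((x ^ M / (M ! : ℝ)) ^ κ) ^ (1 / κ) := by
          rw [← rpow_mul pos!, mul_one_div_cancel hκ0.ne', rpow_one]
      _ ≤ t := rpow_le_rpow pos! h2 pos!
  have h4 : exp (x / 2) ≤ t * 2 := by
    have e1 : HasSum (fun M : ℕ => (x / 2) ^ M / (M ! : ℝ)) (exp (x / 2)) := by
      rw [Real.exp_eq_exp_ℝ]; exact NormedSpace.expSeries_div_hasSum_exp (x / 2)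
    refine hasSum_le (fun M => ?_) e1 (hasSum_geometric_two.mul_left t)
    have := h1 M
    calc (x / 2) ^ M / (M ! : ℝ) = (x ^ M / (M ! : ℝ)) * (1 / 2) ^ M := by rw [div_pow, div_pow]; ring
      _ ≤ _ := mono!
  have h5 : exp (x / 2) ^ κ ≤ (B / j) * 2 ^ κ := by
    calc _ ≤ (t * 2) ^ κ := mono!
      _ = _ := by
        rw [mul_rpow ht num!]
        simp only [t]
        rw [← rpow_mul pos!, one_div_mul_cancel hκ0.ne', rpow_one]
  have h6 : exp (x / 2) ≤ exp (x / 2) ^ κ :=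
    Real.self_le_rpow_of_one_le (one_le_exp pos!) hκ
  have h7 := h6.trans h5
  rw [div_mul_eq_mul_div, le_div_iff₀ hj] at h7
  have h8 : -(1 / 2) * x = -(x / 2) := by ring
  rw [h8, exp_neg, ← div_eq_mul_inv, le_div_iff₀ (exp_pos _)]
  linarith

end Decay

section Oscillatory

variable {V : Type} [NormedAddCommGroup V] [InnerProductSpace ℝ V]

/-- The character `e^{-i⟨P, Q⟩}`. -/
def ec (P Q : V) : ℂ := Complex.exp (-I * (inner ℝ P Q : ℝ))

lemma norm_ec (P Q : V) : ‖ec P Q‖ = 1 := by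
  unfold ec
  rw [Complex.norm_exp]; simp

lemma ec_comm (P Q : V) : ec P Q = ec Q P := by simp [ec, real_inner_comm]

lemma contDiff_ec (Q : V) : C∞ fun P : V => ec P Q := by
  unfold ec
  have : C∞ fun P : V => ((inner ℝ P Q : ℝ) : ℂ) :=
    ofRealCLM.contDiff.comp (contDiff_id.inner ℝ contDiff_const)
  exact (contDiff_const.mul this).cexp

lemma continuous_ec : Continuous fun z : V × V => ec z.1 z.2 := by
  unfold ec
  fun_prop

lemma dd_ec (v Q : V) : dd v (fun P => ec P Q) = fun P => -I * (inner ℝ v Q : ℝ) * ec P Q := by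
  funext P
  unfold dd ec
  have h1 : HasFDerivAt (fun P : V => (inner ℝ P Q : ℝ)) ((innerSL ℝ).flip Q) P :=
    ((innerSL ℝ).flip Q).hasFDerivAt
  have h2 : HasFDerivAt (fun P : V => ((inner ℝ P Q : ℝ) : ℂ))
      (ofRealCLM.comp ((innerSL ℝ).flip Q)) P := ofRealCLM.hasFDerivAt.comp P h1
  have h3 := (h2.const_mul (-I)).cexp
  rw [h3.fderiv]
  simp only [FunLike.coe_smul, Pi.smul_apply, comp_apply,
    flip_apply, innerSL_apply_apply, ofRealCLM_apply, smul_eq_mul]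
  ring

variable [MeasurableSpace V] [BorelSpace V] [FiniteDimensional ℝ V]

lemma integrable_ec_mul {f : V → ℂ} (hf : Integrable f) (Q : V) : Integrable fun P => ec P Q * f P := by
  refine hf.norm.mono' ?_ (.of_forall fun P => by simp [norm_ec])
  exact (contDiff_ec Q).continuous.aestronglyMeasurable.mul hf.aestronglyMeasurable

lemma integral_ec_mul_dd {f : V → ℂ} (hf : C∞ f) {v : V} (hi : Integrable f)
    (hi' : Integrable (dd v f)) (Q : V) :
    ∫ P, ec P Q * dd v f P = I * (inner ℝ v Q : ℝ) * ∫ P, ec P Q * f P := by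
  have he : ∀ P, fderiv ℝ (fun P => ec P Q) P v = -I * (inner ℝ v Q : ℝ) * ec P Q :=
    fun P => congrFun (dd_ec v Q) P
  have h := integral_mul_fderiv_eq_neg_fderiv_mul_of_integrable (𝕜 := ℂ) (μ := volume)
    (f := fun P => ec P Q) (g := f) (v := v)
    (by simp only [he, mul_assoc]; exact ((integrable_ec_mul hi Q).const_mul _).const_mul _)
    (integrable_ec_mul hi' Q) (integrable_ec_mul hi Q)
    (fun P _ => (contDiff_ec Q).differentiable (by simp) P)
    (fun P _ => hf.differentiable (by simp) P)
  simp only [he] at h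
  unfold dd
  rw [h, ← integral_neg, ← integral_const_mul]
  congr 1
  funext P
  ring

lemma integral_ec_mul_dd_iterate {f : V → ℂ} (hf : C∞ f) {v : V}
    (hi : ∀ j, Integrable ((dd v)^[j] f)) (Q : V) (M : ℕ) :
    ∫ P, ec P Q * (dd v)^[M] f P = (I * (inner ℝ v Q : ℝ)) ^ M * ∫ P, ec P Q * f P := by
  induction M with
  | zero => simp
  | succ M ih =>
    have h1 := hi (M + 1)
    rw [iterate_succ_apply'] at h1 ⊢
    rw [integral_ec_mul_dd (contDiff_dd_iterate hf v M) (hi M) h1, ih]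
    ring

end Oscillatory

section InnerIntegral

lemma GB.translate {U F : Type} [NormedAddCommGroup U] [NormedSpace ℝ U] [NormedAddCommGroup F]
    [NormedSpace ℝ F] {f : U → F} {a : U} (h : GB κ f a M R) :
    GB κ (fun z => f (a + z)) 0 M R := by
  intro k
  rw [iteratedFDeriv_comp_add_left, add_zero]
  exact h k

variable {V : Type} [NormedAddCommGroup V] [InnerProductSpace ℝ V]
  [MeasurableSpace V] [BorelSpace V] [FiniteDimensional ℝ V]
  {U : Type} [NormedAddCommGroup U] [NormedSpace ℝ U]

/-- The Fourier integral `∫ e^{-i⟨P, Q⟩} f(P) dP`. -/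
def osc (f : V → ℂ) (Q : V) : ℂ := ∫ P, ec P Q * f P

/-- Domination of all derivatives of `G`, uniformly in the first variable, near `u₀`. -/
def LocDom (κ : ℝ) (G : V × U → ℂ) (u₀ : U) : Prop :=
  ∃ (g : V → ℝ) (R : ℝ), 0 ≤ R ∧ Integrable g ∧ ∀ᶠ u in 𝓝 u₀, ∀ P, GB κ G (P, u) (g P) R

lemma iteratedFDeriv_const_mul_complex {f : U → ℂ} (hf : C∞ f) (c : ℂ) (k : ℕ) (u : U) :
    𝒟 k (fun v => c * f v) u = c • 𝒟 k f u := by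
  have h := iteratedFDeriv_const_smul_apply (𝕜 := ℝ) (i := k) (a := c) (f := f) (x := u)
    ((hf.of_le (mod_cast le_top)).contDiffAt)
  exact h

lemma norm_iteratedFDeriv_const_mul {f : U → ℂ} (hf : C∞ f) (c : ℂ) (k : ℕ) (u : U) :
    ‖𝒟 k (fun v => c * f v) u‖ = ‖c‖ * ‖𝒟 k f u‖ := by
  rw [iteratedFDeriv_const_mul_complex hf, norm_smul]

lemma LocDom.dd (hκ : 0 ≤ κ) {G : V × U → ℂ} (hG : C∞ G) {u₀ : U}
    (h : LocDom κ G u₀) (v : V × U) : LocDom κ (dd v G) u₀ := by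
  obtain ⟨g, R, hR, hg, hb⟩ := h
  refine ⟨fun P => ‖v‖ * (g P * R), 2 ^ κ * R, pos!, (hg.mul_const R).const_mul _, ?_⟩
  filter_upwards [hb] with u hu P
  exact (hu P).dd hκ hR hG v

lemma LocDom.dd_iterate (hκ : 0 ≤ κ) {G : V × U → ℂ} (hG : C∞ G) {u₀ : U}
    (h : LocDom κ G u₀) (v : V × U) (M : ℕ) : LocDom κ ((GevreyConj.dd v)^[M] G) u₀ := by
  induction M with
  | zero => exact h
  | succ M ih =>
    rw [iterate_succ_apply']
    exact ih.dd hκ (contDiff_dd_iterate hG v M) v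

lemma contDiff_section_left {G : V × U → ℂ} (hG : C∞ G) (u : U) :
    C∞ fun P => G (P, u) := hG.comp (contDiff_id.prodMk contDiff_const)

lemma contDiff_section_right {G : V × U → ℂ} (hG : C∞ G) (P : V) :
    C∞ fun u => G (P, u) := hG.comp (contDiff_const.prodMk contDiff_id)

lemma LocDom.integrable {G : V × U → ℂ} (hG : C∞ G) {u : U}
    (h : LocDom κ G u) : Integrable fun P => G (P, u) := by
  obtain ⟨g, R, hR, hg, hb⟩ := h
  exact hg.mono' (contDiff_section_left hG u).continuous.aestronglyMeasurable
    (.of_forall fun P => (hb.self_of_nhds P).norm_le)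

lemma dd_section_left {G : V × U → ℂ} (hG : C∞ G) (u : U) (v : V) :
    GevreyConj.dd v (fun P => G (P, u)) = fun P => GevreyConj.dd (v, 0) G (P, u) := by
  have := dd_comp_affine hG ((0, u) : V × U) (inl ℝ V U) v
  simpa using this

lemma dd_iterate_section_left {G : V × U → ℂ} (hG : C∞ G) (u : U) (v : V) (M : ℕ) :
    (GevreyConj.dd v)^[M] (fun P => G (P, u)) = fun P => (GevreyConj.dd (v, 0))^[M] G (P, u) := by
  induction M with
  | zero => rfl
  | succ M ih =>
    rw [iterate_succ_apply', ih, dd_section_left (contDiff_dd_iterate hG _ M),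
      iterate_succ_apply']

lemma aestronglyMeasurable_iteratedFDeriv_section {G : V × U → ℂ} (hG : C∞ G) (k : ℕ) (u : U) :
    AEStronglyMeasurable (fun P => 𝒟 k (fun u => G (P, u)) u) (volume : Measure V) :=
  ((continuous_iteratedFDeriv_section hG k).comp
    (continuous_id.prodMk continuous_const)).aestronglyMeasurable

/-- Smooth dependence of the inner integral on parameters. -/
lemma contDiff_osc {G : V × U → ℂ} (hG : C∞ G) (h : ∀ u₀, LocDom κ G u₀) (Q : V) :
    C∞ (fun u => osc (fun P => G (P, u)) Q) ∧
      ∀ k u, 𝒟 k (fun u => osc (fun P => G (P, u)) Q) u =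
        ∫ P, ec P Q • 𝒟 k (fun v => G (P, v)) u := by
  have e : ∀ k P u, 𝒟 k (fun v => ec P Q * G (P, v)) u =
      ec P Q • 𝒟 k (fun v => G (P, v)) u :=
    fun k P u => iteratedFDeriv_const_mul_complex (contDiff_section_right hG P) _ k u
  have hmain := contDiff_integral_and_iteratedFDeriv (μ := (volume : Measure V))
    (f := fun u P => ec P Q * G (P, u))
    (fun P => contDiff_const.mul (contDiff_section_right hG P))
    (fun k u => by
      simp only [e]
      exact (contDiff_ec Q).continuous.aestronglyMeasurable.smul
        (aestronglyMeasurable_iteratedFDeriv_section hG k u))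
    (fun k u₀ => by
      obtain ⟨g, R, hR, hg, hb⟩ := h u₀
      refine ⟨fun P => g P * R ^ k * (k ! : ℝ) ^ κ, (hg.mul_const _).mul_const _, ?_⟩
      filter_upwards [hb] with u hu P
      rw [e, norm_smul, norm_ec, one_mul]
      exact (norm_iteratedFDeriv_section_le hG k P u).trans (hu P k))
  refine ⟨hmain.1, fun k u => ?_⟩
  rw [show (fun u => osc (fun P => G (P, u)) Q) = fun u => ∫ P, ec P Q * G (P, u) from rfl, hmain.2]
  simp only [e]

/-- Decay of the inner integral and all its derivatives in the parameters. -/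
lemma norm_iteratedFDeriv_osc_le (hκ : 1 ≤ κ) (hR : 0 < R) (hl : 0 < l) {G : V × U → ℂ}
    (hG : C∞ G) (h : ∀ u, LocDom κ G u) {u₀ : U} {g : V → ℝ} (hg : Integrable g)
    (hb : ∀ P, GB κ (fun z : V × U => G ((P, u₀) + (l • z.1, z.2))) 0 (g P) R) (Q : V) (k : ℕ) :
    ‖𝒟 k (fun u => osc (fun P => G (P, u)) Q) u₀‖ ≤
      2 ^ κ * ((∫ P, g P) * (2 ^ κ * R) ^ k * (k ! : ℝ) ^ κ) *
        exp (-(1 / 2) * (l * ‖Q‖ / (2 ^ κ * R)) ^ (1 / κ)) := by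
  have hκ0 : 0 ≤ κ := lin!
  refine le_exp_of_moments hκ pos! pos! (norm_nonneg _) fun M => ?_
  set v : V := (l / ‖Q‖) • Q
  have hv : ‖v‖ ≤ l := by
    simp only [v]
    rw [norm_smul, norm_eq_abs, abs_div, abs_of_pos hl, abs_norm]
    rcases eq_or_ne ‖Q‖ 0 with h0 | h0
    · rw [h0]; simp [hl.le]
    · rw [div_mul_cancel₀ _ h0]
  have hvQ : (inner ℝ v Q : ℝ) = l * ‖Q‖ := by
    simp only [v]
    rw [real_inner_smul_left, real_inner_self_eq_norm_sq]
    rcases eq_or_ne ‖Q‖ 0 with h0 | h0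
    · rw [h0]; simp
    · field_simp
  set GM := (GevreyConj.dd ((v, 0) : V × U))^[M] G
  have hGM : C∞ GM := contDiff_dd_iterate hG _ M
  have hGMd : ∀ u, LocDom κ GM u := fun u => (h u).dd_iterate hκ0 hG _ M
  have e1 : (fun u => osc (fun P => GM (P, u)) Q) =
      fun u => (I * (l * ‖Q‖ : ℝ)) ^ M * osc (fun P => G (P, u)) Q := by
    funext u
    have := integral_ec_mul_dd_iterate (contDiff_section_left hG u) (v := v)
      (fun j => by
        rw [dd_iterate_section_left hG]
        exact ((h u).dd_iterate hκ0 hG _ j).integrable (contDiff_dd_iterate hG _ j)) Q M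
    rw [hvQ, dd_iterate_section_left hG] at this
    exact this
  have e2 : (l * ‖Q‖) ^ M * ‖𝒟 k (fun u => osc (fun P => G (P, u)) Q) u₀‖ =
      ‖𝒟 k (fun u => osc (fun P => GM (P, u)) Q) u₀‖ := by
    rw [e1, norm_iteratedFDeriv_const_mul (contDiff_osc hG h Q).1]
    congr 1
    rw [norm_pow, norm_mul, norm_I, one_mul, norm_real, norm_of_nonneg pos!]
  have hgn : ∀ P, 0 ≤ g P := fun P => (hb P).nonneg
  rw [e2, (contDiff_osc hGM hGMd Q).2]
  have hpt : ∀ P, ‖𝒟 k (fun u => GM (P, u)) u₀‖ ≤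
      g P * R ^ (k + M) * ((k + M)! : ℝ) ^ κ := by
    intro P
    set T : V × U →L[ℝ] V × U := (l • fst ℝ V U).prod (snd ℝ V U)
    have hT : ∀ z : V × U, T z = (l • z.1, z.2) := fun z => rfl
    have hGT : C∞ (fun z : V × U => G ((P, u₀) + T z)) :=
      hG.comp (contDiff_const.add T.contDiff)
    have hdT : (fun z : V × U => GM ((P, u₀) + T z)) =
        (GevreyConj.dd ((l⁻¹ • v, 0) : V × U))^[M] (fun z => G ((P, u₀) + T z)) := by
      have : ∀ j, (GevreyConj.dd ((l⁻¹ • v, 0) : V × U))^[j] (fun z => G ((P, u₀) + T z)) =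
          fun z => (GevreyConj.dd ((v, 0) : V × U))^[j] G ((P, u₀) + T z) := by
        intro j
        induction j with
        | zero => rfl
        | succ j ih =>
          rw [iterate_succ_apply', ih, dd_comp_affine (contDiff_dd_iterate hG _ j),
            iterate_succ_apply', hT]
          simp only [smul_smul, mul_inv_cancel₀ hl.ne', one_smul]
      rw [this M]
    have h1 : ‖𝒟 k (fun z : V × U => GM ((P, u₀) + T z)) 0‖ ≤
        g P * R ^ (k + M) * ((k + M)! : ℝ) ^ κ := by
      rw [hdT]
      refine (norm_iteratedFDeriv_dd_iterate_le hGT _ _ k M).trans ?_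
      have hn : ‖((l⁻¹ • v, 0) : V × U)‖ ≤ 1 := by
        rw [norm_mk, norm_zero, norm_smul, norm_inv, norm_of_nonneg hl.le]
        refine max_le ?_ zero_le_one
        rw [inv_mul_le_iff₀ hl]; linarith
      refine (mul_le_of_le_one_left (norm_nonneg _) (pow_le_one₀ (norm_nonneg _) hn)).trans ?_
      exact hb P (k + M)
    have h2 : (fun u => GM (P, u)) = fun u => (fun z : V × U => GM ((P, u₀) + T z))
        ((0, -u₀) + inr ℝ V U u) := by
      funext u
      simp [hT]
    rw [h2]
    refine (norm_iteratedFDeriv_comp_affine_le (hGM.comp (contDiff_const.add T.contDiff)) _ _ _ _).trans ?_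
    have h3 : ((0, -u₀) : V × U) + inr ℝ V U u₀ = 0 := by simp
    rw [h3]
    exact (mul_le_of_le_one_right (norm_nonneg _)
      (pow_le_one₀ (norm_nonneg _) (ContinuousLinearMap.norm_inr_le_one ℝ V U))).trans h1
  calc _ ≤ ∫ P, g P * (R ^ (k + M) * ((k + M)! : ℝ) ^ κ) := by
        refine norm_integral_le_of_norm_le (hg.mul_const _) (.of_forall fun P => ?_)
        rw [norm_smul, norm_ec, one_mul, ← mul_assoc]
        exact hpt P
    _ = (∫ P, g P) * (R ^ (k + M) * ((k + M)! : ℝ) ^ κ) := integral_mul_const _ _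
    _ ≤ (∫ P, g P) * (R ^ (k + M) * (((2 : ℝ) ^ κ) ^ (k + M) * ((k ! : ℝ) ^ κ * (M ! : ℝ) ^ κ))) := by
        have : 0 ≤ ∫ P, g P := integral_nonneg hgn
        gcongr
        exact fact_add_rpow_le hκ0 k M
    _ = _ := by rw [mul_pow, mul_pow, pow_add, pow_add]; ring

end InnerIntegral

section OuterIntegral

variable {V : Type} [NormedAddCommGroup V] [InnerProductSpace ℝ V]
  [MeasurableSpace V] [BorelSpace V] [FiniteDimensional ℝ V]
  {U : Type} [NormedAddCommGroup U] [NormedSpace ℝ U]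
  {S : Type} [NormedAddCommGroup S] [NormedSpace ℝ S] [MeasurableSpace S] [BorelSpace S]
  [SecondCountableTopology S]

/-- The conditions for the convergence of `∫_S ∫_V e^{-i⟨P, ϑ(s)⟩} G(P, s, u) dP dμ(s)`, locally
uniformly in `u` near `u₀`. -/
def OscDom (κ : ℝ) (G : V × S × U → ℂ) (ϑ : S → V) (μ : Measure S) (u₀ : U) : Prop :=
  ∃ (g : V → ℝ) (τ : S → ℝ) (R : ℝ), 0 < R ∧ Integrable g ∧
    Integrable (fun s => τ s * exp (-(1 / 2) * (‖ϑ s‖ / (2 ^ κ * R)) ^ (1 / κ))) μ ∧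
    ∀ᶠ u in 𝓝 u₀, ∀ P s, GB κ (fun z : V × U => G (z.1, s, z.2)) (P, u) (g P * τ s) R

lemma contDiff_slice {G : V × S × U → ℂ} (hG : C∞ G) (s : S) :
    C∞ fun z : V × U => G (z.1, s, z.2) :=
  hG.comp (contDiff_fst.prodMk (contDiff_const.prodMk contDiff_snd))

lemma OscDom.locDom {G : V × S × U → ℂ} {ϑ : S → V} {μ : Measure S} {u₀ : U}
    (h : OscDom κ G ϑ μ u₀) (s : S) : LocDom κ (fun z : V × U => G (z.1, s, z.2)) u₀ := by
  obtain ⟨g, τ, R, hR, hg, -, hb⟩ := h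
  refine ⟨fun P => g P * τ s, R, hR.le, hg.mul_const _, ?_⟩
  filter_upwards [hb] with u hu P using hu P s

/-- The oscillatory integral with parameters. -/
def oscInt (G : V × S × U → ℂ) (ϑ : S → V) (μ : Measure S) (u : U) : ℂ :=
  ∫ s, osc (fun P => G (P, s, u)) (ϑ s) ∂μ

lemma aestronglyMeasurable_iteratedFDeriv_osc {G : V × S × U → ℂ} (hG : C∞ G)
    {ϑ : S → V} (hϑ : Continuous ϑ) {μ : Measure S} [SFinite μ] (h : ∀ u₀, OscDom κ G ϑ μ u₀) (k : ℕ) (u : U) :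
    AEStronglyMeasurable (fun s => 𝒟 k (fun u => osc (fun P => G (P, s, u)) (ϑ s)) u) μ := by
  have e : ∀ s, 𝒟 k (fun u => osc (fun P => G (P, s, u)) (ϑ s)) u =
      ∫ P, ec P (ϑ s) • 𝒟 k (fun v => G (P, s, v)) u := fun s =>
    (contDiff_osc (contDiff_slice hG s) (fun u₀ => (h u₀).locDom s) (ϑ s)).2 k u
  simp only [e]
  have hG' := hG.comp (contDiff_fst.snd.prodMk (contDiff_fst.fst.prodMk contDiff_snd))
  have hc : Continuous fun z : S × V => ec z.2 (ϑ z.1) • 𝒟 k (fun v => G (z.2, z.1, v)) u := by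
    have h1 := continuous_ec.comp (continuous_snd.prodMk (hϑ.comp continuous_fst))
    have h2 : Continuous fun z : S × V => 𝒟 k (fun v => G (z.2, z.1, v)) u :=
      (continuous_iteratedFDeriv_section hG' k).comp (continuous_id.prodMk continuous_const)
    exact h1.smul h2
  exact (hc.stronglyMeasurable.integral_prod_right (ν := (volume : Measure V))).aestronglyMeasurable

lemma OscDom.norm_iteratedFDeriv_osc_le (hκ : 1 ≤ κ) {G : V × S × U → ℂ} (hG : C∞ G)
    {ϑ : S → V} {μ : Measure S} (h : ∀ u₀, OscDom κ G ϑ μ u₀) (u₀ : U) (k : ℕ) :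
    ∃ B : S → ℝ, Integrable B μ ∧
      ∀ᶠ u in 𝓝 u₀, ∀ s, ‖𝒟 k (fun u => osc (fun P => G (P, s, u)) (ϑ s)) u‖ ≤ B s := by
  obtain ⟨g, τ, R, hR, hg, hτ, hb⟩ := h u₀
  refine ⟨fun s => (2 ^ κ * ((∫ P, g P) * (2 ^ κ * R) ^ k * (k ! : ℝ) ^ κ)) *
    (τ s * exp (-(1 / 2) * (‖ϑ s‖ / (2 ^ κ * R)) ^ (1 / κ))), hτ.const_mul _, ?_⟩
  filter_upwards [hb] with u hu s
  refine (GevreyConj.norm_iteratedFDeriv_osc_le hκ hR one_pos (contDiff_slice hG s)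
    (fun u₀ => (h u₀).locDom s) (u₀ := u) (g := fun P => g P * τ s) (hg.mul_const _) (fun P => ?_)
    (ϑ s) k).trans (le_of_eq ?_)
  · simpa using (hu P s).translate
  · rw [integral_mul_const, one_mul]; ring

/-- Smoothness of oscillatory integrals with parameters. -/
lemma contDiff_oscInt (hκ : 1 ≤ κ) {G : V × S × U → ℂ} (hG : C∞ G)
    {ϑ : S → V} (hϑ : Continuous ϑ) {μ : Measure S} [SFinite μ] (h : ∀ u₀, OscDom κ G ϑ μ u₀) :
    C∞ (oscInt G ϑ μ) ∧ ∀ k u, 𝒟 k (oscInt G ϑ μ) u =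
      ∫ s, 𝒟 k (fun u => osc (fun P => G (P, s, u)) (ϑ s)) u ∂μ :=
  contDiff_integral_and_iteratedFDeriv (μ := μ) (f := fun u s => osc (fun P => G (P, s, u)) (ϑ s))
    (fun s => (contDiff_osc (contDiff_slice hG s) (fun u₀ => (h u₀).locDom s) (ϑ s)).1)
    (fun k u => aestronglyMeasurable_iteratedFDeriv_osc hG hϑ h k u)
    (fun k u₀ => OscDom.norm_iteratedFDeriv_osc_le hκ hG h u₀ k)

lemma OscDom.integrable (hκ : 1 ≤ κ) {G : V × S × U → ℂ} (hG : C∞ G)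
    {ϑ : S → V} (hϑ : Continuous ϑ) {μ : Measure S} [SFinite μ] (h : ∀ u₀, OscDom κ G ϑ μ u₀) (u : U) :
    Integrable (fun s => osc (fun P => G (P, s, u)) (ϑ s)) μ := by
  obtain ⟨B, hB, hb⟩ := OscDom.norm_iteratedFDeriv_osc_le hκ hG h u 0
  refine hB.mono' ?_ (.of_forall fun s => ?_)
  · have h2 := aestronglyMeasurable_iteratedFDeriv_osc hG hϑ h 0 u
    exact ((continuousMultilinearCurryFin0 ℝ U ℂ).continuous.comp_aestronglyMeasurable h2)
  · have := hb.self_of_nhds s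
    rwa [norm_iteratedFDeriv_zero] at this

/-- Gevrey bounds for oscillatory integrals with parameters, at the scales `l` (inner variable)
and `T` (parameters). -/
lemma GB_oscInt {U' : Type} [NormedAddCommGroup U'] [NormedSpace ℝ U'] (hκ : 1 ≤ κ)
    (hR : 0 < R) (hl : 0 < l) {G : V × S × U → ℂ} (hG : C∞ G)
    {ϑ : S → V} (hϑ : Continuous ϑ) {μ : Measure S} [SFinite μ] (h : ∀ u₀, OscDom κ G ϑ μ u₀)
    {u₀ : U} (T : U' →L[ℝ] U) {g : V → ℝ} {τ : S → ℝ} (hg : Integrable g)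
    (hτ : Integrable (fun s => τ s * exp (-(1 / 2) * (l * ‖ϑ s‖ / (2 ^ κ * R)) ^ (1 / κ))) μ)
    (hb : ∀ᵐ s ∂μ, ∀ P, GB κ (fun z : V × U' => G (P + l • z.1, s, u₀ + T z.2)) 0 (g P * τ s) R) :
    GB κ (fun u => oscInt G ϑ μ (u₀ + T u)) 0
      (2 ^ κ * (∫ P, g P) * ∫ s, τ s * exp (-(1 / 2) * (l * ‖ϑ s‖ / (2 ^ κ * R)) ^ (1 / κ)) ∂μ)
      (2 ^ κ * R) := by
  have hκ0 : 0 ≤ κ := lin!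
  have hGs := fun s => contDiff_slice hG s
  have hld := fun s u₀ => (h u₀).locDom s
  have hsm := contDiff_oscInt hκ hG hϑ h
  set T' : V × U' →L[ℝ] V × U := (fst ℝ V U').prod
    (T.comp (snd ℝ V U'))
  set G' : S → V × U' → ℂ := fun s z => G (z.1, s, u₀ + T z.2)
  have e0 : ∀ s, G' s = fun z => (fun z : V × U => G (z.1, s, z.2)) ((0, u₀) + T' z) := by
    intro s; funext z; simp [G', T']
  have hG' : ∀ s, C∞ (G' s) := fun s => hG.comp (contDiff_fst.prodMk (contDiff_const.prodMk
    (contDiff_const.add (T.contDiff.comp contDiff_snd))))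
  have hld' : ∀ s u, LocDom κ (G' s) u := by
    intro s u
    obtain ⟨g, R, hR, hg, hb⟩ := hld s (u₀ + T u)
    refine ⟨g, ‖T'‖ * R, pos!, hg, ?_⟩
    have hc : Continuous fun u => u₀ + T u := continuous_const.add T.continuous
    filter_upwards [hc.continuousAt.eventually hb] with v hv P
    rw [e0]
    refine GB.comp_affine hR (hGs s) le_rfl ?_
    simpa [T'] using hv P
  have e1 : ∀ s u, osc (fun P => G' s (P, u)) (ϑ s) =
      (fun u => osc (fun P => G (P, s, u)) (ϑ s)) (u₀ + T u) := fun s u => rfl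
  intro k
  rw [iteratedFDeriv_comp_affine hsm.1, map_zero, add_zero, hsm.2]
  have hint : Integrable (fun s => 𝒟 k (fun u => osc (fun P => G (P, s, u)) (ϑ s)) u₀) μ := by
    obtain ⟨B, hB, hb⟩ := OscDom.norm_iteratedFDeriv_osc_le hκ hG h u₀ k
    exact hB.mono' (aestronglyMeasurable_iteratedFDeriv_osc hG hϑ h k u₀)
      (.of_forall hb.self_of_nhds)
  have e2 := (compContinuousLinearMapL (F := ℂ) (fun _ : Fin k => T)).integral_comp_comm hint
  have e3 : ∀ s, (compContinuousLinearMapL (F := ℂ) (fun _ : Fin k => T))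
      (𝒟 k (fun u => osc (fun P => G (P, s, u)) (ϑ s)) u₀) =
        𝒟 k (fun u => osc (fun P => G' s (P, u)) (ϑ s)) 0 := by
    intro s
    have := iteratedFDeriv_comp_affine (contDiff_osc (hGs s) (hld s) (ϑ s)).1 u₀ T 0 k
    rw [map_zero, add_zero] at this
    exact this.symm
  simp only [e3] at e2
  rw [ContinuousMultilinearMap.compContinuousLinearMapL_apply] at e2
  rw [← e2]
  calc _ ≤ ∫ s, (2 ^ κ * ((∫ P, g P) * (2 ^ κ * R) ^ k * (k ! : ℝ) ^ κ)) *
        (τ s * exp (-(1 / 2) * (l * ‖ϑ s‖ / (2 ^ κ * R)) ^ (1 / κ))) ∂μ := by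
        refine norm_integral_le_of_norm_le (hτ.const_mul _) (hb.mono fun s hs => ?_)
        refine (GevreyConj.norm_iteratedFDeriv_osc_le hκ hR hl (hG' s) (hld' s) (u₀ := 0)
          (g := fun P => g P * τ s) (hg.mul_const _) (fun P => ?_) (ϑ s) k).trans (le_of_eq ?_)
        · simpa [G'] using hs P
        · rw [integral_mul_const]; ring
    _ = _ := by rw [integral_const_mul]; ring

end OuterIntegral

section ExponentialWeights

lemma pow_le_exp_rpow (hκ : 0 < κ) (hc : 0 < c) (N : ℕ) :
    ∃ C : ℝ, 0 < C ∧ ∀ t : ℝ, 0 ≤ t → (1 + t) ^ N ≤ C * exp (c * t ^ (1 / κ)) := by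
  set K := N * ⌈κ⌉₊
  refine ⟨(2 : ℝ) ^ N * ((K ! : ℝ) * (c⁻¹) ^ K * exp c), pos!, fun t ht => ?_⟩
  set x := t ^ (1 / κ)
  have hx : 0 ≤ x := pos!
  have htx : t = x ^ κ := by
    simp only [x]; rw [← rpow_mul ht, one_div_mul_cancel hκ.ne', rpow_one]
  have h1 : 1 + t ≤ 2 * (1 + x) ^ ⌈κ⌉₊ := by
    have h2 : (1 : ℝ) ≤ (1 + x) ^ ⌈κ⌉₊ := one_le_pow₀ lin!
    have h3 : t ≤ (1 + x) ^ ⌈κ⌉₊ := by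
      rw [htx, ← rpow_natCast]
      calc x ^ κ ≤ (1 + x) ^ κ := by gcongr; linarith
        _ ≤ _ := rpow_le_rpow_of_exponent_le lin! (Nat.le_ceil κ)
    linarith
  have h4 : (1 + x) ^ K ≤ (K ! : ℝ) * (c⁻¹) ^ K * (exp c * exp (c * x)) := by
    have h5 := Real.pow_div_factorial_le_exp (c * (1 + x)) pos! K
    rw [div_le_iff₀ (fact_pos K), mul_add, mul_one, exp_add, ← mul_one_add, mul_pow] at h5
    calc (1 + x) ^ K = (c⁻¹) ^ K * (c ^ K * (1 + x) ^ K) := by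
          rw [← mul_assoc, ← mul_pow, inv_mul_cancel₀ hc.ne']; simp
      _ ≤ (c⁻¹) ^ K * (exp c * exp (c * x) * (K ! : ℝ)) := mono!
      _ = _ := by ring
  calc (1 + t) ^ N ≤ (2 * (1 + x) ^ ⌈κ⌉₊) ^ N := mono!
    _ = 2 ^ N * (1 + x) ^ K := by rw [mul_pow, ← pow_mul, mul_comm ⌈κ⌉₊ N]
    _ ≤ 2 ^ N * ((K ! : ℝ) * (c⁻¹) ^ K * (exp c * exp (c * x))) := mono!
    _ = _ := by ring

variable {V : Type} [NormedAddCommGroup V] [InnerProductSpace ℝ V]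
  [MeasurableSpace V] [BorelSpace V] [FiniteDimensional ℝ V]

lemma integrable_inv_one_add_norm_pow : Integrable fun P : V => ((1 + ‖P‖) ^ (finrank ℝ V + 1))⁻¹ := by
  have h := integrable_one_add_norm (μ := (volume : Measure V)) (E := V)
    (r := (finrank ℝ V + 1 : ℕ)) (by push_cast; linarith)
  refine h.congr (.of_forall fun P => ?_)
  simp only
  rw [rpow_neg pos!, rpow_natCast]

lemma integrable_pow_mul_exp (hκ : 0 < κ) (hc : 0 < c) (N : ℕ) :
    Integrable fun P : V => (1 + ‖P‖) ^ N * exp (-c * ‖P‖ ^ (1 / κ)) := by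
  obtain ⟨C, hC, h⟩ := pow_le_exp_rpow hκ hc (N + (finrank ℝ V + 1))
  refine (integrable_inv_one_add_norm_pow.const_mul C).mono' ?_ (.of_forall fun P => ?_)
  · have : Continuous fun P : V => ‖P‖ ^ (1 / κ) :=
      continuous_norm.rpow_const fun P => Or.inr pos!
    exact Continuous.aestronglyMeasurable fun!
  · rw [norm_of_nonneg pos!]
    have h1 := h ‖P‖ (norm_nonneg P)
    rw [← div_eq_mul_inv, le_div_iff₀ pos!, neg_mul, exp_neg]
    rw [pow_add] at h1
    calc _ = ((1 + ‖P‖) ^ N * (1 + ‖P‖) ^ (finrank ℝ V + 1)) * (exp (c * ‖P‖ ^ (1 / κ)))⁻¹ := by ring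
      _ ≤ (C * exp (c * ‖P‖ ^ (1 / κ))) * (exp (c * ‖P‖ ^ (1 / κ)))⁻¹ := mono!
      _ = C := by field_simp

lemma integrable_exp_neg_rpow (hκ : 0 < κ) (hc : 0 < c) :
    Integrable fun P : V => exp (-c * ‖P‖ ^ (1 / κ)) := by
  simpa using integrable_pow_mul_exp (V := V) hκ hc 0

end ExponentialWeights

section Regularisation

variable {V : Type} [NormedAddCommGroup V] [InnerProductSpace ℝ V]
  {W : Type} [NormedAddCommGroup W] [NormedSpace ℝ W]

/-- The factor `(1 - i s ⟨P, e⟩)⁻¹`. -/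
def stW (s : ℝ) (e P : V) : ℂ := (1 - I * (s * inner ℝ P e : ℝ))⁻¹

lemma one_le_norm_stW_inv (s : ℝ) (e P : V) : 1 ≤ ‖(1 - I * (s * inner ℝ P e : ℝ) : ℂ)‖ := by
  have := Complex.abs_re_le_norm (1 - I * (s * inner ℝ P e : ℝ) : ℂ)
  simpa using this

lemma stW_ne (s : ℝ) (e P : V) : (1 - I * (s * inner ℝ P e : ℝ) : ℂ) ≠ 0 := by
  have := one_le_norm_stW_inv s e P
  intro h; rw [h] at this; simp at this; linarith

lemma norm_stW_le_one (s : ℝ) (e P : V) : ‖stW s e P‖ ≤ 1 := by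
  unfold stW
  rw [norm_inv]
  exact inv_le_one_of_one_le₀ (one_le_norm_stW_inv s e P)

lemma contDiff_stW_inv (s : ℝ) (e : V) :
    C∞ fun P : V => (1 - I * (s * inner ℝ P e : ℝ) : ℂ) := by
  have h : C∞ fun P : V => ((s * inner ℝ P e : ℝ) : ℂ) :=
    ofRealCLM.contDiff.comp (contDiff_const.mul (contDiff_id.inner ℝ contDiff_const))
  exact contDiff_const.sub (contDiff_const.mul h)

lemma contDiff_stW (s : ℝ) (e : V) : C∞ (stW s e) :=
  (contDiff_stW_inv s e).inv fun P => stW_ne s e P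

lemma norm_iteratedFDeriv_linear_le {U F : Type} [NormedAddCommGroup U] [NormedSpace ℝ U]
    [NormedAddCommGroup F] [NormedSpace ℝ F] (c : F) (L : U →L[ℝ] F) (p : U) {k : ℕ} (hk : 1 ≤ k) :
    ‖𝒟 k (fun u => c + L u) p‖ ≤ if k = 1 then ‖L‖ else 0 := by
  obtain ⟨k, rfl⟩ := Nat.exists_eq_add_of_le' hk
  have hf : fderiv ℝ (fun u => c + L u) = fun _ => L := by
    funext u; simp [fderiv_const_add]
  rw [← norm_iteratedFDeriv_fderiv, hf]
  rcases Nat.eq_zero_or_pos k with rfl | hk0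
  · simp
  · rw [iteratedFDeriv_const_of_ne (by omega)]
    simp [show k ≠ 0 by omega]

lemma GB_stW (hκ : 1 ≤ κ) (hs : 0 < s) {e : V} (he : ‖e‖ ≤ 1) (P : V) :
    GB κ (stW s e) P (2 * ‖stW s e P‖) (s * 4) := by
  have h := GB.inv (κ := κ) (M := 1) (R := s) (L := 4) hκ hs zero_le_one num! num!
    (contDiff_stW_inv s e) (contDiff_stW s e) (p := P)
    (.of_forall fun P => mul_inv_cancel₀ (stW_ne s e P)) (fun k hk => ?_)
  · have e2 : ‖(1 - I * (s * inner ℝ P e : ℝ) : ℂ)‖⁻¹ = ‖stW s e P‖ := by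
      unfold stW; rw [norm_inv]
    rwa [e2] at h
  · set L : V →L[ℝ] ℂ := (-I * s) • (ofRealCLM.comp ((innerSL ℝ).flip e))
    have hL : (fun P : V => (1 - I * (s * inner ℝ P e : ℝ) : ℂ)) = fun P => 1 + L P := by
      funext P
      simp only [L, FunLike.coe_smul, Pi.smul_apply, comp_apply,
        flip_apply, innerSL_apply_apply, ofRealCLM_apply, smul_eq_mul]
      push_cast; ring
    have hLn : ‖L‖ ≤ s := by
      refine opNorm_le_bound _ hs.le fun P => ?_
      simp only [L, FunLike.coe_smul, Pi.smul_apply, comp_apply,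
        flip_apply, innerSL_apply_apply, ofRealCLM_apply, smul_eq_mul]
      rw [norm_mul, norm_mul, norm_neg, norm_I, one_mul, norm_real, norm_real,
        norm_of_nonneg hs.le]
      gcongr
      exact (norm_inner_le_norm P e).trans (mul_le_of_le_one_right (norm_nonneg _) he)
    rw [hL]
    refine (norm_iteratedFDeriv_linear_le 1 L P hk).trans ?_
    split_ifs with hk1
    · subst hk1
      simp only [pow_one, Nat.factorial_one, cast_one, one_rpow, mul_one, one_mul]
      exact hLn.trans (le_mul_of_one_le_left hs.le (one_le_norm_stW_inv s e P))
    · positivity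

/-- One step of the regularisation of an oscillatory integral. -/
def St (s : ℝ) (e : V) (e' : W) (a : V × W → ℂ) : V × W → ℂ :=
  fun z => stW s e z.1 * (a z - s * dd ((0, e') : V × W) a z)

/-- Iterated regularisation along a list of directions. -/
def StL (s : ℝ) (l : List (V × W)) (a : V × W → ℂ) : V × W → ℂ :=
  l.foldr (fun e f => St s e.1 e.2 f) a

lemma contDiff_St {a : V × W → ℂ} (ha : C∞ a) (s : ℝ) (e : V) (e' : W) :
    C∞ (St s e e' a) :=
  ((contDiff_stW s e).comp contDiff_fst).mul (ha.sub (contDiff_const.mul (contDiff_dd ha _)))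

lemma contDiff_StL {a : V × W → ℂ} (ha : C∞ a) (s : ℝ) (l : List (V × W)) :
    C∞ (StL s l a) := by
  induction l with
  | nil => exact ha
  | cons e l ih => exact contDiff_St ih s e.1 e.2

lemma GB.comp_fst (hR : 0 ≤ R) {f : V → ℂ} (hf : C∞ f) {z : V × W} (h : GB κ f z.1 M R) :
    GB κ (fun z : V × W => f z.1) z M R := by
  have := GB.comp_affine (a := 0) (T := fst ℝ V W) hR hf
    (ContinuousLinearMap.norm_fst_le ℝ V W) (u := z) (M := M) (κ := κ) (by simpa using h)
  simpa using this

lemma GB.St (hκ : 1 ≤ κ) (hs : 0 < s) (hsR : s ≤ R) {a : V × W → ℂ} (ha : C∞ a)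
    {e : V} {e' : W} (he : ‖e‖ ≤ 1) (he' : ‖e'‖ ≤ 1) {z : V × W} (h : GB κ a z M R) :
    GB κ (St s e e' a) z (2 * (1 + s * R) * ‖stW s e z.1‖ * M) (8 * 2 ^ κ * R) := by
  have hM := h.nonneg
  have hR := hs.trans_le hsR
  have h2κ : (1 : ℝ) ≤ 2 ^ κ := one_le_rpow num! lin!
  have h1 : GB κ (fun z : V × W => stW s e z.1) z (2 * ‖stW s e z.1‖) (4 * 2 ^ κ * R) :=
    ((GB_stW hκ hs he z.1).comp_fst pos! (contDiff_stW s e)).mono pos! le_rfl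
      (by nlinarith)
  have hn : ‖((0, e') : V × W)‖ ≤ 1 := by rw [norm_mk, norm_zero]; exact max_le zero_le_one he'
  have h2 : GB κ (fun z => (s : ℂ) * GevreyConj.dd ((0, e') : V × W) a z) z (s * (M * R)) (4 * 2 ^ κ * R) := by
    have h3 := ((h.dd lin! hR.le ha ((0, e') : V × W)).const_smul (contDiff_dd ha _) (s : ℂ))
    refine h3.mono pos! ?_ (by nlinarith)
    rw [norm_real, norm_of_nonneg hs.le]
    have : ‖((0, e') : V × W)‖ * (M * R) ≤ M * R := mul_le_of_le_one_left pos! hn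
    gcongr
  have h3 := (h.mono hR.le le_rfl (show R ≤ 4 * 2 ^ κ * R by nlinarith)).sub ha
    (contDiff_const.mul (contDiff_dd ha _)) h2
  refine (h1.mul hκ pos! ((contDiff_stW s e).comp contDiff_fst)
    (ha.sub (contDiff_const.mul (contDiff_dd ha _))) h3).mono pos! (le_of_eq (by ring))
    (le_of_eq (by ring))

/-- The weight gained by iterated regularisation. -/
def stWL (s : ℝ) (l : List (V × W)) (P : V) : ℝ := (l.map fun e => ‖stW s e.1 P‖).prod

lemma stWL_nonneg (s : ℝ) (l : List (V × W)) (P : V) : 0 ≤ stWL s l P := by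
  induction l with
  | nil => simp [stWL]
  | cons e l ih => simp only [stWL, map_cons, prod_cons] at ih ⊢; positivity

lemma stWL_le_one (s : ℝ) (l : List (V × W)) (P : V) : stWL s l P ≤ 1 := by
  induction l with
  | nil => simp [stWL]
  | cons e l ih =>
    have := stWL_nonneg s l P
    simp only [stWL, map_cons, prod_cons] at ih this ⊢
    exact mul_le_one₀ (norm_stW_le_one s e.1 P) this ih

lemma GB.StL (hκ : 1 ≤ κ) (hs : 0 < s) (hsR : s ≤ R) {a : V × W → ℂ} (ha : C∞ a)
    {N : ℕ} (l : List (V × W)) (hl : ∀ e ∈ l, ‖e.1‖ ≤ 1 ∧ ‖e.2‖ ≤ 1) (hN : l.length ≤ N) {z : V × W}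
    (h : GB κ a z M R) :
    GB κ (StL s l a) z ((2 * (1 + s * ((8 * 2 ^ κ) ^ N * R))) ^ l.length * stWL s l z.1 * M)
      ((8 * 2 ^ κ) ^ l.length * R) := by
  have hM := h.nonneg
  have hR := hs.trans_le hsR
  have h2κ : (1 : ℝ) ≤ 2 ^ κ := one_le_rpow num! lin!
  have h8 : (1 : ℝ) ≤ 8 * 2 ^ κ := lin!
  induction l with
  | nil => simpa [GevreyConj.StL, stWL] using h
  | cons e l ih =>
    have ih := ih (fun e he => hl e (List.mem_cons_of_mem _ he)) (by simp at hN; omega)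
    obtain ⟨he1, he2⟩ := hl e List.mem_cons_self
    have hl1 : (1 : ℝ) ≤ (8 * 2 ^ κ) ^ l.length := one_le_pow₀ h8
    have hlN : ((8 : ℝ) * 2 ^ κ) ^ l.length ≤ (8 * 2 ^ κ) ^ N :=
      pow_le_pow_right₀ h8 (by simp at hN; omega)
    have h1 := ih.St hκ hs (by nlinarith) (contDiff_StL ha s l) he1 he2
    have hw := stWL_nonneg s l z.1
    refine h1.mono pos! ?_ (le_of_eq (by rw [List.length_cons, pow_succ]; ring))
    simp only [stWL, map_cons, prod_cons, List.length_cons, pow_succ] at hw ⊢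
    calc _ ≤ 2 * (1 + s * ((8 * 2 ^ κ) ^ N * R)) * ‖stW s e.1 z.1‖ *
          ((2 * (1 + s * ((8 * 2 ^ κ) ^ N * R))) ^ l.length * (l.map fun e => ‖stW s e.1 z.1‖).prod * M) := by
          gcongr
      _ = _ := by ring

lemma St_comp_affine {W' : Type} [NormedAddCommGroup W'] [NormedSpace ℝ W'] {a : V × W → ℂ}
    (ha : C∞ a) (s : ℝ) (e : V) (w : W) (T : W' →L[ℝ] W) (e' : W') :
    St s e e' (fun z => a (z.1, w + T z.2)) = fun z => St s e (T e') a (z.1, w + T z.2) := by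
  funext z
  have := dd_comp_affine ha ((0, w) : V × W)
    ((fst ℝ V W').prod (T.comp (snd ℝ V W'))) ((0, e') : V × W')
  simp at this
  simp only [St, this]

lemma StL_comp_affine {W' : Type} [NormedAddCommGroup W'] [NormedSpace ℝ W'] {a : V × W → ℂ}
    (ha : C∞ a) (s : ℝ) (w : W) (T : W' →L[ℝ] W) (l : List (V × W')) :
    StL s l (fun z => a (z.1, w + T z.2)) =
      fun z => StL s (l.map fun e => (e.1, T e.2)) a (z.1, w + T z.2) := by
  induction l with
  | nil => rfl
  | cons e l ih =>
    simp only [StL, map_cons, foldr_cons] at ih ⊢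
    rw [ih]
    exact St_comp_affine (contDiff_StL ha s (l.map fun e => (e.1, T e.2))) s e.1 w T e.2

lemma St_mul_left {a : V × W → ℂ} (ha : C∞ a) {f : V → ℂ} (hf : C∞ f) (s : ℝ) (e : V) (e' : W) :
    St s e e' (fun z => f z.1 * a z) = fun z => f z.1 * St s e e' a z := by
  funext z
  have h0 : dd ((0, e') : V × W) (fun z => f z.1) = fun _ => 0 := by
    have := dd_comp_affine hf (0 : V) (fst ℝ V W) ((0, e') : V × W)
    simp at this
    rw [this]; funext z; simp [dd]
  have h1 := dd_mul (f := fun z : V × W => f z.1) (hf.comp contDiff_fst) ha ((0, e') : V × W)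
  rw [h0] at h1
  simp only [St, h1]
  ring

lemma StL_mul_left {a : V × W → ℂ} (ha : C∞ a) {f : V → ℂ} (hf : C∞ f) (s : ℝ)
    (l : List (V × W)) : StL s l (fun z => f z.1 * a z) = fun z => f z.1 * StL s l a z := by
  induction l with
  | nil => rfl
  | cons e l ih =>
    simp only [StL, foldr_cons] at ih ⊢
    rw [ih]
    exact St_mul_left (contDiff_StL ha s l) hf s e.1 e.2

end Regularisation

section RegularisedIntegrals

variable {V : Type} [NormedAddCommGroup V] [InnerProductSpace ℝ V]
  [MeasurableSpace V] [BorelSpace V] [FiniteDimensional ℝ V]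

lemma norm_osc_le (hκ : 1 ≤ κ) (hR : 0 < R) {f : V → ℂ} (hf : C∞ f) {g : V → ℝ}
    (hg : Integrable g) (h : ∀ P, GB κ f P (g P) R) (Q : V) :
    ‖osc f Q‖ ≤ 2 ^ κ * (∫ P, g P) * exp (-(1 / 2) * (‖Q‖ / (2 ^ κ * R)) ^ (1 / κ)) := by
  have hG : C∞ fun z : V × ℝ => f z.1 := hf.comp contDiff_fst
  have hb : ∀ (P : V) (u : ℝ), GB κ (fun z : V × ℝ => f z.1) (P, u) (g P) R := fun P u =>
    (h P).comp_fst (z := (P, u)) hR.le hf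
  have hl : ∀ u : ℝ, LocDom κ (fun z : V × ℝ => f z.1) u := fun u =>
    ⟨g, R, hR.le, hg, .of_forall fun u P => hb P u⟩
  have h1 : ∀ P : V, GB κ (fun z : V × ℝ => (fun z : V × ℝ => f z.1) ((P, 0) + ((1 : ℝ) • z.1, z.2))) 0 (g P) R := by
    intro P
    have h2 := (hb P 0).translate
    simp only [one_smul]
    exact h2
  have h3 := norm_iteratedFDeriv_osc_le hκ hR one_pos hG hl (u₀ := (0 : ℝ)) hg h1 Q 0
  rw [norm_iteratedFDeriv_zero, pow_zero, Nat.factorial_zero, cast_one, one_rpow, mul_one,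
    mul_one, one_mul] at h3
  exact h3

lemma GB.slice (hR : 0 ≤ R) {W : Type} [NormedAddCommGroup W] [NormedSpace ℝ W]
    {a : V × W → ℂ} (ha : C∞ a) {P : V} {Q : W}
    (h : GB κ a (P, Q) M R) : GB κ (fun P => a (P, Q)) P M R := by
  have := GB.comp_affine (a := ((0, Q) : V × W)) (T := inl ℝ V W) hR ha
    (ContinuousLinearMap.norm_inl_le_one ℝ V W) (u := P) (M := M) (κ := κ) (by simpa using h)
  simpa using this

/-- The decay weight of a Fourier integral of a Gevrey function with constant `R`. -/
def dec (κ R : ℝ) (Q : V) : ℝ := exp (-(1 / 2) * (‖Q‖ / (2 ^ κ * R)) ^ (1 / κ))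

lemma continuous_dec (hκ : 0 < κ) (R : ℝ) : Continuous (dec κ R : V → ℝ) := by
  unfold dec
  have : Continuous fun Q : V => (‖Q‖ / (2 ^ κ * R)) ^ (1 / κ) :=
    (continuous_norm.div_const _).rpow_const fun P => Or.inr pos!
  fun_prop

lemma dec_pos (κ R : ℝ) (Q : V) : 0 < dec κ R Q := exp_pos _

lemma dec_mono (hκ : 0 < κ) (hR : 0 < R) (h : R ≤ R') (Q : V) : dec κ R Q ≤ dec κ R' Q := by
  unfold dec
  have h2 : (0 : ℝ) < 2 ^ κ := pos!
  have : (‖Q‖ / (2 ^ κ * R')) ^ (1 / κ) ≤ (‖Q‖ / (2 ^ κ * R)) ^ (1 / κ) := by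
    have : 0 < R' := hR.trans_le h
    gcongr
  apply exp_le_exp.mpr
  linarith

lemma integrable_osc (hκ : 1 ≤ κ) (hR : 0 < R) {a : V × V → ℂ} (ha : C∞ a)
    {g τ : V → ℝ} (hg : Integrable g) (hτ : Integrable fun Q => τ Q * dec κ R Q)
    (h : ∀ P Q, GB κ a (P, Q) (g P * τ Q) R) :
    Integrable fun Q => osc (fun P => a (P, Q)) Q := by
  refine (hτ.const_mul (2 ^ κ * ∫ P, g P)).mono' ?_ (.of_forall fun Q => ?_)
  · have hc : Continuous fun z : V × V => ec z.2 z.1 * a (z.2, z.1) :=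
      (continuous_ec.comp continuous_swap).mul (ha.continuous.comp continuous_swap)
    exact (hc.stronglyMeasurable.integral_prod_right (ν := (volume : Measure V))).aestronglyMeasurable
  · refine (norm_osc_le hκ hR (ha.comp (contDiff_id.prodMk contDiff_const)) (hg.mul_const (τ Q))
      (fun P => (h P Q).slice hR.le ha) Q).trans (le_of_eq ?_)
    rw [integral_mul_const]; unfold dec; ring

lemma norm_integral_osc_le (hκ : 1 ≤ κ) (hR : 0 < R) {a : V × V → ℂ} (ha : C∞ a)
    {g τ : V → ℝ} (hg : Integrable g) (hτ : Integrable fun Q => τ Q * dec κ R Q)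
    (h : ∀ P Q, GB κ a (P, Q) (g P * τ Q) R) :
    ‖∫ Q, osc (fun P => a (P, Q)) Q‖ ≤ 2 ^ κ * (∫ P, g P) * ∫ Q, τ Q * dec κ R Q := by
  rw [← integral_const_mul]
  refine norm_integral_le_of_norm_le (hτ.const_mul _) (.of_forall fun Q => ?_)
  refine (norm_osc_le hκ hR (ha.comp (contDiff_id.prodMk contDiff_const)) (hg.mul_const (τ Q))
      (fun P => (h P Q).slice hR.le ha) Q).trans (le_of_eq ?_)
  rw [integral_mul_const]; unfold dec; ring

lemma hasDerivAt_comp_line {a : V × V → ℂ} (ha : C∞ a) (e P Q : V) (t : ℝ) :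
    HasDerivAt (fun t : ℝ => ec P (Q + t • e) * a (P, Q + t • e))
      (ec P (Q + t • e) * (-(I * (inner ℝ P e : ℝ)) * a (P, Q + t • e) +
        dd ((0, e) : V × V) a (P, Q + t • e))) t := by
  have hl : HasDerivAt (fun t : ℝ => Q + t • e) e t := by
    simpa using ((hasDerivAt_id t).smul_const e).const_add Q
  have h1 : HasDerivAt (fun t : ℝ => ec P (Q + t • e))
      (-I * (inner ℝ e P : ℝ) * ec P (Q + t • e)) t := by
    have h0 := ((contDiff_ec P).differentiable (by simp) (Q + t • e)).hasFDerivAt.comp_hasDerivAt t hl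
    have h2 := congrFun (dd_ec e P) (Q + t • e)
    unfold dd at h2
    rw [h2] at h0
    simpa only [ec_comm, comp_def] using h0
  have h2 : HasDerivAt (fun t : ℝ => a (P, Q + t • e)) (dd ((0, e) : V × V) a (P, Q + t • e)) t :=
    (ha.differentiable (by simp) (P, Q + t • e)).hasFDerivAt.comp_hasDerivAt t
      ((hasDerivAt_const t P).prodMk hl)
  refine (h1.mul h2).congr_deriv ?_
  rw [real_inner_comm]; ring

lemma integral_osc_St (hκ : 1 ≤ κ) (hs : 0 < s) (hsR : s ≤ R) {a : V × V → ℂ}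
    (ha : C∞ a) {g τ : V → ℝ} (hg : Integrable g) (hτc : Continuous τ)
    (hτ : Integrable fun Q => τ Q * dec κ (8 * 2 ^ κ * R) Q) {e : V} (he : ‖e‖ ≤ 1)
    (h : ∀ P Q, GB κ a (P, Q) (g P * τ Q) R) :
    ∫ Q, osc (fun P => a (P, Q)) Q = ∫ Q, osc (fun P => St s e e a (P, Q)) Q := by
  have hR : 0 < R := hs.trans_le hsR
  have h2κ : (1 : ℝ) ≤ 2 ^ κ := one_le_rpow num! lin!
  have hR8 : R ≤ 8 * 2 ^ κ * R := by nlinarith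
  have hR8' : 0 < 8 * 2 ^ κ * R := pos!
  have hst := contDiff_St ha s e e
  set b : V × V → ℂ := fun z => stW s e z.1 * a z
  have hbs : C∞ b := ((contDiff_stW s e).comp contDiff_fst).mul ha
  have hgτ : ∀ P Q, 0 ≤ g P * τ Q := fun P Q => (h P Q).nonneg
  set K := 2 * (1 + s * R)
  have h1 : ∀ P Q, GB κ a (P, Q) (g P * τ Q) (8 * 2 ^ κ * R) := fun P Q => (h P Q).mono hR.le le_rfl hR8
  have h2 : ∀ P Q, GB κ (St s e e a) (P, Q) (K * g P * τ Q) (8 * 2 ^ κ * R) := by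
    intro P Q
    refine ((h P Q).St hκ hs hsR ha he he).mono pos! ?_ le_rfl
    have := norm_stW_le_one s e P
    calc _ ≤ K * 1 * (g P * τ Q) := by gcongr; exact hgτ P Q
      _ = _ := by ring
  have h3 : ∀ P Q, GB κ b (P, Q) (2 * g P * τ Q) (8 * 2 ^ κ * R) := by
    intro P Q
    have h4 : GB κ (fun z : V × V => stW s e z.1) (P, Q) (2 * ‖stW s e P‖) (4 * R) :=
      ((GB_stW hκ hs he P).comp_fst (z := (P, Q)) pos! (contDiff_stW s e)).mono
        pos! le_rfl lin!
    refine (h4.mul hκ pos! ((contDiff_stW s e).comp contDiff_fst) ha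
      ((h P Q).mono hR.le le_rfl lin!)).mono pos! ?_ (by nlinarith)
    have := norm_stW_le_one s e P
    calc _ ≤ 2 * 1 * (g P * τ Q) := by gcongr; exact hgτ P Q
      _ = _ := by ring
  have i1 := integrable_osc hκ hR8' ha hg hτ h1
  have i2 := integrable_osc hκ hR8' hst (hg.const_mul K) hτ h2
  have i3 := integrable_osc hκ hR8' hbs (hg.const_mul 2) hτ h3
  have hder : ∀ P Q, (s : ℂ) * (-(I * (inner ℝ P e : ℝ)) * b (P, Q) + dd ((0, e) : V × V) b (P, Q)) =
      a (P, Q) - St s e e a (P, Q) := by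
    intro P Q
    have e1 : dd ((0, e) : V × V) b (P, Q) = stW s e P * dd ((0, e) : V × V) a (P, Q) := by
      have h0 : dd ((0, e) : V × V) (fun z : V × V => stW s e z.1) = fun _ => 0 := by
        have := dd_comp_affine (contDiff_stW s e) (0 : V) (fst ℝ V V) ((0, e) : V × V)
        simp at this
        rw [this]; funext z; simp [dd]
      have h1 := dd_mul (f := fun z : V × V => stW s e z.1) ((contDiff_stW s e).comp contDiff_fst) ha
        ((0, e) : V × V)
      rw [h0] at h1
      simp only [b, h1]; ring
    have e2 : stW s e P * (1 - I * (s * inner ℝ P e : ℝ)) = 1 := inv_mul_cancel₀ (stW_ne s e P)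
    rw [e1]
    simp only [St, b]
    push_cast at e2 ⊢
    linear_combination (-(a (P, Q))) * e2 + 2 * a (P, Q) * e2 - 2 * a (P, Q) * e2 + 2 * a (P, Q) * e2
  have hld : ∀ Q, HasLineDerivAt ℝ (fun Q => s * osc (fun P => b (P, Q)) Q)
      (osc (fun P => a (P, Q)) Q - osc (fun P => St s e e a (P, Q)) Q) Q e := by
    intro Q
    obtain ⟨T, hT⟩ := (isCompact_Icc (a := (-1 : ℝ)) (b := 1)).bddAbove_image
      (f := fun t : ℝ => |τ (Q + t • e)|) fun!
    have hT' : ∀ t ∈ Icc (-1 : ℝ) 1, |τ (Q + t • e)| ≤ T := fun t ht => hT ⟨t, ht, rfl⟩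
    have hcb : ∀ Q, Continuous fun P => ec P Q * b (P, Q) := fun Q =>
      (contDiff_ec Q).continuous.mul (hbs.continuous.comp fun!)
    have key := hasDerivAt_integral_of_dominated_loc_of_deriv_le (μ := (volume : Measure V)) (𝕜 := ℝ)
      (F := fun t P => s * (ec P (Q + t • e) * b (P, Q + t • e)))
      (F' := fun t P => ec P (Q + t • e) * (a (P, Q + t • e) - St s e e a (P, Q + t • e)))
      (x₀ := 0) (s := Icc (-1) 1) (bound := fun P => (1 + K) * (|g P| * T))
      (Icc_mem_nhds num! num!)
      (.of_forall fun t => (continuous_const.mul (hcb _)).aestronglyMeasurable)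
      (by
        refine Integrable.const_mul ?_ _
        refine integrable_ec_mul ?_ _
        refine ((hg.const_mul 2).mul_const (τ (Q + (0 : ℝ) • e))).mono'
          (hbs.continuous.comp fun!).aestronglyMeasurable (.of_forall fun P => ?_)
        exact (h3 P _).norm_le)
      (((contDiff_ec _).continuous.mul ((ha.continuous.comp fun!).sub
        (hst.continuous.comp fun!))).aestronglyMeasurable)
      (.of_forall fun P t ht => by
        rw [norm_mul, norm_ec, one_mul]
        have n1 := (h1 P (Q + t • e)).norm_le
        have n2 := (h2 P (Q + t • e)).norm_le
        have n3 : g P * τ (Q + t • e) ≤ |g P| * T := by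
          refine (le_abs_self _).trans ?_
          rw [abs_mul]
          have := hT' t ht
          gcongr
        calc _ ≤ g P * τ (Q + t • e) + K * g P * τ (Q + t • e) := (norm_sub_le _ _).trans (add_le_add n1 n2)
          _ = (1 + K) * (g P * τ (Q + t • e)) := by ring
          _ ≤ _ := mono!)
      ((hg.abs.mul_const T).const_mul _)
      (.of_forall fun P t ht => by
        refine ((hasDerivAt_comp_line hbs e P Q t).const_mul (s : ℂ)).congr_deriv ?_
        rw [← hder]; ring)
    have k2 := key.2
    simp only [zero_smul, add_zero] at k2
    unfold HasLineDerivAt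
    simp only [osc]
    simp only [integral_const_mul] at k2
    refine k2.congr_deriv ?_
    rw [← integral_sub]
    · congr 1; funext P; ring
    · exact integrable_ec_mul ((hg.mul_const (τ Q)).mono' (ha.continuous.comp fun!).aestronglyMeasurable
        (.of_forall fun P => (h1 P Q).norm_le)) Q
    · exact integrable_ec_mul (((hg.const_mul K).mul_const (τ Q)).mono'
        (hst.continuous.comp fun!).aestronglyMeasurable
        (.of_forall fun P => (h2 P Q).norm_le)) Q
  have hfin := integral_bilinear_hasLineDerivAt_right_eq_neg_left_of_integrable (μ := (volume : Measure V))
    (f := fun _ => (1 : ℂ)) (f' := fun _ => 0) (g := fun Q => s * osc (fun P => b (P, Q)) Q)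
    (g' := fun Q => osc (fun P => a (P, Q)) Q - osc (fun P => St s e e a (P, Q)) Q) (v := e)
    (B := ContinuousLinearMap.mul ℝ ℂ) (by simp) (by simpa using Integrable.sub' i1 i2)
    (by simpa using i3.const_mul (s : ℂ))
    (fun Q _ => by
      have := (hasFDerivAt_const (𝕜 := ℝ) (1 : ℂ) Q).hasLineDerivAt e
      simpa using this) (fun Q _ => hld Q)
  simp at hfin
  rw [integral_sub i1 i2] at hfin
  exact sub_eq_zero.mp hfin

end RegularisedIntegrals

section CutoffLimits

variable {V : Type} [NormedAddCommGroup V] [InnerProductSpace ℝ V]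
  [MeasurableSpace V] [BorelSpace V] [FiniteDimensional ℝ V]

/-- A Gevrey cut-off function, supported in a ball and equal to one at the origin. -/
structure IsCutoff (κ C R : ℝ) (ψ : V → ℂ) : Prop where
  smooth : C∞ ψ
  bound : ∀ P, GB κ ψ P C R
  support : ∃ c : ℝ, ∀ P, c < ‖P‖ → ψ P = 0
  at_zero : ψ 0 = 1

lemma GB_zero_of_eventuallyEq {U F : Type} [NormedAddCommGroup U] [NormedSpace ℝ U] [NormedAddCommGroup F]
    [NormedSpace ℝ F] (hR : 0 ≤ R) {f : U → F} {u : U} (h : f =ᶠ[𝓝 u] fun _ => 0) :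
    GB κ f u 0 R := by
  have := GB_const (κ := κ) hR (0 : F) u
  rw [norm_zero] at this
  exact this.congr h.symm

lemma IsCutoff.contDiff_scale {ψ : V → ℂ} (hψ : IsCutoff κ C R ψ) (ε : ℝ) :
    C∞ fun P => ψ (ε • P) := hψ.smooth.comp (contDiff_const_smul ε)

lemma IsCutoff.scale (hR : 0 ≤ R) {ψ : V → ℂ} (hψ : IsCutoff κ C R ψ) :
    ∃ c : ℝ, ∀ ε : ℝ, 0 < ε → ε ≤ 1 → ∀ P, GB κ (fun P => ψ (ε • P)) P
      ((closedBall (0 : V) (c / ε)).indicator (fun _ => C) P) R := by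
  obtain ⟨c, hc⟩ := hψ.support
  refine ⟨c, fun ε hε hε1 P => ?_⟩
  by_cases hP : P ∈ closedBall (0 : V) (c / ε)
  · rw [indicator_of_mem hP]
    have h1 : ‖ε • ContinuousLinearMap.id ℝ V‖ ≤ 1 := by
      rw [norm_smul, norm_of_nonneg hε.le]
      exact mul_le_one₀ hε1 (norm_nonneg _) norm_id_le
    have := GB.comp_affine (a := (0 : V)) (T := ε • ContinuousLinearMap.id ℝ V) (u := P) hR hψ.smooth h1
      (hψ.bound _)
    simpa using this
  · rw [indicator_of_notMem hP]
    refine GB_zero_of_eventuallyEq hR ?_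
    have : (closedBall (0 : V) (c / ε))ᶜ ∈ 𝓝 P := Metric.isClosed_closedBall.isOpen_compl.mem_nhds hP
    filter_upwards [this] with P' hP'
    apply hc
    simp only [Set.mem_compl_iff, Metric.mem_closedBall, dist_zero_right, not_le] at hP'
    rw [norm_smul, norm_of_nonneg hε.le]
    rwa [div_lt_iff₀' hε] at hP'

lemma IsCutoff.GB_scale (hR : 0 ≤ R) {ψ : V → ℂ} (hψ : IsCutoff κ C R ψ)
    (hε : 0 < ε) (hε1 : ε ≤ 1) (P : V) : GB κ (fun P => ψ (ε • P)) P C R := by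
  obtain ⟨c, hc⟩ := hψ.scale hR
  refine (hc ε hε hε1 P).mono hR ?_ le_rfl
  exact Set.indicator_le_self' (fun _ _ => (hψ.bound 0).nonneg) P

lemma integrable_indicator_closedBall (r C : ℝ) :
    Integrable ((closedBall (0 : V) r).indicator fun _ => C) :=
  (integrable_indicator_iff Metric.isClosed_closedBall.measurableSet).mpr
    (integrableOn_const (isCompact_closedBall _ _).measure_lt_top.ne)

/-- The list of directions `(e, e)`, for `e` in a list. -/
def diagL (d : List V) : List (V × V) := d.map fun e => (e, e)

lemma diagL_norm {d : List V} (hd : ∀ e ∈ d, ‖e‖ ≤ 1) : ∀ e ∈ diagL d, ‖e.1‖ ≤ 1 ∧ ‖e.2‖ ≤ 1 := by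
  intro e he
  simp only [diagL, List.mem_map] at he
  obtain ⟨e', he', rfl⟩ := he
  exact ⟨hd e' he', hd e' he'⟩

/-- The constants for iterated regularisation. -/
def stC (κ s R : ℝ) (N : ℕ) : ℝ := (2 * (1 + s * ((8 * 2 ^ κ) ^ N * R))) ^ N

def stR (κ R : ℝ) (N : ℕ) : ℝ := 2 * (8 * 2 ^ κ) ^ N * R

lemma stR_pos (κ : ℝ) (hR : 0 < R) (N : ℕ) : 0 < stR κ R N := by unfold stR; positivity

lemma stC_pos (κ : ℝ) (hs : 0 < s) (hR : 0 < R) (N : ℕ) : 0 < stC κ s R N := by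
  unfold stC; positivity

lemma GB.StL' {W : Type} [NormedAddCommGroup W] [NormedSpace ℝ W]
    (hκ : 1 ≤ κ) (hs : 0 < s) (hsR : s ≤ R) {a : V × W → ℂ} (ha : C∞ a)
    {N : ℕ} (l : List (V × W)) (hl : ∀ e ∈ l, ‖e.1‖ ≤ 1 ∧ ‖e.2‖ ≤ 1) (hN : l.length ≤ N) {z : V × W}
    (h : GB κ a z M R) :
    GB κ (GevreyConj.StL s l a) z (stC κ s R N * stWL s l z.1 * M) ((8 * 2 ^ κ) ^ N * R) := by
  have hR : 0 < R := hs.trans_le hsR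
  have h2κ : (1 : ℝ) ≤ 2 ^ κ := one_le_rpow num! lin!
  have hw := stWL_nonneg s l z.1
  have hM := h.nonneg
  have h8 : (0 : ℝ) < (8 * 2 ^ κ) ^ N := pos!
  refine (h.StL hκ hs hsR ha l hl hN).mono pos! ?_ ?_
  · unfold stC
    have : (1 : ℝ) ≤ 2 * (1 + s * ((8 * 2 ^ κ) ^ N * R)) := by
      have : 0 < s * ((8 * 2 ^ κ) ^ N * R) := pos!
      linarith
    gcongr
  · gcongr; linarith

lemma GB.cutoff_StL (hκ : 1 ≤ κ) (hs : 0 < s) (hsR : s ≤ R) {a : V × V → ℂ}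
    (ha : C∞ a) {N : ℕ} (d : List V) (hd : ∀ e ∈ d, ‖e‖ ≤ 1) (hN : d.length ≤ N)
    {ϕ : V → ℂ} (hϕ : C∞ ϕ) {z : V × V} (hϕb : GB κ ϕ z.1 C R) (h : GB κ a z M R) :
    GB κ (fun z => ϕ z.1 * GevreyConj.StL s (diagL d) a z) z
      (C * (stC κ s R N * stWL s (diagL d) z.1 * M)) (stR κ R N) := by
  have hR : 0 < R := hs.trans_le hsR
  have h2κ : (1 : ℝ) ≤ 2 ^ κ := one_le_rpow num! lin!
  have h8 : (1 : ℝ) ≤ (8 * 2 ^ κ) ^ N := one_le_pow₀ lin!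
  have h1 := h.StL' hκ hs hsR ha (diagL d) (diagL_norm hd) (by simpa [diagL] using hN)
  refine ((hϕb.comp_fst hR.le hϕ).mono hR.le le_rfl (by nlinarith)).mul hκ pos!
    (hϕ.comp contDiff_fst) (contDiff_StL ha s _) h1 |>.mono pos! le_rfl (le_of_eq ?_)
  unfold stR; ring

/-- Regularisation does not change a cut-off oscillatory integral. -/
lemma integral_osc_StL (hκ : 1 ≤ κ) (hs : 0 < s) (hsR : s ≤ R) {a : V × V → ℂ} (ha : C∞ a)
    {g τ : V → ℝ} (hg : Integrable g) (hτc : Continuous τ) {N : ℕ} (hτ : Integrable fun Q => τ Q * dec κ ((8 * 2 ^ κ) ^ N * R) Q)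
    (h : ∀ P Q, GB κ a (P, Q) (g P * τ Q) R) (d : List V) (hd : ∀ e ∈ d, ‖e‖ ≤ 1) (hN : d.length ≤ N) :
    ∫ Q, osc (fun P => a (P, Q)) Q = ∫ Q, osc (fun P => StL s (diagL d) a (P, Q)) Q := by
  have hR : 0 < R := hs.trans_le hsR
  have h2κ : (1 : ℝ) ≤ 2 ^ κ := one_le_rpow num! lin!
  induction d with
  | nil => rfl
  | cons e d ih =>
    have hd' := fun e he => hd e (List.mem_cons_of_mem _ he)
    rw [List.length_cons] at hN
    rw [ih hd' (by omega)]
    have hb : ∀ P Q, GB κ (StL s (diagL d) a) (P, Q) (stC κ s R (N - 1) * g P * τ Q) ((8 * 2 ^ κ) ^ (N - 1) * R) := by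
      intro P Q
      refine (GB.StL' hκ hs hsR ha (diagL d) (diagL_norm hd') (N := N - 1) (by rw [diagL, List.length_map]; omega) (h P Q)).mono
        pos! ?_ le_rfl
      have h0 := (h P Q).nonneg
      have hst := stC_pos κ hs hR (N - 1)
      calc _ ≤ stC κ s R (N - 1) * 1 * (g P * τ Q) := by gcongr; exact stWL_le_one s (diagL d) P
        _ = _ := by ring
    have h8 : 8 * 2 ^ κ * ((8 * 2 ^ κ) ^ (N - 1) * R) = (8 * 2 ^ κ) ^ N * R := by
      obtain ⟨N', rfl⟩ : ∃ N', N = N' + 1 := ⟨N - 1, by omega⟩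
      simp only [Nat.add_sub_cancel, pow_succ]; ring
    exact integral_osc_St hκ hs (show s ≤ (8 * 2 ^ κ) ^ (N - 1) * R by
        have : (1 : ℝ) ≤ (8 * 2 ^ κ) ^ (N - 1) := one_le_pow₀ lin!
        nlinarith) (contDiff_StL ha s _) (hg.const_mul _) hτc (by rw [h8]; exact hτ) (hd e List.mem_cons_self) hb

lemma integral_osc_cutoff_StL (hκ : 1 ≤ κ) (hs : 0 < s) (hsR : s ≤ R) {a : V × V → ℂ}
    (ha : C∞ a) {τ : V → ℝ} (hτc : Continuous τ) {N : ℕ} {ψ : V → ℂ} (hψ : IsCutoff κ C R ψ)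
    (hτ : Integrable fun Q => τ Q * dec κ (stR κ R N) Q) (h : ∀ P Q, GB κ a (P, Q) (τ Q) R) (hε : 0 < ε) (hε1 : ε ≤ 1) (d : List V) (hd : ∀ e ∈ d, ‖e‖ ≤ 1) (hN : d.length ≤ N) :
    ∫ Q, osc (fun P => ψ (ε • P) * a (P, Q)) Q =
      ∫ Q, osc (fun P => ψ (ε • P) * StL s (diagL d) a (P, Q)) Q := by
  have hR : 0 < R := hs.trans_le hsR
  obtain ⟨c, hc⟩ := hψ.scale hR.le
  have hψs := hψ.contDiff_scale ε
  have key := integral_osc_StL hκ hs (hsR.trans lin!) (a := fun z : V × V => ψ (ε • z.1) * a z) ((hψs.comp contDiff_fst).mul ha)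
    (integrable_indicator_closedBall (c / ε) C) hτc (R := 2 * R) (N := N) (by convert hτ using 3; unfold stR; ring_nf) (fun P Q =>
      (GB.comp_fst (f := fun P => ψ (ε • P)) (z := (P, Q)) hR.le hψs (hc ε hε hε1 P)).mul hκ hR.le (hψs.comp contDiff_fst) ha (h P Q)) d hd hN
  rw [key, StL_mul_left ha hψs]

/-- The limit of cut-off oscillatory integrals. -/
lemma tendsto_integral_osc_cutoff (hκ : 1 ≤ κ) (hs : 0 < s) (hsR : s ≤ R) {a : V × V → ℂ}
    (ha : C∞ a) {τ : V → ℝ} (hτc : Continuous τ) {N : ℕ} {ψ : V → ℂ} (hψ : IsCutoff κ C R ψ)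
    (hτ : Integrable fun Q => τ Q * dec κ (stR κ R N) Q) (h : ∀ P Q, GB κ a (P, Q) (τ Q) R)
    (d : List V) (hd : ∀ e ∈ d, ‖e‖ ≤ 1) (hN : d.length ≤ N) (hw : Integrable (stWL s (diagL d))) :
    (∀ ε : ℝ, 0 < ε → ε ≤ 1 → ‖∫ Q, osc (fun P => ψ (ε • P) * a (P, Q)) Q‖ ≤
      2 ^ κ * (C * stC κ s R N * ∫ P, stWL s (diagL d) P) * ∫ Q, τ Q * dec κ (stR κ R N) Q) ∧
    Tendsto (fun ε : ℝ => ∫ Q, osc (fun P => ψ (ε • P) * a (P, Q)) Q) (𝓝[>] 0)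
      (𝓝 (∫ Q, osc (fun P => StL s (diagL d) a (P, Q)) Q)) := by
  have hR : 0 < R := hs.trans_le hsR
  have hψs := hψ.contDiff_scale
  have hal := contDiff_StL ha s (diagL d)
  have hsR' := stR_pos κ hR N
  have hb : ∀ ε : ℝ, 0 < ε → ε ≤ 1 → ∀ P Q, GB κ (fun z : V × V => ψ (ε • z.1) * StL s (diagL d) a z) (P, Q)
      ((C * stC κ s R N * stWL s (diagL d) P) * τ Q) (stR κ R N) := by
    intro ε hε hε1 P Q
    refine (GB.cutoff_StL (z := (P, Q)) hκ hs hsR ha d hd hN (hψs ε) (hψ.GB_scale hR.le hε hε1 P) (h P Q)).mono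
      hsR'.le (le_of_eq (by ring)) le_rfl
  have hbs : ∀ ε : ℝ, C∞ (fun z : V × V => ψ (ε • z.1) * StL s (diagL d) a z) := fun ε =>
    ((hψs ε).comp contDiff_fst).mul hal
  have hg : Integrable fun P => C * stC κ s R N * stWL s (diagL d) P := hw.const_mul _
  constructor
  · intro ε hε hε1
    rw [integral_osc_cutoff_StL hκ hs hsR ha hτc hψ hτ h hε hε1 d hd hN]
    have := norm_integral_osc_le hκ hsR' (hbs ε) hg hτ (hb ε hε hε1)
    rwa [integral_const_mul] at this
  · have hev : ∀ᶠ ε : ℝ in 𝓝[>] 0, 0 < ε ∧ ε ≤ 1 := by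
      filter_upwards [Ioc_mem_nhdsGT (zero_lt_one' ℝ)] with ε hε using hε
    have e1 : (fun ε : ℝ => ∫ Q, osc (fun P => ψ (ε • P) * a (P, Q)) Q) =ᶠ[𝓝[>] 0]
        fun ε => ∫ Q, osc (fun P => ψ (ε • P) * StL s (diagL d) a (P, Q)) Q := by
      filter_upwards [hev] with ε hε
      exact integral_osc_cutoff_StL hκ hs hsR ha hτc hψ hτ h hε.1 hε.2 d hd hN
    rw [tendsto_congr' e1]
    refine tendsto_integral_filter_of_dominated_convergence
      (fun Q => 2 ^ κ * (∫ P, C * stC κ s R N * stWL s (diagL d) P) * (τ Q * dec κ (stR κ R N) Q)) ?_ ?_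
      (hτ.const_mul _) ?_
    · filter_upwards [hev] with ε hε
      exact (integrable_osc hκ hsR' (hbs ε) hg hτ (hb ε hε.1 hε.2)).aestronglyMeasurable
    · filter_upwards [hev] with ε hε
      refine .of_forall fun Q => ?_
      refine (norm_osc_le hκ hsR' ((hbs ε).comp (contDiff_id.prodMk contDiff_const)) (hg.mul_const (τ Q))
        (fun P => (hb ε hε.1 hε.2 P Q).slice hsR'.le (hbs ε)) Q).trans (le_of_eq ?_)
      rw [integral_mul_const]; unfold dec; ring
    · refine .of_forall fun Q => ?_
      unfold osc
      refine tendsto_integral_filter_of_dominated_convergence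
        (fun P => (C * stC κ s R N * stWL s (diagL d) P) * τ Q) ?_ ?_ (hg.mul_const _) ?_
      · refine .of_forall fun ε => Continuous.aestronglyMeasurable ?_
        exact (contDiff_ec Q).continuous.mul (((hψs ε).continuous).mul (hal.continuous.comp fun!))
      · filter_upwards [hev] with ε hε
        refine .of_forall fun P => ?_
        rw [norm_mul, norm_ec, one_mul]
        exact (hb ε hε.1 hε.2 P Q).norm_le
      · refine .of_forall fun P => ?_
        have h1 : Tendsto (fun ε : ℝ => ψ (ε • P)) (𝓝[>] 0) (𝓝 1) := by
          have : Continuous fun ε : ℝ => ψ (ε • P) := hψ.smooth.continuous.comp fun!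
          have h2 := (this.tendsto 0).mono_left (nhdsWithin_le_nhds (s := Set.Ioi 0))
          simpa [hψ.at_zero] using h2
        have h3 := (h1.mul_const (StL s (diagL d) a (P, Q))).const_mul (ec P Q)
        simpa using h3

/-- The directions used for regularisation: each vector of an orthonormal basis, repeated. -/
def stDirs (V : Type) [NormedAddCommGroup V] [InnerProductSpace ℝ V] [FiniteDimensional ℝ V] (k : ℕ) : List V :=
  (List.replicate k ((finRange (finrank ℝ V)).map (stdOrthonormalBasis ℝ V))).flatten

lemma stDirs_norm (k : ℕ) : ∀ e ∈ stDirs V k, ‖e‖ ≤ 1 := by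
  intro e he
  simp only [stDirs, List.mem_flatten, List.mem_replicate] at he
  obtain ⟨l, ⟨-, rfl⟩, hl⟩ := he
  obtain ⟨i, -, rfl⟩ := List.mem_map.mp hl
  simp

lemma stDirs_length (k : ℕ) : (stDirs V k).length = k * finrank ℝ V := by
  simp [stDirs]

lemma sq_norm_stW (s : ℝ) (e P : V) : ‖stW s e P‖ ^ 2 = (1 + (s * inner ℝ P e) ^ 2)⁻¹ := by
  unfold stW
  rw [norm_inv, inv_pow, ← Complex.normSq_eq_norm_sq, Complex.normSq_apply]
  simp
  ring

lemma one_add_sum_le_prod {ι : Type} (s : Finset ι) {f : ι → ℝ} (hf : ∀ i, 0 ≤ f i) :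
    1 + ∑ i ∈ s, f i ≤ ∏ i ∈ s, (1 + f i) := by
  classical
  induction s using induction_on with
  | empty => simp
  | insert i s hi ih =>
    rw [sum_insert hi, Finset.prod_insert hi]
    have h1 := hf i
    have h2 : 0 ≤ ∑ i ∈ s, f i := sum_nonneg fun i _ => hf i
    nlinarith

lemma stWL_stDirs_le (hs : 0 < s) {W : Type} [NormedAddCommGroup W] [NormedSpace ℝ W]
    (f : V → W) (k : ℕ) (P : V) :
    stWL s ((stDirs V k).map fun e => (e, f e)) P ≤ (2 * max 1 s⁻¹) ^ k * ((1 + ‖P‖) ^ k)⁻¹ := by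
  set b := stdOrthonormalBasis ℝ V
  have h1 : stWL s ((stDirs V k).map fun e => (e, f e)) P = (∏ i, ‖stW s (b i) P‖) ^ k := by
    unfold stWL stDirs
    rw [List.map_map, List.map_flatten, List.map_replicate, List.prod_flatten, List.map_replicate,
      List.prod_replicate, List.map_map, ← List.ofFn_eq_map, List.prod_ofFn]
    rfl
  have h2 : (∏ i, ‖stW s (b i) P‖) ^ 2 ≤ (1 + s ^ 2 * ‖P‖ ^ 2)⁻¹ := by
    rw [← Finset.prod_pow]
    simp only [sq_norm_stW]
    rw [Finset.prod_inv_distrib]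
    refine inv_anti₀ pos! ?_
    have h3 : ‖P‖ ^ 2 = ∑ i, (inner ℝ P (b i) : ℝ) ^ 2 := by
      rw [← b.sum_sq_norm_inner_right P]
      exact sum_congr rfl fun i _ => by rw [real_inner_comm, norm_eq_abs, sq_abs]
    rw [h3, mul_sum]
    simp only [mul_pow]
    exact one_add_sum_le_prod _ fun i => pos!
  have h3 : ∏ i, ‖stW s (b i) P‖ ≤ 2 * max 1 s⁻¹ * (1 + ‖P‖)⁻¹ := by
    have hm1 : (1 : ℝ) ≤ max 1 s⁻¹ := le_max_left _ _
    have hm2 : s⁻¹ ≤ max 1 s⁻¹ := le_max_right _ _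
    refine abs_le_of_sq_le_sq' (h2.trans ?_) pos! |>.2
    rw [mul_pow, inv_pow, ← div_eq_mul_inv, inv_eq_one_div, div_le_div_iff₀ pos! pos!, one_mul]
    have h4 : 1 ≤ max 1 s⁻¹ * s := by
      calc 1 = s⁻¹ * s := (inv_mul_cancel₀ hs.ne').symm
        _ ≤ _ := mono!
    have h5 : ‖P‖ ^ 2 ≤ (max 1 s⁻¹ * s) ^ 2 * ‖P‖ ^ 2 := le_mul_of_one_le_left pos! (one_le_pow₀ h4)
    nlinarith [sq_nonneg (‖P‖ - 1)]
  rw [h1]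
  calc _ ≤ (2 * max 1 s⁻¹ * (1 + ‖P‖)⁻¹) ^ k := by
        gcongr
    _ = _ := by rw [mul_pow, inv_pow]

lemma continuous_stWL {W : Type} [NormedAddCommGroup W] [NormedSpace ℝ W] (s : ℝ) (l : List (V × W)) :
    Continuous (stWL s l) := by
  unfold stWL
  exact continuous_list_prod (f := fun (e : V × W) P => ‖stW s e.1 P‖) l
    fun e _ => (contDiff_stW s e.1).continuous.norm

lemma integrable_pow_mul_stWL (hs : 0 < s) {W : Type} [NormedAddCommGroup W] [NormedSpace ℝ W]
    (f : V → W) (k : ℕ) :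
    Integrable fun P => (1 + ‖P‖) ^ k * stWL s ((stDirs V (k + (finrank ℝ V + 1))).map fun e => (e, f e)) P := by
  refine (integrable_inv_one_add_norm_pow.const_mul
    ((2 * max 1 s⁻¹) ^ (k + (finrank ℝ V + 1)))).mono' ?_ (.of_forall fun P => ?_)
  · have := continuous_stWL s ((stDirs V (k + (finrank ℝ V + 1))).map fun e => (e, f e))
    exact Continuous.aestronglyMeasurable fun!
  · have h0 := stWL_nonneg s ((stDirs V (k + (finrank ℝ V + 1))).map fun e => (e, f e)) P
    rw [norm_of_nonneg pos!]
    calc _ ≤ (1 + ‖P‖) ^ k * ((2 * max 1 s⁻¹) ^ (k + (finrank ℝ V + 1)) *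
          ((1 + ‖P‖) ^ (k + (finrank ℝ V + 1)))⁻¹) := by
          gcongr; exact stWL_stDirs_le hs f _ P
      _ = _ := by rw [pow_add (1 + ‖P‖)]; field_simp

end CutoffLimits

section BumpFunctions

/-- The function `exp (-x ^ (-a))` for `x > 0`, extended by zero. -/
def flat (a : ℕ) (x : ℝ) : ℝ := expNegInvGlue (x ^ a)

lemma contDiff_flat (a : ℕ) : C∞ (flat a) :=
  expNegInvGlue.contDiff.comp (contDiff_id.pow a)

lemma flat_of_nonpos {a : ℕ} (ha : Odd a) (hx : x ≤ 0) : flat a x = 0 :=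
  expNegInvGlue.zero_of_nonpos (ha.pow_nonpos_iff.mpr hx)

lemma flat_of_pos {a : ℕ} (hx : 0 < x) : flat a x = exp (-(x ^ a)⁻¹) := by
  unfold flat expNegInvGlue
  rw [if_neg (not_le.mpr (pow_pos hx a))]

lemma abs_iteratedDeriv_neg_inv_pow_le {a : ℕ} (hx : 0 < x) {k : ℕ} (hk : 1 ≤ k) :
    |iteratedDeriv k (fun x : ℝ => -(x ^ a)⁻¹) x| ≤
      (1 / 2 * (x ^ a)⁻¹) * (2 ^ (a + 2) / x) ^ k * k ! := by
  have e1 : (fun x : ℝ => -(x ^ a)⁻¹) = fun x => -(x ^ (-(a : ℤ))) := by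
    funext x; rw [zpow_neg, zpow_natCast]
  have e2 : iteratedDeriv k (fun x : ℝ => -(x ^ (-(a : ℤ)))) x =
      -((∏ i ∈ range k, (((-(a : ℤ) : ℤ) : ℝ) - i)) * x ^ (-(a : ℤ) - k)) := by
    rw [iteratedDeriv_fun_neg, iteratedDeriv_eq_iterate, iter_deriv_zpow]
  have e3 : ∏ i ∈ range k, |(((-(a : ℤ) : ℤ) : ℝ) - i)| = (a.ascFactorial k : ℝ) := by
    rw [Nat.ascFactorial_eq_prod_range]
    push_cast
    refine Finset.prod_congr rfl fun i _ => ?_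
    rw [show (-a - i) = -((a : ℝ) + i) by ring, abs_neg, abs_of_nonneg pos!]
  have e4 : (a.ascFactorial k : ℝ) ≤ k ! * 2 ^ (a + k - 1) := by
    rw [Nat.ascFactorial_eq_factorial_mul_choose']
    push_cast
    gcongr
    exact_mod_cast Nat.choose_le_two_pow (a + k - 1) k
  have e5 : x ^ (-(a : ℤ) - k) = (x ^ a)⁻¹ * (x ^ k)⁻¹ := by
    rw [zpow_sub₀ hx.ne', zpow_neg, zpow_natCast, zpow_natCast, div_eq_mul_inv]
  rw [e1, e2, abs_neg, abs_mul, Finset.abs_prod, e3, e5, abs_of_pos pos!]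
  calc _ ≤ k ! * 2 ^ (a + k - 1) * ((x ^ a)⁻¹ * (x ^ k)⁻¹) := mono!
    _ ≤ k ! * (1 / 2 * (2 ^ (a + 2)) ^ k) * ((x ^ a)⁻¹ * (x ^ k)⁻¹) := by
        gcongr
        rw [one_div, inv_mul_eq_div, le_div_iff₀ num!, ← pow_succ, ← pow_mul]
        apply pow_le_pow_right₀ num!
        obtain ⟨j, rfl⟩ := Nat.exists_eq_add_of_le' hk
        have : a + (j + 1) - 1 + 1 = a + j + 1 := by omega
        rw [this]; nlinarith
    _ = _ := by rw [div_pow]; ring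

lemma exists_smooth_neg_inv_pow (a : ℕ) (hx : 0 < x) :
    ∃ g : ℝ → ℝ, C∞ g ∧ g =ᶠ[𝓝 x] fun y => -(y ^ a)⁻¹ := by
  refine ⟨fun y => smoothTransition (4 * y / x - 1) * -(y ^ a)⁻¹, ?_, ?_⟩
  · rw [contDiff_iff_contDiffAt]
    intro y
    by_cases hy : 0 < y
    · refine ContDiffAt.mul ?_ ?_
      · exact (smoothTransition.contDiff.comp (by fun_prop : C∞ fun y => 4 * y / x - 1)).contDiffAt
      · exact ((contDiffAt_id.pow a).inv (by simpa using (pow_pos hy a).ne')).neg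
    · have : (fun y => smoothTransition (4 * y / x - 1) * -(y ^ a)⁻¹) =ᶠ[𝓝 y] fun _ => 0 := by
        have : Set.Iio (x / 4) ∈ 𝓝 y := Iio_mem_nhds lin!
        filter_upwards [this] with z hz
        rw [smoothTransition.zero_of_nonpos, zero_mul]
        rw [Set.mem_Iio] at hz
        rw [sub_nonpos, div_le_one hx]; linarith
      exact contDiffAt_const.congr_of_eventuallyEq this
  · have : Set.Ioi (x / 2) ∈ 𝓝 x := Ioi_mem_nhds lin!
    filter_upwards [this] with z hz
    rw [Set.mem_Ioi] at hz
    rw [smoothTransition.one_of_one_le, one_mul]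
    rw [le_sub_iff_add_le, le_div_iff₀ hx]; linarith

lemma GB_flat_pos {a : ℕ} (hx : 0 < x) :
    GB 1 (flat a) x (exp (-(1 / 2) * (x ^ a)⁻¹)) (2 * (2 ^ (a + 2) / x)) := by
  obtain ⟨g, hg, hgx⟩ := exists_smooth_neg_inv_pow a hx
  have h1 := GB.exp (κ := 1) (m := 1 / 2 * (x ^ a)⁻¹) (R := 2 ^ (a + 2) / x) le_rfl pos!
    pos! hg (p := x) (fun k hk => by
      rw [hgx.iteratedFDeriv ℝ k |>.self_of_nhds, norm_iteratedFDeriv_eq_norm_iteratedDeriv, rpow_one]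
      exact abs_iteratedDeriv_neg_inv_pow_le hx hk)
  have h2 : g x + 1 / 2 * (x ^ a)⁻¹ = -(1 / 2) * (x ^ a)⁻¹ := by
    rw [hgx.self_of_nhds]; ring
  rw [h2] at h1
  refine h1.congr ?_
  filter_upwards [hgx, Ioi_mem_nhds hx] with z hz hz0
  rw [hz, flat_of_pos hz0]

lemma inv_pow_mul_exp_le {a : ℕ} (ha : 1 ≤ a) (hx : 0 < x) (k : ℕ) :
    (x⁻¹) ^ k * exp (-(1 / 2) * (x ^ a)⁻¹) ≤ 2 ^ k * k ! ^ (1 / (a : ℝ)) := by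
  set s := x⁻¹
  have ha0 : (0 : ℝ) < a := by exact_mod_cast ha
  rw [(inv_pow x a).symm]
  have h1 : (s ^ a) ^ k ≤ (2 ^ k * (k ! : ℝ)) * exp (1 / 2 * s ^ a) := by
    have := Real.pow_div_factorial_le_exp (1 / 2 * s ^ a) pos! k
    rw [div_le_iff₀ (fact_pos k), mul_pow, one_div, inv_pow, inv_mul_le_iff₀ pos!] at this
    rw [one_div]; linarith
  have h2 : s ^ k ≤ 2 ^ k * k ! ^ (1 / (a : ℝ)) * exp (1 / 2 * s ^ a) := by
    have h3 : s ^ k = ((s ^ a) ^ k) ^ (1 / (a : ℝ)) := by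
      rw [← pow_mul, mul_comm a k, pow_mul, ← rpow_natCast (s ^ k) a, ← rpow_mul pos!,
        mul_one_div_cancel ha0.ne', rpow_one]
    rw [h3]
    have h4 : (1 : ℝ) / a ≤ 1 := by
      rw [div_le_one ha0]; exact_mod_cast ha
    calc _ ≤ ((2 ^ k * (k ! : ℝ)) * exp (1 / 2 * s ^ a)) ^ (1 / (a : ℝ)) := mono!
      _ = (2 ^ k) ^ (1 / (a : ℝ)) * k ! ^ (1 / (a : ℝ)) * exp (1 / 2 * s ^ a) ^ (1 / (a : ℝ)) := by
          rw [mul_rpow pos! pos!, mul_rpow pos! pos!]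
      _ ≤ _ := by
          have h5 : ((2 : ℝ) ^ k) ^ (1 / (a : ℝ)) ≤ 2 ^ k := by
            conv_rhs => rw [← rpow_one (2 ^ k)]
            exact rpow_le_rpow_of_exponent_le (one_le_pow₀ num!) h4
          have h6 : exp (1 / 2 * s ^ a) ^ (1 / (a : ℝ)) ≤ exp (1 / 2 * s ^ a) := by
            conv_rhs => rw [← rpow_one (exp (1 / 2 * s ^ a))]
            exact rpow_le_rpow_of_exponent_le (one_le_exp pos!) h4
          gcongr
  rw [neg_mul, exp_neg, ← div_eq_mul_inv, div_le_iff₀ (exp_pos _)]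
  exact h2

lemma abs_iteratedDeriv_flat_le_of_pos {a : ℕ} (ha : 1 ≤ a) (hx : 0 < x) (k : ℕ) :
    |iteratedDeriv k (flat a) x| ≤ (2 ^ (a + 4)) ^ k * k ! ^ (1 + 1 / (a : ℝ)) := by
  have h := GB_flat_pos (a := a) hx k
  rw [norm_iteratedFDeriv_eq_norm_iteratedDeriv, norm_eq_abs, rpow_one] at h
  refine h.trans ?_
  calc _ = (2 ^ (a + 3)) ^ k * ((x⁻¹) ^ k * exp (-(1 / 2) * (x ^ a)⁻¹)) * k ! := by
        rw [div_eq_mul_inv (2 ^ (a + 2)) x, pow_succ _ (a + 2)]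
        ring
    _ ≤ (2 ^ (a + 3)) ^ k * (2 ^ k * k ! ^ (1 / (a : ℝ))) * k ! := by
        refine mul_le_mul_of_nonneg_right (mul_le_mul_of_nonneg_left ?_ pos!) pos!
        exact inv_pow_mul_exp_le ha hx k
    _ = _ := by
        rw [rpow_add (fact_pos k), rpow_one, pow_succ _ (a + 3), mul_pow]; ring

lemma abs_iteratedDeriv_flat_le {a : ℕ} (ha : Odd a) (x : ℝ) (k : ℕ) :
    |iteratedDeriv k (flat a) x| ≤ (2 ^ (a + 4)) ^ k * k ! ^ (1 + 1 / (a : ℝ)) := by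
  rcases lt_or_ge 0 x with hx | hx
  · exact abs_iteratedDeriv_flat_le_of_pos ha.pos hx k
  · have h0 : ∀ y < 0, iteratedDeriv k (flat a) y = 0 := by
      intro y hy
      have : flat a =ᶠ[𝓝 y] fun _ => 0 := by
        filter_upwards [Iio_mem_nhds hy] with z hz using flat_of_nonpos ha (le_of_lt hz)
      rw [this.iteratedDeriv_eq]
      simp
    have hc : Continuous (iteratedDeriv k (flat a)) :=
      (contDiff_flat a).continuous_iteratedDeriv k (mod_cast le_top)
    have : Set.Iic 0 ⊆ {y | iteratedDeriv k (flat a) y = 0} := by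
      rw [← closure_Iio]
      exact (isClosed_eq hc continuous_const).closure_subset_iff.mpr fun y hy => h0 y hy
    rw [show iteratedDeriv k (flat a) x = 0 from this hx, abs_zero]
    positivity

lemma flat_nonneg (a : ℕ) (x : ℝ) : 0 ≤ flat a x := expNegInvGlue.nonneg _

lemma flat_mono {a : ℕ} (ha : Odd a) : Monotone (flat a) := fun _ _ h =>
  expNegInvGlue.monotone (ha.strictMono_pow.monotone h)

/-- Gevrey step functions of any order greater than one. -/
lemma exists_step (hκ : 1 < κ) : ∃ (ϕ : ℝ → ℝ) (C B : ℝ), C∞ ϕ ∧ 0 ≤ C ∧ 0 ≤ B ∧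
    (∀ j t, |iteratedDeriv j ϕ t| ≤ C * B ^ j * j ! ^ κ) ∧ (∀ t ≤ 1 / 2, ϕ t = 1) ∧ ∀ t, 1 ≤ t → ϕ t = 0 := by
  obtain ⟨j, hj⟩ := exists_nat_gt (1 / (κ - 1))
  set a := 2 * j + 1
  have ha : Odd a := odd_two_mul_add_one j
  have haκ : 1 + 1 / a ≤ κ := by
    have ha0 : (0 : ℝ) < a := pos!
    rw [div_lt_iff₀ lin!] at hj
    have : (j : ℝ) ≤ a := by simp only [a]; push_cast; linarith [(cast_nonneg j : 0 ≤ j)]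
    have : 1 / a ≤ κ - 1 := by rw [div_le_iff₀ ha0]; nlinarith
    linarith
  set B : ℝ := 2 ^ (a + 4)
  have hB : 0 < B := pos!
  have hf : ∀ x, GB κ (flat a) x 1 B := by
    intro x k
    rw [norm_iteratedFDeriv_eq_norm_iteratedDeriv, norm_eq_abs, one_mul]
    refine (abs_iteratedDeriv_flat_le ha x k).trans ?_
    gcongr
    exact one_le_fact k
  have aff : ∀ (c d x : ℝ), |d| ≤ 1 → GB κ (fun t => flat a (c + d * t)) x 1 B := by
    intro c d x hd
    have := GB.comp_affine (a := c) (T := d • ContinuousLinearMap.id ℝ ℝ) (u := x) (t := 1) hB.le (contDiff_flat a)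
      (by rw [norm_smul, norm_eq_abs]; exact mul_le_one₀ hd (norm_nonneg _) norm_id_le) (hf _)
    simpa using this
  have sm : ∀ c d : ℝ, C∞ fun t => flat a (c + d * t) := fun c d =>
    (contDiff_flat a).comp fun!
  set D : ℝ → ℝ := fun t => flat a (1 + (-1) * t) + flat a (-(1 / 2) + 1 * t)
  have hD : C∞ D := (sm _ _).add (sm _ _)
  set c := flat a (1 / 4)
  have hc : 0 < c := by simp only [c]; rw [flat_of_pos num!]; exact exp_pos _
  have hDc : ∀ t, c ≤ D t := by
    intro t
    rcases le_total t (3 / 4) with ht | ht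
    · have := flat_mono ha (show 1 / 4 ≤ 1 + (-1) * t by linarith)
      linarith [flat_nonneg a (-(1 / 2) + 1 * t)]
    · have := flat_mono ha (show 1 / 4 ≤ -(1 / 2) + 1 * t by linarith)
      linarith [flat_nonneg a (1 + (-1) * t)]
  have hD0 : ∀ t, D t ≠ 0 := fun t => (hc.trans_le (hDc t)).ne'
  have hDi : C∞ fun t => (D t)⁻¹ := hD.inv hD0
  set M := 2 / c
  set L := max 2 (4 * M)
  have hM : 0 < M := pos!
  have hL : 2 ≤ L := le_max_left _ _
  have hinv : ∀ t, GB κ (fun t => (D t)⁻¹) t (2 * c⁻¹) (B * L) := by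
    intro t
    refine (GB.inv hκ.le hB hM.le hL (le_max_right _ _) hD hDi
      (.of_forall fun u => mul_inv_cancel₀ (hD0 u)) (fun k _ => ?_)).mono pos! ?_ le_rfl
    · refine ((aff 1 (-1) t num!).add (sm _ _) (sm _ _) (aff (-(1 / 2)) 1 t num!) k).trans ?_
      have h1 : 1 + 1 ≤ M * ‖D t‖ := by
        rw [norm_of_nonneg (hc.le.trans (hDc t))]
        rw [div_mul_eq_mul_div, le_div_iff₀ hc]
        linarith [hDc t]
      gcongr
    · rw [norm_of_nonneg (hc.le.trans (hDc t))]
      have := hDc t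
      gcongr
  refine ⟨fun t => flat a (1 + (-1) * t) * (D t)⁻¹, 1 * (2 * c⁻¹), 2 * (B * L), (sm _ _).mul hDi,
    pos!, pos!, fun j t => ?_, fun t ht => ?_, fun t ht => ?_⟩
  · have h1 := ((aff 1 (-1) t num!).mono hB.le le_rfl (show B ≤ B * L by nlinarith)).mul hκ.le
      pos! (sm _ _) hDi (hinv t) j
    rwa [norm_iteratedFDeriv_eq_norm_iteratedDeriv, norm_eq_abs] at h1
  · have h1 : flat a (-(1 / 2) + 1 * t) = 0 := flat_of_nonpos ha lin!
    have h2 := hD0 t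
    simp only [D, h1, add_zero] at h2 ⊢
    exact mul_inv_cancel₀ h2
  · have h1 : flat a (1 + -1 * t) = 0 := flat_of_nonpos ha lin!
    simp only [h1, zero_mul]

lemma GB_norm_sq {V : Type} [NormedAddCommGroup V] [InnerProductSpace ℝ V] (hκ : 0 ≤ κ) (x : V) :
    GB κ (fun x : V => ‖x‖ ^ 2) x ((1 + ‖x‖) ^ 2) 2 := by
  have hx := norm_nonneg x
  intro k
  have hf : fderiv ℝ (fun x : V => ‖x‖ ^ 2) = fun x => (0 : V →L[ℝ] ℝ) + ((2 : ℝ) • innerSL ℝ : V →L[ℝ] V →L[ℝ] ℝ) x := by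
    funext x; rw [fderiv_norm_sq_apply]; ext y; simp
  have h1 := one_le_fact_rpow k hκ
  rcases Nat.eq_zero_or_pos k with rfl | hk
  · rw [norm_iteratedFDeriv_zero]; simp; nlinarith
  obtain ⟨k, rfl⟩ := Nat.exists_eq_add_of_le' hk
  have hp : (2 : ℝ) ≤ 2 ^ (k + 1) := by
    rw [pow_succ]; have : (1 : ℝ) ≤ 2 ^ k := one_le_pow₀ num!
    linarith
  have hgoal : 2 * (1 + ‖x‖) ≤ (1 + ‖x‖) ^ 2 * 2 ^ (k + 1) * ((k + 1)! : ℝ) ^ κ := by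
    calc 2 * (1 + ‖x‖) ≤ (1 + ‖x‖) ^ 2 * 2 * 1 := by nlinarith
      _ ≤ _ := mono!
  refine le_trans ?_ hgoal
  rw [← norm_iteratedFDeriv_fderiv, hf]
  have hL : ‖((2 : ℝ) • innerSL ℝ : V →L[ℝ] V →L[ℝ] ℝ)‖ ≤ 2 :=
    opNorm_le_bound _ num! fun y => by
      have : ((2 : ℝ) • innerSL ℝ : V →L[ℝ] V →L[ℝ] ℝ) y = (2 : ℝ) • innerSL ℝ y := rfl
      rw [this, norm_smul, innerSL_apply_norm, Real.norm_ofNat]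
  rcases Nat.eq_zero_or_pos k with rfl | hk
  · rw [norm_iteratedFDeriv_zero, zero_add]
    refine (ContinuousLinearMap.le_opNorm _ _).trans ?_
    nlinarith
  · refine (norm_iteratedFDeriv_linear_le _ _ _ hk).trans ?_
    split_ifs <;> linarith

lemma GB.upgrade {U F : Type} [NormedAddCommGroup U] [NormedSpace ℝ U] [NormedAddCommGroup F]
    [NormedSpace ℝ F] {f : U → F} {u : U} (h : GB κ' f u M R)
    (hC : ∀ k : ℕ, R ^ k * k ! ^ κ' ≤ C * R' ^ k * k ! ^ κ) : GB κ f u (M * C) R' := by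
  intro k
  refine (h k).trans ?_
  have := h.nonneg
  calc _ = M * (R ^ k * k ! ^ κ') := by ring
    _ ≤ M * (C * R' ^ k * k ! ^ κ) := mul_le_mul_of_nonneg_left (hC k) this
    _ = _ := by ring

lemma GB.of_order {U F : Type} [NormedAddCommGroup U] [NormedSpace ℝ U] [NormedAddCommGroup F]
    [NormedSpace ℝ F] (hκ : κ' ≤ κ) (hR : 0 ≤ R) {f : U → F} {u : U} (h : GB κ' f u M R) :
    GB κ f u M R := by
  intro k
  refine (h k).trans ?_
  have := h.nonneg
  gcongr
  exact one_le_fact k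

/-- Gevrey cut-off functions with arbitrarily small constant. -/
lemma exists_cutoff (V : Type) [NormedAddCommGroup V] [InnerProductSpace ℝ V] (hκ : 1 < κ) (hR : 0 < R) :
    ∃ (C : ℝ) (ψ : V → ℂ), IsCutoff κ C R ψ ∧ (∀ P, ‖P‖ ^ 2 ≤ 1 / 2 → ψ P = 1) ∧ ∀ P, 1 ≤ ‖P‖ → ψ P = 0 := by
  have hκ' : 1 < (1 + κ) / 2 := lin!
  obtain ⟨ϕ, C, B, hϕ, hC, hB, hb, h1, h0⟩ := exists_step hκ'
  set L := max 2 (4 * (1 + 2) ^ 2 * B)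
  obtain ⟨K, hK1, hK⟩ := exists_gevrey_upgrade (κ' := (1 + κ) / 2) (κ := κ) lin! (R := 2 * L) (R' := R)
    pos! hR
  have hsm : C∞ fun P : V => ϕ (‖P‖ ^ 2) := hϕ.comp (contDiff_norm_sq ℝ)
  have hsupp : ∀ P : V, 1 ≤ ‖P‖ → ((ϕ (‖P‖ ^ 2) : ℝ) : ℂ) = 0 := fun P hP => by
    rw [h0 _ (one_le_pow₀ hP), ofReal_zero]
  refine ⟨2 * C * K, fun P => (ϕ (‖P‖ ^ 2) : ℝ), ⟨ofRealCLM.contDiff.comp hsm, fun P => ?_, ⟨1, fun P hP => hsupp P hP.le⟩, ?_⟩, ?_, hsupp⟩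
  · rcases le_or_gt ‖P‖ 2 with hP | hP
    · have h2 := GB.comp_gevrey (κ := (1 + κ) / 2) (C := C) (B := B) (M := (1 + 2) ^ 2) (R := 2) (L := L)
        hκ'.le num! num! hC hB (le_max_left _ _) (le_max_right _ _) hϕ (contDiff_norm_sq ℝ) (p := P)
        (fun j => hb j _) (fun k _ => by
          have := GB_norm_sq (κ := 1) zero_le_one P k
          rw [rpow_one] at this
          refine this.trans ?_
          gcongr)
      exact (h2.upgrade hK).ofReal hsm
    · refine (GB_zero_of_eventuallyEq hR.le ?_).mono hR.le pos! le_rfl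
      filter_upwards [(isOpen_lt continuous_const continuous_norm).mem_nhds hP] with P' hP'
      exact hsupp P' lin!
  · simp [h1 0 num!]
  · intro P hP
    simp only [h1 _ hP, Complex.ofReal_one]

lemma jap_sq (n : ℕ) (h : ℝ) (ξ : E n) : jap h ξ ^ 2 = h ^ 2 + ‖ξ‖ ^ 2 := by
  unfold jap; rw [Real.sq_sqrt pos!]

lemma le_jap (h : ℝ) (ξ : E n) : h ≤ jap h ξ := by
  unfold jap; exact Real.le_sqrt_of_sq_le (by nlinarith)

lemma norm_le_jap (h : ℝ) (ξ : E n) : ‖ξ‖ ≤ jap h ξ := by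
  unfold jap; exact Real.le_sqrt_of_sq_le (by nlinarith)

lemma one_le_jap (hh : 1 ≤ h) (ξ : E n) : 1 ≤ jap h ξ :=
  hh.trans (le_jap h ξ)

lemma continuous_jap (h : ℝ) : Continuous (jap h : E n → ℝ) := by
  unfold jap; fun_prop

/-- Gevrey cut-off functions to the region `‖Θ‖ ≤ c ⟨ξ⟩`, at the scale `⟨ξ⟩`. -/
lemma exists_conic_cutoff (V : Type) [NormedAddCommGroup V] [InnerProductSpace ℝ V] (n : ℕ)
    (hκ : 1 < κ) (hR : 0 < R) :
    ∃ C : ℝ, ∀ h : ℝ, 1 ≤ h → ∃ X : V × E n → ℂ, C∞ X ∧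
      (∀ Θ ξ, GB κ (fun z : V × E n => X (Θ + jap h ξ • z.1, ξ + jap h ξ • z.2)) 0 C R) ∧
      (∀ Θ ξ, ‖Θ‖ ≤ jap h ξ / 16 → X (Θ, ξ) = 1) ∧ ∀ Θ ξ, jap h ξ / 8 ≤ ‖Θ‖ → X (Θ, ξ) = 0 := by
  have hκ' : 1 < (1 + κ) / 2 := lin!
  obtain ⟨ϕ, C, B, hϕ, hC, hB, hb, h1, h0⟩ := exists_step hκ'
  set M : ℝ := 64 * 4 * 2
  set L := max 2 (4 * M * B)
  obtain ⟨K, hK1, hK⟩ := exists_gevrey_upgrade (κ' := (1 + κ) / 2) (κ := κ) lin! (R := (2 * (2 * 20)) * L) (R' := R)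
    pos! hR
  refine ⟨2 * C * K, fun h hh => ?_⟩
  have hj : ∀ ξ : E n, 0 < jap h ξ := fun ξ => zero_lt_one.trans_le (one_le_jap hh ξ)
  have hD0 : ∀ ξ : E n, h ^ 2 + ‖ξ‖ ^ 2 ≠ 0 := fun ξ => by
    rw [← jap_sq]; exact (pow_pos (hj ξ) 2).ne'
  set q : V × E n → ℝ := fun z => 64 * ‖z.1‖ ^ 2 * (h ^ 2 + ‖z.2‖ ^ 2)⁻¹
  have hq : C∞ q := (contDiff_const.mul (contDiff_fst.norm_sq ℝ)).mul
    ((contDiff_const.add (contDiff_snd.norm_sq ℝ)).inv fun z => hD0 z.2)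
  have hsm : C∞ fun z => ϕ (q z) := hϕ.comp hq
  have hz : ∀ Θ ξ, jap h ξ / 8 ≤ ‖Θ‖ → ϕ (q (Θ, ξ)) = 0 := by
    intro Θ ξ hΘ
    apply h0
    simp only [q]
    rw [← jap_sq, ← div_eq_mul_inv, le_div_iff₀ (pow_pos (hj ξ) 2)]
    have := hj ξ
    nlinarith
  refine ⟨fun z => (ϕ (q z) : ℝ), ofRealCLM.contDiff.comp hsm, fun Θ ξ => ?_, fun Θ ξ hΘ => ?_,
    fun Θ ξ hΘ => by simp only [hz Θ ξ hΘ, ofReal_zero]⟩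
  · set b := jap h ξ
    have hb0 : 0 < b := hj ξ
    have haff : C∞ fun z : V × E n => (Θ + b • z.1, ξ + b • z.2) :=
      (contDiff_const.add (contDiff_fst.const_smul b)).prodMk
        (contDiff_const.add (contDiff_snd.const_smul b))
    rcases le_or_gt ‖Θ‖ b with hΘ | hΘ
    · set N : V × E n → ℝ := fun z => ‖b⁻¹ • Θ + z.1‖ ^ 2
      set D : V × E n → ℝ := fun z => h ^ 2 / b ^ 2 + ‖b⁻¹ • ξ + z.2‖ ^ 2
      have hN : C∞ N := (contDiff_const.add contDiff_fst).norm_sq ℝ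
      have hD : C∞ D := contDiff_const.add ((contDiff_const.add contDiff_snd).norm_sq ℝ)
      have hDz : ∀ z : V × E n, D z = (h ^ 2 + ‖ξ + b • z.2‖ ^ 2) / b ^ 2 := by
        intro z
        have : ‖b⁻¹ • ξ + z.2‖ = ‖ξ + b • z.2‖ / b := by
          rw [show b⁻¹ • ξ + z.2 = b⁻¹ • (ξ + b • z.2) by rw [smul_add, smul_smul, inv_mul_cancel₀ hb0.ne', one_smul],
            norm_smul, norm_inv, norm_of_nonneg hb0.le]; ring
        simp only [D, this]; ring
      have hDne : ∀ z, D z ≠ 0 := fun z => by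
        rw [hDz]; exact div_ne_zero (hD0 _) (pow_pos hb0 2).ne'
      have hDi : C∞ fun z => (D z)⁻¹ := hD.inv hDne
      have hD1 : D 0 = 1 := by
        rw [hDz, Prod.snd_zero, smul_zero, add_zero, ← jap_sq, div_self (pow_pos hb0 2).ne']
      have hqz : ∀ z : V × E n, q (Θ + b • z.1, ξ + b • z.2) = 64 * (N z * (D z)⁻¹) := by
        intro z
        have : ‖b⁻¹ • Θ + z.1‖ = ‖Θ + b • z.1‖ / b := by
          rw [show b⁻¹ • Θ + z.1 = b⁻¹ • (Θ + b • z.1) by rw [smul_add, smul_smul, inv_mul_cancel₀ hb0.ne', one_smul],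
            norm_smul, norm_inv, norm_of_nonneg hb0.le]; ring
        rw [hDz]
        simp only [q, N, this]
        field_simp
      have n1 : ‖b⁻¹ • Θ‖ ≤ 1 := by
        rw [norm_smul, norm_inv, norm_of_nonneg hb0.le, inv_mul_le_iff₀ hb0]; linarith
      have n2 : ‖b⁻¹ • ξ‖ ≤ 1 := by
        rw [norm_smul, norm_inv, norm_of_nonneg hb0.le, inv_mul_le_iff₀ hb0, mul_one]; exact norm_le_jap h ξ
      have gN : GB 1 N 0 4 (2 * 20) := by
        have h2 := (GB_norm_sq (κ := 1) zero_le_one (b⁻¹ • Θ))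
        have h3 := GB.comp_affine (a := b⁻¹ • Θ) (T := fst ℝ V (E n)) (u := 0) (R := 2) num!
          (contDiff_norm_sq ℝ) (ContinuousLinearMap.norm_fst_le ℝ V (E n)) (by simpa using h2)
        refine h3.mono num! ?_ num!
        nlinarith [norm_nonneg (b⁻¹ • Θ)]
      have gD : ∀ k, 1 ≤ k → ‖𝒟 k D 0‖ ≤ (5 * ‖D 0‖) * 2 ^ k * k ! ^ (1 : ℝ) := by
        intro k _
        have h2 := (GB_norm_sq (κ := 1) zero_le_one (b⁻¹ • ξ))
        have h3 := GB.comp_affine (a := b⁻¹ • ξ) (T := snd ℝ V (E n)) (u := 0) (R := 2) num!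
          (contDiff_norm_sq ℝ) (ContinuousLinearMap.norm_snd_le ℝ V (E n)) (by simpa using h2)
        have h4 := (GB_const (κ := 1) (R := 2) num! (h ^ 2 / b ^ 2 : ℝ) (0 : V × E n)).add contDiff_const
          ((contDiff_const.add contDiff_snd).norm_sq ℝ) (h3.mono num! le_rfl (by norm_num : (1 : ℝ) * 2 ≤ 2))
        refine (h4.mono num! ?_ le_rfl) k
        rw [hD1, norm_one, mul_one]
        have : ‖h ^ 2 / b ^ 2‖ ≤ 1 := by
          rw [norm_of_nonneg pos!, div_le_one pos!]
          have := le_jap h ξ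
          gcongr
        nlinarith [norm_nonneg (b⁻¹ • ξ)]
      have gI := GB.inv (κ := 1) (M := 5) (R := 2) (L := 20) le_rfl num! num! num!
        num! hD hDi (p := 0) (.of_forall fun z => mul_inv_cancel₀ (hDne z)) gD
      rw [hD1, norm_one, inv_one, mul_one] at gI
      have h2 := GB.comp_gevrey (κ := (1 + κ) / 2) (C := C) (B := B) (M := M) (R := 2 * (2 * 20)) (L := L)
        hκ'.le num! (by norm_num [M]) hC hB (le_max_left _ _) (le_max_right _ _) hϕ (hq.comp haff) (p := 0)
        (fun j => hb j _) (fun k _ => by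
          have h3 := (((gN.mul le_rfl num! hN hDi gI).const_smul (hN.mul hDi) (64 : ℝ))) k
          rw [rpow_one] at h3
          simp only [comp_def, hqz]
          refine h3.trans (le_of_eq ?_)
          rw [Real.norm_ofNat]; simp only [M]; ring)
      exact (h2.upgrade hK).ofReal (hsm.comp haff)
    · refine (GB_zero_of_eventuallyEq hR.le ?_).mono hR.le pos! le_rfl
      have hc : IsOpen {z : V × E n | jap h (ξ + b • z.2) / 8 < ‖Θ + b • z.1‖} :=
        isOpen_lt (((continuous_jap h).comp fun!).div_const 8) fun!
      have : {z : V × E n | jap h (ξ + b • z.2) / 8 < ‖Θ + b • z.1‖} ∈ 𝓝 (0 : V × E n) := by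
        refine hc.mem_nhds ?_
        simp
        linarith
      filter_upwards [this] with z hz'
      rw [hz _ _ (le_of_lt hz'), ofReal_zero]
  · have : ϕ (q (Θ, ξ)) = 1 := by
      apply h1
      simp only [q]
      rw [← jap_sq, ← div_eq_mul_inv, div_le_iff₀ (pow_pos (hj ξ) 2)]
      nlinarith [norm_nonneg Θ]
    simp only [this, Complex.ofReal_one]

end BumpFunctions

section SymbolBounds

variable {Z F : Type} [NormedAddCommGroup Z] [NormedSpace ℝ Z] [NormedAddCommGroup F] [NormedSpace ℝ F]

lemma GB_scl_comp (hR : 0 ≤ R) (hb : 0 < b) (ht : 0 ≤ t) {f : E² n → F} (hf : C∞ f)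
    {q : E² n} (h : GB κ (fun u => f (q + scl n b u)) 0 M R) (T : Z →L[ℝ] E² n)
    (h1 : ∀ z, ‖(T z).1‖ ≤ t * ‖z‖) (h2 : ∀ z, ‖(T z).2‖ ≤ t * b * ‖z‖) :
    GB κ (fun z => f (q + T z)) 0 M (t * R) := by
  have e : ∀ z, T z = scl n b ((scl n b⁻¹).comp T z) := by
    intro z
    rw [comp_apply, scl_apply, scl_apply, smul_smul, mul_inv_cancel₀ hb.ne', one_smul]
  have hn : ‖(scl n b⁻¹).comp T‖ ≤ t := by
    refine opNorm_le_bound _ ht fun z => ?_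
    rw [comp_apply, scl_apply, norm_mk]
    refine max_le (h1 z) ?_
    rw [norm_smul, norm_inv, norm_of_nonneg hb.le, inv_mul_le_iff₀ hb]
    refine (h2 z).trans (le_of_eq (by ring))
  have hfS : C∞ fun u => f (q + scl n b u) := hf.comp (contDiff_const.add (scl n b).contDiff)
  have := GB.comp_affine (a := (0 : E² n)) (T := (scl n b⁻¹).comp T) (u := 0) hR hfS hn (by simpa using h)
  simp only [zero_add] at this
  simp only [e]
  exact this

/-- Removing a scaling by a map with a contractive inverse. -/
lemma GB_unscale (hR : 0 ≤ R) {f : Z → F} (hf : C∞ f) {z₀ : Z} (S S' : Z →L[ℝ] Z)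
    (hS : ∀ z, S (S' z) = z) (hS' : ‖S'‖ ≤ 1) (h : GB κ (fun z => f (z₀ + S z)) 0 M R) : GB κ f z₀ M R := by
  have hfS : C∞ fun z => f (z₀ + S z) := hf.comp (contDiff_const.add S.contDiff)
  have h1 := GB.comp_affine (a := (0 : Z)) (T := S') (u := (0 : Z)) hR hfS hS' (by simpa using h)
  simp only [zero_add, hS, one_mul] at h1
  have h2 := GB.comp_affine (a := -z₀) (T := ContinuousLinearMap.id ℝ Z) (u := z₀) (t := 1) (f := fun z => f (z₀ + z)) hR
    (hf.comp (contDiff_const.add contDiff_id)) norm_id_le (by simpa using h1)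
  simpa using h2

lemma GB_affine (hκ : 0 ≤ κ) (hR : 0 < R) (c : F) (L : Z →L[ℝ] F) :
    GB κ (fun z => c + L z) 0 (‖c‖ + ‖L‖ / R) R := by
  intro k
  have h1 := one_le_fact_rpow k hκ
  have hc := norm_nonneg c
  rcases Nat.eq_zero_or_pos k with rfl | hk
  · rw [norm_iteratedFDeriv_zero, map_zero, add_zero, pow_zero, mul_one]
    have : 0 ≤ ‖L‖ / R := pos!
    calc ‖c‖ ≤ (‖c‖ + ‖L‖ / R) * 1 := lin!
      _ ≤ _ := mono!
  · refine (norm_iteratedFDeriv_linear_le c L 0 hk).trans ?_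
    split_ifs with hk1
    · subst hk1
      have : ‖L‖ = ‖L‖ / R * R ^ 1 * 1 := by field_simp
      calc ‖L‖ = ‖L‖ / R * R ^ 1 * 1 := this
        _ ≤ _ := by gcongr; linarith
    · positivity

/-- Gevrey bounds are stable under averaging over a parameter in `[0, 1]`. -/
lemma GB_integral [FiniteDimensional ℝ Z] [CompleteSpace F] {a : ℝ × Z → F} (ha : C∞ a) {z₀ : Z}
    (h : ∀ t ∈ Icc (0 : ℝ) 1, GB κ (fun z => a (t, z)) z₀ M R) :
    GB κ (fun z => ∫ t in (0 : ℝ)..1, a (t, z)) z₀ M R := by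
  simp only [intervalIntegral.integral_of_le zero_le_one, ← integral_Icc_eq_integral_Ioc]
  have hc : ∀ k, Continuous fun w : ℝ × Z => 𝒟 k (fun z => a (w.1, z)) w.2 :=
    fun k => continuous_iteratedFDeriv_section ha k
  set f : Z → ℝ → F := fun z t => (Icc (0 : ℝ) 1).indicator (fun t => a (t, z)) t
  have hfz : ∀ t ∈ Icc (0 : ℝ) 1, (fun z => f z t) = fun z => a (t, z) := fun t ht => by
    funext z; simp only [f, indicator_of_mem ht]
  have hfz' : ∀ t ∉ Icc (0 : ℝ) 1, (fun z => f z t) = fun _ => 0 := fun t ht => by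
    funext z; simp only [f, indicator_of_notMem ht]
  have hder : ∀ k z t, 𝒟 k (fun z => f z t) z =
      (Icc (0 : ℝ) 1).indicator (fun t => 𝒟 k (fun z => a (t, z)) z) t := by
    intro k z t
    by_cases ht : t ∈ Icc (0 : ℝ) 1
    · rw [hfz t ht, indicator_of_mem ht]
    · rw [hfz' t ht, indicator_of_notMem ht, iteratedFDeriv_fun_zero]; rfl
  have hmain := contDiff_integral_and_iteratedFDeriv (μ := (volume : Measure ℝ)) (f := f)
    (fun t => by
      by_cases ht : t ∈ Icc (0 : ℝ) 1
      · rw [hfz t ht]; exact ha.comp (contDiff_const.prodMk contDiff_id)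
      · rw [hfz' t ht]; exact contDiff_const)
    (fun k z => by
      simp only [hder]
      refine AEStronglyMeasurable.indicator ?_ measurableSet_Icc
      exact ((hc k).comp (continuous_id.prodMk continuous_const)).aestronglyMeasurable)
    (fun k z => by
      obtain ⟨B, hB⟩ := ((isCompact_Icc (a := (0 : ℝ)) (b := 1)).prod (isCompact_closedBall z 1)).bddAbove_image
        (f := fun w : ℝ × Z => ‖𝒟 k (fun z => a (w.1, z)) w.2‖) (hc k).norm.continuousOn
      refine ⟨(Icc (0 : ℝ) 1).indicator fun _ => B, (integrable_indicator_iff measurableSet_Icc).mpr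
        (integrableOn_const isCompact_Icc.measure_lt_top.ne), ?_⟩
      filter_upwards [Metric.closedBall_mem_nhds z one_pos] with z' hz' t
      rw [hder, norm_indicator_eq_indicator_norm]
      by_cases ht : t ∈ Icc (0 : ℝ) 1
      · simp only [indicator_of_mem ht]; exact hB ⟨(t, z'), ⟨ht, hz'⟩, rfl⟩
      · simp only [indicator_of_notMem ht, le_refl])
  intro k
  have e : (fun z => ∫ t in Icc (0 : ℝ) 1, a (t, z)) = fun z => ∫ t, f z t := by
    funext z; rw [← integral_indicator measurableSet_Icc]
  rw [e, hmain.2 k z₀]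
  simp only [hder]
  rw [integral_indicator measurableSet_Icc]
  have := norm_setIntegral_le_of_norm_le_const (μ := (volume : Measure ℝ)) (s := Icc (0 : ℝ) 1)
    (f := fun t => 𝒟 k (fun z => a (t, z)) z₀) (C := M * R ^ k * (k ! : ℝ) ^ κ) (by simp)
    (fun t ht => h t ht k)
  simpa using this

/-- Symbols of order `m`, in terms of total derivatives at the natural scale. -/
structure SymBd (κ R M m h : ℝ) (p : E² n → F) : Prop where
  smooth : C∞ p
  bound : ∀ q, GB κ (fun u => p (q + scl n (jap h q.2) u)) 0 (M * jap h q.2 ^ m) R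

/-- Phases, in terms of total derivatives at the natural scale. -/
structure PhaseBd (κ R ρ h : ℝ) (Λ : E² n → ℝ) : Prop where
  sym : SymBd κ R ρ (1 / κ) h Λ
  symx : ∀ j, SymBd κ R ρ 0 h (dd (ex j) Λ)
  symξ : ∀ j, SymBd κ R ρ (1 / κ - 1) h (dd (eξ j) Λ)

lemma SymBd.mono (hR : 0 ≤ R) {p : E² n → F} (hp : SymBd κ R M m h p) (hR' : R ≤ R')
    (hM : M ≤ M') (hh : 1 ≤ h) : SymBd κ R' M' m h p :=
  ⟨hp.smooth, fun q => (hp.bound q).mono hR (by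
    have := rpow_nonneg (zero_le_one.trans (one_le_jap hh q.2)) m
    gcongr) hR'⟩

lemma SymBd.of_isGevreySymbol (hκ : 0 ≤ κ) (hA : 0 ≤ A) (hh : 1 ≤ h) {p : E n → E n → ℂ}
    (hp : IsGevreySymbol κ A C m h p) : SymBd κ ((2 * n + 1) * A) C m h (unc p) ∧ 0 ≤ C := by
  have hj : ∀ ξ : E n, 0 < jap h ξ := fun ξ => zero_lt_one.trans_le (one_le_jap hh ξ)
  have hC : 0 ≤ C := by
    have h1 := (norm_nonneg _).trans (hp.2 0 0 0 0)
    simp only [len_zero, mfact_zero] at h1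
    simp only [add_zero, pow_zero, mul_one, one_rpow] at h1
    exact nonneg_of_mul_nonneg_left h1 (rpow_pos_of_pos (hj 0) _)
  have hs : C∞ (unc p) := hp.1
  refine ⟨⟨hs, fun q => ?_⟩, hC⟩
  refine GB_scl_of_bound hκ hA (mul_nonneg hC (rpow_nonneg (hj _).le _)) (hj _) hs fun α β => ?_
  rw [← dξ_dx_eq (a := p) hp.1 α β q.1 q.2]
  refine (hp.2 α β q.1 q.2).trans (le_of_eq ?_)
  rw [sub_eq_add_neg, rpow_add (hj _)]; ring

lemma mfact_add_single_rpow_le (hκ : 0 ≤ κ) (β : MIdx n) (j : Fin n) :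
    mfact (β + Pi.single j 1) ^ κ ≤ ((2 : ℝ) ^ κ) ^ len β * mfact β ^ κ := by
  rw [mfact_add_single, mul_rpow pos! (mfact_pos β).le, ← rpow_natCast, ← rpow_mul num!,
    mul_comm κ, rpow_mul num!, rpow_natCast]
  gcongr
  · exact rpow_nonneg (mfact_pos β).le _
  · calc (β j : ℝ) + 1 ≤ (len β : ℝ) + 1 := by
          gcongr; exact single_le_sum (f := β) (fun i _ => Nat.zero_le _) (mem_univ j)
      _ ≤ 2 ^ len β := succ_le_two_pow _

lemma PhaseBd.of_isAdmissiblePhase (hκ : 1 ≤ κ) (hA : 0 < A) (hh : 1 ≤ h) {Λ : E n → E n → ℝ}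
    (hΛ : IsAdmissiblePhase κ A ρ h Λ) :
    PhaseBd κ (2 ^ κ * ((2 * n + 1) * A)) (ρ * (1 + (2 * n + 1) * A)) h (unc Λ) ∧ 0 ≤ ρ := by
  have hκ0 : 0 ≤ κ := lin!
  have hj : ∀ ξ : E n, 0 < jap h ξ := fun ξ => zero_lt_one.trans_le (one_le_jap hh ξ)
  obtain ⟨hs₀, hb0, hbx⟩ := hΛ
  have hs : C∞ (unc Λ) := hs₀
  have h2κ : (1 : ℝ) ≤ 2 ^ κ := one_le_rpow num! hκ0
  have hρ : 0 ≤ ρ := by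
    have h1 := (abs_nonneg _).trans (hb0 0 0 0)
    simp only [len_zero, mfact_zero] at h1
    simp only [pow_zero, mul_one, one_rpow] at h1
    exact nonneg_of_mul_nonneg_left h1 (rpow_pos_of_pos (hj 0) _)
  have h0 : SymBd κ ((2 * n + 1) * A) ρ (1 / κ) h (unc Λ) := by
    refine ⟨hs, fun q => GB_scl_of_bound hκ0 hA.le (mul_nonneg hρ (rpow_nonneg (hj _).le _)) (hj _) hs fun α β => ?_⟩
    rw [← dξ_dx_eq (a := Λ) hs α β q.1 q.2, norm_eq_abs]
    have e : ρ * jap h q.2 ^ (1 / κ) * A ^ (len α + len β) * mfact α ^ κ * mfact β ^ κ * jap h q.2 ^ (-(len α : ℝ)) =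
        ρ * A ^ (len α + len β) * mfact α ^ κ * mfact β ^ κ * jap h q.2 ^ (1 / κ - len α) := by
      rw [sub_eq_add_neg, rpow_add (hj _)]; ring
    rw [e]
    by_cases hβ : β = 0
    · subst hβ
      have e1 : dx (0 : MIdx n) Λ = Λ := by
        funext x ξ; rw [dx_eq hs, mdd_zero]; rfl
      rw [e1]
      simpa only [len_zero, mfact_zero, add_zero, one_rpow, mul_one] using hb0 α q.1 q.2
    · refine (hbx α β q.1 q.2 hβ).trans ?_
      have h1 := rpow_nonneg (mfact_pos α).le κ
      have h2 := rpow_nonneg (mfact_pos β).le κ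
      have h3 : (0 : ℝ) ≤ 1 / κ := pos!
      gcongr
      · exact one_le_jap hh _
      · linarith
  have hR0 : 0 ≤ (2 * (n : ℝ) + 1) * A := pos!
  have hR1 : (2 * (n : ℝ) + 1) * A ≤ 2 ^ κ * ((2 * n + 1) * A) := by nlinarith
  have hA1 : A ≤ (2 * n + 1) * A := by nlinarith [(cast_nonneg n : (0 : ℝ) ≤ n)]
  refine ⟨⟨h0.mono hR0 hR1 (by nlinarith) hh, fun j => ?_, fun j => ?_⟩, hρ⟩
  · have hx : SymBd κ ((2 * n + 1) * (2 ^ κ * A)) (ρ * A) 0 h (dd (ex j) (unc Λ)) := by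
      refine ⟨contDiff_dd hs _, fun q => GB_scl_of_bound hκ0 pos! (by
        positivity) (hj _) (contDiff_dd hs _) fun α β => ?_⟩
      rw [← dd_mdd_comm ex β hs (ex j), dd_mdd ex β j hs, ← dξ_dx_eq (a := Λ) hs α _ q.1 q.2]
      refine (hbx α _ q.1 q.2 ?_).trans ?_
      · intro h; have := congrFun h j; simp at this
      · rw [len_add_single, Real.rpow_zero, mul_one]
        have h1 := rpow_nonneg (mfact_pos α).le κ
        have h2 := rpow_nonneg (hj q.2).le (-(len α : ℝ))
        have h4 := rpow_nonneg (mfact_pos β).le κ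
        calc _ ≤ ρ * A ^ (len α + (len β + 1)) * mfact α ^ κ * (((2 : ℝ) ^ κ) ^ len β * mfact β ^ κ) *
              jap h q.2 ^ (-(len α : ℝ)) := by gcongr; exact mfact_add_single_rpow_le hκ0 β j
          _ ≤ ρ * A ^ (len α + (len β + 1)) * mfact α ^ κ * (((2 : ℝ) ^ κ) ^ (len α + len β) * mfact β ^ κ) *
              jap h q.2 ^ (-(len α : ℝ)) := by gcongr; omega
          _ = _ := by rw [mul_pow]; ring
    refine hx.mono pos! (le_of_eq (by ring)) ?_ hh
    gcongr; linarith
  · refine ⟨contDiff_dd hs _, fun q => ?_⟩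
    set b := jap h q.2
    have hb : 0 < b := hj _
    have hsS : C∞ fun u => unc Λ (q + scl n b u) := hs.comp (contDiff_const.add (scl n b).contDiff)
    have h1 := (h0.bound q).dd hκ0 hR0 hsS (eξ j)
    have e1 : dd (eξ j) (fun u => unc Λ (q + scl n b u)) = fun u => b • dd (eξ j) (unc Λ) (q + scl n b u) := by
      rw [dd_comp_affine hs, scl_eξ]
      funext u; rw [dd_smul_dir]
    have hsm : C∞ fun u => dd (eξ j) (unc Λ) (q + scl n b u) :=
      (contDiff_dd hs _).comp (contDiff_const.add (scl n b).contDiff)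
    rw [e1] at h1
    have h2 := h1.const_smul (contDiff_const.mul hsm) b⁻¹
    simp only [← mul_assoc, inv_mul_cancel₀ hb.ne', one_mul] at h2
    refine h2.mono pos! ?_ (le_of_eq (by ring))
    have hn := norm_eξ_le (n := n) j
    rw [norm_inv, norm_of_nonneg hb.le, Real.rpow_sub_one hb.ne']
    calc b⁻¹ * ‖(eξ j : E² n)‖ * ρ * b ^ (1 / κ) * (2 * n + 1) * A
        ≤ b⁻¹ * 1 * ρ * b ^ (1 / κ) * (2 * n + 1) * A := mono!
      _ = ρ * ((2 * n + 1) * A) * (b ^ (1 / κ) / b) := by ring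
      _ ≤ _ := by gcongr; linarith

end SymbolBounds

section Amplitude

/-- The phase space of the oscillatory variables. -/
abbrev V2 (n : ℕ) : Type := WithLp 2 (E² n)

/-- The two components of a point of `V2 n`. -/
def pr1 : V2 n →L[ℝ] E n := WithLp.fstL 2 ℝ (E n) (E n)

def pr2 : V2 n →L[ℝ] E n := WithLp.sndL 2 ℝ (E n) (E n)

lemma norm_pr1_le (Y : V2 n) : ‖pr1 Y‖ ≤ ‖Y‖ := WithLp.norm_fst_le _ Y

lemma norm_pr2_le (Y : V2 n) : ‖pr2 Y‖ ≤ ‖Y‖ := WithLp.norm_snd_le _ Y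

/-- The variables `(Y, Θ, (x, ξ))` of the amplitude. -/
abbrev Z3 (n : ℕ) : Type := V2 n × V2 n × (E² n)

def cY : Z3 n →L[ℝ] V2 n := fst ℝ _ _

def cΘ : Z3 n →L[ℝ] V2 n := (fst ℝ _ _).comp (snd ℝ (V2 n) _)

def cq : Z3 n →L[ℝ] E² n := (snd ℝ _ _).comp (snd ℝ (V2 n) _)

lemma norm_cY_le (z : Z3 n) : ‖cY z‖ ≤ ‖z‖ := norm_fst_le z

lemma norm_cΘ_le (z : Z3 n) : ‖cΘ z‖ ≤ ‖z‖ := (norm_fst_le z.2).trans (norm_snd_le z)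

lemma norm_cq_le (z : Z3 n) : ‖cq z‖ ≤ ‖z‖ := (norm_snd_le z.2).trans (norm_snd_le z)

/-- The map `(x + s z, ξ + τ + t θ)`, where `Y = (y, z)` and `Θ = (θ, τ)`. -/
def pathL (s t : ℝ) : Z3 n →L[ℝ] E² n :=
  ((fst ℝ _ _).comp cq + s • pr2.comp cY).prod
    ((snd ℝ _ _).comp cq + pr2.comp cΘ + t • pr1.comp cΘ)

lemma pathL_apply (s t : ℝ) (z : Z3 n) :
    pathL s t z = (z.2.2.1 + s • pr2 z.1, z.2.2.2 + pr2 z.2.1 + t • pr1 z.2.1) := rfl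

/-- The map `(x + y, ξ + τ)`. -/
def shiftL : Z3 n →L[ℝ] E² n :=
  ((fst ℝ _ _).comp cq + pr1.comp cY).prod
    ((snd ℝ _ _).comp cq + pr2.comp cΘ)

lemma shiftL_apply (z : Z3 n) : shiftL z = (z.2.2.1 + pr1 z.1, z.2.2.2 + pr2 z.2.1) := rfl

/-- The amplitude `e^{Λ(x, ξ+τ+θ)} p(x+y, ξ+τ) e^{-Λ(x+z, ξ+τ)}`. -/
def amp (Λ : E² n → ℝ) (p : E² n → ℂ) (z : Z3 n) : ℂ :=
  (exp (Λ (pathL 0 1 z) - Λ (pathL 1 0 z)) : ℝ) * p (shiftL z)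

/-- Scaling of the variables `(Y, Θ, (x, ξ))`. -/
def sclZ (β c : ℝ) : Z3 n →L[ℝ] Z3 n := cY.prod ((β • cΘ).prod ((scl n c).comp cq))

lemma sclZ_apply (β c : ℝ) (z : Z3 n) : sclZ β c z = (z.1, β • z.2.1, (z.2.2.1, c • z.2.2.2)) := rfl

lemma norm_pathL_sclZ_fst_le (hs : |s| ≤ 1) (t β c : ℝ) (z : Z3 n) :
    ‖(pathL s t (sclZ β c z)).1‖ ≤ 2 * ‖z‖ := by
  rw [pathL_apply, sclZ_apply]
  have h1 : ‖z.2.2.1‖ ≤ ‖z‖ := (norm_fst_le z.2.2).trans (norm_cq_le z)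
  have h2 : ‖s • pr2 z.1‖ ≤ ‖z‖ := by
    rw [norm_smul]
    exact (mul_le_of_le_one_left (norm_nonneg _) hs).trans ((norm_pr2_le _).trans (norm_cY_le z))
  refine (norm_add_le _ _).trans ?_
  linarith

lemma norm_pathL_sclZ_snd_le (s : ℝ) (ht : |t| ≤ 1) (hβ : 0 ≤ β) (hc : 0 ≤ c) (z : Z3 n) :
    ‖(pathL s t (sclZ β c z)).2‖ ≤ (c + 2 * β) * ‖z‖ := by
  rw [pathL_apply, sclZ_apply]
  simp only [map_smul]
  have h1 : ‖c • z.2.2.2‖ ≤ c * ‖z‖ := by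
    rw [norm_smul, norm_of_nonneg hc]
    have : ‖z.2.2.2‖ ≤ ‖z‖ := (norm_snd_le z.2.2).trans (norm_cq_le z)
    gcongr
  have h2 : ‖β • pr2 z.2.1‖ ≤ β * ‖z‖ := by
    rw [norm_smul, norm_of_nonneg hβ]
    have := (norm_pr2_le _).trans (norm_cΘ_le z)
    exact mul_le_mul_of_nonneg_left this hβ
  have h3 : ‖t • β • pr1 z.2.1‖ ≤ β * ‖z‖ := by
    rw [norm_smul, norm_smul, norm_of_nonneg hβ]
    refine (mul_le_of_le_one_left pos! ht).trans ?_
    have := (norm_pr1_le _).trans (norm_cΘ_le z)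
    exact mul_le_mul_of_nonneg_left this hβ
  refine (norm_add₃_le).trans ?_
  linarith

lemma norm_shiftL_sclZ_fst_le (β c : ℝ) (z : Z3 n) : ‖(shiftL (sclZ β c z)).1‖ ≤ 2 * ‖z‖ := by
  rw [shiftL_apply, sclZ_apply]
  have h1 : ‖z.2.2.1‖ ≤ ‖z‖ := (norm_fst_le z.2.2).trans (norm_cq_le z)
  have h2 : ‖pr1 z.1‖ ≤ ‖z‖ := (norm_pr1_le _).trans (norm_cY_le z)
  refine (norm_add_le _ _).trans ?_
  linarith

lemma norm_shiftL_sclZ_snd_le (hβ : 0 ≤ β) (hc : 0 ≤ c) (z : Z3 n) :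
    ‖(shiftL (sclZ β c z)).2‖ ≤ (c + 2 * β) * ‖z‖ := by
  have := norm_pathL_sclZ_snd_le (t := 0) 0 (by simp) hβ hc z
  simpa [pathL_apply, shiftL_apply] using this

lemma contDiff_amp (hΛ : C∞ Λ) (hp : C∞ p) :
    C∞ (amp Λ p) :=
  (ofRealCLM.contDiff.comp ((hΛ.comp (pathL 0 1).contDiff).sub (hΛ.comp (pathL 1 0).contDiff)).exp).mul
    (hp.comp shiftL.contDiff)

lemma jap_add_le (h : ℝ) (ξ η : E n) : jap h (ξ + η) ≤ jap h ξ + ‖η‖ := by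
  have h0 : 0 ≤ jap h ξ := sqrt_nonneg _
  have h1 := norm_le_jap h ξ
  have h2 := norm_add_le ξ η
  have h3 := norm_nonneg η
  refine Real.sqrt_le_iff.mpr ⟨pos!, ?_⟩
  have := jap_sq n h ξ
  have h5 : ‖ξ + η‖ ^ 2 ≤ (‖ξ‖ + ‖η‖) ^ 2 := mono!
  nlinarith

lemma jap_le_add (h : ℝ) (ξ η : E n) : jap h ξ ≤ jap h (ξ + η) + ‖η‖ := by
  have := jap_add_le h (ξ + η) (-η)
  rwa [add_neg_cancel_right, norm_neg] at this

lemma GB_amp_of_phase (hκ : 1 ≤ κ) (ht : 0 < t) (hR : 0 < R) (hΛ : C∞ Λ) (hh : 1 ≤ h)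
    (hp : SymBd κ R M m h p) {z₀ : Z3 n} (hβ : 0 ≤ β) (hc : 0 ≤ c) (h2t : 2 ≤ t)
    (h3 : c + 2 * β ≤ t * jap h (z₀.2.2.2 + pr2 z₀.2.1))
    (hg : GB κ (fun z => Λ (pathL 0 1 (z₀ + sclZ β c z)) - Λ (pathL 1 0 (z₀ + sclZ β c z))) 0 N (2 * t * R)) :
    GB κ (fun z => amp Λ p (z₀ + sclZ β c z)) 0
      (exp (2 * N) * (M * jap h (z₀.2.2.2 + pr2 z₀.2.1) ^ m)) (8 * t * R) := by
  have hN := hg.nonneg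
  have hj : ∀ ξ : E n, 0 < jap h ξ := fun ξ => zero_lt_one.trans_le (one_le_jap hh ξ)
  have hgs : C∞ fun z => Λ (pathL 0 1 (z₀ + sclZ β c z)) - Λ (pathL 1 0 (z₀ + sclZ β c z)) :=
    (hΛ.comp ((pathL 0 1).contDiff.comp (contDiff_const.add (sclZ β c).contDiff))).sub
      (hΛ.comp ((pathL 1 0).contDiff.comp (contDiff_const.add (sclZ β c).contDiff)))
  have h1 := GB.exp hκ pos! hN hgs (p := 0) (fun k _ => hg k)
  have h2 := (h1.mono pos! (exp_le_exp.mpr (by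
    have := (le_abs_self _).trans hg.norm_le
    show _ ≤ 2 * N
    linarith)) le_rfl).ofReal hgs.exp
  have hpS : GB κ (fun z => p (shiftL z₀ + (shiftL.comp (sclZ β c)) z)) 0
      (M * jap h (z₀.2.2.2 + pr2 z₀.2.1) ^ m) (t * R) :=
    GB_scl_comp (q := shiftL z₀) hR.le (hj (z₀.2.2.2 + pr2 z₀.2.1)) ht.le hp.smooth (hp.bound (shiftL z₀)) _
      (fun z => (norm_shiftL_sclZ_fst_le β c z).trans mono!)
      (fun z => (norm_shiftL_sclZ_snd_le hβ hc z).trans mono!)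
  have hps : C∞ fun z => p (shiftL z₀ + (shiftL.comp (sclZ β c)) z) :=
    hp.smooth.comp (contDiff_const.add (shiftL.comp (sclZ β c)).contDiff)
  have h4 := h2.mul hκ pos! (ofRealCLM.contDiff.comp hgs.exp) hps
    (hpS.mono pos! le_rfl (show t * R ≤ 2 * (2 * t * R) by nlinarith))
  have e : (fun z => amp Λ p (z₀ + sclZ β c z)) = fun z =>
      ((exp (Λ (pathL 0 1 (z₀ + sclZ β c z)) - Λ (pathL 1 0 (z₀ + sclZ β c z))) : ℝ) : ℂ) *
        p (shiftL z₀ + (shiftL.comp (sclZ β c)) z) := by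
    funext z; simp only [amp, map_add, comp_apply]
  rw [e]
  exact h4.mono pos! le_rfl (le_of_eq (by ring))

/-- Bounds for the amplitude which do not use the cancellation in the phase. -/
lemma GB_amp_lossy (hκ : 1 ≤ κ) (hR : 0 < R) (hh : 1 ≤ h)
    (hΛ : PhaseBd κ R ρ h Λ) (hp : SymBd κ R M m h p) {z₀ : Z3 n} (hβ : 0 ≤ β) (hc : 0 ≤ c) (h2t : 2 ≤ t)
    (h3 : c + 2 * β ≤ t * jap h (z₀.2.2.2 + pr2 z₀.2.1))
    (h3' : c + 2 * β ≤ t * jap h (z₀.2.2.2 + pr2 z₀.2.1 + pr1 z₀.2.1)) :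
    GB κ (fun z => amp Λ p (z₀ + sclZ β c z)) 0
      (exp (2 * (ρ * jap h (z₀.2.2.2 + pr2 z₀.2.1 + pr1 z₀.2.1) ^ (1 / κ) +
        ρ * jap h (z₀.2.2.2 + pr2 z₀.2.1) ^ (1 / κ))) * (M * jap h (z₀.2.2.2 + pr2 z₀.2.1) ^ m)) (8 * t * R) := by
  have ht : 0 < t := lin!
  have hj : ∀ ξ : E n, 0 < jap h ξ := fun ξ => zero_lt_one.trans_le (one_le_jap hh ξ)
  have hΛs := hΛ.sym.smooth
  refine GB_amp_of_phase hκ ht hR hΛs hh hp hβ hc h2t h3 ?_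
  have key : ∀ s t' : ℝ, |s| ≤ 1 → |t'| ≤ 1 → c + 2 * β ≤ t * jap h (pathL s t' z₀).2 →
      GB κ (fun z => Λ (pathL s t' z₀ + ((pathL s t').comp (sclZ β c)) z)) 0
        (ρ * jap h (pathL s t' z₀).2 ^ (1 / κ)) (t * R) := fun s t' hs ht' h4 =>
    GB_scl_comp hR.le (hj _) ht.le hΛs (hΛ.sym.bound _) _
      (fun z => (norm_pathL_sclZ_fst_le hs t' β c z).trans mono!)
      (fun z => (norm_pathL_sclZ_snd_le s ht' hβ hc z).trans mono!)
  have k1 := key 0 1 (by simp) (by simp) (by simpa [pathL_apply] using h3')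
  have k2 := key 1 0 (by simp) (by simp) (by simpa [pathL_apply] using h3)
  have sm : ∀ s t' : ℝ, C∞ fun z => Λ (pathL s t' z₀ + ((pathL s t').comp (sclZ β c)) z) := fun s t' =>
    hΛs.comp (contDiff_const.add ((pathL s t').comp (sclZ β c)).contDiff)
  have h5 := (k1.sub (sm 0 1) (sm 1 0) k2).mono pos! le_rfl (show t * R ≤ 2 * t * R by nlinarith)
  simpa [pathL_apply, map_add] using h5

/-- The derivative of the phase along the path `t ↦ (x + (1-t) z, ξ + τ + t θ)`. -/
def phaseInt (Λ : E² n → ℝ) (w : ℝ × Z3 n) : ℝ := ∑ j,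
  ((pr1 w.2.2.1) j * dd (eξ j) Λ (pathL (1 - w.1) w.1 w.2) - (pr2 w.2.1) j * dd (ex j) Λ (pathL (1 - w.1) w.1 w.2))

/-- The phase difference as an integral. -/
lemma phase_eq_integral (hΛ : C∞ Λ) (z : Z3 n) :
    Λ (pathL 0 1 z) - Λ (pathL 1 0 z) = ∫ t in (0 : ℝ)..1, phaseInt Λ (t, z) := by
  have hd : ∀ t : ℝ, HasDerivAt (fun t : ℝ => Λ (pathL (1 - t) t z)) (phaseInt Λ (t, z)) t := by
    intro t
    have h1 : HasDerivAt (fun t : ℝ => pathL (1 - t) t z) (-pr2 z.1, pr1 z.2.1) t := by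
      simp only [pathL_apply]
      have a1 : HasDerivAt (fun t : ℝ => z.2.2.1 + (1 - t) • pr2 z.1) (-pr2 z.1) t := by
        simpa using (((hasDerivAt_id t).const_sub 1).smul_const (pr2 z.1)).const_add z.2.2.1
      have a2 : HasDerivAt (fun t : ℝ => z.2.2.2 + pr2 z.2.1 + t • pr1 z.2.1) (pr1 z.2.1) t := by
        simpa using ((hasDerivAt_id t).smul_const (pr1 z.2.1)).const_add (z.2.2.2 + pr2 z.2.1)
      exact a1.prodMk a2
    have h2 := ((hΛ.differentiable (by simp)) (pathL (1 - t) t z)).hasFDerivAt.comp_hasDerivAt t h1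
    refine h2.congr_deriv ?_
    simp only [phaseInt]
    rw [prod_eq_sum ((-pr2 z.1, pr1 z.2.1) : E² n), map_sum, sum_sum_type, ← Finset.sum_add_distrib]
    refine sum_congr rfl fun j _ => ?_
    simp only [elim_inl, elim_inr, map_smul, smul_eq_mul, dd, PiLp.neg_apply]
    ring
  have hc : Continuous fun t : ℝ => phaseInt Λ (t, z) := by
    simp only [phaseInt]
    have hp : Continuous fun t : ℝ => pathL (1 - t) t z := by
      simp only [pathL_apply]; fun_prop
    refine continuous_finsetSum _ fun j _ => ?_
    exact (continuous_const.mul ((contDiff_dd hΛ _).continuous.comp hp)).sub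
      (continuous_const.mul ((contDiff_dd hΛ _).continuous.comp hp))
  rw [intervalIntegral.integral_eq_sub_of_hasDerivAt (fun t _ => hd t) (hc.intervalIntegrable _ _)]
  simp

lemma contDiff_phase_integrand (hΛ : C∞ Λ) : C∞ (phaseInt Λ) := by
  have hp : C∞ fun w : ℝ × Z3 n => pathL (1 - w.1) w.1 w.2 := by
    simp only [pathL_apply]
    have h1 : C∞ fun w : ℝ × Z3 n => pr2 w.2.1 := pr2.contDiff.comp contDiff_snd.fst
    have h2 : C∞ fun w : ℝ × Z3 n => pr2 w.2.2.1 := pr2.contDiff.comp contDiff_snd.snd.fst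
    have h3 : C∞ fun w : ℝ × Z3 n => pr1 w.2.2.1 := pr1.contDiff.comp contDiff_snd.snd.fst
    exact (contDiff_snd.snd.snd.fst.add ((contDiff_const.sub contDiff_fst).smul h1)).prodMk
      ((contDiff_snd.snd.snd.snd.add h2).add (contDiff_fst.smul h3))
  refine ContDiff.sum fun j _ => ?_
  have h2 : C∞ fun w : ℝ × Z3 n => (pr2 w.2.1) j :=
    (proj (𝕜 := ℝ) j).contDiff.comp (pr2.contDiff.comp contDiff_snd.fst)
  have h3 : C∞ fun w : ℝ × Z3 n => (pr1 w.2.2.1) j :=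
    (proj (𝕜 := ℝ) j).contDiff.comp (pr1.contDiff.comp contDiff_snd.snd.fst)
  exact (h3.mul ((contDiff_dd hΛ _).comp hp)).sub (h2.mul ((contDiff_dd hΛ _).comp hp))

lemma GB_coord (hκ : 0 ≤ κ) (hr : 0 < r) (T : Z3 n →L[ℝ] E n) (v : E n) (j : Fin n) (hβ : 0 ≤ β)
    (hT : ∀ z, ‖T z‖ ≤ β * ‖z‖) : GB κ (fun z => (v + T z) j) 0 (‖v‖ + β / r) r := by
  have h := GB_affine hκ hr (v j) ((proj (𝕜 := ℝ) j).comp T)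
  refine h.mono hr.le ?_ le_rfl
  gcongr
  · exact PiLp.norm_apply_le v j
  · refine opNorm_le_bound _ hβ fun z => ?_
    exact (PiLp.norm_apply_le (T z) j).trans (hT z)

lemma GB_phase_integrand (hκ : 1 ≤ κ) (hR : 0 < R) (hρ : 0 ≤ ρ) (hh : 1 ≤ h) (hΛ : PhaseBd κ R ρ h Λ) {z₀ : Z3 n}
    (hΘ : ‖z₀.2.1‖ ≤ jap h z₀.2.2.2 / 4) (hbd : b = jap h z₀.2.2.2) (hβd : β = b ^ (1 - 1 / κ)) (ht : t ∈ Icc (0 : ℝ) 1) :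
    GB κ (fun z => phaseInt Λ (t, z₀ + sclZ β b z)) 0
      (2 * n * ρ * (‖z₀.2.1‖ * b ^ (1 / κ - 1) + ‖z₀.1‖ + 1 / R)) (2 * 6 * R) := by
  have hκ0 : 0 ≤ κ := lin!
  have hb1 : 1 ≤ b := hbd ▸ one_le_jap hh _
  have hb : 0 < b := lin!
  have h1κ : 1 / κ ≤ 1 := by rw [div_le_one lin!]; exact hκ
  have h1κ' : 0 ≤ 1 / κ := pos!
  have hβ : 0 ≤ β := by rw [hβd]; positivity
  have hβb : β ≤ b := by
    rw [hβd]
    conv_rhs => rw [← rpow_one b]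
    exact rpow_le_rpow_of_exponent_le hb1 lin!
  have hβ1 : β * b ^ (1 / κ - 1) = 1 := by
    rw [hβd, ← rpow_add hb]; norm_num
  have hΛs := hΛ.sym.smooth
  set S := sclZ (n := n) β b
  rw [← hbd] at hΘ
  have ht1 : |1 - t| ≤ 1 := abs_le.mpr ⟨by linarith [ht.2], by linarith [ht.1]⟩
  have ht2 : |t| ≤ 1 := abs_le.mpr ⟨by linarith [ht.1], ht.2⟩
  set q := pathL (1 - t) t z₀
  have hbq : b / 2 ≤ jap h q.2 := by
    have h1 := jap_le_add h z₀.2.2.2 (pr2 z₀.2.1 + t • pr1 z₀.2.1)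
    rw [← hbd] at h1
    have h2 : ‖pr2 z₀.2.1 + t • pr1 z₀.2.1‖ ≤ b / 2 := by
      refine (norm_add_le _ _).trans ?_
      have h3 := (norm_pr2_le z₀.2.1).trans hΘ
      have h4 : ‖t • pr1 z₀.2.1‖ ≤ b / 4 := by
        rw [norm_smul]
        exact (mul_le_of_le_one_left (norm_nonneg _) ht2).trans ((norm_pr1_le z₀.2.1).trans hΘ)
      linarith
    have h5 : q.2 = z₀.2.2.2 + (pr2 z₀.2.1 + t • pr1 z₀.2.1) := by
      simp only [q, pathL_apply]; rw [add_assoc]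
    rw [h5]; linarith
  have hbq0 : 0 < jap h q.2 := lin!
  set T := (pathL (1 - t) t).comp S
  have hcomp : ∀ {f : E² n → ℝ} {N μ : ℝ}, SymBd κ R N μ h f →
      GB κ (fun z => f (pathL (1 - t) t (z₀ + S z))) 0 (N * jap h q.2 ^ μ) (6 * R) := by
    intro f N μ hf
    have := GB_scl_comp (t := 6) (q := q) hR.le hbq0 num! hf.smooth (hf.bound q) T
      (fun z => (norm_pathL_sclZ_fst_le ht1 t β b z).trans (by gcongr; norm_num))
      (fun z => (norm_pathL_sclZ_snd_le (1 - t) ht2 hβ hb.le z).trans (by gcongr; linarith))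
    simpa only [map_add, T, q, comp_apply] using this
  have hsm : ∀ {f : E² n → ℝ}, C∞ f → C∞ fun z => f (pathL (1 - t) t (z₀ + S z)) := fun hf =>
    hf.comp ((pathL (1 - t) t).contDiff.comp (contDiff_const.add S.contDiff))
  have hc1 : ∀ j, GB κ (fun z => (pr1 (z₀ + S z).2.1) j) 0 (‖z₀.2.1‖ + β / (6 * R)) (6 * R) := by
    intro j
    have := GB_coord hκ0 (show 0 < 6 * R by positivity) (pr1.comp (β • cΘ)) (pr1 z₀.2.1) j hβ (fun z => by
      rw [comp_apply]
      refine (norm_pr1_le _).trans ?_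
      have : (β • cΘ) z = β • z.2.1 := rfl
      rw [this, norm_smul, norm_of_nonneg hβ]
      exact mul_le_mul_of_nonneg_left (norm_cΘ_le z) hβ)
    have e : (fun z => (pr1 (z₀ + S z).2.1) j) = fun z => (pr1 z₀.2.1 + (pr1.comp (β • cΘ)) z) j := by
      funext z
      have : (z₀ + S z).2.1 = z₀.2.1 + β • z.2.1 := rfl
      rw [this, map_add]; rfl
    rw [e]
    exact this.mono pos! (add_le_add (norm_pr1_le _) le_rfl) le_rfl
  have hc2 : ∀ j, GB κ (fun z => (pr2 (z₀ + S z).1) j) 0 (‖z₀.1‖ + 1 / (6 * R)) (6 * R) := by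
    intro j
    have := GB_coord hκ0 (show 0 < 6 * R by positivity) (pr2.comp cY) (pr2 z₀.1) j zero_le_one (fun z => by
      rw [comp_apply, one_mul]
      exact (norm_pr2_le _).trans (norm_cY_le z))
    have e : (fun z => (pr2 (z₀ + S z).1) j) = fun z => (pr2 z₀.1 + (pr2.comp cY) z) j := by
      funext z
      have : (z₀ + S z).1 = z₀.1 + z.1 := rfl
      rw [this, map_add]; rfl
    rw [e]
    exact this.mono pos! (add_le_add (norm_pr2_le _) le_rfl) le_rfl
  have hs1 : ∀ j, C∞ fun z => (pr1 (z₀ + S z).2.1) j := fun j =>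
    (proj (𝕜 := ℝ) j).contDiff.comp (pr1.contDiff.comp (contDiff_const.add S.contDiff).snd.fst)
  have hs2 : ∀ j, C∞ fun z => (pr2 (z₀ + S z).1) j := fun j =>
    (proj (𝕜 := ℝ) j).contDiff.comp (pr2.contDiff.comp (contDiff_const.add S.contDiff).fst)
  have hsum := GB.sum (κ := κ) (R := 2 * (6 * R)) (u := 0) pos! univ
    (f := fun (j : Fin n) z => (pr1 (z₀ + S z).2.1) j * dd (eξ j) Λ (pathL (1 - t) t (z₀ + S z)) -
      (pr2 (z₀ + S z).1) j * dd (ex j) Λ (pathL (1 - t) t (z₀ + S z)))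
    (M := fun _ => (‖z₀.2.1‖ + β / (6 * R)) * (ρ * jap h q.2 ^ (1 / κ - 1)) +
      (‖z₀.1‖ + 1 / (6 * R)) * (ρ * jap h q.2 ^ (0 : ℝ)))
    (fun j _ => ((hs1 j).mul (hsm (contDiff_dd hΛs _))).sub ((hs2 j).mul (hsm (contDiff_dd hΛs _))))
    (fun j _ => ((hc1 j).mul hκ pos! (hs1 j) (hsm (contDiff_dd hΛs _)) (hcomp (hΛ.symξ j))).sub
      ((hs1 j).mul (hsm (contDiff_dd hΛs _))) ((hs2 j).mul (hsm (contDiff_dd hΛs _)))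
      ((hc2 j).mul hκ pos! (hs2 j) (hsm (contDiff_dd hΛs _)) (hcomp (hΛ.symx j))))
  refine hsum.mono pos! ?_ (le_of_eq (by ring))
  rw [sum_const, card_univ, card_fin, nsmul_eq_mul, Real.rpow_zero, mul_one]
  have hq : jap h q.2 ^ (1 / κ - 1) ≤ 2 * b ^ (1 / κ - 1) := by
    calc jap h q.2 ^ (1 / κ - 1) ≤ (b / 2) ^ (1 / κ - 1) :=
          Real.rpow_le_rpow_of_nonpos pos! hbq lin!
      _ = b ^ (1 / κ - 1) * 2 ^ (1 - 1 / κ) := by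
          rw [div_rpow hb.le num!, div_eq_mul_inv, ← rpow_neg num!, neg_sub]
      _ ≤ b ^ (1 / κ - 1) * 2 := by
          gcongr
          conv_rhs => rw [← rpow_one 2]
          exact rpow_le_rpow_of_exponent_le num! lin!
      _ = _ := by ring
  calc _ ≤ n * ((‖z₀.2.1‖ + β / (6 * R)) * (ρ * (2 * b ^ (1 / κ - 1))) + (‖z₀.1‖ + 1 / (6 * R)) * ρ) := mono!
    _ = n * ρ * (2 * (‖z₀.2.1‖ * b ^ (1 / κ - 1)) + ‖z₀.1‖ + (2 * (β * b ^ (1 / κ - 1)) + 1) * (1 / (6 * R))) := by ring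
    _ = n * ρ * (2 * (‖z₀.2.1‖ * b ^ (1 / κ - 1)) + ‖z₀.1‖ + 1 / (2 * R)) := by
        rw [hβ1]; congr 2; field_simp; norm_num
    _ ≤ n * ρ * (2 * (‖z₀.2.1‖ * b ^ (1 / κ - 1)) + 2 * ‖z₀.1‖ + 2 * (1 / R)) := by
        gcongr
        · linarith [norm_nonneg z₀.1]
        · rw [one_div, one_div, mul_inv]
          have : 0 < R⁻¹ := pos!
          linarith
    _ = _ := by ring

lemma GB_phase_near (hκ : 1 ≤ κ) (hR : 0 < R) (hρ : 0 ≤ ρ) (hh : 1 ≤ h) (hΛ : PhaseBd κ R ρ h Λ) {z₀ : Z3 n}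
    (hΘ : ‖z₀.2.1‖ ≤ jap h z₀.2.2.2 / 4) (hbd : b = jap h z₀.2.2.2) (hβd : β = b ^ (1 - 1 / κ)) :
    GB κ (fun z => Λ (pathL 0 1 (z₀ + sclZ β b z)) - Λ (pathL 1 0 (z₀ + sclZ β b z))) 0
      (2 * n * ρ * (‖z₀.2.1‖ * b ^ (1 / κ - 1) + ‖z₀.1‖ + 1 / R)) (2 * 6 * R) := by
  have hΛs := hΛ.sym.smooth
  have ha : C∞ fun w : ℝ × Z3 n => phaseInt Λ (w.1, z₀ + sclZ β b w.2) := (contDiff_phase_integrand hΛs).comp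
    (contDiff_fst.prodMk (contDiff_const.add ((sclZ β b).contDiff.comp contDiff_snd)))
  have e : (fun z => Λ (pathL 0 1 (z₀ + sclZ β b z)) - Λ (pathL 1 0 (z₀ + sclZ β b z))) =
      fun z => ∫ t in (0 : ℝ)..1, phaseInt Λ (t, z₀ + sclZ β b z) := by
    funext z; exact phase_eq_integral hΛs _
  rw [e]
  exact GB_integral (a := fun w : ℝ × Z3 n => phaseInt Λ (w.1, z₀ + sclZ β b w.2)) ha fun t ht => GB_phase_integrand hκ hR hρ hh hΛ hΘ hbd hβd ht

/-- Bounds for the amplitude near the diagonal. -/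
lemma GB_amp_near (hκ : 1 ≤ κ) (hR : 0 < R) (hρ : 0 ≤ ρ) (hh : 1 ≤ h) (hΛ : PhaseBd κ R ρ h Λ)
    (hp : SymBd κ R M m h p) {z₀ : Z3 n} (hΘ : ‖z₀.2.1‖ ≤ jap h z₀.2.2.2 / 4) :
    GB κ (fun z => amp Λ p (z₀ + sclZ (jap h z₀.2.2.2 ^ (1 - 1 / κ)) (jap h z₀.2.2.2) z)) 0
      (exp (2 * (2 * n * ρ * (‖z₀.2.1‖ * jap h z₀.2.2.2 ^ (1 / κ - 1) + ‖z₀.1‖ + 1 / R))) *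
        (M * jap h (z₀.2.2.2 + pr2 z₀.2.1) ^ m)) (8 * 6 * R) := by
  set b := jap h z₀.2.2.2
  have hb1 : 1 ≤ b := one_le_jap hh _
  have h1κ' : 0 ≤ 1 / κ := pos!
  have hβb : b ^ (1 - 1 / κ) ≤ b := by
    conv_rhs => rw [← rpow_one b]
    exact rpow_le_rpow_of_exponent_le hb1 lin!
  refine GB_amp_of_phase hκ num! hR hΛ.sym.smooth hh hp pos! lin! num! ?_
    (GB_phase_near hκ hR hρ hh hΛ hΘ rfl rfl)
  have h1 := jap_le_add h z₀.2.2.2 (pr2 z₀.2.1)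
  have h2 := (norm_pr2_le z₀.2.1).trans hΘ
  linarith

end Amplitude

section FourierInversion

variable {V : Type} [NormedAddCommGroup V] [InnerProductSpace ℝ V]
  [MeasurableSpace V] [BorelSpace V] [FiniteDimensional ℝ V]

lemma osc_eq_fourier (f : V → ℂ) (Q : V) : osc f Q = FourierTransform.fourier f ((2 * Real.pi)⁻¹ • Q) := by
  rw [Real.fourier_eq']
  unfold osc
  congr 1; funext P
  rw [ec, smul_eq_mul, inner_smul_right]
  congr 2
  push_cast
  have : (Real.pi : ℂ) ≠ 0 := by exact_mod_cast Real.pi_ne_zero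
  field_simp

/-- The Fourier inversion formula at the origin. -/
lemma integral_osc {f : V → ℂ} (hf : Continuous f) (hi : Integrable f) (hi' : Integrable (osc f)) :
    ∫ Q, osc f Q = ((2 * Real.pi) ^ finrank ℝ V : ℝ) * f 0 := by
  have hπ : (0 : ℝ) < 2 * Real.pi := pos!
  have e : osc f = fun Q => FourierTransform.fourier f ((2 * Real.pi)⁻¹ • Q) := funext fun Q => osc_eq_fourier f Q
  have h1 : Integrable (FourierTransform.fourier f) := by
    rw [e] at hi'
    exact (integrable_comp_smul_iff volume _ (inv_ne_zero hπ.ne')).mp hi'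
  have h2 := congrFun (hf.fourierInv_fourier_eq hi h1) 0
  rw [Real.fourierInv_eq'] at h2
  simp only [inner_zero_right, mul_zero, ofReal_zero, zero_mul, Complex.exp_zero, one_smul] at h2
  rw [e, Measure.integral_comp_smul, h2]
  rw [inv_pow, inv_inv, abs_of_pos pos!, real_smul]

end FourierInversion

section MixedDerivatives

variable {V : Type} [NormedAddCommGroup V] [InnerProductSpace ℝ V]
  {U U' : Type} [NormedAddCommGroup U] [NormedSpace ℝ U] [NormedAddCommGroup U'] [NormedSpace ℝ U']
  {ι : Type} [Fintype ι] (e : OrthonormalBasis ι ℝ V)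

/-- The operator `∑ D_{Y_i} ∂_{Θ_i}` on functions of `(Y, Θ, u)`. -/
def dmix (H : V × V × U → ℂ) : V × V × U → ℂ := fun z =>
  -I * ∑ i, dd ((e i, 0, 0) : V × V × U) (dd ((0, e i, 0) : V × V × U) H) z

lemma contDiff_dmix {H : V × V × U → ℂ} (hH : C∞ H) : C∞ (dmix e H) :=
  contDiff_const.mul (ContDiff.sum fun _ _ => contDiff_dd (contDiff_dd hH _) _)

lemma contDiff_dmix_iterate {H : V × V × U → ℂ} (hH : C∞ H) (N : ℕ) : C∞ ((dmix e)^[N] H) := by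
  induction N with
  | zero => exact hH
  | succ N ih => rw [iterate_succ_apply']; exact contDiff_dmix e ih

lemma norm_iteratedFDeriv_dmix_le {H : V × V × U → ℂ} (hH : C∞ H) (z : V × V × U) (k : ℕ) :
    ‖𝒟 k (dmix e H) z‖ ≤ Fintype.card ι * ‖𝒟 (k + 2) H z‖ := by
  have hs : ∀ i, C∞ (dd ((e i, 0, 0) : V × V × U) (dd ((0, e i, 0) : V × V × U) H)) := fun i =>
    contDiff_dd (contDiff_dd hH _) _
  unfold dmix
  rw [norm_iteratedFDeriv_const_mul (f := fun z => ∑ i, dd ((e i, 0, 0) : V × V × U) (dd ((0, e i, 0) : V × V × U) H) z)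
    (ContDiff.sum fun i _ => hs i)]
  rw [norm_neg, norm_I, one_mul]
  rw [iteratedFDeriv_fun_sum_apply fun i _ => ((hs i).of_le (mod_cast le_top)).contDiffAt]
  refine (norm_sum_le _ _).trans ?_
  rw [Fintype.card, ← nsmul_eq_mul]
  refine Finset.sum_le_card_nsmul _ _ _ fun i _ => ?_
  refine (norm_iteratedFDeriv_dd_le (contDiff_dd hH _) _ _ _).trans ?_
  have h1 : ‖((e i, 0, 0) : V × V × U)‖ = 1 := by simp [norm_def]
  have h2 : ‖((0, e i, 0) : V × V × U)‖ = 1 := by simp [norm_def]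
  rw [h1, one_mul]
  refine (norm_iteratedFDeriv_dd_le hH _ _ _).trans ?_
  rw [h2, one_mul]

lemma norm_iteratedFDeriv_dmix_iterate_le {H : V × V × U → ℂ} (hH : C∞ H) (z : V × V × U) (N k : ℕ) :
    ‖𝒟 k ((dmix e)^[N] H) z‖ ≤ (Fintype.card ι) ^ N * ‖𝒟 (k + 2 * N) H z‖ := by
  induction N generalizing k with
  | zero => simp
  | succ N ih =>
    rw [iterate_succ_apply']
    refine (norm_iteratedFDeriv_dmix_le e (contDiff_dmix_iterate e hH N) z k).trans ?_
    calc _ ≤ (Fintype.card ι : ℝ) * ((Fintype.card ι) ^ N * ‖𝒟 (k + 2 + 2 * N) H z‖) := by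
          gcongr; exact ih _
      _ = _ := by rw [show k + 2 + 2 * N = k + 2 * (N + 1) by ring, pow_succ]; ring

lemma dmix_comp {H : V × V × U → ℂ} (hH : C∞ H) (z₀ : V × V × U) (S : V × V × U' →L[ℝ] V × V × U) (h1 : ∀ v : V, S (v, 0, 0) = (v, 0, 0)) (h2 : ∀ v : V, S (0, v, 0) = β • (0, v, 0)) :
    dmix e (fun z => H (z₀ + S z)) = fun z => (β : ℂ) * dmix e H (z₀ + S z) := by
  funext z
  unfold dmix
  simp only [dd_comp_affine hH, h2, dd_smul_dir]
  have : ∀ i, dd ((e i, 0, 0) : V × V × U') (fun z => β • dd ((0, e i, 0) : V × V × U) H (z₀ + S z)) z =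
      (β : ℂ) * dd ((e i, 0, 0) : V × V × U) (dd ((0, e i, 0) : V × V × U) H) (z₀ + S z) := by
    intro i
    have hs : C∞ fun z => β • dd ((0, e i, 0) : V × V × U) H z := (contDiff_dd hH _).const_smul β
    rw [dd_comp_affine (f := fun z => β • dd ((0, e i, 0) : V × V × U) H z) hs, h1]
    change fderiv ℝ (fun z => β • dd ((0, e i, 0) : V × V × U) H z) (z₀ + S z) (e i, 0, 0) = _
    rw [fderiv_fun_const_smul ((contDiff_dd hH _).differentiable (by simp) _)]
    exact real_smul
  simp only [this]
  rw [← mul_sum]; ring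

lemma dmix_const_mul {H : V × V × U → ℂ} (hH : C∞ H) (c : ℂ) :
    dmix e (fun z => c * H z) = fun z => c * dmix e H z := by
  funext z
  unfold dmix
  have h : ∀ (f : V × V × U → ℂ), C∞ f → ∀ v, dd v (fun z => c * f z) = fun z => c * dd v f z := by
    intro f hf v; funext z
    simp only [dd]
    rw [fderiv_const_mul (hf.differentiable (by simp) _)]; simp
  simp only [h H hH, h _ (contDiff_dd hH _)]
  rw [← mul_sum]; ring

lemma dmix_iterate_comp {H : V × V × U → ℂ} (hH : C∞ H) (z₀ : V × V × U) (S : V × V × U' →L[ℝ] V × V × U) (h1 : ∀ v : V, S (v, 0, 0) = (v, 0, 0)) (h2 : ∀ v : V, S (0, v, 0) = β • (0, v, 0)) (N : ℕ) :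
    (dmix e)^[N] (fun z => H (z₀ + S z)) = fun z => (β : ℂ) ^ N * (dmix e)^[N] H (z₀ + S z) := by
  induction N with
  | zero => simp
  | succ N ih =>
    have hs : C∞ fun z => (dmix e)^[N] H (z₀ + S z) :=
      (contDiff_dmix_iterate e hH N).comp (contDiff_const.add S.contDiff)
    rw [iterate_succ_apply', ih, dmix_const_mul e hs, dmix_comp e (contDiff_dmix_iterate e hH N) z₀ S h1 h2]
    funext z
    rw [iterate_succ_apply', pow_succ]; ring

lemma GB_dmix_iterate (hκ : 0 ≤ κ) (hR : 0 ≤ R) (hβ : 0 < β) {H : V × V × U → ℂ} (hH : C∞ H)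
    {z₀ : V × V × U} {S : V × V × U' →L[ℝ] V × V × U}
    (h1 : ∀ v : V, S (v, 0, 0) = (v, 0, 0)) (h2 : ∀ v : V, S (0, v, 0) = β • (0, v, 0))
    (h : GB κ (fun z => H (z₀ + S z)) 0 M R) (N : ℕ) :
    GB κ (fun z => (dmix e)^[N] H (z₀ + S z)) 0
      (M * ((β⁻¹ * Fintype.card ι) ^ N * (2 ^ κ * R) ^ (2 * N) * ((2 * N)! : ℝ) ^ κ)) (2 ^ κ * R) := by
  intro k
  have hs : C∞ fun z => H (z₀ + S z) := hH.comp (contDiff_const.add S.contDiff)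
  have hs' : C∞ fun z => (dmix e)^[N] H (z₀ + S z) :=
    (contDiff_dmix_iterate e hH N).comp (contDiff_const.add S.contDiff)
  have a1 := norm_iteratedFDeriv_dmix_iterate_le e hs 0 N k
  rw [dmix_iterate_comp e hH z₀ S h1 h2, norm_iteratedFDeriv_const_mul hs', norm_pow, norm_real,
    norm_of_nonneg hβ.le] at a1
  have a2 := h (k + 2 * N)
  have hM := h.nonneg
  have a3 := fact_add_rpow_le hκ k (2 * N)
  calc _ = (β⁻¹) ^ N * (β ^ N * ‖𝒟 k (fun z => (dmix e)^[N] H (z₀ + S z)) 0‖) := by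
        rw [← mul_assoc, ← mul_pow, inv_mul_cancel₀ hβ.ne', one_pow, one_mul]
    _ ≤ (β⁻¹) ^ N * ((Fintype.card ι) ^ N * (M * R ^ (k + 2 * N) *
        (((2 : ℝ) ^ κ) ^ (k + 2 * N) * ((k ! : ℝ) ^ κ * ((2 * N)! : ℝ) ^ κ)))) := by
        refine mul_le_mul_of_nonneg_left (a1.trans (mul_le_mul_of_nonneg_left (a2.trans ?_) pos!)) pos!
        exact mul_le_mul_of_nonneg_left a3 pos!
    _ = _ := by rw [mul_pow, mul_pow, mul_pow, pow_add, pow_add]; ring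

lemma dd_congr_eventually {F : Type} [NormedAddCommGroup F] [NormedSpace ℝ F] {f g : U → F} {u : U}
    (h : f =ᶠ[𝓝 u] g) (v : U) : dd v f =ᶠ[𝓝 u] dd v g := by
  filter_upwards [h.eventuallyEq_nhds] with x hx
  simp only [dd, hx.fderiv_eq]

lemma dmix_iterate_congr {H H' : V × V × U → ℂ} {z : V × V × U} (h : H =ᶠ[𝓝 z] H') (N : ℕ) :
    (dmix e)^[N] H =ᶠ[𝓝 z] (dmix e)^[N] H' := by
  induction N with
  | zero => exact h
  | succ N ih =>
    rw [iterate_succ_apply', iterate_succ_apply']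
    have : ∀ᶠ w in 𝓝 z, ∀ i ∈ univ, dd ((e i, 0, 0) : V × V × U) (dd ((0, e i, 0) : V × V × U) ((dmix e)^[N] H)) w =
        dd ((e i, 0, 0) : V × V × U) (dd ((0, e i, 0) : V × V × U) ((dmix e)^[N] H')) w :=
      (Filter.eventually_all_finset _).mpr fun i _ =>
        dd_congr_eventually (dd_congr_eventually ih _) _
    filter_upwards [this] with w hw
    exact congrArg (-I * ·) (sum_congr rfl hw)

lemma dmix_zero (N : ℕ) : (dmix e)^[N] (fun _ : V × V × U => (0 : ℂ)) = fun _ => 0 := by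
  induction N with
  | zero => rfl
  | succ N ih =>
    rw [iterate_succ_apply', ih]
    funext z
    have h0 : ∀ v : V × V × U, dd v (fun _ : V × V × U => (0 : ℂ)) = fun _ => 0 := fun v => by funext z; simp [dd]
    simp [dmix, h0]

lemma dmix_iterate_eq_zero {H : V × V × U → ℂ} (h : ∀ z, c < ‖z.1‖ → H z = 0) (N : ℕ) {z : V × V × U}
    (hz : c < ‖z.1‖) : (dmix e)^[N] H z = 0 := by
  have h1 : H =ᶠ[𝓝 z] fun _ => 0 := by
    have : ∀ᶠ w : V × V × U in 𝓝 z, c < ‖w.1‖ :=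
      (continuous_fst.norm).continuousAt.eventually (lt_mem_nhds hz)
    filter_upwards [this] with w hw using h w hw
  rw [(dmix_iterate_congr e h1 N).eq_of_nhds, dmix_zero]

variable [MeasurableSpace V] [BorelSpace V] [FiniteDimensional ℝ V]

lemma hasDerivAt_osc_ray {H : V × V × U → ℂ} (hH : C∞ H) (hc : ∀ z, c < ‖z.1‖ → H z = 0)
    (Θ : V) (u : U) (t : ℝ) :
    HasDerivAt (fun t : ℝ => osc (fun Y => H (Y, t • Θ, u)) Θ) (osc (fun Y => dmix e H (Y, t • Θ, u)) Θ) t := by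
  have hcs : ∀ f : V → ℂ, Continuous f → (∀ Y, c < ‖Y‖ → f Y = 0) → Integrable f := fun f hf h0 =>
    hf.integrable_of_hasCompactSupport (HasCompactSupport.intro (isCompact_closedBall (0 : V) c) fun Y hY =>
      h0 Y (by simpa using hY))
  have hline : ∀ (Y : V) (t : ℝ), HasDerivAt (fun t : ℝ => ((Y, t • Θ, u) : V × V × U)) (0, Θ, 0) t := fun Y t => by
    have h1 : HasDerivAt (fun t : ℝ => t • Θ) Θ t := by simpa using (hasDerivAt_id t).smul_const Θ
    exact (hasDerivAt_const t Y).prodMk (h1.prodMk (hasDerivAt_const t u))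
  have hcl : Continuous fun w : ℝ × V => ((w.2, w.1 • Θ, u) : V × V × U) := fun!
  have hd : ∀ (Y : V) (t : ℝ), HasDerivAt (fun t : ℝ => H (Y, t • Θ, u)) (dd ((0, Θ, 0) : V × V × U) H (Y, t • Θ, u)) t :=
    fun Y t => ((hH.differentiable (by simp)) _).hasFDerivAt.comp_hasDerivAt t (hline Y t)
  have hG : C∞ (dd ((0, Θ, 0) : V × V × U) H) := contDiff_dd hH _
  have hz : ∀ (f : V × V × U → ℂ), (∀ z, c < ‖z.1‖ → f z = 0) → ∀ v z, c < ‖z.1‖ → dd v f z = 0 := by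
    intro f hf v z hz
    have h1 : f =ᶠ[𝓝 z] fun _ => 0 := by
      have : ∀ᶠ w : V × V × U in 𝓝 z, c < ‖w.1‖ :=
        (continuous_fst.norm).continuousAt.eventually (lt_mem_nhds hz)
      filter_upwards [this] with w hw using hf w hw
    simp [dd, h1.fderiv_eq]
  obtain ⟨C, hC⟩ := ((isCompact_Icc (a := t - 1) (b := t + 1)).prod (isCompact_closedBall (0 : V) c)).exists_bound_of_continuousOn
    (f := fun w : ℝ × V => dd ((0, Θ, 0) : V × V × U) H (w.2, w.1 • Θ, u)) (hG.continuous.comp hcl).continuousOn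
  have hsec : ∀ (f : V × V × U → ℂ), Continuous f → ∀ t : ℝ, Continuous fun Y : V => f (Y, t • Θ, u) := fun f hf t =>
    hf.comp fun!
  have hec : Continuous fun Y : V => ec Y Θ := (contDiff_ec Θ).continuous
  have key := (hasDerivAt_integral_of_dominated_loc_of_deriv_le (μ := (volume : Measure V)) (x₀ := t)
    (F := fun t Y => ec Y Θ * H (Y, t • Θ, u)) (F' := fun t Y => ec Y Θ * dd ((0, Θ, 0) : V × V × U) H (Y, t • Θ, u))
    (bound := (closedBall (0 : V) c).indicator fun _ => C) (s := Icc (t - 1) (t + 1))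
    (Icc_mem_nhds lin! lin!)
    (.of_forall fun t => (hec.mul (hsec _ hH.continuous t)).aestronglyMeasurable)
    (hcs _ (hec.mul (hsec _ hH.continuous t)) fun Y hY => by rw [hc _ hY, mul_zero])
    (hec.mul (hsec _ hG.continuous t)).aestronglyMeasurable
    (.of_forall fun Y s hs => by
      by_cases hY : Y ∈ closedBall (0 : V) c
      · rw [indicator_of_mem hY, norm_mul, norm_ec, one_mul]
        exact hC (s, Y) ⟨hs, hY⟩
      · rw [indicator_of_notMem hY, hz H hc _ _ (by simpa using hY), mul_zero, norm_zero])
    (integrable_indicator_closedBall c C)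
    (.of_forall fun Y s _ => (hd Y s).const_mul _)).2
  refine key.congr_deriv ?_
  have hint : ∀ i, Integrable fun Y : V => dd ((0, e i, 0) : V × V × U) H (Y, t • Θ, u) := fun i =>
    hcs _ (hsec _ (contDiff_dd hH _).continuous t) fun Y hY => hz H hc _ _ hY
  have hint' : ∀ i, Integrable fun Y : V => dd ((e i, 0, 0) : V × V × U) (dd ((0, e i, 0) : V × V × U) H) (Y, t • Θ, u) :=
    fun i => hcs _ (hsec _ (contDiff_dd (contDiff_dd hH _) _).continuous t) fun Y hY => hz _ (hz H hc _) _ _ hY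
  have hsect : ∀ i, dd (e i) (fun Y => dd ((0, e i, 0) : V × V × U) H (Y, t • Θ, u)) = fun Y =>
      dd ((e i, 0, 0) : V × V × U) (dd ((0, e i, 0) : V × V × U) H) (Y, t • Θ, u) := fun i =>
    dd_section_left (G := dd ((0, e i, 0) : V × V × U) H) (contDiff_dd hH _) (t • Θ, u) (e i)
  have hIBP : ∀ i, ((inner ℝ (e i) Θ : ℝ) : ℂ) * ∫ Y, ec Y Θ * dd ((0, e i, 0) : V × V × U) H (Y, t • Θ, u) =
      -I * ∫ Y, ec Y Θ * dd ((e i, 0, 0) : V × V × U) (dd ((0, e i, 0) : V × V × U) H) (Y, t • Θ, u) := by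
    intro i
    have h := integral_ec_mul_dd (f := fun Y => dd ((0, e i, 0) : V × V × U) H (Y, t • Θ, u)) (v := e i)
      ((contDiff_dd hH _).comp (contDiff_id.prodMk contDiff_const)) (hint i) (by rw [hsect i]; exact hint' i) Θ
    rw [hsect i] at h
    rw [h]
    linear_combination (((inner ℝ (e i) Θ : ℝ) : ℂ) * ∫ Y, ec Y Θ * dd ((0, e i, 0) : V × V × U) H (Y, t • Θ, u)) * Complex.I_mul_I
  have hΘ : ∀ Y, ec Y Θ * dd ((0, Θ, 0) : V × V × U) H (Y, t • Θ, u) =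
      ∑ i, ((inner ℝ (e i) Θ : ℝ) : ℂ) * (ec Y Θ * dd ((0, e i, 0) : V × V × U) H (Y, t • Θ, u)) := by
    intro Y
    have h1 : ((0, Θ, 0) : V × V × U) = ∑ i, (inner ℝ (e i) Θ : ℝ) • ((0, e i, 0) : V × V × U) := by
      conv_lhs => rw [← e.sum_repr' Θ]
      simp [Prod.ext_iff, fst_sum, snd_sum]
    conv_lhs => rw [dd, h1, map_sum, mul_sum]
    refine sum_congr rfl fun i _ => ?_
    rw [map_smul, real_smul, dd]; ring
  simp only [hΘ]
  rw [integral_finsetSum _ fun i _ => (integrable_ec_mul (hint i) Θ).const_mul _]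
  simp only [integral_const_mul, hIBP]
  unfold osc dmix
  rw [← mul_sum, ← integral_finsetSum _ fun i _ => integrable_ec_mul (hint' i) Θ, ← integral_const_mul]
  congr 1; funext Y
  rw [mul_sum]
  simp only [mul_sum]
  refine sum_congr rfl fun i _ => by ring

/-- Taylor's formula with integral remainder for a sequence of successive derivatives. -/
lemma taylor_of_hasDerivAt {f : ℕ → ℝ → ℂ} (hf : ∀ j t, HasDerivAt (f j) (f (j + 1) t) t) (N : ℕ) :
    f 0 1 = ∑ j ∈ range (N + 1), ((j ! : ℂ))⁻¹ * f j 0 +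
      ∫ t in (0 : ℝ)..1, (((1 - t) ^ N / N ! : ℝ) : ℂ) * f (N + 1) t := by
  have hc : ∀ j, Continuous (f j) := fun j => continuous_iff_continuousAt.mpr fun t => (hf j t).continuousAt
  induction N with
  | zero =>
    have := intervalIntegral.integral_eq_sub_of_hasDerivAt (a := 0) (b := 1) (fun t _ => hf 0 t) ((hc 1).intervalIntegrable _ _)
    simp [this]
  | succ N ih =>
    rw [ih, Finset.sum_range_succ _ (N + 1), add_assoc]
    congr 1
    have hu : ∀ t : ℝ, HasDerivAt (fun t : ℝ => ((-((1 - t) ^ (N + 1) / (N + 1)!) : ℝ) : ℂ))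
        (((1 - t) ^ N / N ! : ℝ) : ℂ) t := by
      intro t
      refine HasDerivAt.ofReal_comp ?_
      have h1 := ((((hasDerivAt_id t).const_sub 1).pow (N + 1)).div_const ((N + 1)! : ℝ)).neg
      refine h1.congr_deriv ?_
      simp only [id, Nat.add_sub_cancel, Nat.factorial_succ]
      push_cast
      have : (N ! : ℝ) ≠ 0 := pos!
      have : (N + 1 : ℝ) ≠ 0 := pos!
      field_simp
    have h := intervalIntegral.integral_deriv_mul_eq_sub (a := 0) (b := 1) (fun t _ => hu t) (fun t _ => hf (N + 1) t)
      (Continuous.intervalIntegrable fun! _ _) ((hc (N + 2)).intervalIntegrable _ _)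
    have c1 : Continuous fun t : ℝ => (((1 - t) ^ N / N ! : ℝ) : ℂ) * f (N + 1) t := by
      have := hc (N + 1); fun_prop
    have c2 : Continuous fun t : ℝ => ((-((1 - t) ^ (N + 1) / (N + 1)!) : ℝ) : ℂ) * f (N + 1 + 1) t := by
      have := hc (N + 1 + 1); fun_prop
    rw [intervalIntegral.integral_add (c1.intervalIntegrable _ _) (c2.intervalIntegrable _ _)] at h
    have e2 : (∫ t in (0 : ℝ)..1, ((-((1 - t) ^ (N + 1) / (N + 1)!) : ℝ) : ℂ) * f (N + 1 + 1) t) =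
        -∫ t in (0 : ℝ)..1, (((1 - t) ^ (N + 1) / (N + 1)! : ℝ) : ℂ) * f (N + 1 + 1) t := by
      rw [← intervalIntegral.integral_neg]; congr 1; funext t; push_cast; ring
    rw [e2] at h
    have e3 : ∫ t in (0 : ℝ)..1, (((1 - t) ^ N / N ! : ℝ) : ℂ) * f (N + 1) t = ((N + 1)! : ℂ)⁻¹ * f (N + 1) 0 +
        ∫ t in (0 : ℝ)..1, (((1 - t) ^ (N + 1) / (N + 1)! : ℝ) : ℂ) * f (N + 1 + 1) t := by
      rw [← sub_eq_iff_eq_add, sub_eq_add_neg, h]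
      simp
    exact e3

end MixedDerivatives

section ExponentialBounds

/-- The exponential weight `e^{γ t^{1/κ}}`. -/
abbrev ew (κ γ t : ℝ) : ℝ := exp (γ * t ^ (1 / κ))

lemma ew_pos (κ γ t : ℝ) : 0 < ew κ γ t := exp_pos _

@[gcongr]
lemma ew_le_ew (hx : 0 ≤ x) (h : s ≤ t) : ew κ s x ≤ ew κ t x :=
  exp_le_exp.mpr (mul_le_mul_of_nonneg_right h pos!)

lemma ew_mul (κ γ γ' t : ℝ) : ew κ γ t * ew κ γ' t = ew κ (γ + γ') t := by
  unfold ew; rw [← exp_add, add_mul]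

lemma ew_mono (hκ : 0 ≤ κ) (hγ : 0 ≤ γ') (ht : 0 ≤ t) (hg : γ ≤ γ') (htt : t ≤ t') :
    ew κ γ t ≤ ew κ γ' t' := by
  refine exp_le_exp.mpr ?_
  calc γ * t ^ (1 / κ) ≤ γ' * t ^ (1 / κ) := mono!
    _ ≤ γ' * t' ^ (1 / κ) := mono!

lemma one_le_ew (hγ : 0 ≤ γ) (ht : 0 ≤ t) : 1 ≤ ew κ γ t := one_le_exp pos!

lemma exp_dec_eq (hκ : 0 < κ) (hR : 0 < R) (hγ : 1024 * γ = R ^ (-(1 / κ))) (ht : 0 ≤ t) :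
    exp (-(1 / 2) * (t / (2 ^ κ * R)) ^ (1 / κ)) = ew κ (-(256 * γ)) t := by
  unfold ew
  rw [div_rpow ht pos!, mul_rpow pos! hR.le, ← rpow_mul num!,
    mul_one_div_cancel hκ.ne', rpow_one, mul_comm (2 : ℝ), ← div_div, div_eq_mul_inv (t ^ (1 / κ)), ← rpow_neg hR.le, ← hγ]
  ring_nf

lemma integrable_ew {V : Type} [NormedAddCommGroup V] [InnerProductSpace ℝ V]
    [MeasurableSpace V] [BorelSpace V] [FiniteDimensional ℝ V] (hκ : 0 < κ) (hγ : 0 < γ) :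
    Integrable fun P : V => ew κ (-γ) ‖P‖ := integrable_exp_neg_rpow hκ hγ

variable {V : Type} [NormedAddCommGroup V] [InnerProductSpace ℝ V]
  [MeasurableSpace V] [BorelSpace V] [FiniteDimensional ℝ V]
  {U : Type} [NormedAddCommGroup U] [NormedSpace ℝ U]
  {S : Type} [NormedAddCommGroup S] [NormedSpace ℝ S] [MeasurableSpace S] [BorelSpace S]
  [SecondCountableTopology S]

lemma OscDom.of_ew (hκ : 0 < κ) (hR : 0 < R) (hγ : 1024 * γ = R ^ (-(1 / κ))) {G : V × S × U → ℂ}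
    {ϑ : S → V} {μ : Measure S} {g : V → ℝ} (hg : Integrable g) {J : U → ℝ} (hJ : Continuous J)
    (h : ∀ B : ℝ, ∃ τ : S → ℝ, Integrable τ μ ∧ ∀ u, J u ≤ B → ∀ P s,
      GB κ (fun z : V × U => G (z.1, s, z.2)) (P, u) (g P * (τ s * ew κ (256 * γ) ‖ϑ s‖)) R) (u₀ : U) :
    OscDom κ G ϑ μ u₀ := by
  obtain ⟨τ, hτ, hb⟩ := h (J u₀ + 1)
  refine ⟨g, fun s => τ s * ew κ (256 * γ) ‖ϑ s‖, R, hR, hg, ?_, ?_⟩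
  · refine hτ.congr (.of_forall fun s => ?_)
    simp only
    rw [exp_dec_eq hκ hR hγ (norm_nonneg _), mul_assoc, ew_mul, add_neg_cancel]
    simp [ew]
  · have : ∀ᶠ u in 𝓝 u₀, J u < J u₀ + 1 := hJ.continuousAt.eventually (gt_mem_nhds lin!)
    filter_upwards [this] with u hu using hb u hu.le

lemma GB_oscInt_ew {U' : Type} [NormedAddCommGroup U'] [NormedSpace ℝ U'] (hκ : 1 ≤ κ)
    (hR : 0 < R) (hγ : 1024 * γ = R ^ (-(1 / κ))) (hl : 0 < l) {G : V × S × U → ℂ} (hG : C∞ G)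
    {ϑ : S → V} (hϑ : Continuous ϑ) {μ : Measure S} [SFinite μ] (h : ∀ u₀, OscDom κ G ϑ μ u₀)
    {u₀ : U} (T : U' →L[ℝ] U) {g : V → ℝ} {τ : S → ℝ} (hg : Integrable g) (hτ : Integrable τ μ)
    (hb : ∀ᵐ s ∂μ, ∀ P, GB κ (fun z : V × U' => G (P + l • z.1, s, u₀ + T z.2)) 0
      (g P * (τ s * ew κ (256 * γ) (l * ‖ϑ s‖))) R) :
    GB κ (fun u => oscInt G ϑ μ (u₀ + T u)) 0 (2 ^ κ * (∫ P, g P) * ∫ s, τ s ∂μ) (2 ^ κ * R) := by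
  have hκ0 : 0 < κ := lin!
  have e : (fun s => τ s * ew κ (256 * γ) (l * ‖ϑ s‖) * exp (-(1 / 2) * (l * ‖ϑ s‖ / (2 ^ κ * R)) ^ (1 / κ))) = τ := by
    funext s
    rw [exp_dec_eq hκ0 hR hγ pos!, mul_assoc, ew_mul, add_neg_cancel]
    simp [ew]
  have := GB_oscInt hκ hR hl hG hϑ h T hg (τ := fun s => τ s * ew κ (256 * γ) (l * ‖ϑ s‖)) (by rw [e]; exact hτ) hb
  rw [e] at this
  exact this

end ExponentialBounds

section AmplitudeBounds

/-- The assumptions on the symbols `Λ` and `p`, together with the smallness of `ρ`. -/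
structure Data (κ γ R ρ M m h : ℝ) (Λ : E² n → ℝ) (p : E² n → ℂ) : Prop where
  hκ : 1 < κ
  hR : 0 < R
  hγ : 0 < γ
  hρ : 0 ≤ ρ
  small : 8 * (n + 1) * ρ ≤ γ
  hh : 1 ≤ h
  phase : PhaseBd κ R ρ h Λ
  sym : SymBd κ R M m h p
  hM : 0 ≤ M

lemma rpow_le_ew (hκ : 0 < κ) (hγ : 0 < γ) (m : ℝ) : ∃ C : ℝ, 0 < C ∧ ∀ b : ℝ, 1 ≤ b → b ^ m ≤ C * ew κ γ b := by
  obtain ⟨C, hC, hb⟩ := pow_le_exp_rpow hκ hγ ⌈|m|⌉₊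
  refine ⟨C, hC, fun b hb1 => le_trans ?_ (hb b lin!)⟩
  calc b ^ m ≤ b ^ (⌈|m|⌉₊ : ℝ) := rpow_le_rpow_of_exponent_le hb1 ((le_abs_self m).trans (Nat.le_ceil _))
    _ = b ^ ⌈|m|⌉₊ := rpow_natCast _ _
    _ ≤ (1 + b) ^ ⌈|m|⌉₊ := by gcongr; linarith

lemma rpow_add_le' {a : ℝ} (hκ : 1 ≤ κ) (ha : 0 ≤ a) (hb : 0 ≤ b) : (a + b) ^ (1 / κ) ≤ a ^ (1 / κ) + b ^ (1 / κ) :=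
  Real.rpow_add_le_add_rpow ha hb pos! (by rw [div_le_one lin!]; exact hκ)

lemma exists_GB_amp_lossy (n : ℕ) (hκ : 1 < κ) (hγ : 0 < γ) (m : ℝ) : ∃ C : ℝ, 0 < C ∧
    ∀ {R ρ M h Λ p}, Data κ γ R ρ M m h Λ p →
    ∀ {z₀ : Z3 n} {β c t : ℝ}, 0 ≤ β → 0 ≤ c → 2 ≤ t → c + 2 * β ≤ t * jap h (z₀.2.2.2 + pr2 z₀.2.1) →
      c + 2 * β ≤ t * jap h (z₀.2.2.2 + pr2 z₀.2.1 + pr1 z₀.2.1) →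
      GB κ (fun z => amp Λ p (z₀ + sclZ β c z)) 0
        (C * M * ew κ (2 * γ) (jap h z₀.2.2.2) * ew κ (2 * γ) ‖z₀.2.1‖) (8 * t * R) := by
  obtain ⟨C, hC, hCm⟩ := rpow_le_ew (by linarith : 0 < κ) hγ m
  refine ⟨C, hC, fun {R ρ M h Λ p} D {z₀ β c t} hβ hc ht h3 h3' => ?_⟩
  have hR := D.hR
  have hM := D.hM
  have hρ := D.hρ
  refine (GB_amp_lossy hκ.le hR D.hh D.phase D.sym hβ hc ht h3 h3').mono pos! ?_ le_rfl
  set b := jap h z₀.2.2.2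
  set J₁ := jap h (z₀.2.2.2 + pr2 z₀.2.1 + pr1 z₀.2.1)
  set J₂ := jap h (z₀.2.2.2 + pr2 z₀.2.1)
  have hb : 1 ≤ b := one_le_jap D.hh _
  have hJ₁ : 1 ≤ J₁ := one_le_jap D.hh _
  have hJ₂ : 1 ≤ J₂ := one_le_jap D.hh _
  set q := ‖z₀.2.1‖
  have hq : 0 ≤ q := norm_nonneg _
  have h2 : J₂ ≤ b + q := (jap_add_le h _ _).trans (by gcongr; exact norm_pr2_le _)
  have h1 : J₁ ≤ b + q + q := (jap_add_le h _ _).trans (by gcongr; exact norm_pr1_le _)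
  have hk0 : 0 ≤ 1 / κ := pos!
  have k2 : J₂ ^ (1 / κ) ≤ b ^ (1 / κ) + q ^ (1 / κ) :=
    (rpow_le_rpow pos! h2 hk0).trans (rpow_add_le' hκ.le pos! hq)
  have k1 : J₁ ^ (1 / κ) ≤ b ^ (1 / κ) + q ^ (1 / κ) + q ^ (1 / κ) :=
    (rpow_le_rpow pos! h1 hk0).trans ((rpow_add_le' hκ.le pos! hq).trans (by
      gcongr; exact rpow_add_le' hκ.le pos! hq))
  have hsm : 8 * ρ ≤ γ := by
    have := D.small
    nlinarith [(cast_nonneg n : (0 : ℝ) ≤ n), mul_nonneg (cast_nonneg n : (0 : ℝ) ≤ n) hρ]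
  calc _ ≤ exp (2 * (ρ * J₁ ^ (1 / κ) + ρ * J₂ ^ (1 / κ))) * (M * (C * ew κ γ J₂)) := by
        gcongr; exact hCm _ hJ₂
    _ = C * M * (exp (2 * (ρ * J₁ ^ (1 / κ) + ρ * J₂ ^ (1 / κ))) * ew κ γ J₂) := by ring
    _ ≤ C * M * (ew κ (2 * γ) b * ew κ (2 * γ) q) := by
        refine mul_le_mul_of_nonneg_left ?_ pos!
        unfold ew
        rw [← exp_add, ← exp_add]
        refine exp_le_exp.mpr ?_
        have e1 : ρ * J₁ ^ (1 / κ) ≤ ρ * (b ^ (1 / κ) + q ^ (1 / κ) + q ^ (1 / κ)) := mono!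
        have e2 : ρ * J₂ ^ (1 / κ) ≤ ρ * (b ^ (1 / κ) + q ^ (1 / κ)) := mono!
        have e3 : γ * J₂ ^ (1 / κ) ≤ γ * (b ^ (1 / κ) + q ^ (1 / κ)) := mul_le_mul_of_nonneg_left k2 hγ.le
        have e4 : 8 * ρ * b ^ (1 / κ) ≤ γ * b ^ (1 / κ) := mono!
        have e5 : 8 * ρ * q ^ (1 / κ) ≤ γ * q ^ (1 / κ) := mono!
        have e6 : 0 ≤ ρ * b ^ (1 / κ) := pos!
        have e7 : 0 ≤ ρ * q ^ (1 / κ) := pos!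
        nlinarith
    _ = _ := by ring

lemma rpow_le_two_rpow_mul {a : ℝ} (m : ℝ) (hb : 0 < b) (h1 : b / 2 ≤ a) (h2 : a ≤ 2 * b) : a ^ m ≤ 2 ^ |m| * b ^ m := by
  have ha : 0 < a := lin!
  have e : a ^ m = (a / b) ^ m * b ^ m := by rw [← mul_rpow pos! hb.le, div_mul_cancel₀ _ hb.ne']
  rw [e]
  gcongr
  rcases le_total 0 m with hm | hm
  · rw [abs_of_nonneg hm]
    exact rpow_le_rpow pos! (by rw [div_le_iff₀ hb]; linarith) hm
  · rw [abs_of_nonpos hm, rpow_neg num!, ← Real.inv_rpow num!]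
    exact Real.rpow_le_rpow_of_nonpos num! (by rw [le_div_iff₀ hb]; linarith) hm

lemma exists_GB_amp_near (n : ℕ) (hκ : 1 < κ) (hγ : 0 < γ) (hR : 0 < R) (m : ℝ) : ∃ C : ℝ, 0 < C ∧
    ∀ {ρ M h Λ p}, Data κ γ R ρ M m h Λ p →
    ∀ {z₀ : Z3 n}, ‖z₀.1‖ ≤ 1 → ‖z₀.2.1‖ ≤ jap h z₀.2.2.2 / 8 →
      GB κ (fun z => amp Λ p (z₀ + sclZ (jap h z₀.2.2.2 ^ (1 - 1 / κ)) (jap h z₀.2.2.2) z)) 0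
        (C * M * jap h z₀.2.2.2 ^ m * ew κ γ ‖z₀.2.1‖) (48 * R) := by
  refine ⟨exp (γ * (1 + 1 / R)) * 2 ^ |m|, pos!, fun {ρ M h Λ p} D {z₀} hY hΘ => ?_⟩
  have hM := D.hM
  have hρ := D.hρ
  set b := jap h z₀.2.2.2
  have hb : 1 ≤ b := one_le_jap D.hh _
  refine (GB_amp_near hκ.le hR hρ D.hh D.phase D.sym (z₀ := z₀) (hΘ.trans lin!)).mono pos! ?_
    (le_of_eq (by ring))
  set q := ‖z₀.2.1‖
  have hq : 0 ≤ q := norm_nonneg _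
  have hpr : ‖pr2 z₀.2.1‖ ≤ b / 8 := (norm_pr2_le _).trans hΘ
  have j1 : jap h (z₀.2.2.2 + pr2 z₀.2.1) ^ m ≤ 2 ^ |m| * b ^ m := by
    refine rpow_le_two_rpow_mul m lin! ?_ ?_
    · have := jap_le_add h z₀.2.2.2 (pr2 z₀.2.1); linarith
    · have := jap_add_le h z₀.2.2.2 (pr2 z₀.2.1); linarith
  have hq1 : q * b ^ (1 / κ - 1) ≤ q ^ (1 / κ) := by
    rcases hq.eq_or_lt with h0 | h0
    · rw [← h0, zero_mul]; exact rpow_nonneg le_rfl _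
    · have : b ^ (1 / κ - 1) ≤ q ^ (1 / κ - 1) :=
        Real.rpow_le_rpow_of_nonpos h0 lin! (by
          have : 1 / κ ≤ 1 := by rw [div_le_one lin!]; exact hκ.le
          linarith)
      calc q * b ^ (1 / κ - 1) ≤ q * q ^ (1 / κ - 1) := mono!
        _ = q ^ (1 / κ) := by rw [Real.rpow_sub_one h0.ne']; field_simp
  have hsm : 4 * n * ρ ≤ γ := by
    have := D.small
    nlinarith [(cast_nonneg n : (0 : ℝ) ≤ n), mul_nonneg (cast_nonneg n : (0 : ℝ) ≤ n) hρ]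
  have key : exp (2 * (2 * n * ρ * (q * b ^ (1 / κ - 1) + ‖z₀.1‖ + 1 / R))) ≤
      exp (γ * (1 + 1 / R)) * ew κ γ q := by
    unfold ew
    rw [← exp_add]
    refine exp_le_exp.mpr ?_
    calc _ = 4 * n * ρ * (q * b ^ (1 / κ - 1) + ‖z₀.1‖ + 1 / R) := by ring
      _ ≤ γ * (q ^ (1 / κ) + 1 + 1 / R) := by
          gcongr
      _ = _ := by ring
  calc _ ≤ (exp (γ * (1 + 1 / R)) * ew κ γ q) * (M * (2 ^ |m| * b ^ m)) :=
        mul_le_mul key (mul_le_mul_of_nonneg_left j1 hM)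
          (mul_nonneg hM (rpow_nonneg (zero_le_one.trans (one_le_jap D.hh _)) _))
          (mul_nonneg (exp_pos _).le (ew_pos _ _ _).le)
    _ = _ := by ring

end AmplitudeBounds

section Slices

variable {V S U : Type} [NormedAddCommGroup V] [NormedSpace ℝ V] [NormedAddCommGroup S] [NormedSpace ℝ S]
  [NormedAddCommGroup U] [NormedSpace ℝ U]

/-- The inclusion `(Y, u) ↦ (Y, 0, u)`. -/
def insMid (V S U : Type) [NormedAddCommGroup V] [NormedSpace ℝ V] [NormedAddCommGroup S] [NormedSpace ℝ S]
    [NormedAddCommGroup U] [NormedSpace ℝ U] : V × U →L[ℝ] V × S × U :=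
  (fst ℝ V U).prod ((0 : V × U →L[ℝ] S).prod (snd ℝ V U))

lemma insMid_apply (z : V × U) : insMid V S U z = (z.1, 0, z.2) := rfl

lemma norm_insMid_le : ‖insMid V S U‖ ≤ 1 :=
  opNorm_le_bound _ zero_le_one fun z => by
    rw [insMid_apply, one_mul]
    simp [norm_def]

/-- The inclusion `(s, u) ↦ (0, s, u)`. -/
def insTail (V S U : Type) [NormedAddCommGroup V] [NormedSpace ℝ V] [NormedAddCommGroup S] [NormedSpace ℝ S]
    [NormedAddCommGroup U] [NormedSpace ℝ U] : S × U →L[ℝ] V × S × U :=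
  (0 : S × U →L[ℝ] V).prod (ContinuousLinearMap.id ℝ (S × U))

lemma insTail_apply (z : S × U) : insTail V S U z = (0, z.1, z.2) := rfl

lemma norm_insTail_le : ‖insTail V S U‖ ≤ 1 :=
  opNorm_le_bound _ zero_le_one fun z => by
    rw [insTail_apply, one_mul]
    simp [norm_def]

lemma GB.slice_mid (hR : 0 ≤ R) {f : V × S × U → ℂ} (hf : C∞ f) {P : V} {s : S} {u : U}
    (h : GB κ f (P, s, u) M R) : GB κ (fun z : V × U => f (z.1, s, z.2)) (P, u) M R := by
  have e : (fun z : V × U => f (z.1, s, z.2)) = fun z => f ((0, s, 0) + insMid V S U z) := by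
    funext z; simp [insMid_apply]
  rw [e]
  have h1 := GB.comp_affine (u := (P, u)) (a := ((0, s, 0) : V × S × U)) hR hf (norm_insMid_le (V := V) (S := S) (U := U))
    (M := M) (κ := κ) (by simpa [insMid_apply] using h)
  simpa using h1

lemma GB.slice_tail (hR : 0 ≤ R) {f : V × S × U → ℂ} (hf : C∞ f) {P : V} {s : S} {u : U}
    (h : GB κ f (P, s, u) M R) : GB κ (fun z : S × U => f (P, z.1, z.2)) (s, u) M R := by
  have e : (fun z : S × U => f (P, z.1, z.2)) = fun z => f ((P, 0, 0) + insTail V S U z) := by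
    funext z; simp only [insTail_apply, mk_add_mk, zero_add, add_zero]
  rw [e]
  have h1 := GB.comp_affine (u := (s, u)) (a := ((P, 0, 0) : V × S × U)) hR hf (norm_insTail_le (V := V) (S := S) (U := U))
    (M := M) (κ := κ) (by simpa [insTail_apply] using h)
  simpa using h1

end Slices

section Cutoffs

lemma GB.of_sclZ {f : Z3 n → ℂ} (hR : 0 ≤ R) (hf : C∞ f) {z₀ : Z3 n} (hβ : 1 ≤ β) (hc : 1 ≤ c)
    (h : GB κ (fun z => f (z₀ + sclZ β c z)) 0 M R) : GB κ f z₀ M R := by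
  refine GB_unscale hR hf (sclZ β c) (sclZ β⁻¹ c⁻¹) (fun z => ?_) ?_ h
  · rw [sclZ_apply, sclZ_apply]
    simp only [smul_smul]
    rw [mul_inv_cancel₀ (by linarith : β ≠ 0), mul_inv_cancel₀ (by linarith : c ≠ 0), one_smul, one_smul]
  · refine opNorm_le_bound _ zero_le_one fun z => ?_
    rw [one_mul, sclZ_apply]
    have h1 : β⁻¹ ≤ 1 := inv_le_one_of_one_le₀ hβ
    have h2 : c⁻¹ ≤ 1 := inv_le_one_of_one_le₀ hc
    have h3 : 0 ≤ β⁻¹ := pos!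
    have h4 : 0 ≤ c⁻¹ := pos!
    refine max_le (norm_fst_le z) (max_le ?_ (max_le ((norm_fst_le z.2.2).trans (norm_cq_le z)) ?_))
    · rw [norm_smul, norm_of_nonneg h3]
      exact (mul_le_of_le_one_left (norm_nonneg _) h1).trans (norm_cΘ_le z)
    · change ‖c⁻¹ • z.2.2.2‖ ≤ _
      rw [norm_smul, norm_of_nonneg h4]
      exact (mul_le_of_le_one_left (norm_nonneg _) h2).trans ((norm_snd_le z.2.2).trans (norm_cq_le z))

/-- A cutoff `ψ(Y)` to the unit ball and a conic cutoff `X(Θ, ξ)`. -/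
structure Cuts (n : ℕ) (κ R C h : ℝ) (ψ : V2 n → ℂ) (X : V2 n × E n → ℂ) : Prop where
  cutoff : IsCutoff κ C R ψ
  ψ_one : ∀ Y, ‖Y‖ ^ 2 ≤ 1 / 2 → ψ Y = 1
  ψ_zero : ∀ Y, 1 ≤ ‖Y‖ → ψ Y = 0
  smooth : C∞ X
  bound : ∀ Θ ξ, GB κ (fun z : V2 n × E n => X (Θ + jap h ξ • z.1, ξ + jap h ξ • z.2)) 0 C R
  X_one : ∀ Θ ξ, ‖Θ‖ ≤ jap h ξ / 16 → X (Θ, ξ) = 1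
  X_zero : ∀ Θ ξ, jap h ξ / 8 ≤ ‖Θ‖ → X (Θ, ξ) = 0

lemma exists_cuts (n : ℕ) (hκ : 1 < κ) (hR : 0 < R) : ∃ C : ℝ, 0 ≤ C ∧ ∀ h : ℝ, 1 ≤ h → ∃ ψ X, Cuts n κ R C h ψ X := by
  obtain ⟨C₁, ψ, hψ, h1, h0⟩ := exists_cutoff (V2 n) hκ hR
  obtain ⟨C₂, hX⟩ := exists_conic_cutoff (V2 n) n hκ hR
  have hC₁ : 0 ≤ C₁ := (hψ.bound 0).nonneg
  refine ⟨max C₁ C₂, le_max_of_le_left hC₁, fun h hh => ?_⟩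
  obtain ⟨X, hs, hb, h1', h0'⟩ := hX h hh
  exact ⟨ψ, X, ⟨hψ.smooth, fun P => (hψ.bound P).mono hR.le (le_max_left _ _) le_rfl, hψ.support, hψ.at_zero⟩, h1, h0, hs,
    fun Θ ξ => (hb Θ ξ).mono hR.le (le_max_right _ _) le_rfl, h1', h0'⟩

variable {ψ : V2 n → ℂ} {X : V2 n × E n → ℂ}

/-- The cutoffs as functions of `(Y, Θ, (x, ξ))`. -/
def fψ (ψ : V2 n → ℂ) (z : Z3 n) : ℂ := ψ z.1

def fX (X : V2 n × E n → ℂ) (z : Z3 n) : ℂ := X (z.2.1, z.2.2.2)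

lemma Cuts.contDiff_fψ (hc : Cuts n κ R C h ψ X) : C∞ (fψ ψ) := hc.cutoff.smooth.comp contDiff_fst

lemma Cuts.contDiff_fX (hc : Cuts n κ R C h ψ X) : C∞ (fX X) :=
  hc.smooth.comp (contDiff_snd.fst.prodMk contDiff_snd.snd.snd)

lemma contDiff_comp_sclZ {f : Z3 n → ℂ} (hf : C∞ f) (z₀ : Z3 n) (β c : ℝ) :
    C∞ fun z => f (z₀ + sclZ β c z) := hf.comp (contDiff_const.add (sclZ β c).contDiff)

lemma Cuts.GB_fψ (hR : 0 ≤ R) (hc : Cuts n κ R C h ψ X) (z₀ : Z3 n) (β c : ℝ) :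
    GB κ (fun z => fψ ψ (z₀ + sclZ β c z)) 0 C R := by
  have hn : ‖(cY : Z3 n →L[ℝ] V2 n)‖ ≤ 1 :=
    opNorm_le_bound _ zero_le_one fun z => by rw [one_mul]; exact norm_cY_le z
  have h1 := GB.comp_affine (u := (0 : Z3 n)) (a := z₀.1) hR hc.cutoff.smooth hn (hc.cutoff.bound (z₀.1 + cY 0))
  rw [one_mul] at h1
  exact h1

/-- The scaled projection to the variables `(Θ, ξ)`. -/
def coneL (s t : ℝ) : Z3 n →L[ℝ] V2 n × E n := (s • cΘ).prod (t • (snd ℝ (E n) (E n)).comp cq)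

lemma coneL_apply (s t : ℝ) (z : Z3 n) : coneL s t z = (s • z.2.1, t • z.2.2.2) := rfl

lemma norm_coneL_le (hs : 0 ≤ s) (hs1 : s ≤ 1) (ht : 0 ≤ t) (ht1 : t ≤ 1) : ‖(coneL s t : Z3 n →L[ℝ] V2 n × E n)‖ ≤ 1 := by
  refine opNorm_le_bound _ zero_le_one fun z => ?_
  rw [one_mul, coneL_apply]
  refine max_le ?_ ?_
  · simp only
    rw [norm_smul, norm_of_nonneg hs]
    exact (mul_le_of_le_one_left (norm_nonneg _) hs1).trans (norm_cΘ_le z)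
  · simp only
    rw [norm_smul, norm_of_nonneg ht]
    exact (mul_le_of_le_one_left (norm_nonneg _) ht1).trans ((norm_snd_le z.2.2).trans (norm_cq_le z))

lemma fX_sclZ (z₀ z : Z3 n) (β c : ℝ) : fX X (z₀ + sclZ β c z) = X (z₀.2.1 + β • z.2.1, z₀.2.2.2 + c • z.2.2.2) := rfl

lemma Cuts.GB_fX (hR : 0 ≤ R) (hh : 1 ≤ h) (hc : Cuts n κ R C h ψ X) (z₀ : Z3 n) (hβ : 0 ≤ β) (hβb : β ≤ jap h z₀.2.2.2)
    (hc0 : 0 ≤ c) (hcb : c ≤ jap h z₀.2.2.2) : GB κ (fun z => fX X (z₀ + sclZ β c z)) 0 C R := by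
  have hb : 0 < jap h z₀.2.2.2 := zero_lt_one.trans_le (one_le_jap hh _)
  have h0 := hc.bound z₀.2.1 z₀.2.2.2
  generalize jap h z₀.2.2.2 = b at *
  have hT := norm_coneL_le (n := n) (s := b⁻¹ * β) (t := b⁻¹ * c) pos! (by rw [inv_mul_le_iff₀ hb]; linarith)
    pos! (by rw [inv_mul_le_iff₀ hb]; linarith)
  have k1 : C∞ fun z : V2 n × E n => z₀.2.1 + b • z.1 := contDiff_const.add (contDiff_fst.const_smul b)
  have k2 : C∞ fun z : V2 n × E n => z₀.2.2.2 + b • z.2 := contDiff_const.add (contDiff_snd.const_smul b)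
  have hs : C∞ fun z : V2 n × E n => X (z₀.2.1 + b • z.1, z₀.2.2.2 + b • z.2) :=
    hc.smooth.comp (k1.prodMk k2)
  have e : (fun z => fX X (z₀ + sclZ β c z)) = fun z => (fun z : V2 n × E n => X (z₀.2.1 + b • z.1, z₀.2.2.2 + b • z.2))
      (0 + coneL (b⁻¹ * β) (b⁻¹ * c) z) := by
    funext z
    rw [zero_add, fX_sclZ, coneL_apply]
    simp only
    rw [smul_smul, smul_smul, mul_inv_cancel_left₀ hb.ne', mul_inv_cancel_left₀ hb.ne']
  rw [e]
  generalize (fun z : V2 n × E n => X (z₀.2.1 + b • z.1, z₀.2.2.2 + b • z.2)) = f at *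
  have h1 := GB.comp_affine (u := (0 : Z3 n)) (a := (0 : V2 n × E n)) hR hs hT (M := C) (κ := κ)
    (by rw [map_zero, add_zero]; exact h0)
  rw [one_mul] at h1
  exact h1

lemma GB_one_sub {f : Z3 n → ℂ} (hR : 0 ≤ R) (hf : C∞ f) {z : Z3 n} (h : GB κ f z N R) :
    GB κ (fun z => 1 - f z) z (1 + N) R := by
  have := (GB_const (κ := κ) hR (1 : ℂ) z).sub contDiff_const hf h
  rwa [norm_one] at this

lemma Cuts.fX_eventually_zero (hc : Cuts n κ R C h ψ X) {z₀ : Z3 n} (hz : jap h z₀.2.2.2 / 8 < ‖z₀.2.1‖) :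
    fX X =ᶠ[𝓝 z₀] fun _ => 0 := by
  have h1 : Continuous fun z : Z3 n => jap h z.2.2.2 / 8 := ((continuous_jap h).comp continuous_snd.snd.snd).div_const _
  have h2 : Continuous fun z : Z3 n => ‖z.2.1‖ := continuous_snd.fst.norm
  filter_upwards [(h1.continuousAt.eventually_lt h2.continuousAt hz)] with z hz using hc.X_zero _ _ hz.le

lemma Cuts.fX_eventually_one (hc : Cuts n κ R C h ψ X) {z₀ : Z3 n} (hz : ‖z₀.2.1‖ < jap h z₀.2.2.2 / 16) :
    fX X =ᶠ[𝓝 z₀] fun _ => 1 := by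
  have h1 : Continuous fun z : Z3 n => jap h z.2.2.2 / 16 := ((continuous_jap h).comp continuous_snd.snd.snd).div_const _
  have h2 : Continuous fun z : Z3 n => ‖z.2.1‖ := continuous_snd.fst.norm
  filter_upwards [(h2.continuousAt.eventually_lt h1.continuousAt hz)] with z hz using hc.X_one _ _ hz.le

lemma Cuts.fψ_eventually_zero (hc : Cuts n κ R C h ψ X) {z₀ : Z3 n} (hz : 1 < ‖z₀.1‖) : fψ ψ =ᶠ[𝓝 z₀] fun _ => 0 := by
  filter_upwards [continuous_fst.norm.continuousAt.eventually (lt_mem_nhds hz)] with z hz using hc.ψ_zero _ hz.le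

lemma Cuts.fψ_eventually_one (hc : Cuts n κ R C h ψ X) {z₀ : Z3 n} (hz : ‖z₀.1‖ ^ 2 < 1 / 2) : fψ ψ =ᶠ[𝓝 z₀] fun _ => 1 := by
  filter_upwards [(continuous_fst.norm.pow 2).continuousAt.eventually (gt_mem_nhds hz)] with z hz using hc.ψ_one _ hz.le

lemma tendsto_sclZ (z₀ : Z3 n) (β c : ℝ) : Tendsto (fun z => z₀ + sclZ β c z) (𝓝 0) (𝓝 z₀) := by
  have : Continuous fun z => z₀ + sclZ β c z := continuous_const.add (sclZ β c).continuous
  simpa using this.tendsto 0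

/-- The amplitude away from the diagonal in `Θ`. -/
def farAmp (X : V2 n × E n → ℂ) (Λ : E² n → ℝ) (p : E² n → ℂ) (z : Z3 n) : ℂ := (1 - fX X z) * amp Λ p z

/-- The amplitude near the diagonal in `Θ`, but away from it in `Y`. -/
def midAmp (ψ : V2 n → ℂ) (X : V2 n × E n → ℂ) (Λ : E² n → ℝ) (p : E² n → ℂ) (z : Z3 n) : ℂ :=
  fX X z * ((1 - fψ ψ z) * amp Λ p z)

/-- The amplitude near the diagonal in `Y`. -/
def nearAmp (ψ : V2 n → ℂ) (Λ : E² n → ℝ) (p : E² n → ℂ) (z : Z3 n) : ℂ := fψ ψ z * amp Λ p z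

lemma Data.contDiff_amp (D : Data κ γ R ρ M m h Λ p) : C∞ (amp Λ p) :=
  GevreyConj.contDiff_amp D.phase.sym.smooth D.sym.smooth

lemma contDiff_farAmp (D : Data κ γ R ρ M m h Λ p) (hc : Cuts n κ R C h ψ X) : C∞ (farAmp X Λ p) :=
  (contDiff_const.sub hc.contDiff_fX).mul D.contDiff_amp

lemma contDiff_midAmp (D : Data κ γ R ρ M m h Λ p) (hc : Cuts n κ R C h ψ X) : C∞ (midAmp ψ X Λ p) :=
  hc.contDiff_fX.mul ((contDiff_const.sub hc.contDiff_fψ).mul D.contDiff_amp)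

lemma contDiff_nearAmp (D : Data κ γ R ρ M m h Λ p) (hc : Cuts n κ R C h ψ X) : C∞ (nearAmp ψ Λ p) :=
  hc.contDiff_fψ.mul D.contDiff_amp

lemma exists_GB_farAmp (n : ℕ) (hκ : 1 < κ) (hγ : 0 < γ) (m C : ℝ) (hC : 0 ≤ C) : ∃ C' : ℝ, 0 < C' ∧
    ∀ {R ρ M h Λ p ψ X}, Data κ γ R ρ M m h Λ p → Cuts n κ R C h ψ X →
    ∀ z₀ : Z3 n, GB κ (farAmp X Λ p) z₀ (if ‖z₀.2.1‖ < jap h z₀.2.2.2 / 16 then 0 else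
      C' * M * ew κ (2 * γ) (jap h z₀.2.2.2) * ew κ (2 * γ) ‖z₀.2.1‖) (48 * R) := by
  obtain ⟨C₀, hC₀, hb⟩ := exists_GB_amp_lossy n hκ hγ m
  refine ⟨(1 + C) * C₀, pos!, fun {R ρ M h Λ p ψ X} D hc z₀ => ?_⟩
  have hR := D.hR
  split_ifs with hz
  · refine GB_zero_of_eventuallyEq pos! ?_
    filter_upwards [hc.fX_eventually_one hz] with z hz
    simp [farAmp, hz]
  · have hb1 : 1 ≤ jap h z₀.2.2.2 := one_le_jap D.hh _
    have h1 := hb D (z₀ := z₀) (β := 1) (c := 1) (t := 3) zero_le_one zero_le_one num!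
      (by have := one_le_jap D.hh (z₀.2.2.2 + pr2 z₀.2.1); linarith)
      (by have := one_le_jap D.hh (z₀.2.2.2 + pr2 z₀.2.1 + pr1 z₀.2.1); linarith)
    have h2 := GB_one_sub hR.le (contDiff_comp_sclZ hc.contDiff_fX z₀ 1 1) (hc.GB_fX hR.le D.hh z₀ zero_le_one hb1 zero_le_one hb1)
    have h3 := (h2.mono hR.le le_rfl (show R ≤ 8 * 3 * R by linarith)).mul hκ.le pos!
      (contDiff_const.sub (contDiff_comp_sclZ hc.contDiff_fX z₀ 1 1)) (contDiff_comp_sclZ D.contDiff_amp z₀ 1 1) h1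
    exact (GB.of_sclZ pos! (contDiff_farAmp D hc) le_rfl le_rfl h3).mono pos! (le_of_eq (by ring)) (le_of_eq (by ring))

lemma exists_GB_midAmp (n : ℕ) (hκ : 1 < κ) (hγ : 0 < γ) (m C : ℝ) (hC : 0 ≤ C) : ∃ C' : ℝ, 0 < C' ∧
    ∀ {R ρ M h Λ p ψ X}, Data κ γ R ρ M m h Λ p → Cuts n κ R C h ψ X →
    ∀ z₀ : Z3 n, GB κ (fun z => midAmp ψ X Λ p (z₀ + sclZ (jap h z₀.2.2.2) 1 z)) 0
      (if ‖z₀.1‖ ^ 2 < 1 / 2 ∨ jap h z₀.2.2.2 / 8 < ‖z₀.2.1‖ then 0 else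
      C' * M * ew κ (2 * γ) (jap h z₀.2.2.2) * ew κ (2 * γ) ‖z₀.2.1‖) (192 * R) := by
  obtain ⟨C₀, hC₀, hb⟩ := exists_GB_amp_lossy n hκ hγ m
  refine ⟨(1 + C) * ((1 + C) * C₀), pos!, fun {R ρ M h Λ p ψ X} D hc z₀ => ?_⟩
  have hR := D.hR
  have hM := D.hM
  set b := jap h z₀.2.2.2
  have hb1 : 1 ≤ b := one_le_jap D.hh _
  split_ifs with hz
  · refine GB_zero_of_eventuallyEq pos! ?_
    have : ∀ᶠ z in 𝓝 z₀, midAmp ψ X Λ p z = 0 := by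
      rcases hz with hz | hz
      · filter_upwards [hc.fψ_eventually_one hz] with z hz
        simp [midAmp, hz]
      · filter_upwards [hc.fX_eventually_zero hz] with z hz
        simp [midAmp, hz]
    exact (tendsto_sclZ z₀ b 1).eventually this
  · push Not at hz
    have hpr : ‖pr2 z₀.2.1‖ ≤ b / 8 := (norm_pr2_le _).trans hz.2
    have hpr1 : ‖pr1 z₀.2.1‖ ≤ b / 8 := (norm_pr1_le _).trans hz.2
    have j1 := jap_le_add h z₀.2.2.2 (pr2 z₀.2.1)
    have j2 := jap_le_add h (z₀.2.2.2 + pr2 z₀.2.1) (pr1 z₀.2.1)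
    have h1 := hb D (z₀ := z₀) (β := b) (c := 1) (t := 6) lin! zero_le_one num!
      lin! lin!
    have s1 := contDiff_comp_sclZ hc.contDiff_fψ z₀ b 1
    have s2 := contDiff_comp_sclZ hc.contDiff_fX z₀ b 1
    have s3 := contDiff_comp_sclZ D.contDiff_amp z₀ b 1
    have h2 := GB_one_sub hR.le s1 (hc.GB_fψ hR.le z₀ b 1)
    have h3 := (h2.mono hR.le le_rfl (show R ≤ 8 * 6 * R by linarith)).mul hκ.le pos!
      (contDiff_const.sub s1) s3 h1
    have h4 := ((hc.GB_fX hR.le D.hh z₀ lin! le_rfl zero_le_one hb1).mono hR.le (show C ≤ 1 + C by linarith)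
      (show R ≤ 2 * (8 * 6 * R) by linarith)).mul hκ.le pos! s2 ((contDiff_const.sub s1).mul s3) h3
    exact h4.mono pos! (le_of_eq (by ring)) (le_of_eq (by ring))

lemma exists_GB_nearAmp_lossy (n : ℕ) (hκ : 1 < κ) (hγ : 0 < γ) (m C : ℝ) (hC : 0 ≤ C) : ∃ C' : ℝ, 0 < C' ∧
    ∀ {R ρ M h Λ p ψ X}, Data κ γ R ρ M m h Λ p → Cuts n κ R C h ψ X →
    ∀ z₀ : Z3 n, GB κ (fun z => nearAmp ψ Λ p (z₀ + sclZ 1 1 z)) 0 (if 1 < ‖z₀.1‖ then 0 else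
      C' * M * ew κ (2 * γ) (jap h z₀.2.2.2) * ew κ (2 * γ) ‖z₀.2.1‖) (96 * R) := by
  obtain ⟨C₀, hC₀, hb⟩ := exists_GB_amp_lossy n hκ hγ m
  refine ⟨(1 + C) * C₀, pos!, fun {R ρ M h Λ p ψ X} D hc z₀ => ?_⟩
  have hR := D.hR
  split_ifs with hz
  · have : ∀ᶠ z in 𝓝 z₀, nearAmp ψ Λ p z = 0 := by
      filter_upwards [hc.fψ_eventually_zero hz] with z hz
      simp [nearAmp, hz]
    exact GB_zero_of_eventuallyEq pos! ((tendsto_sclZ z₀ 1 1).eventually this)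
  · have h1 := hb D (z₀ := z₀) (β := 1) (c := 1) (t := 3) zero_le_one zero_le_one num!
      (by have := one_le_jap D.hh (z₀.2.2.2 + pr2 z₀.2.1); linarith)
      (by have := one_le_jap D.hh (z₀.2.2.2 + pr2 z₀.2.1 + pr1 z₀.2.1); linarith)
    have h3 := ((hc.GB_fψ hR.le z₀ 1 1).mono hR.le (show C ≤ 1 + C by linarith) (show R ≤ 8 * 3 * R by linarith)).mul hκ.le
      pos! (contDiff_comp_sclZ hc.contDiff_fψ z₀ 1 1) (contDiff_comp_sclZ D.contDiff_amp z₀ 1 1) h1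
    exact h3.mono pos! (le_of_eq (by ring)) (by nlinarith)

lemma exists_GB_nearAmp (n : ℕ) (hκ : 1 < κ) (hγ : 0 < γ) (hR : 0 < R) (m C : ℝ) (hC : 0 ≤ C) : ∃ C' : ℝ, 0 < C' ∧
    ∀ {ρ M h Λ p ψ X}, Data κ γ R ρ M m h Λ p → Cuts n κ R C h ψ X →
    ∀ z₀ : Z3 n, ‖z₀.2.1‖ ≤ jap h z₀.2.2.2 / 8 →
      GB κ (fun z => nearAmp ψ Λ p (z₀ + sclZ (jap h z₀.2.2.2 ^ (1 - 1 / κ)) (jap h z₀.2.2.2) z)) 0 (if 1 < ‖z₀.1‖ then 0 else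
        C' * M * jap h z₀.2.2.2 ^ m * ew κ γ ‖z₀.2.1‖) (96 * R) := by
  obtain ⟨C₀, hC₀, hb⟩ := exists_GB_amp_near n hκ hγ hR m
  refine ⟨(1 + C) * C₀, pos!, fun {ρ M h Λ p ψ X} D hc z₀ hΘ => ?_⟩
  set b := jap h z₀.2.2.2
  split_ifs with hz
  · have : ∀ᶠ z in 𝓝 z₀, nearAmp ψ Λ p z = 0 := by
      filter_upwards [hc.fψ_eventually_zero hz] with z hz
      simp [nearAmp, hz]
    exact GB_zero_of_eventuallyEq pos! ((tendsto_sclZ z₀ _ b).eventually this)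
  · have h1 := hb D (z₀ := z₀) (not_lt.mp hz) hΘ
    have h3 := ((hc.GB_fψ hR.le z₀ (b ^ (1 - 1 / κ)) b).mono hR.le (show C ≤ 1 + C by linarith) (show R ≤ 48 * R by linarith)).mul hκ.le
      pos! (contDiff_comp_sclZ hc.contDiff_fψ z₀ _ b) (contDiff_comp_sclZ D.contDiff_amp z₀ _ b) h1
    exact h3.mono pos! (le_of_eq (by ring)) lin!

end Cutoffs

section Exponents

variable {q : ℝ}

lemma rpow_inv_le_mul {k : ℝ} (hκ : 1 ≤ κ) (hk : 1 ≤ k) (hx : 0 ≤ x) (hy : 0 ≤ y) (h : x ≤ k * y) :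
    x ^ (1 / κ) ≤ k * y ^ (1 / κ) := by
  have hκ0 : 0 ≤ 1 / κ := pos!
  calc x ^ (1 / κ) ≤ (k * y) ^ (1 / κ) := mono!
    _ = k ^ (1 / κ) * y ^ (1 / κ) := mul_rpow lin! hy
    _ ≤ k ^ (1 : ℝ) * y ^ (1 / κ) := by
        gcongr
        rw [div_le_one lin!]; exact hκ
    _ = _ := by rw [rpow_one]

@[gcongr] lemma ew_le_ew_right {s x : ℝ} (hκ : 0 ≤ κ) (hs : 0 ≤ s) (hx : 0 ≤ x) (h : x ≤ y) : ew κ s x ≤ ew κ s y :=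
  ew_mono hκ hs hx le_rfl h

lemma ew_far_le (hκ : 1 ≤ κ) (hγ : 0 ≤ γ) (hb : 0 ≤ b) (hq : b / 16 ≤ q) :
    ew κ (2 * γ) b * ew κ (2 * γ) q ≤ ew κ (-(4 * γ)) b * (ew κ (-γ) q * ew κ (256 * γ) q) := by
  have h := rpow_inv_le_mul (k := 16) hκ num! hb lin! (show b ≤ 16 * q by linarith)
  have hq0 : 0 ≤ q ^ (1 / κ) := rpow_nonneg lin! _
  unfold ew
  rw [← exp_add, ← exp_add, ← exp_add]
  refine exp_le_exp.mpr ?_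
  nlinarith [mul_le_mul_of_nonneg_left h hγ, mul_nonneg hγ hq0]

lemma ew_mid_le (hκ : 1 ≤ κ) (hγ : 0 ≤ γ) (hb : 1 ≤ b) (hq : 0 ≤ q) (hqb : q ≤ b / 8) (hy0 : 0 ≤ y) (hy : 1 / 2 ≤ y ^ 2) :
    ew κ (2 * γ) b * ew κ (2 * γ) q ≤ ew κ (-(4 * γ)) b * (ew κ (-γ) q * (ew κ (-γ) y * ew κ (256 * γ) (b * y))) := by
  have hy2 : 1 / 2 ≤ y := by nlinarith
  have h1 := rpow_inv_le_mul (k := 2) hκ num! lin! pos! (show b ≤ 2 * (b * y) by nlinarith)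
  have h2 := rpow_inv_le_mul (k := 1) hκ le_rfl hy0 pos! (show y ≤ 1 * (b * y) by nlinarith)
  have h3 := rpow_inv_le_mul (k := 1) hκ le_rfl hq lin! (show q ≤ 1 * b by linarith)
  have hq0 : 0 ≤ (b * y) ^ (1 / κ) := rpow_nonneg pos! _
  unfold ew
  rw [← exp_add, ← exp_add, ← exp_add, ← exp_add]
  refine exp_le_exp.mpr ?_
  nlinarith [mul_le_mul_of_nonneg_left h1 hγ, mul_nonneg hγ hq0, mul_le_mul_of_nonneg_left h2 hγ, mul_le_mul_of_nonneg_left h3 hγ]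

lemma ew_tail_le (hκ : 1 ≤ κ) (hγ : 0 ≤ γ) (hb : 0 ≤ b) (hq : b / 16 ≤ q) :
    ew κ γ b ≤ ew κ (-(4 * γ)) b * (ew κ (-γ) q * ew κ (256 * γ) q) := by
  refine le_trans ?_ (ew_far_le hκ hγ hb hq)
  have h1 := ew_mono (κ := κ) lin! lin! hb (show γ ≤ 2 * γ by linarith) le_rfl
  have h2 := one_le_ew (κ := κ) (γ := 2 * γ) (t := q) lin! lin!
  exact h1.trans (le_mul_of_one_le_right (ew_pos _ _ _).le h2)

lemma ew_le_ew_mul {a : ℝ} (ha : a ≤ 255 * γ) (hq : 0 ≤ q) :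
    ew κ a q ≤ ew κ (-γ) q * ew κ (256 * γ) q := by
  rw [ew_mul]
  refine exp_le_exp.mpr ?_
  have : 0 ≤ q ^ (1 / κ) := rpow_nonneg hq _
  exact mul_le_mul_of_nonneg_right lin! this

end Exponents

section GBLinear

variable {U U' F : Type} [NormedAddCommGroup U] [NormedSpace ℝ U]
  [NormedAddCommGroup U'] [NormedSpace ℝ U'] [NormedAddCommGroup F] [NormedSpace ℝ F]

lemma GB.comp_linear (hR : 0 ≤ R) {f : U → F} (hf : C∞ f) {T : U' →L[ℝ] U} (hT : ‖T‖ ≤ 1)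
    (h : GB κ f 0 M R) : GB κ (fun v => f (T v)) 0 M R := by
  have := GB.comp_affine (u := (0 : U')) (a := (0 : U)) hR hf hT (by rw [map_zero, add_zero]; exact h)
  simpa using this

lemma GB.of_translate {f : U → F} {a : U} (h : GB κ (fun z => f (a + z)) 0 M R) : GB κ f a M R := by
  intro k
  have := h k
  rwa [iteratedFDeriv_comp_add_left, add_zero] at this

end GBLinear

section Remainders

/-- The number of regularisations. -/
def stN (n : ℕ) : ℕ := (0 + (finrank ℝ (V2 n) + 1)) * finrank ℝ (V2 n)

/-- The factor between the radii of the amplitudes and those of the symbols. -/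
abbrev bigK (κ : ℝ) (n : ℕ) : ℝ := 2 ^ κ * (192 * (8 * 2 ^ κ) ^ stN n)

lemma one_le_two_rpow (hκ : 0 ≤ κ) : (1 : ℝ) ≤ 2 ^ κ := one_le_rpow num! hκ

lemma le_bigK (hκ : 0 ≤ κ) : 192 * 2 ^ κ ≤ bigK κ n ∧ 192 ≤ bigK κ n ∧ (8 * 2 ^ κ) ^ stN n * 48 ≤ bigK κ n := by
  have h1 := one_le_two_rpow hκ
  have h2 : (1 : ℝ) ≤ (8 * 2 ^ κ) ^ stN n := one_le_pow₀ lin!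
  unfold bigK
  refine ⟨by nlinarith, by nlinarith, ?_⟩
  calc ((8 : ℝ) * 2 ^ κ) ^ stN n * 48 ≤ 1 * (192 * (8 * 2 ^ κ) ^ stN n) := lin!
    _ ≤ _ := mono!

lemma bigK_pos (κ : ℝ) (n : ℕ) : 0 < bigK κ n := by unfold bigK; positivity

/-- The directions of the regularisation in `Θ`. -/
def stDir (n : ℕ) : List (V2 n × (V2 n × (E² n))) :=
  (stDirs (V2 n) (0 + (finrank ℝ (V2 n) + 1))).map fun e => (e, (e, 0))

lemma stDir_length : (stDir n).length = stN n := by rw [stDir, List.length_map, stDirs_length, stN]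

lemma stDir_norm : ∀ e ∈ stDir n, ‖e.1‖ ≤ 1 ∧ ‖e.2‖ ≤ 1 := by
  intro e he
  simp only [stDir, List.mem_map] at he
  obtain ⟨a, ha, rfl⟩ := he
  have := stDirs_norm _ a ha
  exact ⟨this, max_le this (by simp)⟩

lemma integrable_stWL_stDir (hs : 0 < s) : Integrable (stWL s (stDir n)) := by
  have := integrable_pow_mul_stWL (V := V2 n) hs (fun e => ((e, 0) : V2 n × (E² n))) 0
  simpa [stDir] using this

/-- The basis of the space of the oscillatory variables. -/
def eB (n : ℕ) : OrthonormalBasis (Fin n ⊕ Fin n) ℝ (V2 n) :=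
  (basisFun (Fin n) ℝ).prod (basisFun (Fin n) ℝ)

variable {ψ : V2 n → ℂ} {X : V2 n × E n → ℂ}

def farG (R : ℝ) (X : V2 n × E n → ℂ) (Λ : E² n → ℝ) (p : E² n → ℂ) : Z3 n → ℂ :=
  StL (48 * R) (stDir n) (farAmp X Λ p)

lemma contDiff_farG (D : Data κ γ R ρ M m h Λ p) (hc : Cuts n κ R C h ψ X) : C∞ (farG R X Λ p) :=
  contDiff_StL (contDiff_farAmp D hc) _ _

/-- The contribution of the region away from the diagonal in `Θ`. -/
def farInt (R : ℝ) (X : V2 n × E n → ℂ) (Λ : E² n → ℝ) (p : E² n → ℂ) : E² n → ℂ :=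
  oscInt (farG R X Λ p) (id : V2 n → V2 n) volume

lemma integral_ew_nonneg : 0 ≤ ∫ Θ : V2 n, ew κ (-γ) ‖Θ‖ := integral_nonneg fun _ => (ew_pos _ _ _).le

lemma exists_GB_oscInt_far (hκ : 1 < κ) (hγ : 0 < γ) (hr : 0 < r) (hγr : 1024 * γ = r ^ (-(1 / κ))) {w : V2 n → ℝ}
    (hw : Integrable w) (hw0 : ∀ P, 0 ≤ w P) : ∃ C' : ℝ, 0 < C' ∧ ∀ {h K : ℝ} {G : Z3 n → ℂ}, 0 ≤ K → C∞ G →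
    (∀ P Θ u, GB κ (fun z : V2 n × (E² n) => G (z.1, Θ, z.2)) (P, u) (if ‖Θ‖ < jap h u.2 / 16 then 0 else
      w P * (K * ew κ (2 * γ) (jap h u.2) * ew κ (2 * γ) ‖Θ‖)) r) →
    (∀ u, OscDom κ G (id : V2 n → V2 n) volume u) ∧
      ∀ q, GB κ (oscInt G (id : V2 n → V2 n) volume) q (C' * K * ew κ (-(4 * γ)) (jap h q.2)) (2 ^ κ * r) := by
  have hτ : Integrable fun Θ : V2 n => ew κ (-γ) ‖Θ‖ := integrable_ew lin! hγ
  have hI1 : 0 ≤ ∫ P, w P := integral_nonneg hw0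
  have hI2 := integral_ew_nonneg (n := n) (κ := κ) (γ := γ)
  refine ⟨2 ^ κ * (∫ P, w P) * (∫ Θ : V2 n, ew κ (-γ) ‖Θ‖) + 1, pos!, fun {h K G} hK hG hGB => ?_⟩
  have hj : ∀ u : E² n, 0 ≤ jap h u.2 := fun u => sqrt_nonneg _
  have hdom : ∀ u, OscDom κ G (id : V2 n → V2 n) volume u := by
    refine OscDom.of_ew lin! hr hγr hw ((continuous_jap h).comp continuous_snd) fun B =>
      ⟨fun Θ => K * ew κ (2 * γ) B * ew κ (-γ) ‖Θ‖, hτ.const_mul _, fun u hu P Θ => (hGB P Θ u).mono hr.le ?_ le_rfl⟩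
    have hwP := hw0 P
    split_ifs
    · positivity
    · calc _ ≤ w P * (K * ew κ (2 * γ) B * (ew κ (-γ) ‖Θ‖ * ew κ (256 * γ) ‖Θ‖)) := by
            gcongr
            exacts [hj u, hu, ew_le_ew_mul lin! (norm_nonneg Θ)]
        _ = _ := by rw [id]; ring
  refine ⟨hdom, fun q => GB.of_translate (GB.mono (GB_oscInt_ew hκ.le hr hγr one_pos hG continuous_id hdom
    (ContinuousLinearMap.id ℝ _) hw (τ := fun Θ => K * ew κ (-(4 * γ)) (jap h q.2) * ew κ (-γ) ‖Θ‖) (hτ.const_mul _)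
    (.of_forall fun Θ P => ?_)) pos! ?_ le_rfl)⟩
  · have hwP := hw0 P
    simp only [one_smul, id, one_mul]
    refine (hGB P Θ q).translate.mono hr.le ?_ le_rfl
    split_ifs with hz
    · positivity
    · have h2 := ew_far_le hκ.le hγ.le (hj q) (not_lt.mp hz)
      calc _ = w P * (K * (ew κ (2 * γ) (jap h q.2) * ew κ (2 * γ) ‖Θ‖)) := by ring
        _ ≤ w P * (K * (ew κ (-(4 * γ)) (jap h q.2) * (ew κ (-γ) ‖Θ‖ * ew κ (256 * γ) ‖Θ‖))) := mono!
        _ = _ := by ring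
  · have : 0 ≤ K * ew κ (-(4 * γ)) (jap h q.2) := pos!
    rw [integral_const_mul]
    linarith

lemma exists_farInt (n : ℕ) (hκ : 1 < κ) (hγ : 0 < γ) (hR : 0 < R) (hγR : 1024 * γ = (bigK κ n * R) ^ (-(1 / κ)))
    (m C : ℝ) (hC : 0 ≤ C) : ∃ C' : ℝ, 0 < C' ∧
    ∀ {ρ M h Λ p ψ X}, Data κ γ R ρ M m h Λ p → Cuts n κ R C h ψ X →
      (∀ u, OscDom κ (farG R X Λ p) (id : V2 n → V2 n) volume u) ∧
      ∀ q, GB κ (farInt R X Λ p) q (C' * M * ew κ (-(4 * γ)) (jap h q.2)) (2 ^ κ * (bigK κ n * R)) := by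
  obtain ⟨C₀, hC₀, hb⟩ := exists_GB_farAmp n hκ hγ m C hC
  have hS : 0 < stC κ (48 * R) (48 * R) (stN n) := stC_pos _ pos! pos! _
  obtain ⟨C₁, hC₁, H⟩ := exists_GB_oscInt_far (n := n) hκ hγ pos! hγR (integrable_stWL_stDir (s := 48 * R) pos!)
    (stWL_nonneg _ _)
  refine ⟨C₁ * (stC κ (48 * R) (48 * R) (stN n) * C₀), pos!, fun {ρ M h Λ p ψ X} D hc => ?_⟩
  have hM := D.hM
  have hG := contDiff_farG D hc
  have := (le_bigK (n := n) (by linarith : 0 ≤ κ)).2.2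
  rw [mul_assoc C₁]
  refine H pos! hG fun P Θ u => GB.slice_mid pos! hG (((hb D hc (P, Θ, u)).StL' hκ.le (s := 48 * R)
    pos! le_rfl (contDiff_farAmp D hc) (stDir n) stDir_norm stDir_length.le).mono pos! ?_ ?_)
  · split_ifs
    exacts [(mul_zero _).le, le_of_eq (by ring)]
  · rw [← mul_assoc]
    gcongr

/-- The exchange of the variables `Y` and `Θ`. -/
def swapL (n : ℕ) : Z3 n →L[ℝ] Z3 n := cΘ.prod (cY.prod cq)

def midG (ψ : V2 n → ℂ) (X : V2 n × E n → ℂ) (Λ : E² n → ℝ) (p : E² n → ℂ) (z : Z3 n) : ℂ :=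
  midAmp ψ X Λ p (z.2.1, z.1, z.2.2)

lemma contDiff_midG (D : Data κ γ R ρ M m h Λ p) (hc : Cuts n κ R C h ψ X) : C∞ (midG ψ X Λ p) :=
  (contDiff_midAmp D hc).comp (swapL n).contDiff

/-- The contribution of the region near the diagonal in `Θ`, but away from it in `Y`. -/
def midInt (ψ : V2 n → ℂ) (X : V2 n × E n → ℂ) (Λ : E² n → ℝ) (p : E² n → ℂ) : E² n → ℂ :=
  oscInt (midG ψ X Λ p) (id : V2 n → V2 n) volume

lemma exists_midInt (n : ℕ) (hκ : 1 < κ) (hγ : 0 < γ) (hR : 0 < R) (hγR : 1024 * γ = (bigK κ n * R) ^ (-(1 / κ)))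
    (m C : ℝ) (hC : 0 ≤ C) : ∃ C' : ℝ, 0 < C' ∧
    ∀ {ρ M h Λ p ψ X}, Data κ γ R ρ M m h Λ p → Cuts n κ R C h ψ X →
      (∀ u, OscDom κ (midG ψ X Λ p) (id : V2 n → V2 n) volume u) ∧
      ∀ q, GB κ (midInt ψ X Λ p) q (C' * M * ew κ (-(4 * γ)) (jap h q.2)) (2 ^ κ * (bigK κ n * R)) := by
  obtain ⟨C₀, hC₀, hb⟩ := exists_GB_midAmp n hκ hγ m C hC
  have hτ : Integrable fun Θ : V2 n => ew κ (-γ) ‖Θ‖ := integrable_ew lin! hγ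
  have hI2 := integral_ew_nonneg (n := n) (κ := κ) (γ := γ)
  have hK1 := (le_bigK (n := n) (by linarith : 0 ≤ κ)).2.1
  refine ⟨2 ^ κ * (∫ Θ : V2 n, ew κ (-γ) ‖Θ‖) * (C₀ * ∫ Θ : V2 n, ew κ (-γ) ‖Θ‖) + 1, pos!, fun {ρ M h Λ p ψ X} D hc => ?_⟩
  have hM := D.hM
  have hG := contDiff_midG D hc
  have hA := contDiff_midAmp D hc
  have hj : ∀ u : E² n, 1 ≤ jap h u.2 := fun u => one_le_jap D.hh _
  have hdom : ∀ u, OscDom κ (midG ψ X Λ p) (id : V2 n → V2 n) volume u := by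
    refine OscDom.of_ew lin! pos! hγR hτ ((continuous_jap h).comp continuous_snd) fun B => ?_
    refine ⟨fun Y => C₀ * M * ew κ (5 * γ) B * ew κ (-γ) ‖Y‖, hτ.const_mul _, fun u hu Θ Y => ?_⟩
    have h1 := GB.slice_tail pos! hA (GB.of_sclZ pos! hA (hj u) le_rfl (hb D hc (Y, Θ, u)))
    refine h1.mono pos! ?_ mono!
    have hu0 : 0 ≤ jap h u.2 := sqrt_nonneg _
    have k2 := ew_le_ew_mul (κ := κ) (show 0 ≤ 255 * γ by linarith) (norm_nonneg Y)
    rw [ew, zero_mul, exp_zero] at k2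
    simp only [id]
    split_ifs with hz
    · positivity
    · push Not at hz
      have k3 : ew κ (2 * γ) (jap h u.2) * ew κ (2 * γ) ‖Θ‖ ≤ ew κ (5 * γ) (jap h u.2) * ew κ (-γ) ‖Θ‖ := by
        unfold ew
        rw [← exp_add, ← exp_add]
        have hq : ‖Θ‖ ^ (1 / κ) ≤ jap h u.2 ^ (1 / κ) :=
          rpow_le_rpow (norm_nonneg _) (hz.2.trans (by linarith [hj u])) pos!
        exact exp_le_exp.mpr (by nlinarith)
      calc _ = C₀ * M * (ew κ (2 * γ) (jap h u.2) * ew κ (2 * γ) ‖Θ‖) * 1 := by ring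
        _ ≤ C₀ * M * (ew κ (5 * γ) (jap h u.2) * ew κ (-γ) ‖Θ‖) * (ew κ (-γ) ‖Y‖ * ew κ (256 * γ) ‖Y‖) := mono!
        _ ≤ C₀ * M * (ew κ (5 * γ) B * ew κ (-γ) ‖Θ‖) * (ew κ (-γ) ‖Y‖ * ew κ (256 * γ) ‖Y‖) := by gcongr; exact hu
        _ = _ := by ring
  refine ⟨hdom, fun q => GB.of_translate ?_⟩
  have key := GB_oscInt_ew hκ.le pos! hγR (zero_lt_one.trans_le (hj q)) hG continuous_id hdom
    (ContinuousLinearMap.id ℝ _) hτ (τ := fun Y => C₀ * M * ew κ (-(4 * γ)) (jap h q.2) * ew κ (-γ) ‖Y‖) (hτ.const_mul _)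
    (.of_forall fun Y Θ => by
      have h1 := GB.comp_linear pos! (contDiff_comp_sclZ hA _ _ _) (norm_insTail_le (V := V2 n) (S := V2 n) (U := E² n))
        (hb D hc (Y, Θ, q))
      have e : (fun z : V2 n × (E² n) => midG ψ X Λ p (Θ + jap h q.2 • z.1, Y, q + ContinuousLinearMap.id ℝ (E² n) z.2)) =
          fun z => midAmp ψ X Λ p ((Y, Θ, q) + sclZ (jap h q.2) 1 (insTail (V2 n) (V2 n) (E² n) z)) := by
        funext z
        rw [insTail_apply, sclZ_apply]
        simp only [midG, one_smul, mk_add_mk, add_zero]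
        rfl
      rw [e]
      refine h1.mono pos! ?_ mono!
      simp only [id]
      split_ifs with hz
      · positivity
      · push Not at hz
        have h2 := ew_mid_le hκ.le hγ.le (hj q) (norm_nonneg Θ) hz.2 (norm_nonneg Y) hz.1
        calc _ = C₀ * M * (ew κ (2 * γ) (jap h q.2) * ew κ (2 * γ) ‖Θ‖) := by ring
          _ ≤ C₀ * M * (ew κ (-(4 * γ)) (jap h q.2) * (ew κ (-γ) ‖Θ‖ * (ew κ (-γ) ‖Y‖ * ew κ (256 * γ) (jap h q.2 * ‖Y‖)))) := mono!
          _ = _ := by ring)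
  refine GB.mono key pos! ?_ le_rfl
  rw [integral_const_mul]
  calc _ = (2 ^ κ * (∫ Θ : V2 n, ew κ (-γ) ‖Θ‖) * (C₀ * ∫ Θ : V2 n, ew κ (-γ) ‖Θ‖)) * M * ew κ (-(4 * γ)) (jap h q.2) := by ring
    _ ≤ _ := by gcongr; linarith

end Remainders

section TaylorRemainders

variable {ψ : V2 n → ℂ} {X : V2 n × E n → ℂ}

/-- The mixed derivatives of the amplitude near the diagonal in `Y`. -/
def nearD (ψ : V2 n → ℂ) (Λ : E² n → ℝ) (p : E² n → ℂ) (j : ℕ) : Z3 n → ℂ := (dmix (eB n))^[j] (nearAmp ψ Λ p)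

lemma contDiff_nearD (D : Data κ γ R ρ M m h Λ p) (hc : Cuts n κ R C h ψ X) (j : ℕ) : C∞ (nearD ψ Λ p j) :=
  contDiff_dmix_iterate _ (contDiff_nearAmp D hc) j

def derK (κ : ℝ) (n : ℕ) : ℝ := (2 * n + 1) * (2 ^ κ * 96 * 2 ^ κ)

lemma derK_pos (κ : ℝ) (n : ℕ) : 0 < derK κ n := by unfold derK; positivity

lemma sclZ_Y (β c : ℝ) (v : V2 n) : sclZ β c (v, 0, 0) = (v, 0, 0) := by
  rw [sclZ_apply]; simp

lemma sclZ_Θ (β c : ℝ) (v : V2 n) : sclZ β c (0, v, 0) = β • (0, v, 0) := by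
  rw [sclZ_apply]; simp

lemma GB_nearD_aux (hκ : 0 ≤ κ) (hR : 0 ≤ R) {H : Z3 n → ℂ} (hH : C∞ H) {z₀ : Z3 n} (hβ : 0 < β)
    (h : GB κ (fun z => H (z₀ + sclZ β c z)) 0 N (96 * R)) (j : ℕ) :
    GB κ (fun z => (dmix (eB n))^[j] H (z₀ + sclZ β c z)) 0 (N * ((β⁻¹) ^ j * (derK κ n * R) ^ (2 * j) * ((j ! : ℝ) ^ κ) ^ 2))
      (2 ^ κ * (96 * R)) := by
  have hN := h.nonneg
  refine (GB_dmix_iterate (eB n) hκ pos! hβ hH (sclZ_Y β c) (sclZ_Θ β c) h j).mono pos! ?_ le_rfl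
  refine mul_le_mul_of_nonneg_left ?_ hN
  have h1 := fact_add_rpow_le hκ j j
  rw [← two_mul] at h1
  have h2 : ((Fintype.card (Fin n ⊕ Fin n) : ℕ) : ℝ) ≤ (2 * n + 1) ^ 2 := by
    rw [card_sum, card_fin]
    push_cast
    nlinarith [(cast_nonneg n : (0 : ℝ) ≤ n)]
  calc _ ≤ (β⁻¹ * (2 * n + 1) ^ 2) ^ j * (2 ^ κ * (96 * R)) ^ (2 * j) *
        (((2 : ℝ) ^ κ) ^ (2 * j) * ((j ! : ℝ) ^ κ * (j ! : ℝ) ^ κ)) := mono!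
    _ = _ := by unfold derK; rw [mul_pow (β⁻¹), ← pow_mul, mul_pow, mul_pow, mul_pow, mul_pow, mul_pow, mul_pow]; ring

lemma exists_GB_nearD (n : ℕ) (hκ : 1 < κ) (hγ : 0 < γ) (hR : 0 < R) (m C : ℝ) (hC : 0 ≤ C) : ∃ C' : ℝ, 0 < C' ∧
    ∀ {ρ M h Λ p ψ X}, Data κ γ R ρ M m h Λ p → Cuts n κ R C h ψ X →
    ∀ z₀ : Z3 n, ‖z₀.2.1‖ ≤ jap h z₀.2.2.2 / 8 → ∀ j : ℕ,
      GB κ (fun z => nearD ψ Λ p j (z₀ + sclZ (jap h z₀.2.2.2 ^ (1 - 1 / κ)) (jap h z₀.2.2.2) z)) 0 (if 1 < ‖z₀.1‖ then 0 else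
        C' * M * jap h z₀.2.2.2 ^ (m - (1 - 1 / κ) * j) * (derK κ n * R) ^ (2 * j) * ((j ! : ℝ) ^ κ) ^ 2 * ew κ γ ‖z₀.2.1‖)
        (2 ^ κ * (96 * R)) := by
  obtain ⟨C₀, hC₀, hb⟩ := exists_GB_nearAmp n hκ hγ hR m C hC
  refine ⟨C₀, hC₀, fun {ρ M h Λ p ψ X} D hc z₀ hΘ j => ?_⟩
  have hb0 : 0 < jap h z₀.2.2.2 := zero_lt_one.trans_le (one_le_jap D.hh _)
  have h1 := GB_nearD_aux lin! hR.le (contDiff_nearAmp D hc) pos! (hb D hc z₀ hΘ) j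
  refine h1.mono pos! (le_of_eq ?_) le_rfl
  split_ifs with hz
  · rw [zero_mul]
  · rw [← rpow_neg hb0.le, ← rpow_natCast _ j, ← rpow_mul hb0.le, sub_eq_add_neg m, rpow_add hb0]
    ring_nf

lemma exists_GB_nearD_lossy (n : ℕ) (hκ : 1 < κ) (hγ : 0 < γ) (m C : ℝ) (hC : 0 ≤ C) : ∃ C' : ℝ, 0 < C' ∧
    ∀ {R ρ M h Λ p ψ X}, Data κ γ R ρ M m h Λ p → Cuts n κ R C h ψ X →
    ∀ (z₀ : Z3 n) (j : ℕ), GB κ (nearD ψ Λ p j) z₀ (if 1 < ‖z₀.1‖ then 0 else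
      C' * M * ew κ (2 * γ) (jap h z₀.2.2.2) * ew κ (2 * γ) ‖z₀.2.1‖ * ((derK κ n * R) ^ (2 * j) * ((j ! : ℝ) ^ κ) ^ 2))
      (2 ^ κ * (96 * R)) := by
  obtain ⟨C₀, hC₀, hb⟩ := exists_GB_nearAmp_lossy n hκ hγ m C hC
  refine ⟨C₀, hC₀, fun {R ρ M h Λ p ψ X} D hc z₀ j => ?_⟩
  have hR := D.hR
  have h1 := GB_nearD_aux lin! hR.le (contDiff_nearAmp D hc) one_pos (hb D hc z₀) j
  refine (GB.of_sclZ pos! (contDiff_nearD D hc j) le_rfl le_rfl h1).mono pos! (le_of_eq ?_) le_rfl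
  split_ifs with hz
  · rw [zero_mul]
  · rw [inv_one, one_pow, one_mul]

/-- The inclusion `(Y, Θ, u) ↦ (Y, 0, u)`. -/
def diagZ (n : ℕ) : Z3 n →L[ℝ] Z3 n := cY.prod ((0 : Z3 n →L[ℝ] V2 n).prod cq)

def tailG (ψ : V2 n → ℂ) (X : V2 n × E n → ℂ) (Λ : E² n → ℝ) (p : E² n → ℂ) (j : ℕ) (z : Z3 n) : ℂ :=
  (1 - fX X z) * nearD ψ Λ p j (z.1, 0, z.2.2)

lemma contDiff_tailG (D : Data κ γ R ρ M m h Λ p) (hc : Cuts n κ R C h ψ X) (j : ℕ) : C∞ (tailG ψ X Λ p j) :=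
  (contDiff_const.sub hc.contDiff_fX).mul ((contDiff_nearD D hc j).comp (diagZ n).contDiff)

/-- The error from the localisation of the terms of the expansion. -/
def tailInt (ψ : V2 n → ℂ) (X : V2 n × E n → ℂ) (Λ : E² n → ℝ) (p : E² n → ℂ) (j : ℕ) : E² n → ℂ :=
  oscInt (tailG ψ X Λ p j) (id : V2 n → V2 n) volume

lemma contDiff_slice_mid {f : Z3 n → ℂ} (hf : C∞ f) (Θ : V2 n) :
    C∞ fun z : V2 n × (E² n) => f (z.1, Θ, z.2) := contDiff_slice hf Θ

lemma exists_GB_tailG (n : ℕ) (hκ : 1 < κ) (hγ : 0 < γ) (hR : 0 < R) (m C : ℝ) (hC : 0 ≤ C) : ∃ C' : ℝ, 0 < C' ∧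
    ∀ {ρ M h Λ p ψ X}, Data κ γ R ρ M m h Λ p → Cuts n κ R C h ψ X →
    ∀ (j : ℕ) (P Θ : V2 n) (u : E² n), GB κ (fun z : V2 n × (E² n) => tailG ψ X Λ p j (z.1, Θ, z.2)) (P, u)
      (if ‖Θ‖ < jap h u.2 / 16 then 0 else (closedBall (0 : V2 n) 1).indicator (fun _ => (1 : ℝ)) P *
        (C' * M * ew κ γ (jap h u.2) * ((derK κ n * R) ^ (2 * j) * ((j ! : ℝ) ^ κ) ^ 2))) (bigK κ n * R) := by
  obtain ⟨C₀, hC₀, hb⟩ := exists_GB_nearD n hκ hγ hR m C hC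
  obtain ⟨C₁, hC₁, hm⟩ := rpow_le_ew (by linarith : 0 < κ) hγ m
  refine ⟨(1 + C) * (C₀ * C₁), pos!, fun {ρ M h Λ p ψ X} D hc j P Θ u => ?_⟩
  have hM := D.hM
  have hb1 : 1 ≤ jap h u.2 := one_le_jap D.hh _
  have hK := bigK_pos κ n
  have hK1 := (le_bigK (n := n) (by linarith : 0 ≤ κ)).1
  have h2κ := one_le_two_rpow (by linarith : 0 ≤ κ)
  split_ifs with hz
  · refine GB_zero_of_eventuallyEq pos! ?_
    have h1 : ∀ᶠ z in 𝓝 ((P, Θ, u) : Z3 n), tailG ψ X Λ p j z = 0 := by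
      filter_upwards [hc.fX_eventually_one (z₀ := (P, Θ, u)) hz] with z hz
      simp [tailG, hz]
    have h2 : ContinuousAt (fun z : V2 n × (E² n) => ((z.1, Θ, z.2) : Z3 n)) (P, u) := fun!
    exact h2.eventually h1
  · have h1 := GB.of_sclZ hR.le hc.contDiff_fX le_rfl le_rfl (hc.GB_fX hR.le D.hh (P, Θ, u) zero_le_one hb1 zero_le_one hb1)
    have h2 := GB.slice_mid hR.le (contDiff_const.sub hc.contDiff_fX) (GB_one_sub hR.le hc.contDiff_fX h1)
    have h3 := hb D hc (P, 0, u) (by simp only [norm_zero]; positivity) j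
    have hκ' : 0 ≤ 1 - 1 / κ := by rw [sub_nonneg, div_le_one lin!]; exact hκ.le
    have hβ : 1 ≤ jap h u.2 ^ (1 - 1 / κ) := one_le_rpow hb1 hκ'
    have h4 := GB.slice_mid pos! (contDiff_nearD D hc j) (GB.of_sclZ pos! (contDiff_nearD D hc j) hβ hb1 h3)
    have h5 := (h2.mono hR.le le_rfl (show R ≤ 2 ^ κ * (96 * R) by nlinarith)).mul hκ.le pos!
      (contDiff_slice_mid (contDiff_const.sub hc.contDiff_fX) Θ) (contDiff_slice_mid (contDiff_nearD D hc j) 0) h4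
    refine h5.mono pos! ?_ (by nlinarith)
    by_cases hP : 1 < ‖P‖
    · rw [if_pos hP, mul_zero, indicator_of_notMem (by simpa using hP), zero_mul]
    · rw [if_neg hP, indicator_of_mem (by simpa using hP), one_mul]
      have e0 : ew κ γ ‖((P, 0, u) : Z3 n).2.1‖ = 1 := by
        rw [norm_zero, ew, Real.zero_rpow pos!, mul_zero, exp_zero]
      rw [e0, mul_one]
      have e1 : jap h u.2 ^ (m - (1 - 1 / κ) * j) ≤ C₁ * ew κ γ (jap h u.2) := by
        refine le_trans (rpow_le_rpow_of_exponent_le hb1 ?_) (hm _ hb1)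
        have : 0 ≤ (1 - 1 / κ) * j := pos!
        linarith
      have hdK := derK_pos κ n
      calc _ ≤ (1 + C) * (C₀ * M * (C₁ * ew κ γ (jap h u.2)) * (derK κ n * R) ^ (2 * j) * ((j ! : ℝ) ^ κ) ^ 2) := by
            gcongr
        _ = _ := by ring

lemma integrable_indicator_one : Integrable ((closedBall (0 : V2 n) 1).indicator fun _ => (1 : ℝ)) :=
  integrable_indicator_closedBall 1 1

lemma indicator_one_nonneg (P : V2 n) : 0 ≤ (closedBall (0 : V2 n) 1).indicator (fun _ => (1 : ℝ)) P :=
  Set.indicator_nonneg (fun _ _ => zero_le_one) P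

lemma exists_tailInt (n : ℕ) (hκ : 1 < κ) (hγ : 0 < γ) (hR : 0 < R) (hγR : 1024 * γ = (bigK κ n * R) ^ (-(1 / κ)))
    (m C : ℝ) (hC : 0 ≤ C) : ∃ C' : ℝ, 0 < C' ∧
    ∀ {ρ M h Λ p ψ X}, Data κ γ R ρ M m h Λ p → Cuts n κ R C h ψ X → ∀ j : ℕ,
      (∀ u, OscDom κ (tailG ψ X Λ p j) (id : V2 n → V2 n) volume u) ∧
      ∀ q, GB κ (tailInt ψ X Λ p j) q (C' * M * ((derK κ n * R) ^ (2 * j) * ((j ! : ℝ) ^ κ) ^ 2) * ew κ (-(4 * γ)) (jap h q.2))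
        (2 ^ κ * (bigK κ n * R)) := by
  obtain ⟨C₀, hC₀, hb⟩ := exists_GB_tailG n hκ hγ hR m C hC
  obtain ⟨C₁, hC₁, H⟩ := exists_GB_oscInt_far (n := n) hκ hγ pos! hγR integrable_indicator_one indicator_one_nonneg
  refine ⟨C₁ * C₀, pos!, fun {ρ M h Λ p ψ X} D hc j => ?_⟩
  have hM := D.hM
  have hdK := derK_pos κ n
  rw [mul_assoc C₁, mul_assoc C₁]
  refine H pos! (contDiff_tailG D hc j) fun P Θ u => (hb D hc j P Θ u).mono pos! ?_ le_rfl
  have hj : 0 ≤ jap h u.2 := sqrt_nonneg _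
  split_ifs
  · rfl
  · refine mul_le_mul_of_nonneg_left ?_ (indicator_one_nonneg P)
    calc _ = C₀ * M * ((derK κ n * R) ^ (2 * j) * ((j ! : ℝ) ^ κ) ^ 2) * ew κ γ (jap h u.2) * 1 := by ring
      _ ≤ _ := by
        gcongr
        exacts [lin!, one_le_ew pos! (norm_nonneg _)]

/-- The amplitude of the remainder in Taylor's formula. -/
def remG (ψ : V2 n → ℂ) (X : V2 n × E n → ℂ) (Λ : E² n → ℝ) (p : E² n → ℂ) (N : ℕ)
    (z : V2 n × (ℝ × V2 n) × (E² n)) : ℂ :=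
  (((1 - z.2.1.1) ^ N / N ! : ℝ) : ℂ) * (X (z.2.1.2, z.2.2.2) * nearD ψ Λ p (N + 1) (z.1, z.2.1.1 • z.2.1.2, z.2.2))

lemma contDiff_remG (D : Data κ γ R ρ M m h Λ p) (hc : Cuts n κ R C h ψ X) (N : ℕ) : C∞ (remG ψ X Λ p N) := by
  have h1 : C∞ fun z : V2 n × (ℝ × V2 n) × (E² n) => (1 - z.2.1.1) ^ N / (N ! : ℝ) :=
    ((contDiff_const.sub contDiff_snd.fst.fst).pow N).div_const _
  have h2 : C∞ fun z : V2 n × (ℝ × V2 n) × (E² n) => X (z.2.1.2, z.2.2.2) :=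
    hc.smooth.comp (contDiff_snd.fst.snd.prodMk contDiff_snd.snd.snd)
  have h3 : C∞ fun z : V2 n × (ℝ × V2 n) × (E² n) => z.2.1.1 • z.2.1.2 :=
    contDiff_snd.fst.fst.smul contDiff_snd.fst.snd
  exact (ofRealCLM.contDiff.comp h1).mul (h2.mul ((contDiff_nearD D hc (N + 1)).comp
    (contDiff_fst.prodMk (h3.prodMk contDiff_snd.snd))))

def remμ (n : ℕ) : Measure (ℝ × V2 n) := (volume.restrict (Icc (0 : ℝ) 1)).prod volume

instance : SFinite (remμ n) := by unfold remμ; infer_instance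

/-- The remainder in Taylor's formula. -/
def remInt (ψ : V2 n → ℂ) (X : V2 n × E n → ℂ) (Λ : E² n → ℝ) (p : E² n → ℂ) (N : ℕ) : E² n → ℂ :=
  oscInt (remG ψ X Λ p N) (Prod.snd : ℝ × V2 n → V2 n) (remμ n)

lemma remμ_ae (n : ℕ) : ∀ᵐ s ∂remμ n, s.1 ∈ Icc (0 : ℝ) 1 := by
  unfold remμ
  exact (Measure.quasiMeasurePreserving_fst (μ := volume.restrict (Icc (0 : ℝ) 1)) (ν := (volume : Measure (V2 n)))).ae
    (ae_restrict_mem measurableSet_Icc)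

lemma integrable_remμ {f : ℝ → ℝ} (hf : Continuous f) {g : V2 n → ℝ} (hg : Integrable g) :
    Integrable (fun s : ℝ × V2 n => f s.1 * g s.2) (remμ n) :=
  Integrable.mul_prod (hf.integrableOn_Icc) hg

lemma integral_remμ (f : ℝ → ℝ) (g : V2 n → ℝ) :
    ∫ s, f s.1 * g s.2 ∂remμ n = (∫ t in Icc (0 : ℝ) 1, f t) * ∫ Θ, g Θ := integral_prod_mul f g

lemma integral_one_sub_pow (N : ℕ) : ∫ t in Icc (0 : ℝ) 1, |(1 - t) ^ N / N !| = ((N + 1)! : ℝ)⁻¹ := by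
  rw [setIntegral_congr_fun (g := fun t : ℝ => (1 - t) ^ N / N !) measurableSet_Icc fun t ht => by
    have : 0 ≤ 1 - t := by linarith [ht.2]
    exact abs_of_nonneg pos!]
  rw [integral_Icc_eq_integral_Ioc, ← intervalIntegral.integral_of_le zero_le_one, intervalIntegral.integral_div,
    intervalIntegral.integral_comp_sub_left (fun t => t ^ N) 1]
  simp [integral_pow, Nat.factorial_succ]
  field_simp

lemma exists_remInt (n : ℕ) (hκ : 1 < κ) (hγ : 0 < γ) (hR : 0 < R) (hγR : 1024 * γ = (bigK κ n * R) ^ (-(1 / κ)))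
    (m C : ℝ) (hC : 0 ≤ C) : ∃ C' : ℝ, 0 < C' ∧
    ∀ {ρ M h Λ p ψ X}, Data κ γ R ρ M m h Λ p → Cuts n κ R C h ψ X → ∀ N : ℕ,
      (∀ u, OscDom κ (remG ψ X Λ p N) (Prod.snd : ℝ × V2 n → V2 n) (remμ n) u) ∧
      ∀ q, GB κ (fun u => remInt ψ X Λ p N (q + scl n (jap h q.2) u)) 0
        (C' * M * ((derK κ n * R) ^ (2 * (N + 1)) * (((N + 1)! : ℝ) ^ κ) ^ 2 * ((N + 1)! : ℝ)⁻¹) *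
          jap h q.2 ^ (m - (1 - 1 / κ) * ((N + 1 : ℕ) : ℝ))) (2 ^ κ * (bigK κ n * R)) := by
  obtain ⟨C₀, hC₀, hb⟩ := exists_GB_nearD n hκ hγ hR m C hC
  obtain ⟨C₁, hC₁, hl⟩ := exists_GB_nearD_lossy n hκ hγ m C hC
  set w := (closedBall (0 : V2 n) 1).indicator fun _ => (1 : ℝ)
  have hw : Integrable w := integrable_indicator_one
  have hw0 : ∀ P, 0 ≤ w P := indicator_one_nonneg
  have hτ : Integrable fun Θ : V2 n => ew κ (-γ) ‖Θ‖ := integrable_ew lin! hγ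
  have hI1 : 0 ≤ ∫ P, w P := integral_nonneg hw0
  have hI2 := integral_ew_nonneg (n := n) (κ := κ) (γ := γ)
  have hK1 := (le_bigK (n := n) (by linarith : 0 ≤ κ)).1
  have h2κ := one_le_two_rpow (by linarith : 0 ≤ κ)
  have hdK := derK_pos κ n
  refine ⟨2 ^ κ * (∫ P, w P) * (C * C₀ * ∫ Θ : V2 n, ew κ (-γ) ‖Θ‖) + 1, pos!, fun {ρ M h Λ p ψ X} D hc N => ?_⟩
  have hM := D.hM
  have hG := contDiff_remG D hc N
  have hH := contDiff_nearD D hc (N + 1)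
  have hj : ∀ u : E² n, 1 ≤ jap h u.2 := fun u => one_le_jap D.hh _
  set A := (derK κ n * R) ^ (2 * (N + 1)) * (((N + 1)! : ℝ) ^ κ) ^ 2
  have hA : 0 ≤ A := pos!
  set f : ℝ → ℝ := fun t => (1 - t) ^ N / (N ! : ℝ)
  have hf : Continuous f := fun!
  have hfn : ∀ t : ℝ, ‖((f t : ℝ) : ℂ)‖ = |f t| := fun t => by rw [norm_real, norm_eq_abs]
  have hdom : ∀ u, OscDom κ (remG ψ X Λ p N) (Prod.snd : ℝ × V2 n → V2 n) (remμ n) u := by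
    refine OscDom.of_ew lin! pos! hγR hw ((continuous_jap h).comp continuous_snd) fun B => ?_
    set B' := max B 0
    have hfc : Continuous fun t : ℝ => |f t| * (C * (C₁ * M * ew κ (2 * γ) B' * ew κ (2 * γ) (|t| * B') * A)) * ew κ γ B' := by
      unfold ew
      have : Continuous fun t : ℝ => (|t| * B') ^ (1 / κ) :=
        (by fun_prop : Continuous fun t : ℝ => |t| * B').rpow_const fun _ => Or.inr pos!
      fun_prop
    refine ⟨_, integrable_remμ hfc hτ, fun u hu P s => ?_⟩
    have hb1 := hj u
    have huB : jap h u.2 ≤ B' := hu.trans (le_max_left _ _)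
    have hB0 : 0 ≤ B' := le_max_right _ _
    have hwP := hw0 P
    by_cases hz : jap h u.2 / 8 < ‖s.2‖
    · refine GB.mono (M := 0) (R := bigK κ n * R) ?_ pos! pos! le_rfl
      refine GB_zero_of_eventuallyEq pos! ?_
      have h1 := hc.fX_eventually_zero (z₀ := (P, s.2, u)) hz
      have h2 : ContinuousAt (fun z : V2 n × (E² n) => ((z.1, s.2, z.2) : Z3 n)) (P, u) := fun!
      filter_upwards [h2.eventually h1] with z hz
      simp [remG, show X (s.2, z.2.2) = 0 from hz]
    · have hq : ‖s.2‖ ≤ B' := by linarith [not_lt.mp hz]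
      have h1 := GB.slice_mid hR.le hc.contDiff_fX (GB.of_sclZ hR.le hc.contDiff_fX le_rfl le_rfl
        (hc.GB_fX hR.le D.hh (P, s.2, u) zero_le_one hb1 zero_le_one hb1))
      have h2 := GB.slice_mid pos! hH (hl D hc (P, s.1 • s.2, u) (N + 1))
      have s1 := contDiff_slice_mid hc.contDiff_fX s.2
      have s2 := contDiff_slice_mid hH (s.1 • s.2)
      have h3 := ((h1.mono hR.le le_rfl (show R ≤ 2 ^ κ * (96 * R) by nlinarith)).mul hκ.le pos! s1 s2 h2).const_smul
        (s1.mul s2) ((f s.1 : ℝ) : ℂ)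
      refine h3.mono pos! ?_ (by nlinarith)
      rw [hfn]
      by_cases hP : 1 < ‖P‖
      · rw [if_pos hP, mul_zero, mul_zero]; positivity
      · rw [if_neg hP]
        rw [show w P = 1 from indicator_of_mem (by simpa using hP) _, one_mul]
        have hu0 : 0 ≤ jap h u.2 := lin!
        have k2 : ‖s.1 • s.2‖ ≤ |s.1| * B' := by rw [norm_smul, norm_eq_abs]; gcongr
        have k3 : 1 ≤ ew κ γ B' * (ew κ (-γ) ‖s.2‖ * ew κ (256 * γ) ‖s.2‖) := by
          rw [ew_mul]
          have l1 := one_le_ew (κ := κ) hγ.le hB0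
          have l2 := one_le_ew (κ := κ) (show 0 ≤ -γ + 256 * γ by linarith) (norm_nonneg s.2)
          nlinarith
        calc _ ≤ |f s.1| * (C * (C₁ * M * ew κ (2 * γ) B' * ew κ (2 * γ) (|s.1| * B') * A)) * 1 := by
              rw [mul_one]; gcongr
          _ ≤ |f s.1| * (C * (C₁ * M * ew κ (2 * γ) B' * ew κ (2 * γ) (|s.1| * B') * A)) *
              (ew κ γ B' * (ew κ (-γ) ‖s.2‖ * ew κ (256 * γ) ‖s.2‖)) := mono!
          _ = _ := by ring
  refine ⟨hdom, fun q => ?_⟩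
  have hb1 := hj q
  set b := jap h q.2
  set D₀ := C * (C₀ * M * b ^ (m - (1 - 1 / κ) * ((N + 1 : ℕ) : ℝ)) * A)
  have hD₀ : 0 ≤ D₀ := pos!
  have key := GB_oscInt_ew hκ.le (R := bigK κ n * R) pos! hγR one_pos hG continuous_snd hdom (u₀ := q) (scl n b) hw
    (τ := fun s => |f s.1| * (D₀ * ew κ (-γ) ‖s.2‖)) (integrable_remμ hf.abs (hτ.const_mul D₀))
    ((remμ_ae n).mono fun s hs P => by
      have hwP := hw0 P
      have hins := norm_insMid_le (V := V2 n) (S := V2 n) (U := E² n)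
      have e : (fun z : V2 n × (E² n) => remG ψ X Λ p N (P + (1 : ℝ) • z.1, s, q + scl n b z.2)) = fun z =>
          ((f s.1 : ℝ) : ℂ) * (fX X ((P, s.2, q) + sclZ 0 b (insMid (V2 n) (V2 n) (E² n) z)) *
            nearD ψ Λ p (N + 1) ((P, s.1 • s.2, q) + sclZ (b ^ (1 - 1 / κ)) b (insMid (V2 n) (V2 n) (E² n) z))) := by
        funext z
        simp only [remG, fX, sclZ_apply, insMid_apply, scl_apply, one_smul, smul_zero, mk_add_mk, add_zero]
        rfl
      rw [e]
      have s1 : C∞ fun z => fX X ((P, s.2, q) + sclZ 0 b (insMid (V2 n) (V2 n) (E² n) z)) :=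
        (contDiff_comp_sclZ hc.contDiff_fX (P, s.2, q) 0 b).comp (insMid (V2 n) (V2 n) (E² n)).contDiff
      have s2 : C∞ fun z => nearD ψ Λ p (N + 1) ((P, s.1 • s.2, q) + sclZ (b ^ (1 - 1 / κ)) b
          (insMid (V2 n) (V2 n) (E² n) z)) :=
        (contDiff_comp_sclZ hH (P, s.1 • s.2, q) _ b).comp (insMid (V2 n) (V2 n) (E² n)).contDiff
      by_cases hz : b / 8 < ‖s.2‖
      · refine GB.mono (M := 0) (R := bigK κ n * R) ?_ pos! pos! le_rfl
        refine GB_zero_of_eventuallyEq pos! ?_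
        have h1 := hc.fX_eventually_zero (z₀ := (P, s.2, q)) hz
        have h2 : Tendsto (fun z : V2 n × (E² n) => ((P, s.2, q) : Z3 n) + sclZ 0 b (insMid (V2 n) (V2 n) (E² n) z))
            (𝓝 0) (𝓝 (P, s.2, q)) := by
          have := (insMid (V2 n) (V2 n) (E² n)).continuous.tendsto 0
          rw [map_zero] at this
          exact (tendsto_sclZ (P, s.2, q) 0 b).comp this
        filter_upwards [h2.eventually h1] with z hz
        rw [hz, zero_mul, mul_zero]
      · have hq : ‖s.1 • s.2‖ ≤ ‖s.2‖ := by
          rw [norm_smul, norm_of_nonneg hs.1]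
          exact mul_le_of_le_one_left (norm_nonneg _) hs.2
        have h1 := GB.comp_linear hR.le (contDiff_comp_sclZ hc.contDiff_fX (P, s.2, q) 0 b) hins
          (hc.GB_fX hR.le D.hh (P, s.2, q) le_rfl lin! lin! le_rfl)
        have h2 := GB.comp_linear pos! (contDiff_comp_sclZ hH (P, s.1 • s.2, q) _ b) hins
          (hb D hc (P, s.1 • s.2, q) (hq.trans (not_lt.mp hz)) (N + 1))
        have h3 := ((h1.mono hR.le le_rfl (show R ≤ 2 ^ κ * (96 * R) by nlinarith)).mul hκ.le pos! s1 s2 h2).const_smul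
          (s1.mul s2) ((f s.1 : ℝ) : ℂ)
        refine h3.mono pos! ?_ (by nlinarith)
        rw [hfn, one_mul]
        by_cases hP : 1 < ‖P‖
        · rw [if_pos hP, mul_zero, mul_zero]; positivity
        · rw [if_neg hP]
          rw [show w P = 1 from indicator_of_mem (by simpa using hP) _, one_mul]
          have k2 : ew κ γ ‖s.1 • s.2‖ ≤ ew κ (-γ) ‖s.2‖ * ew κ (256 * γ) ‖s.2‖ :=
            (ew_mono lin! hγ.le (norm_nonneg _) le_rfl hq).trans (ew_le_ew_mul lin! (norm_nonneg _))
          calc _ = |f s.1| * D₀ * ew κ γ ‖s.1 • s.2‖ := by simp only [D₀, A]; ring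
            _ ≤ |f s.1| * D₀ * (ew κ (-γ) ‖s.2‖ * ew κ (256 * γ) ‖s.2‖) := mono!
            _ = _ := by ring)
  refine GB.mono key pos! ?_ le_rfl
  rw [integral_remμ (fun t => |f t|) (fun Θ => D₀ * ew κ (-γ) ‖Θ‖), integral_const_mul, integral_one_sub_pow]
  calc _ = (2 ^ κ * (∫ P, w P) * (C * C₀ * ∫ Θ : V2 n, ew κ (-γ) ‖Θ‖)) * M * (A * ((N + 1)! : ℝ)⁻¹) *
        b ^ (m - (1 - 1 / κ) * ((N + 1 : ℕ) : ℝ)) := by ring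
    _ ≤ _ := by gcongr; linarith

end TaylorRemainders

section Decomposition

variable {ψ χ : V2 n → ℂ}
  {X : V2 n × E n → ℂ}

/-- The regularised oscillatory integral over `V2 n × V2 n`. -/
def cutInt (χ : V2 n → ℂ) (f : Z3 n → ℂ) (q : E² n) (ε : ℝ) : ℂ :=
  ∫ Θ, osc (fun Y => χ (ε • Y) * f (Y, Θ, q)) Θ

/-- The part of the composed symbol near the diagonal. -/
def nearInt (ψ : V2 n → ℂ) (X : V2 n × E n → ℂ) (Λ : E² n → ℝ) (p : E² n → ℂ) (q : E² n) : ℂ :=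
  ∫ Θ, X (Θ, q.2) * osc (fun Y => nearAmp ψ Λ p (Y, Θ, q)) Θ

lemma dec_le_ew {V : Type} [NormedAddCommGroup V] [InnerProductSpace ℝ V] [MeasurableSpace V] [BorelSpace V]
    [FiniteDimensional ℝ V] (hκ : 0 < κ) (hR : 0 < R) (hγR : 1024 * γ = (bigK κ n * R) ^ (-(1 / κ))) (hr0 : 0 < r)
    (hr : r ≤ bigK κ n * R) (Θ : V) : dec κ r Θ ≤ ew κ (-(256 * γ)) ‖Θ‖ := by
  have hK := bigK_pos κ n
  rw [← exp_dec_eq hκ (show 0 < bigK κ n * R by positivity) hγR (norm_nonneg _)]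
  exact dec_mono hκ hr0 hr Θ

lemma contDiff_freeze {f : Z3 n → ℂ} (hf : C∞ f) (q : E² n) :
    C∞ fun z : V2 n × V2 n => f (z.1, z.2, q) :=
  hf.comp (contDiff_fst.prodMk (contDiff_snd.prodMk contDiff_const))

lemma GB.freeze {f : Z3 n → ℂ} (hr : 0 ≤ r) (hf : C∞ f) {P Θ : V2 n} {q : E² n} (h : GB κ f (P, Θ, q) N r) :
    GB κ (fun z : V2 n × V2 n => f (z.1, z.2, q)) (P, Θ) N r := by
  have e : (fun z : V2 n × V2 n => f (z.1, z.2, q)) = fun z => f ((0, 0, q) +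
      (fst ℝ (V2 n) (V2 n)).prod ((snd ℝ (V2 n) (V2 n)).prod 0) z) := by
    funext z; simp
  rw [e, ← one_mul r]
  refine GB.comp_affine hr hf (opNorm_le_bound _ zero_le_one fun z => ?_) (by simpa using h)
  simp [norm_def]

lemma integral_ew_two_mul_dec (hκ : 0 < κ) (hγ : 0 < γ) (hR : 0 < R) (hγR : 1024 * γ = (bigK κ n * R) ^ (-(1 / κ))) (hr0 : 0 < r)
    (hr : r ≤ bigK κ n * R) (c : ℝ) : Integrable fun Θ : V2 n => c * ew κ (2 * γ) ‖Θ‖ * dec κ r Θ := by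
  have h1 : Integrable fun Θ : V2 n => ew κ (2 * γ) ‖Θ‖ * dec κ r Θ := by
    refine (integrable_ew hκ (show 0 < 254 * γ by positivity)).mono' ?_ (.of_forall fun Θ => ?_)
    · unfold ew
      have : Continuous fun Θ : V2 n => ‖Θ‖ ^ (1 / κ) := continuous_norm.rpow_const fun _ => Or.inr pos!
      exact (by fun_prop : Continuous fun Θ : V2 n => exp (2 * γ * ‖Θ‖ ^ (1 / κ))).aestronglyMeasurable.mul
        (continuous_dec hκ r).aestronglyMeasurable
    · have h0 := ew_pos κ (2 * γ) ‖Θ‖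
      rw [norm_of_nonneg (mul_nonneg h0.le (dec_pos _ _ _).le)]
      calc _ ≤ ew κ (2 * γ) ‖Θ‖ * ew κ (-(256 * γ)) ‖Θ‖ := by gcongr; exact dec_le_ew hκ hR hγR hr0 hr Θ
        _ = _ := by rw [ew_mul]; congr 1; ring
  simpa only [mul_assoc] using h1.const_mul c

lemma continuous_ew_norm (hκ : 0 < κ) (c γ : ℝ) : Continuous fun Θ : V2 n => c * ew κ γ ‖Θ‖ := by
  unfold ew
  have : Continuous fun Θ : V2 n => ‖Θ‖ ^ (1 / κ) := continuous_norm.rpow_const fun _ => Or.inr pos!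
  fun_prop

lemma integrable_cutInt (hκ : 1 < κ) (hγ : 0 < γ) (hR : 0 < R) (hγR : 1024 * γ = (bigK κ n * R) ^ (-(1 / κ)))
    (hχ : IsCutoff κ C₁ (48 * R) χ) {f : Z3 n → ℂ} (hf : C∞ f) {q : E² n}
    (hb : ∀ Y Θ, GB κ f (Y, Θ, q) (c * ew κ (2 * γ) ‖Θ‖) (192 * R)) (hε : 0 < ε) (hε1 : ε ≤ 1) :
    Integrable fun Θ => osc (fun Y => χ (ε • Y) * f (Y, Θ, q)) Θ := by
  obtain ⟨d, hd⟩ := hχ.scale pos!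
  have hK : 384 * R ≤ bigK κ n * R := by
    have h1 := (le_bigK (n := n) (by linarith : 0 ≤ κ)).1
    have h2 : (2 : ℝ) ≤ 2 ^ κ := by simpa using rpow_le_rpow_of_exponent_le one_le_two hκ.le
    nlinarith
  have hs : C∞ fun z : V2 n × V2 n => χ (ε • z.1) :=
    ContDiff.comp (g := fun P : V2 n => χ (ε • P)) (f := Prod.fst) (hχ.contDiff_scale ε) contDiff_fst
  have ha : C∞ fun z : V2 n × V2 n => χ (ε • z.1) * f (z.1, z.2, q) := hs.mul (contDiff_freeze hf q)
  have key : ∀ P Θ, GB κ (fun z : V2 n × V2 n => χ (ε • z.1) * f (z.1, z.2, q)) (P, Θ)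
      ((closedBall (0 : V2 n) (d / ε)).indicator (fun _ => C₁) P * (c * ew κ (2 * γ) ‖Θ‖)) (2 * (192 * R)) := fun P Θ => by
    have h1 : GB κ (fun z : V2 n × V2 n => χ (ε • z.1)) (P, Θ) ((closedBall (0 : V2 n) (d / ε)).indicator (fun _ => C₁) P) (192 * R) :=
      (GB.comp_fst (f := fun P : V2 n => χ (ε • P)) (z := (P, Θ)) pos! (hχ.contDiff_scale ε) (hd ε hε hε1 P)).mono
        pos! le_rfl lin!
    exact h1.mul hκ.le pos! hs (contDiff_freeze hf q) ((hb P Θ).freeze pos! hf)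
  exact integrable_osc hκ.le (show 0 < 2 * (192 * R) by positivity) ha (integrable_indicator_closedBall _ _)
    (integral_ew_two_mul_dec lin! hγ hR hγR pos! lin! c) key

lemma stR_le_bigK (hκ : 1 < κ) (hR : 0 < R) : stR κ (48 * R) (stN n) ≤ bigK κ n * R := by
  have h2 : (2 : ℝ) ≤ 2 ^ κ := by simpa using rpow_le_rpow_of_exponent_le one_le_two hκ.le
  unfold stR bigK
  have : (0 : ℝ) < (8 * 2 ^ κ) ^ stN n * R := pos!
  nlinarith

/-- The limit of a regularised oscillatory integral. -/
lemma tendsto_cutInt (hκ : 1 < κ) (hγ : 0 < γ) (hR : 0 < R) (hγR : 1024 * γ = (bigK κ n * R) ^ (-(1 / κ)))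
    (hχ : IsCutoff κ C₁ (48 * R) χ) {f : Z3 n → ℂ} (hf : C∞ f) {q : E² n}
    (hb : ∀ Y Θ, GB κ f (Y, Θ, q) (c * ew κ (2 * γ) ‖Θ‖) (48 * R)) :
    (∀ ε : ℝ, 0 < ε → ε ≤ 1 → ‖cutInt χ f q ε‖ ≤ 2 ^ κ * (C₁ * stC κ (48 * R) (48 * R) (stN n) * ∫ P, stWL (48 * R) (stDir n) P) *
      ∫ Θ : V2 n, c * ew κ (2 * γ) ‖Θ‖ * dec κ (stR κ (48 * R) (stN n)) Θ) ∧
    Tendsto (cutInt χ f q) (𝓝[>] 0) (𝓝 (oscInt (StL (48 * R) (stDir n) f) (id : V2 n → V2 n) volume q)) := by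
  set d := stDirs (V2 n) (0 + (finrank ℝ (V2 n) + 1)) with hd
  have e1 : stWL (48 * R) (diagL d) = stWL (48 * R) (stDir n) := by
    funext P; simp [stWL, diagL, stDir, hd, comp_def]
  have e2 : StL (48 * R) (diagL d) (fun z : V2 n × V2 n => f (z.1, z.2, q)) = fun z => StL (48 * R) (stDir n) f (z.1, z.2, q) := by
    have := StL_comp_affine hf (48 * R) (0, q) (inl ℝ (V2 n) (E² n)) (diagL d)
    simp only [ContinuousLinearMap.inl_apply, mk_add_mk, zero_add, add_zero] at this
    rw [this, diagL, List.map_map]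
    rfl
  have key := tendsto_integral_osc_cutoff hκ.le (s := 48 * R) pos! le_rfl (contDiff_freeze hf q)
    (τ := fun Θ => c * ew κ (2 * γ) ‖Θ‖) (continuous_ew_norm lin! _ _) (N := stN n) hχ
    (integral_ew_two_mul_dec lin! hγ hR hγR (stR_pos κ pos! _) (stR_le_bigK hκ hR) c)
    (fun P Θ => (hb P Θ).freeze pos! hf) d (stDirs_norm _) (stDirs_length _).le
    (e1 ▸ integrable_stWL_stDir pos!)
  rw [e1, e2] at key
  exact key

lemma GB_amp_frozen (hκ : 1 < κ) (hγ : 0 < γ) (m : ℝ) (n : ℕ) : ∃ C : ℝ, 0 < C ∧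
    ∀ {R ρ M h Λ p}, Data κ γ R ρ M m h Λ p → ∀ (q : E² n) Y Θ,
      GB κ (amp Λ p) (Y, Θ, q) (C * M * ew κ (2 * γ) (jap h q.2) * ew κ (2 * γ) ‖Θ‖) (48 * R) := by
  obtain ⟨C, hC, hb⟩ := exists_GB_amp_lossy n hκ hγ m
  refine ⟨C, hC, fun {R ρ M h Λ p} D q Y Θ => ?_⟩
  have hR := D.hR
  have h1 := one_le_jap D.hh (q.2 + pr2 Θ)
  have h2 := one_le_jap D.hh (q.2 + pr2 Θ + pr1 Θ)
  have := hb D (z₀ := (Y, Θ, q)) (β := 1) (c := 1) (t := 6) zero_le_one zero_le_one num!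
    (by simp only; linarith) (by simp only; linarith)
  exact (GB.of_sclZ pos! D.contDiff_amp le_rfl le_rfl this).mono pos! le_rfl lin!

lemma integral_sub_sub {S : Type} [MeasurableSpace S] {μ : Measure S} {f g k : S → ℂ} (hf : Integrable f μ) (hg : Integrable g μ)
    (hk : Integrable k μ) : ∫ s, (f s - g s - k s) ∂μ = ∫ s, f s ∂μ - ∫ s, g s ∂μ - ∫ s, k s ∂μ := by
  have h := integral_sub (hf.sub hg) hk
  have h' := integral_sub hf hg
  simp only [Pi.sub_apply] at h
  rw [h, h']

lemma IsCutoff.integrable_slice (hχ : IsCutoff κ C₁ r χ) {f : Z3 n → ℂ} (hf : Continuous f) (hε : 0 < ε) (Θ : V2 n)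
    (q : E² n) : Integrable fun Y => χ (ε • Y) * f (Y, Θ, q) := by
  have cχ := hχ.smooth.continuous
  obtain ⟨d, hd⟩ := hχ.support
  refine Continuous.integrable_of_hasCompactSupport fun! (of_support_subset_isCompact
    (isCompact_closedBall (0 : V2 n) (d / ε)) fun Y hY => ?_)
  by_contra hn
  refine hY ?_
  have : d < ‖ε • Y‖ := by
    rw [norm_smul, norm_of_nonneg hε.le]
    have := not_le.mp (mt mem_closedBall_zero_iff.mpr hn)
    rwa [div_lt_iff₀ hε, mul_comm] at this
  simp [hd _ this]

/-- The regularised integral away from the diagonal in `Y`. -/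
lemma tendsto_cutInt_midAmp (hχ : IsCutoff κ C₁ r χ) (D : Data κ γ R ρ M m h Λ p) (hc : Cuts n κ R C h ψ X) {q : E² n}
    (hI : Integrable fun Y : V2 n => osc (fun P => midG ψ X Λ p (P, Y, q)) Y) :
    Tendsto (cutInt χ (midAmp ψ X Λ p) q) (𝓝[>] 0) (𝓝 (midInt ψ X Λ p q)) := by
  have cχ := hχ.smooth.continuous
  obtain ⟨d, hd⟩ := hχ.support
  have hGc := (contDiff_midAmp D hc).continuous
  have hce : Continuous fun z : V2 n × V2 n => ec z.2 z.1 :=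
    Continuous.comp (g := fun z : V2 n × V2 n => ec z.1 z.2) (f := fun z : V2 n × V2 n => (z.2, z.1)) continuous_ec
      (continuous_snd.prodMk continuous_fst)
  have hsw : ∀ᶠ ε in 𝓝[>] (0 : ℝ), ∫ Y, χ (ε • Y) * osc (fun P => midG ψ X Λ p (P, Y, q)) Y = cutInt χ (midAmp ψ X Λ p) q ε := by
    filter_upwards [self_mem_nhdsWithin] with ε hε
    have hε : 0 < ε := hε
    have hint : Integrable (uncurry fun Θ Y : V2 n => ec Y Θ * (χ (ε • Y) * midAmp ψ X Λ p (Y, Θ, q)))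
        ((volume : Measure (V2 n)).prod volume) := by
      have c1 : Continuous fun z : V2 n × V2 n => χ (ε • z.2) := fun!
      have c2 : Continuous fun z : V2 n × V2 n => midAmp ψ X Λ p (z.2, z.1, q) := fun!
      have c3 : Continuous (uncurry fun Θ Y : V2 n => ec Y Θ * (χ (ε • Y) * midAmp ψ X Λ p (Y, Θ, q))) := hce.mul (c1.mul c2)
      refine Continuous.integrable_of_hasCompactSupport c3 (of_support_subset_isCompact
        ((isCompact_closedBall (0 : V2 n) (jap h q.2 / 8)).prod (isCompact_closedBall (0 : V2 n) (d / ε))) fun z hz => ?_)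
      by_contra hn
      refine hz ?_
      simp only [Set.mem_prod, mem_closedBall_zero_iff, not_and_or, not_le] at hn
      simp only [uncurry_def]
      rcases hn with hn | hn
      · simp [midAmp, fX, hc.X_zero z.1 q.2 hn.le]
      · have : d < ‖ε • z.2‖ := by
          rw [norm_smul, norm_of_nonneg hε.le]
          rwa [div_lt_iff₀ hε, mul_comm] at hn
        simp [hd _ this]
    unfold cutInt osc
    rw [integral_integral_swap hint]
    congr 1
    funext Y
    rw [← integral_const_mul]
    congr 1
    funext Θ
    rw [ec_comm]
    simp only [midG]
    ring
  refine Tendsto.congr' hsw ?_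
  have hlim : midInt ψ X Λ p q = ∫ Y, χ 0 * osc (fun P => midG ψ X Λ p (P, Y, q)) Y := by
    simp only [hχ.at_zero, one_mul]; rfl
  rw [hlim]
  refine tendsto_integral_filter_of_dominated_convergence (fun Y => C₁ * ‖osc (fun P => midG ψ X Λ p (P, Y, q)) Y‖)
    (.of_forall fun ε => ?_) (.of_forall fun ε => .of_forall fun Y => ?_)
    (hI.norm.const_mul C₁) (.of_forall fun Y => ?_)
  · exact (by fun_prop : Continuous fun Y : V2 n => χ (ε • Y)).aestronglyMeasurable.mul hI.aestronglyMeasurable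
  · rw [norm_mul]
    gcongr
    simpa using (hχ.bound (ε • Y)) 0
  · refine Tendsto.mul_const _ ((cχ.tendsto 0).comp ?_)
    have : Tendsto (fun ε : ℝ => ε • Y) (𝓝 0) (𝓝 0) := by
      simpa using (by fun_prop : Continuous fun ε : ℝ => ε • Y).tendsto 0
    exact this.mono_left nhdsWithin_le_nhds

/-- The convergence of the regularised composed symbol. -/
lemma tendsto_cutInt_amp (hγR : 1024 * γ = (bigK κ n * R) ^ (-(1 / κ)))
    (hχ : IsCutoff κ C₁ (48 * R) χ) (hχ1 : ∀ᶠ Y in 𝓝 0, χ Y = 1) (D : Data κ γ R ρ M m h Λ p) (hC : 0 ≤ C) (hc : Cuts n κ R C h ψ X) :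
    ∃ K : ℝ, ∀ q : E² n, (∀ ε : ℝ, 0 < ε → ε ≤ 1 → ‖cutInt χ (amp Λ p) q ε‖ ≤ K * ew κ (2 * γ) (jap h q.2)) ∧
      Tendsto (cutInt χ (amp Λ p) q) (𝓝[>] 0) (𝓝 (nearInt ψ X Λ p q + midInt ψ X Λ p q + farInt R X Λ p q)) := by
  have hκ := D.hκ
  have hκ0 : 0 < κ := lin!
  have hγ := D.hγ
  have hR := D.hR
  have hM := D.hM
  obtain ⟨K₀, hK₀, hb₀⟩ := GB_amp_frozen hκ hγ m n
  obtain ⟨K₁, hK₁, hb₁⟩ := exists_GB_farAmp n hκ hγ m C hC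
  obtain ⟨K₂, hK₂, hb₂⟩ := exists_GB_midAmp n hκ hγ m C hC
  obtain ⟨_, _, hb₃⟩ := exists_midInt n hκ hγ hR hγR m C hC
  refine ⟨2 ^ κ * (C₁ * stC κ (48 * R) (48 * R) (stN n) * ∫ P, stWL (48 * R) (stDir n) P) *
    (K₀ * M * ∫ Θ : V2 n, ew κ (2 * γ) ‖Θ‖ * dec κ (stR κ (48 * R) (stN n)) Θ), fun q => ⟨fun ε hε hε1 => ?_, ?_⟩⟩
  · refine ((tendsto_cutInt hκ hγ hR hγR hχ D.contDiff_amp (hb₀ D q)).1 ε hε hε1).trans_eq ?_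
    simp only [mul_assoc, integral_const_mul]
    ring
  · have p0 := ew_pos κ (2 * γ) (jap h q.2)
    have hfar : ∀ Y Θ, GB κ (farAmp X Λ p) (Y, Θ, q) (K₁ * M * ew κ (2 * γ) (jap h q.2) * ew κ (2 * γ) ‖Θ‖) (48 * R) := fun Y Θ =>
      (hb₁ D hc (Y, Θ, q)).mono pos! (by
        have := ew_pos κ (2 * γ) ‖Θ‖
        dsimp only
        split_ifs
        · positivity
        · exact le_rfl) le_rfl
    have hmid : ∀ Y Θ, GB κ (midAmp ψ X Λ p) (Y, Θ, q) (K₂ * M * ew κ (2 * γ) (jap h q.2) * ew κ (2 * γ) ‖Θ‖) (192 * R) := fun Y Θ =>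
      (GB.of_sclZ pos! (contDiff_midAmp D hc) (one_le_jap D.hh _) le_rfl (hb₂ D hc (Y, Θ, q))).mono pos! (by
        have := ew_pos κ (2 * γ) ‖Θ‖
        dsimp only
        split_ifs
        · positivity
        · exact le_rfl) le_rfl
    have hamp := fun Y Θ => (hb₀ D q Y Θ).mono pos! le_rfl (show 48 * R ≤ 192 * R by linarith)
    have hfar' := fun Y Θ => (hfar Y Θ).mono pos! le_rfl (show 48 * R ≤ 192 * R by linarith)
    have hsplit : ∀ᶠ ε in 𝓝[>] (0 : ℝ), cutInt χ (amp Λ p) q ε =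
        (∫ Θ, X (Θ, q.2) * osc (fun Y => χ (ε • Y) * nearAmp ψ Λ p (Y, Θ, q)) Θ) + cutInt χ (midAmp ψ X Λ p) q ε +
          cutInt χ (farAmp X Λ p) q ε := by
      filter_upwards [Ioc_mem_nhdsGT (zero_lt_one' ℝ)] with ε hε
      have i1 := integrable_cutInt hκ hγ hR hγR hχ D.contDiff_amp hamp hε.1 hε.2
      have i2 := integrable_cutInt hκ hγ hR hγR hχ (contDiff_midAmp D hc) hmid hε.1 hε.2
      have i3 := integrable_cutInt hκ hγ hR hγR hχ (contDiff_farAmp D hc) hfar' hε.1 hε.2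
      have e : ∀ Θ, X (Θ, q.2) * osc (fun Y => χ (ε • Y) * nearAmp ψ Λ p (Y, Θ, q)) Θ =
          osc (fun Y => χ (ε • Y) * amp Λ p (Y, Θ, q)) Θ - osc (fun Y => χ (ε • Y) * midAmp ψ X Λ p (Y, Θ, q)) Θ -
            osc (fun Y => χ (ε • Y) * farAmp X Λ p (Y, Θ, q)) Θ := fun Θ => by
        unfold osc
        rw [← integral_const_mul, ← integral_sub_sub (integrable_ec_mul (hχ.integrable_slice D.contDiff_amp.continuous hε.1 Θ q) Θ)
          (integrable_ec_mul (hχ.integrable_slice (contDiff_midAmp D hc).continuous hε.1 Θ q) Θ)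
          (integrable_ec_mul (hχ.integrable_slice (contDiff_farAmp D hc).continuous hε.1 Θ q) Θ)]
        congr 1
        funext Y
        simp only [nearAmp, midAmp, farAmp, fX]
        ring
      simp only [e, cutInt]
      rw [integral_sub_sub i1 i2 i3]
      ring
    refine Tendsto.congr' (hsplit.mono fun _ h => h.symm) (Tendsto.add (Tendsto.add ?_ ?_) ?_)
    · refine tendsto_const_nhds.congr' ?_
      obtain ⟨r, hr, hr1⟩ := Metric.eventually_nhds_iff.mp hχ1
      filter_upwards [Ioo_mem_nhdsGT hr] with ε hε
      unfold nearInt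
      congr 1
      funext Θ
      congr 2
      funext Y
      by_cases hY : ‖Y‖ < 1
      · rw [hr1 (y := ε • Y), one_mul]
        rw [dist_zero_right, norm_smul, norm_of_nonneg hε.1.le]
        nlinarith [hε.1, hε.2, norm_nonneg Y]
      · simp [nearAmp, fψ, hc.ψ_zero Y (not_lt.mp hY)]
    · exact tendsto_cutInt_midAmp hχ D hc (OscDom.integrable hκ.le (contDiff_midG D hc) continuous_id (hb₃ D hc).1 q)
    · exact (tendsto_cutInt hκ hγ hR hγR hχ (contDiff_farAmp D hc) hfar).2

/-- Taylor's formula for the part near the diagonal. -/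
lemma nearInt_eq (hγR : 1024 * γ = (bigK κ n * R) ^ (-(1 / κ))) (D : Data κ γ R ρ M m h Λ p) (hC : 0 ≤ C) (hc : Cuts n κ R C h ψ X)
    (N : ℕ) (q : E² n) : nearInt ψ X Λ p q = ∑ j ∈ range (N + 1), (j ! : ℂ)⁻¹ *
      (((2 * Real.pi) ^ (2 * n) : ℝ) * (dmix (eB n))^[j] (amp Λ p) (0, 0, q) - tailInt ψ X Λ p j q) + remInt ψ X Λ p N q := by
  have hκ := D.hκ
  have hγ := D.hγ
  have hR := D.hR
  have hM := D.hM
  have hK := bigK_pos κ n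
  obtain ⟨_, _, ht⟩ := exists_tailInt n hκ hγ hR hγR m C hC
  obtain ⟨_, _, hrm⟩ := exists_remInt n hκ hγ hR hγR m C hC
  obtain ⟨C₀, hC₀, hl⟩ := exists_GB_nearD_lossy n hκ hγ m C hC
  have hz : ∀ (j : ℕ) (z : Z3 n), 1 < ‖z.1‖ → nearD ψ Λ p j z = 0 := fun j z hz =>
    dmix_iterate_eq_zero (eB n) (c := 1) (fun z hz => by simp [nearAmp, fψ, hc.ψ_zero z.1 hz.le]) j hz
  have hcs : ∀ (j : ℕ) (Θ : V2 n), Integrable fun Y => nearD ψ Λ p j (Y, Θ, q) := fun j Θ => by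
    have hcn := (contDiff_nearD D hc j).continuous
    refine Continuous.integrable_of_hasCompactSupport fun! (of_support_subset_isCompact
      (isCompact_closedBall (0 : V2 n) 1) fun Y hY => ?_)
    by_contra hn
    exact hY (hz j _ (not_le.mp (mt mem_closedBall_zero_iff.mpr hn)))
  have hdiag : ∀ j, Integrable (osc fun Y => nearD ψ Λ p j (Y, 0, q)) := fun j => by
    have hf : C∞ fun Y : V2 n => nearD ψ Λ p j (Y, 0, q) := contDiff_section_left (U := V2 n × (E² n)) (contDiff_nearD D hc j) (0, q)
    set r := 2 ^ κ * (96 * R)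
    have hr : 0 < r := pos!
    have hr' : r ≤ bigK κ n * R := by
      have := (le_bigK (n := n) (by linarith : 0 ≤ κ)).1
      have : 0 < (2 : ℝ) ^ κ * R := pos!
      simp only [r]; nlinarith
    set c := C₀ * M * ew κ (2 * γ) (jap h q.2) * ew κ (2 * γ) ‖(0 : V2 n)‖ * ((derK κ n * R) ^ (2 * j) * ((j ! : ℝ) ^ κ) ^ 2)
    refine integrable_osc (κ := κ) hκ.le hr (a := fun z : V2 n × V2 n => nearD ψ Λ p j (z.1, 0, q)) (hf.comp contDiff_fst)
      (g := (closedBall (0 : V2 n) 1).indicator fun _ => c) (τ := fun _ => 1) (integrable_indicator_closedBall _ _) ?_ fun P Θ => ?_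
    · simp only [one_mul]
      refine (integrable_ew (κ := κ) lin! (show 0 < 256 * γ by positivity)).mono' (continuous_dec lin! r).aestronglyMeasurable
        (.of_forall fun Θ => ?_)
      rw [norm_of_nonneg (dec_pos _ _ _).le]
      exact dec_le_ew lin! hR hγR hr hr' Θ
    · have h1 := (GB.slice (a := nearD ψ Λ p j) hr.le (contDiff_nearD D hc j) (hl D hc (P, 0, q) j)).comp_fst (W := V2 n) (z := (P, Θ)) hr.le hf
      refine h1.mono hr.le ?_ le_rfl
      rw [mul_one]
      by_cases hP : 1 < ‖P‖
      · rw [if_pos hP, indicator_of_notMem (by simpa using hP)]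
      · rw [if_neg hP, indicator_of_mem (by simpa using hP)]
  have htail := fun j => OscDom.integrable hκ.le (contDiff_tailG D hc j) continuous_id (ht D hc j).1 q
  have hrem := OscDom.integrable hκ.le (contDiff_remG D hc N) continuous_snd (hrm D hc N).1 q
  have etail : ∀ j Θ, X (Θ, q.2) * osc (fun Y => nearD ψ Λ p j (Y, 0, q)) Θ =
      osc (fun Y => nearD ψ Λ p j (Y, 0, q)) Θ - osc (fun Y => tailG ψ X Λ p j (Y, Θ, q)) Θ := fun j Θ => by
    have : osc (fun Y => tailG ψ X Λ p j (Y, Θ, q)) Θ = (1 - X (Θ, q.2)) * osc (fun Y => nearD ψ Λ p j (Y, 0, q)) Θ := by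
      unfold osc
      rw [← integral_const_mul]
      congr 1; funext Y
      simp only [tailG, fX]; ring
    rw [this]; ring
  have taylor : ∀ Θ, X (Θ, q.2) * osc (fun Y => nearAmp ψ Λ p (Y, Θ, q)) Θ =
      ∑ j ∈ range (N + 1), (j ! : ℂ)⁻¹ * (osc (fun Y => nearD ψ Λ p j (Y, 0, q)) Θ - osc (fun Y => tailG ψ X Λ p j (Y, Θ, q)) Θ) +
        ∫ t in Icc (0 : ℝ) 1, osc (fun Y => remG ψ X Λ p N (Y, (t, Θ), q)) Θ := fun Θ => by
    have h1 := taylor_of_hasDerivAt (f := fun j t => osc (fun Y => nearD ψ Λ p j (Y, t • Θ, q)) Θ) (fun j t => by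
      have := hasDerivAt_osc_ray (eB n) (contDiff_nearD D hc j) (c := 1) (hz j) Θ q t
      simpa only [nearD, ← iterate_succ_apply' (f := dmix (eB n))] using this) N
    simp only [one_smul, zero_smul] at h1
    have h2 : osc (fun Y => nearAmp ψ Λ p (Y, Θ, q)) Θ = osc (fun Y => nearD ψ Λ p 0 (Y, Θ, q)) Θ := rfl
    rw [h2, h1, mul_add, mul_sum]
    congr 1
    · refine sum_congr rfl fun j _ => ?_
      rw [← etail]; ring
    · rw [intervalIntegral.integral_of_le zero_le_one, ← integral_Icc_eq_integral_Ioc, ← integral_const_mul]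
      congr 1; funext t
      unfold osc
      rw [← integral_const_mul, ← integral_const_mul]
      congr 1; funext Y
      simp only [remG]; ring
  have hrem' : Integrable (fun Θ => ∫ t in Icc (0 : ℝ) 1, osc (fun Y => remG ψ X Λ p N (Y, (t, Θ), q)) Θ) :=
    Integrable.integral_prod_right (f := fun s : ℝ × V2 n => osc (fun Y => remG ψ X Λ p N (Y, s, q)) s.2) hrem
  have hremE : ∫ Θ, ∫ t in Icc (0 : ℝ) 1, osc (fun Y => remG ψ X Λ p N (Y, (t, Θ), q)) Θ = remInt ψ X Λ p N q :=
    (integral_prod_symm (fun s : ℝ × V2 n => osc (fun Y => remG ψ X Λ p N (Y, s, q)) s.2) hrem).symm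
  have hinv : ∀ j, ∫ Θ, osc (fun Y => nearD ψ Λ p j (Y, 0, q)) Θ =
      ((2 * Real.pi) ^ (2 * n) : ℝ) * (dmix (eB n))^[j] (amp Λ p) (0, 0, q) := fun j => by
    have hcn := (contDiff_nearD D hc j).continuous
    rw [integral_osc fun! (hcs j 0) (hdiag j)]
    congr 2
    · have : finrank ℝ (V2 n) = 2 * n := by
        rw [Module.finrank_eq_card_basis (eB n).toBasis]; simp; ring
      rw [this]
    · have h0 : nearAmp ψ Λ p =ᶠ[𝓝 (0, 0, q)] amp Λ p := by
        filter_upwards [hc.fψ_eventually_one (z₀ := (0, 0, q)) (by simp)] with z hz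
        rw [nearAmp, hz, one_mul]
      exact (dmix_iterate_congr (eB n) h0 j).eq_of_nhds
  have hsum : ∀ j, Integrable fun Θ => (j ! : ℂ)⁻¹ *
      (osc (fun Y => nearD ψ Λ p j (Y, 0, q)) Θ - osc (fun Y => tailG ψ X Λ p j (Y, Θ, q)) Θ) := fun j =>
    ((hdiag j).sub (htail j)).const_mul _
  unfold nearInt
  simp only [taylor]
  rw [integral_add (integrable_finsetSum _ fun j _ => hsum j) hrem', hremE, integral_finsetSum _ fun j _ => hsum j]
  congr 1
  refine sum_congr rfl fun j _ => ?_
  have h := integral_sub (hdiag j) (htail j)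
  rw [hinv] at h
  rw [integral_const_mul]
  exact congrArg _ h

end Decomposition

section Estimates

variable {ψ : V2 n → ℂ} {X : V2 n × E n → ℂ}

/-- The normalisation `(2π)^{-2n}`. -/
def nrm (n : ℕ) : ℂ := (((2 * Real.pi) ^ (2 * n) : ℝ) : ℂ)⁻¹

/-- The remainder of finite order. -/
def remFin (ψ : V2 n → ℂ) (X : V2 n × E n → ℂ) (Λ : E² n → ℝ) (p : E² n → ℂ) (k : ℕ) (q : E² n) : ℂ :=
  nrm n * remInt ψ X Λ p k q

/-- The regularizing remainder. -/
def remInf (R : ℝ) (ψ : V2 n → ℂ) (X : V2 n × E n → ℂ) (Λ : E² n → ℝ) (p : E² n → ℂ) (k : ℕ) (q : E² n) : ℂ :=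
  nrm n * (midInt ψ X Λ p q + farInt R X Λ p q - ∑ j ∈ range (k + 1), (j ! : ℂ)⁻¹ * tailInt ψ X Λ p j q)

/-- The composed symbol. -/
def compSym (R : ℝ) (ψ : V2 n → ℂ) (X : V2 n × E n → ℂ) (Λ : E² n → ℝ) (p : E² n → ℂ) (q : E² n) : ℂ :=
  nrm n * (nearInt ψ X Λ p q + midInt ψ X Λ p q + farInt R X Λ p q)

lemma compSym_eq (hγR : 1024 * γ = (bigK κ n * R) ^ (-(1 / κ))) (D : Data κ γ R ρ M m h Λ p) (hC : 0 ≤ C) (hc : Cuts n κ R C h ψ X)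
    (k : ℕ) (q : E² n) : compSym R ψ X Λ p q =
      ∑ j ∈ range (k + 1), (j ! : ℂ)⁻¹ * (dmix (eB n))^[j] (amp Λ p) (0, 0, q) +
        remFin ψ X Λ p k q + remInf R ψ X Λ p k q := by
  have hn : (((2 * Real.pi) ^ (2 * n) : ℝ) : ℂ) ≠ 0 := by
    rw [Complex.ofReal_ne_zero]; positivity
  rw [compSym, remFin, remInf, nearInt_eq hγR D hC hc k q]
  have : ∑ j ∈ range (k + 1), (j ! : ℂ)⁻¹ * (dmix (eB n))^[j] (amp Λ p) (0, 0, q) =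
      nrm n * ∑ j ∈ range (k + 1), (j ! : ℂ)⁻¹ * (((2 * Real.pi) ^ (2 * n) : ℝ) * (dmix (eB n))^[j] (amp Λ p) (0, 0, q)) := by
    rw [mul_sum]
    refine sum_congr rfl fun j _ => ?_
    rw [nrm]; field_simp
  rw [this]
  simp only [mul_sub, Finset.sum_sub_distrib]
  ring

lemma norm_nrm_le (n : ℕ) : ‖nrm n‖ ≤ 1 := by
  rw [nrm, norm_inv, norm_real, norm_of_nonneg pos!]
  exact inv_le_one_of_one_le₀ (one_le_pow₀ (by linarith [Real.pi_gt_three]))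

lemma bound_of_GB (hκ : 0 ≤ κ) (hr : 0 ≤ r) (hb : 0 < b) {f : E² n → ℂ} (hf : C∞ f) {q : E² n}
    (h : GB κ (fun u => f (q + scl n b u)) 0 N r) (α β : MIdx n) :
    ‖dξ α (dx β fun x ξ => f (x, ξ)) q.1 q.2‖ ≤ N * (((2 : ℝ) ^ κ) ^ (n + 1) * r) ^ (len α + len β) * mfact α ^ κ * mfact β ^ κ *
      b ^ (-(len α : ℝ)) := by
  rw [dξ_dx_eq (a := fun x ξ => f (x, ξ)) hf]
  exact bound_of_GB_scl hκ hr hb hf h α β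

lemma sum_fact_pow_le {a : ℝ} (ha : 0 < a) (hκ : 1 ≤ κ) (N : ℕ) :
    ∑ j ∈ range (N + 1), a ^ (2 * j) * (j ! : ℝ) ^ (2 * κ - 1) ≤
      exp ((a ^ 2)⁻¹) * (a ^ (2 * N) * (N ! : ℝ) ^ (2 * κ - 1)) := by
  have key : ∀ j ∈ range (N + 1), a ^ (2 * j) * (j ! : ℝ) ^ (2 * κ - 1) ≤
      ((a ^ 2)⁻¹ ^ (N - j) / (N - j)!) * (a ^ (2 * N) * (N ! : ℝ) ^ (2 * κ - 1)) := fun j hj => by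
    have hj : j ≤ N := Nat.lt_succ_iff.mp (mem_range.mp hj)
    have h1 : (j ! : ℝ) * (N - j)! ≤ N ! := by exact_mod_cast Nat.le_of_dvd (factorial_pos _) (Nat.factorial_mul_factorial_dvd_factorial hj)
    have h2 : (1 : ℝ) ≤ (N - j)! := by exact_mod_cast factorial_pos _
    have h3 : (j ! : ℝ) ^ (2 * κ - 1) * (N - j)! ≤ (N ! : ℝ) ^ (2 * κ - 1) := by
      calc _ ≤ (j ! : ℝ) ^ (2 * κ - 1) * ((N - j)! : ℝ) ^ (2 * κ - 1) := by
            gcongr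
            simpa using rpow_le_rpow_of_exponent_le h2 (show 1 ≤ 2 * κ - 1 by linarith)
        _ = ((j ! : ℝ) * (N - j)!) ^ (2 * κ - 1) := (mul_rpow pos! pos!).symm
        _ ≤ _ := rpow_le_rpow pos! h1 lin!
    have h4 : a ^ (2 * N) = a ^ (2 * j) * (a ^ 2) ^ (N - j) := by
      rw [← pow_mul, ← pow_add]; congr 1; omega
    have h5 : (0 : ℝ) < (N - j)! := pos!
    calc a ^ (2 * j) * (j ! : ℝ) ^ (2 * κ - 1) = a ^ (2 * j) * ((j ! : ℝ) ^ (2 * κ - 1) * (N - j)!) / (N - j)! := by field_simp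
      _ ≤ a ^ (2 * j) * (N ! : ℝ) ^ (2 * κ - 1) / (N - j)! := mono!
      _ = _ := by rw [h4, inv_pow]; field_simp
  refine (sum_le_sum key).trans ?_
  rw [← sum_mul]
  gcongr
  rw [← Finset.sum_range_reflect]
  refine (sum_le_sum fun j hj => ?_).trans (Real.sum_le_exp_of_nonneg pos! (N + 1))
  have : N - (N + 1 - 1 - j) = j := by have := mem_range.mp hj; omega
  rw [this]

lemma fact_rpow_eq (j : ℕ) : (j ! : ℝ)⁻¹ * ((j ! : ℝ) ^ κ) ^ 2 = (j ! : ℝ) ^ (2 * κ - 1) := by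
  have : (0 : ℝ) < j ! := pos!
  rw [Real.rpow_sub this, rpow_one, mul_comm 2 κ, rpow_mul this.le, Real.rpow_two]
  field_simp

lemma exists_remainder_bounds (n : ℕ) (hκ : 1 < κ) (hγ : 0 < γ) (hR : 0 < R)
    (hγR : 1024 * γ = (bigK κ n * R) ^ (-(1 / κ))) (m C : ℝ) (hC : 0 ≤ C) : ∃ C' : ℝ, 0 < C' ∧
    ∀ {ρ M h Λ p ψ X}, Data κ γ R ρ M m h Λ p → Cuts n κ R C h ψ X → ∀ k : ℕ,
      C∞ (remFin ψ X Λ p k) ∧ C∞ (remInf R ψ X Λ p k) ∧ ∀ (α β : MIdx n) (x ξ : E n),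
      ‖dξ α (dx β fun x ξ => remFin ψ X Λ p k (x, ξ)) x ξ‖ ≤ C' * M * (derK κ n * R) ^ (2 * (k + 1)) *
        (((2 : ℝ) ^ κ) ^ (n + 1) * (2 ^ κ * (bigK κ n * R))) ^ (len α + len β) * mfact α ^ κ * mfact β ^ κ *
          ((k + 1)! : ℝ) ^ (2 * κ - 1) * jap h ξ ^ (m - (1 - 1 / κ) * ((k + 1 : ℕ) : ℝ) - len α) ∧
      ‖dξ α (dx β fun x ξ => remInf R ψ X Λ p k (x, ξ)) x ξ‖ ≤ C' * M * (derK κ n * R) ^ (2 * k) *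
        (((2 : ℝ) ^ κ) ^ (n + 1) * (2 ^ κ * (bigK κ n * R))) ^ (len α + len β) * mfact α ^ κ * mfact β ^ κ *
          (k ! : ℝ) ^ (2 * κ - 1) * ew κ (-(4 * γ)) (jap h ξ) := by
  obtain ⟨C₁, hC₁, hb₁⟩ := exists_farInt n hκ hγ hR hγR m C hC
  obtain ⟨C₂, hC₂, hb₂⟩ := exists_midInt n hκ hγ hR hγR m C hC
  obtain ⟨C₃, hC₃, hb₃⟩ := exists_tailInt n hκ hγ hR hγR m C hC
  obtain ⟨C₄, hC₄, hb₄⟩ := exists_remInt n hκ hγ hR hγR m C hC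
  have hK := bigK_pos κ n
  have ha : 0 < derK κ n * R := mul_pos (derK_pos κ n) hR
  set a := derK κ n * R
  set L := exp ((a ^ 2)⁻¹)
  have hL : 0 < L := exp_pos _
  have hr : 0 ≤ 2 ^ κ * (bigK κ n * R) := pos!
  refine ⟨C₄ + (C₁ + C₂ + C₃) * L, pos!, fun {ρ M h Λ p ψ X} D hc k => ?_⟩
  have hM := D.hM
  have s1 : C∞ (farInt R X Λ p) := (contDiff_oscInt hκ.le (contDiff_farG D hc) continuous_id (hb₁ D hc).1).1
  have s2 : C∞ (midInt ψ X Λ p) := (contDiff_oscInt hκ.le (contDiff_midG D hc) continuous_id (hb₂ D hc).1).1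
  have s3 : ∀ j, C∞ (tailInt ψ X Λ p j) := fun j =>
    (contDiff_oscInt hκ.le (contDiff_tailG D hc j) continuous_id (hb₃ D hc j).1).1
  have s4 : C∞ (remInt ψ X Λ p k) := (contDiff_oscInt hκ.le (contDiff_remG D hc k) continuous_snd (hb₄ D hc k).1).1
  have s3' : ∀ j, C∞ fun q => (j ! : ℂ)⁻¹ * tailInt ψ X Λ p j q := fun j => contDiff_const.mul (s3 j)
  have s5 : C∞ fun q => ∑ j ∈ range (k + 1), (j ! : ℂ)⁻¹ * tailInt ψ X Λ p j q := ContDiff.sum fun j _ => s3' j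
  have s6 : C∞ (remFin ψ X Λ p k) := contDiff_const.mul s4
  have s7 : C∞ (remInf R ψ X Λ p k) := contDiff_const.mul ((s2.add s1).sub s5)
  refine ⟨s6, s7, fun α β x ξ => ⟨?_, ?_⟩⟩
  · have hb : 0 < jap h ξ := zero_lt_one.trans_le (one_le_jap D.hh ξ)
    have g1 := ((hb₄ D hc k).2 (x, ξ)).const_smul (s4.comp (contDiff_const.add (scl n (jap h ξ)).contDiff)) (nrm n)
    refine (bound_of_GB lin! hr hb s6 g1 α β).trans ?_
    have e : jap h ξ ^ (m - (1 - 1 / κ) * ((k + 1 : ℕ) : ℝ) - len α) =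
        jap h ξ ^ (m - (1 - 1 / κ) * ((k + 1 : ℕ) : ℝ)) * jap h ξ ^ (-(len α : ℝ)) := by
      rw [← rpow_add hb]; congr 1
    rw [e, ← fact_rpow_eq]
    have e1 := norm_nrm_le n
    have e2 : C₄ ≤ C₄ + (C₁ + C₂ + C₃) * L := le_add_of_nonneg_right pos!
    have m1 := mfact_pos α
    have m2 := mfact_pos β
    calc _ ≤ 1 * (C₄ * M * (a ^ (2 * (k + 1)) * (((k + 1)! : ℝ) ^ κ) ^ 2 * ((k + 1)! : ℝ)⁻¹) *
          jap h ξ ^ (m - (1 - 1 / κ) * ((k + 1 : ℕ) : ℝ))) * (((2 : ℝ) ^ κ) ^ (n + 1) * (2 ^ κ * (bigK κ n * R))) ^ (len α + len β) *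
          mfact α ^ κ * mfact β ^ κ * jap h ξ ^ (-(len α : ℝ)) := mono!
      _ = C₄ * (M * (a ^ (2 * (k + 1)) * (((k + 1)! : ℝ) ^ κ) ^ 2 * ((k + 1)! : ℝ)⁻¹ *
          jap h ξ ^ (m - (1 - 1 / κ) * ((k + 1 : ℕ) : ℝ))) * (((2 : ℝ) ^ κ) ^ (n + 1) * (2 ^ κ * (bigK κ n * R))) ^ (len α + len β) *
          mfact α ^ κ * mfact β ^ κ * jap h ξ ^ (-(len α : ℝ))) := by ring
      _ ≤ (C₄ + (C₁ + C₂ + C₃) * L) * (M * (a ^ (2 * (k + 1)) * (((k + 1)! : ℝ) ^ κ) ^ 2 * ((k + 1)! : ℝ)⁻¹ *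
          jap h ξ ^ (m - (1 - 1 / κ) * ((k + 1 : ℕ) : ℝ))) * (((2 : ℝ) ^ κ) ^ (n + 1) * (2 ^ κ * (bigK κ n * R))) ^ (len α + len β) *
          mfact α ^ κ * mfact β ^ κ * jap h ξ ^ (-(len α : ℝ))) := mono!
      _ = _ := by ring
  · set w := ew κ (-(4 * γ)) (jap h ξ)
    have hw : 0 < w := ew_pos _ _ _
    have g2 : GB κ (fun q => ∑ j ∈ range (k + 1), (j ! : ℂ)⁻¹ * tailInt ψ X Λ p j q) (x, ξ)
        (∑ j ∈ range (k + 1), C₃ * M * w * (a ^ (2 * j) * (j ! : ℝ) ^ (2 * κ - 1))) (2 ^ κ * (bigK κ n * R)) :=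
      GB.sum hr _ (fun j _ => s3' j) fun j _ => by
        refine (((hb₃ D hc j).2 (x, ξ)).const_smul (s3 j) _).mono hr ?_ le_rfl
        rw [norm_inv, Complex.norm_natCast, ← fact_rpow_eq]
        exact le_of_eq (by ring)
    rw [← mul_sum] at g2
    have g := ((GB.add s2 s1 ((hb₂ D hc).2 (x, ξ)) ((hb₁ D hc).2 (x, ξ))).sub (s2.add s1) s5 g2).const_smul ((s2.add s1).sub s5) (nrm n)
    have g' : GB κ (fun u => remInf R ψ X Λ p k ((x, ξ) + scl n 1 u)) 0 (‖nrm n‖ * (C₂ * M * w + C₁ * M * w +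
        C₃ * M * w * ∑ j ∈ range (k + 1), a ^ (2 * j) * (j ! : ℝ) ^ (2 * κ - 1))) (2 ^ κ * (bigK κ n * R)) := by
      have e : (fun u => remInf R ψ X Λ p k ((x, ξ) + scl n 1 u)) = fun u => remInf R ψ X Λ p k ((x, ξ) + u) := by
        funext u; simp [scl_apply]
      rw [e]
      exact GB.translate g
    refine (bound_of_GB lin! hr one_pos s7 g' α β).trans ?_
    rw [one_rpow, mul_one]
    have e1 := norm_nrm_le n
    have hs := sum_fact_pow_le ha hκ.le k
    set B := a ^ (2 * k) * (k ! : ℝ) ^ (2 * κ - 1)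
    have hB : 1 ≤ L * B := by
      refine le_trans ?_ hs
      have h0 := single_le_sum (f := fun j : ℕ => a ^ (2 * j) * (j ! : ℝ) ^ (2 * κ - 1)) (s := range (k + 1))
        (fun j _ => pos!) (mem_range.mpr (Nat.succ_pos k))
      simpa using h0
    have m1 := mfact_pos α
    have m2 := mfact_pos β
    have h0 : 0 ≤ B := pos!
    have hmain : ‖nrm n‖ * (C₂ * M * w + C₁ * M * w + C₃ * M * w * ∑ j ∈ range (k + 1), a ^ (2 * j) * (j ! : ℝ) ^ (2 * κ - 1)) ≤
        (C₄ + (C₁ + C₂ + C₃) * L) * M * B * w := by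
      calc _ ≤ 1 * (C₂ * M * w + C₁ * M * w + C₃ * M * w * (L * B)) := mono!
        _ ≤ C₂ * M * w * (L * B) + C₁ * M * w * (L * B) + C₃ * M * w * (L * B) := by
          have t1 : C₂ * M * w ≤ C₂ * M * w * (L * B) := le_mul_of_one_le_right pos! hB
          have t2 : C₁ * M * w ≤ C₁ * M * w * (L * B) := le_mul_of_one_le_right pos! hB
          linarith
        _ ≤ C₂ * M * w * (L * B) + C₁ * M * w * (L * B) + C₃ * M * w * (L * B) + C₄ * M * B * w := le_add_of_nonneg_right pos!
        _ = _ := by ring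
    calc _ ≤ ((C₄ + (C₁ + C₂ + C₃) * L) * M * B * w) * (((2 : ℝ) ^ κ) ^ (n + 1) * (2 ^ κ * (bigK κ n * R))) ^ (len α + len β) *
          mfact α ^ κ * mfact β ^ κ := mono!
      _ = _ := by simp only [B]; ring

end Estimates

section DifferentialOperators

variable {U U' : Type} [NormedAddCommGroup U] [NormedSpace ℝ U] [NormedAddCommGroup U'] [NormedSpace ℝ U']

/-- The space of smooth functions. -/
def smoothFun (U : Type) [NormedAddCommGroup U] [NormedSpace ℝ U] : Submodule ℂ (U → ℂ) where
  carrier := {f | C∞ f}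
  add_mem' {f g} (hf : C∞ f) (hg : C∞ g) := show C∞ (f + g) from hf.add hg
  zero_mem' := show C∞ (0 : U → ℂ) from contDiff_const
  smul_mem' c f (hf : C∞ f) := show C∞ (c • f) from hf.const_smul c

/-- A directional derivative, as an endomorphism of the space of smooth functions. -/
def ddE (v : U) : Module.End ℂ (smoothFun U) where
  toFun f := ⟨dd v f.1, contDiff_dd f.2 v⟩
  map_add' f g := Subtype.ext (dd_add f.2 g.2 v)
  map_smul' c f := Subtype.ext (by
    funext x
    have hf : C∞ f.1 := f.2
    have h := fderiv_const_smul ((hf.differentiable (by simp)).differentiableAt (x := x)) c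
    change fderiv ℝ (c • f.1) x v = c • fderiv ℝ f.1 x v
    rw [h]; rfl)

lemma ddE_comm (v w : U) : ddE v * ddE w = ddE w * ddE v :=
  LinearMap.ext fun f => Subtype.ext (dd_comm f.2 v w)

/-- The algebra of differential operators with constant coefficients. -/
def diffAlg (U : Type) [NormedAddCommGroup U] [NormedSpace ℝ U] : Subalgebra ℂ (Module.End ℂ (smoothFun U)) :=
  Algebra.adjoin ℂ (Set.range ddE)

lemma diffAlg_mul_comm (P Q : diffAlg U) : P * Q = Q * P := by
  have : IsMulCommutative (diffAlg U) := Algebra.isMulCommutative_adjoin ℂ (by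
    rintro _ ⟨v, rfl⟩ _ ⟨w, rfl⟩
    exact ddE_comm v w)
  exact mul_comm' P Q

instance : CommSemiring (diffAlg U) := { (inferInstance : Semiring (diffAlg U)) with mul_comm := diffAlg_mul_comm }

/-- A directional derivative, as a differential operator. -/
def dA (v : U) : diffAlg U := ⟨ddE v, Algebra.subset_adjoin ⟨v, rfl⟩⟩

/-- The action of differential operators. -/
def act (P : diffAlg U) (f : smoothFun U) : smoothFun U := P.1 f

lemma act_mul (P Q : diffAlg U) (f : smoothFun U) : act (P * Q) f = act P (act Q f) := rfl

lemma act_one (f : smoothFun U) : act 1 f = f := rfl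

lemma act_smul (c : ℂ) (P : diffAlg U) (f : smoothFun U) : act (c • P) f = c • act P f := rfl

lemma act_sum {ι : Type} (s : Finset ι) (P : ι → diffAlg U) (f : smoothFun U) : act (∑ i ∈ s, P i) f = ∑ i ∈ s, act (P i) f := by
  classical
  induction s using induction_on with
  | empty => rfl
  | insert a s ha ih => rw [sum_insert ha, sum_insert ha, ← ih]; rfl

lemma coe_act_dA_pow (v : U) (k : ℕ) (f : smoothFun U) : (act (dA v ^ k) f : U → ℂ) = (dd v)^[k] f := by
  induction k with
  | zero => rfl
  | succ k ih => rw [pow_succ', act_mul, iterate_succ_apply', ← ih]; rfl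

lemma coe_act_prod (v : Fin n → U) (α : MIdx n) (f : smoothFun U) : (act (∏ i, dA (v i) ^ α i) f : U → ℂ) = mdd v α f := by
  rw [← List.prod_ofFn, List.ofFn_eq_map, mdd]
  induction finRange n with
  | nil => rfl
  | cons i l ih => rw [map_cons, prod_cons, act_mul, coe_act_dA_pow, ih, foldr_cons]

lemma mdd_mul_left {f g : U → ℂ} (v : Fin n → U) (α : MIdx n) (hf : C∞ f) (hg : C∞ g)
    (h : ∀ i x, dd (v i) f x = 0) : mdd v α (fun x => f x * g x) = fun x => f x * mdd v α g x := by
  unfold mdd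
  induction finRange n with
  | nil => rfl
  | cons i l ih =>
    rw [foldr_cons, foldr_cons, ih]
    have hl := contDiff_foldr_dd v α l hg
    generalize l.foldr (fun i g => (dd (v i))^[α i] g) g = k at hl
    induction α i with
    | zero => rfl
    | succ j ih =>
      rw [iterate_succ_apply', ih, dd_mul hf (contDiff_dd_iterate hl _ _), iterate_succ_apply']
      funext x
      rw [h i x, zero_mul, zero_add]

lemma dd_comp_eq_zero {f : U → ℂ} (hf : C∞ f) (T : U' →L[ℝ] U) {v : U'} (hv : T v = 0) (x : U') :
    dd v (fun u => f (T u)) x = 0 := by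
  have h := congrFun (dd_comp_affine hf 0 T v) x
  simp only [zero_add] at h
  rw [h, hv]
  simp [dd]

lemma mdd_comp_linear {f : U → ℂ} (hf : C∞ f) (T : U' →L[ℝ] U) (v : Fin n → U') (α : MIdx n) :
    mdd v α (fun u => f (T u)) = fun u => mdd (fun i => T (v i)) α f (T u) := by
  simpa only [zero_add] using mdd_comp_affine hf 0 T v α

end DifferentialOperators

section Expansion

def dY (s : Fin n ⊕ Fin n) : Z3 n := (eB n s, 0, 0)

def dΘ (s : Fin n ⊕ Fin n) : Z3 n := (0, eB n s, 0)

lemma smul_sum_pow_eq {A : Type} [CommSemiring A] [Algebra ℂ A] (c : ℂ) (a b : Fin n ⊕ Fin n → A) (j : ℕ) :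
    (c • ∑ s, a s * b s) ^ j = ∑ γ ∈ piAntidiag univ j, ((multinomial univ γ : ℂ) * c ^ j) •
      ((∏ i, b (Sum.inr i) ^ γ (Sum.inr i)) * ((∏ i, b (Sum.inl i) ^ γ (Sum.inl i)) *
        ((∏ i, a (Sum.inl i) ^ γ (Sum.inl i)) * ∏ i, a (Sum.inr i) ^ γ (Sum.inr i)))) := by
  rw [smul_pow, Finset.sum_pow_eq_sum_piAntidiag, Finset.smul_sum]
  refine sum_congr rfl fun γ _ => ?_
  rw [Fintype.prod_sum_type]
  simp only [mul_pow, Finset.prod_mul_distrib]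
  rw [mul_comm (multinomial univ γ : ℂ), mul_smul, Nat.cast_smul_eq_nsmul, nsmul_eq_mul]
  congr 1
  ring

lemma dmix_iterate_eq_sum {H : Z3 n → ℂ} (hH : C∞ H) (j : ℕ) (z : Z3 n) :
    (dmix (eB n))^[j] H z = ∑ γ ∈ piAntidiag univ j, (multinomial univ γ : ℂ) * ((-I) ^ j *
      mdd (fun i => dΘ (Sum.inr i)) (fun i => γ (Sum.inr i)) (mdd (fun i => dΘ (Sum.inl i)) (fun i => γ (Sum.inl i))
        (mdd (fun i => dY (Sum.inl i)) (fun i => γ (Sum.inl i)) (mdd (fun i => dY (Sum.inr i)) (fun i => γ (Sum.inr i)) H))) z) := by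
  set P : diffAlg (Z3 n) := (-I) • ∑ s, dA (dY s) * dA (dΘ s) with hP
  have h1 : ∀ j, (dmix (eB n))^[j] H = (act (P ^ j) ⟨H, hH⟩ : Z3 n → ℂ) := fun j => by
    induction j with
    | zero => rfl
    | succ j ih =>
      rw [iterate_succ_apply', ih, pow_succ', act_mul, hP, act_smul, act_sum]
      funext z
      simp only [dmix, Submodule.coe_smul, Submodule.coe_sum, Pi.smul_apply, Finset.sum_apply, smul_eq_mul]
      rfl
  have h2 : P ^ j = ∑ γ ∈ piAntidiag univ j, ((multinomial univ γ : ℂ) * (-I) ^ j) •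
      ((∏ i, dA (dΘ (n := n) (Sum.inr i)) ^ γ (Sum.inr i)) * ((∏ i, dA (dΘ (n := n) (Sum.inl i)) ^ γ (Sum.inl i)) *
        ((∏ i, dA (dY (n := n) (Sum.inl i)) ^ γ (Sum.inl i)) * ∏ i, dA (dY (n := n) (Sum.inr i)) ^ γ (Sum.inr i)))) :=
    smul_sum_pow_eq _ _ _ j
  rw [h1, h2, act_sum, Submodule.coe_sum, Finset.sum_apply]
  refine sum_congr rfl fun γ _ => ?_
  rw [act_smul, act_mul, act_mul, act_mul, Submodule.coe_smul, Pi.smul_apply, coe_act_prod, coe_act_prod, coe_act_prod, coe_act_prod,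
    smul_eq_mul, mul_assoc]

variable {Λ : E n → E n → ℝ} {p : E n → E n → ℂ}

lemma pathL_dY (s t : ℝ) (r : Fin n ⊕ Fin n) : pathL s t (dY r) = elim (fun _ => 0) (fun i => s • ex i) r := by
  rcases r with i | i <;> simp [pathL_apply, dY, eB, ex, pr1, pr2]

lemma pathL_dΘ (s t : ℝ) (r : Fin n ⊕ Fin n) : pathL s t (dΘ r) = elim (fun i => t • eξ i) (fun i => eξ i) r := by
  rcases r with i | i <;> simp [pathL_apply, dΘ, eB, eξ, pr1, pr2]

lemma shiftL_dY (r : Fin n ⊕ Fin n) : shiftL (dY r) = elim (fun i => ex i) (fun _ => 0) r := by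
  rcases r with i | i <;> simp [shiftL_apply, dY, eB, ex, pr1, pr2]

lemma shiftL_dΘ (r : Fin n ⊕ Fin n) : shiftL (dΘ r) = elim (fun _ => 0) (fun i => eξ i) r := by
  rcases r with i | i <;> simp [shiftL_apply, dΘ, eB, eξ, pr1, pr2]

/-- The terms of the expansion, before multiplication with the combinatorial factors. -/
def expTerm (Λ : E n → E n → ℝ) (p : E n → E n → ℂ) (α β : MIdx n) (q : E² n) : ℂ :=
  mdd eξ α (fun q => mdd eξ β (unc (toC (expSym Λ))) q * mdd ex β (unc p) q * mdd ex α (unc (toC (expSym (-Λ)))) q) q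

lemma contDiff_expSym (hΛ : C∞ (unc Λ)) : C∞ (unc (toC (expSym Λ))) :=
  ofRealCLM.contDiff.comp (contDiff_exp.comp hΛ)

lemma mdd_amp (hΛ : C∞ (unc Λ)) (hp : C∞ (unc p)) (α β : MIdx n) (q : E² n) :
    mdd (fun i => dΘ (Sum.inr i)) α (mdd (fun i => dΘ (Sum.inl i)) β
      (mdd (fun i => dY (Sum.inl i)) β (mdd (fun i => dY (Sum.inr i)) α (amp (unc Λ) (unc p))))) (0, 0, q) = expTerm Λ p α β q := by
  set g₁ := unc (toC (expSym Λ))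
  set g₃ := unc (toC (expSym (-Λ)))
  have h1 : C∞ g₁ := contDiff_expSym hΛ
  have h3 : C∞ g₃ := contDiff_expSym (Λ := -Λ) hΛ.neg
  have c1 : ∀ {f : E² n → ℂ}, C∞ f → ∀ T : Z3 n →L[ℝ] E² n, C∞ fun z => f (T z) := fun hf T =>
    hf.comp T.contDiff
  have e0 : amp (unc Λ) (unc p) = fun z => (g₁ (pathL 0 1 z) * unc p (shiftL z)) * g₃ (pathL 1 0 z) := by
    funext z
    simp only [amp, g₁, g₃, unc, toC, expSym, Pi.neg_apply]
    rw [sub_eq_add_neg, exp_add]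
    push_cast
    ring
  have m3 := contDiff_mdd ex α h3
  have m2 := contDiff_mdd ex β hp
  have m1 := contDiff_mdd eξ β h1
  have e1 : mdd (fun i => dY (Sum.inr i)) α (amp (unc Λ) (unc p)) = fun z =>
      g₁ (pathL 0 1 z) * (mdd ex α g₃ (pathL 1 0 z) * unc p (shiftL z)) := by
    rw [e0, mdd_mul_left _ _ ((c1 h1 _).mul (c1 hp _)) (c1 h3 _) fun i x => by
      rw [dd_mul (c1 h1 _) (c1 hp _)]; beta_reduce; rw [dd_comp_eq_zero h1 _ (by rw [pathL_dY]; simp), dd_comp_eq_zero hp _ (by rw [shiftL_dY]; rfl)]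
      ring, mdd_comp_linear h3]
    simp only [pathL_dY, elim_inr, one_smul]
    funext z; ring
  have e2 : mdd (fun i => dY (Sum.inl i)) β (fun z => g₁ (pathL 0 1 z) * (mdd ex α g₃ (pathL 1 0 z) * unc p (shiftL z))) =
      fun z => (mdd ex α g₃ (pathL 1 0 z) * mdd ex β (unc p) (shiftL z)) * g₁ (pathL 0 1 z) := by
    rw [mdd_mul_left _ _ (c1 h1 _) ((c1 m3 _).mul (c1 hp _)) fun i x => dd_comp_eq_zero h1 _ (by rw [pathL_dY]; rfl) _,
      mdd_mul_left _ _ (c1 m3 _) (c1 hp _) fun i x => dd_comp_eq_zero m3 _ (by rw [pathL_dY]; rfl) _, mdd_comp_linear hp]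
    simp only [shiftL_dY, elim_inl]
    funext z; ring
  have e3 : mdd (fun i => dΘ (Sum.inl i)) β (fun z => (mdd ex α g₃ (pathL 1 0 z) * mdd ex β (unc p) (shiftL z)) * g₁ (pathL 0 1 z)) =
      fun z => mdd eξ β g₁ (pathL 0 1 z) * mdd ex β (unc p) (shiftL z) * mdd ex α g₃ (pathL 1 0 z) := by
    rw [mdd_mul_left _ _ ((c1 m3 _).mul (c1 m2 _)) (c1 h1 _) fun i x => by
      rw [dd_mul (c1 m3 _) (c1 m2 _)]; beta_reduce; rw [dd_comp_eq_zero m3 _ (by rw [pathL_dΘ]; simp), dd_comp_eq_zero m2 _ (by rw [shiftL_dΘ]; rfl)]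
      ring, mdd_comp_linear h1]
    simp only [pathL_dΘ, elim_inl, one_smul]
    funext z; ring
  rw [e1, e2, e3]
  set K : Z3 n → ℂ := fun z => mdd eξ β g₁ (pathL 0 1 z) * mdd ex β (unc p) (shiftL z) * mdd ex α g₃ (pathL 1 0 z)
  set F : E² n → ℂ := fun q => mdd eξ β g₁ q * mdd ex β (unc p) q * mdd ex α g₃ q
  have hK : C∞ K := ((c1 m1 _).mul (c1 m2 _)).mul (c1 m3 _)
  have hF : C∞ F := (m1.mul m2).mul m3
  let inr2 : E n →L[ℝ] V2 n := (WithLp.prodContinuousLinearEquiv 2 ℝ (E n) (E n)).symm.toContinuousLinearMap.comp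
    (inr ℝ (E n) (E n))
  let T : E² n →L[ℝ] Z3 n := (0 : E² n →L[ℝ] V2 n).prod ((inr2.comp (snd ℝ _ _)).prod 0)
  let S : E² n →L[ℝ] E² n := (0 : E² n →L[ℝ] E n).prod (snd ℝ _ _)
  have hT : ∀ i, T (eξ i) = dΘ (Sum.inr i) := fun i => by
    simp [T, eξ, dΘ, eB, inr2]
  have hS : ∀ i, S (eξ i) = eξ i := fun i => rfl
  have k1 := congrFun (mdd_comp_affine hK (0, 0, q) T eξ α) 0
  have k2 := congrFun (mdd_comp_affine hF q S eξ α) 0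
  simp only [hT, map_zero, add_zero] at k1
  simp only [hS, map_zero, add_zero] at k2
  have k3 : (fun u => K ((0, 0, q) + T u)) = fun u => F (q + S u) := by
    funext u
    have : q + (0, u.2) = (q.1, q.2 + u.2) := Prod.ext (add_zero _) rfl
    simp [K, F, pathL_apply, shiftL_apply, T, S, inr2, pr1, pr2, this]
  rw [← k1, k3, k2]
  rfl

lemma expansion_eq (hΛ : C∞ (unc Λ)) (hp : C∞ (unc p)) (N : ℕ) (q : E² n) :
    expansion Λ p N q.1 q.2 = ∑ r ∈ pairs n N, (((mfact r.1 * mfact r.2 : ℝ) : ℂ))⁻¹ *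
      ((-I) ^ (len r.1 + len r.2) * expTerm Λ p r.1 r.2 q) := by
  unfold expansion
  refine sum_congr rfl fun r _ => ?_
  have h1 : C∞ (unc (toC (expSym Λ))) := contDiff_expSym hΛ
  have h3 : C∞ (unc (toC (expSym (-Λ)))) := contDiff_expSym (Λ := -Λ) hΛ.neg
  have m3 := contDiff_mdd ex r.1 h3
  have m2 := contDiff_mdd ex r.2 hp
  have m1 := contDiff_mdd eξ r.2 h1
  have hF : C∞ fun q => mdd eξ r.2 (unc (toC (expSym Λ))) q * mdd ex r.2 (unc p) q * mdd ex r.1 (unc (toC (expSym (-Λ)))) q :=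
    (m1.mul m2).mul m3
  have e : unc (fun y η => dξ r.2 (toC (expSym Λ)) y η * Dx r.2 p y η * Dx r.1 (toC (expSym (-Λ))) y η) = fun q =>
      (-I) ^ (len r.1 + len r.2) *
        (mdd eξ r.2 (unc (toC (expSym Λ))) q * mdd ex r.2 (unc p) q * mdd ex r.1 (unc (toC (expSym (-Λ)))) q) := by
    funext q
    simp only [unc, Dx]
    rw [dξ_eq h1, dx_eq hp, dx_eq h3]
    ring
  have hc : C∞ fun q : E² n => (-I) ^ (len r.1 + len r.2) *
        (mdd eξ r.2 (unc (toC (expSym Λ))) q * mdd ex r.2 (unc p) q * mdd ex r.1 (unc (toC (expSym (-Λ)))) q) := contDiff_const.mul hF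
  rw [dξ_eq (e ▸ hc), e, mdd_mul_left _ _ contDiff_const hF fun i x => by simp [dd]]
  simp only [expTerm]
  push_cast
  rw [one_div]

lemma sum_dmix_eq (hΛ : C∞ (unc Λ)) (hp : C∞ (unc p)) (N : ℕ) (q : E² n) :
    ∑ j ∈ range (N + 1), (j ! : ℂ)⁻¹ * (dmix (eB n))^[j] (amp (unc Λ) (unc p)) (0, 0, q) =
      p q.1 q.2 + expansion Λ p (N + 1) q.1 q.2 := by
  classical
  set g : MIdx n × MIdx n → ℂ := fun r => (((mfact r.1 * mfact r.2 : ℝ) : ℂ))⁻¹ *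
      ((-I) ^ (len r.1 + len r.2) * expTerm Λ p r.1 r.2 q) with hg
  set S : Finset (MIdx n × MIdx n) := ((piFinset fun _ : Fin n => range (N + 1)) ×ˢ
    (piFinset fun _ : Fin n => range (N + 1))).filter fun r => len r.1 + len r.2 < N + 1 with hS
  have hle : ∀ (α : MIdx n) i, α i ≤ len α := fun α i => single_le_sum (fun _ _ => Nat.zero_le _) (mem_univ i)
  have memS : ∀ r, r ∈ S ↔ len r.1 + len r.2 < N + 1 := fun r => by
    simp only [hS, mem_filter, Finset.mem_product, Fintype.mem_piFinset, mem_range, and_iff_right_iff_imp]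
    intro h
    exact ⟨fun i => by have := hle r.1 i; omega, fun i => by have := hle r.2 i; omega⟩
  have hpairs : S = insert (0, 0) (pairs n (N + 1)) := by
    ext r
    rw [memS, Finset.mem_insert]
    have hp' : r ∈ pairs n (N + 1) ↔ 1 ≤ len r.1 + len r.2 ∧ len r.1 + len r.2 < N + 1 := by
      have := memS r
      simp only [hS, pairs, mem_filter] at this ⊢
      tauto
    rw [hp']
    have h0 : r = (0, 0) ↔ len r.1 + len r.2 = 0 := by
      constructor
      · rintro rfl; simp [len]
      · intro h
        refine Prod.ext (funext fun i => ?_) (funext fun i => ?_)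
        · have := hle r.1 i; simp only [Pi.zero_apply]; omega
        · have := hle r.2 i; simp only [Pi.zero_apply]; omega
    rw [h0]
    omega
  have h00 : ((0 : MIdx n), (0 : MIdx n)) ∉ pairs n (N + 1) := by simp [pairs, len]
  have g0 : g (0, 0) = p q.1 q.2 := by
    simp only [hg, expTerm, mdd_zero, mfact_zero, len_zero]
    simp only [unc, toC, expSym, Pi.neg_apply]
    have : Complex.exp (Λ q.1 q.2 : ℂ) ≠ 0 := Complex.exp_ne_zero _
    push_cast
    rw [Complex.exp_neg]
    field_simp
  rw [expansion_eq hΛ hp]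
  change _ = p q.1 q.2 + ∑ r ∈ pairs n (N + 1), g r
  rw [← g0, ← sum_insert h00, ← hpairs, ← Finset.sum_fiberwise_of_maps_to (s := S) (t := range (N + 1))
    (g := fun r => len r.1 + len r.2) (fun r hr => mem_range.mpr ((memS r).mp hr))]
  refine sum_congr rfl fun j hj => ?_
  rw [dmix_iterate_eq_sum (contDiff_amp hΛ hp), mul_sum]
  refine Finset.sum_nbij' (fun γ => (fun i => γ (Sum.inr i), fun i => γ (Sum.inl i))) (fun r => elim r.2 r.1) ?_ ?_ ?_ ?_ ?_
  · intro γ hγ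
    rw [mem_piAntidiag, sum_sum_type] at hγ
    have : len (fun i => γ (Sum.inr i)) + len (fun i => γ (Sum.inl i)) = j := by simp only [len]; omega
    rw [mem_filter, memS]
    have hj := mem_range.mp hj
    exact ⟨by simp only; omega, this⟩
  · intro r hr
    have := (mem_filter.mp hr).2
    rw [mem_piAntidiag, sum_sum_type]
    simp only [len] at this
    exact ⟨by simp only [elim_inl, elim_inr]; omega, fun _ _ => mem_univ _⟩
  · intro γ _
    funext s; rcases s with i | i <;> rfl
  · intro r _; rfl
  · intro γ hγ
    have hγ' := (mem_piAntidiag.mp hγ).1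
    rw [mdd_amp hΛ hp]
    have hsum : len (fun i => γ (Sum.inr i)) + len (fun i => γ (Sum.inl i)) = j := by
      rw [sum_sum_type] at hγ'; simp only [len]; omega
    have hm : (multinomial univ γ : ℂ) = (j ! : ℂ) * (((mfact (fun i => γ (Sum.inr i)) * mfact (fun i => γ (Sum.inl i)) : ℝ) : ℂ))⁻¹ := by
      have h := Nat.multinomial_spec univ γ
      rw [hγ', Fintype.prod_sum_type] at h
      have h' : ((∏ i, ((γ (Sum.inl i))! : ℂ)) * ∏ i, ((γ (Sum.inr i))! : ℂ)) * (multinomial univ γ : ℂ) = (j ! : ℂ) := by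
        exact_mod_cast h
      have hne : (mfact (fun i => γ (Sum.inr i)) * mfact (fun i => γ (Sum.inl i)) : ℝ) ≠ 0 := (mul_pos (mfact_pos _) (mfact_pos _)).ne'
      rw [eq_mul_inv_iff_mul_eq₀ (by exact_mod_cast hne), ← h']
      simp only [mfact]
      push_cast
      ring
    have hj0 : (j ! : ℂ) ≠ 0 := by exact_mod_cast (factorial_pos j).ne'
    simp only [hg, hm, hsum]
    field_simp

end Expansion

section TameSymbols

variable {a : E² n → ℂ} {U : E n → ℂ}

/-- The parameters of the operator calculus. -/
structure Par (n : ℕ) (κ γ R : ℝ) : Prop where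
  hκ : 1 < κ
  hγ : 0 < γ
  hR : 0 < R
  hγR : 1024 * γ = (bigK κ n * R) ^ (-(1 / κ))

/-- Gevrey symbols of small exponential type. -/
structure Tame (κ γ R K : ℝ) (a : E² n → ℂ) : Prop where
  smooth : C∞ a
  bound : ∀ q, GB κ a q (K * ew κ γ ‖q.2‖) (2 * R)

/-- Gevrey functions with integrable bounds. -/
structure Nice (κ R N : ℝ) (U : E n → ℂ) : Prop where
  smooth : C∞ U
  bound : ∀ x, GB κ U x (N * ((1 + ‖x‖) ^ (n + 1))⁻¹) (2 * R)

lemma ew_add_le {V : Type} [NormedAddCommGroup V] (hκ : 1 ≤ κ) (hγ : 0 ≤ γ) (a b : V) :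
    ew κ γ ‖a + b‖ ≤ ew κ γ ‖a‖ * ew κ γ ‖b‖ := by
  unfold ew
  rw [← exp_add, ← mul_add]
  exact exp_le_exp.mpr (mul_le_mul_of_nonneg_left ((rpow_le_rpow (norm_nonneg _) (norm_add_le _ _) pos!).trans
    (rpow_add_le' hκ (norm_nonneg _) (norm_nonneg _))) hγ)

lemma Tame.norm_le (ha : Tame κ γ R K a) (q : E² n) : ‖a q‖ ≤ K * ew κ γ ‖q.2‖ := (ha.bound q).norm_le

lemma Tame.nonneg (ha : Tame κ γ R K a) : 0 ≤ K := nonneg_of_mul_nonneg_left (ha.bound 0).nonneg (ew_pos _ _ _)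

lemma Nice.nonneg (hU : Nice κ R N U) : 0 ≤ N := nonneg_of_mul_nonneg_left (hU.bound 0).nonneg pos!

/-- The integrable weight in `x`. -/
abbrev wt (x : E n) : ℝ := ((1 + ‖x‖) ^ (n + 1))⁻¹

lemma wt_pos (x : E n) : 0 < wt x := by unfold wt; positivity

lemma integrable_wt : Integrable (wt : E n → ℝ) := by
  have h := integrable_inv_one_add_norm_pow (V := E n)
  rw [finrank_euclideanSpace_fin] at h
  exact h

lemma Nice.integrable (hU : Nice κ R N U) : Integrable U :=
  (integrable_wt.const_mul N).mono' hU.smooth.continuous.aestronglyMeasurable (.of_forall fun x => (hU.bound x).norm_le)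

/-- The oscillatory integral of `a (·, ζ) U`, at the frequency `θ`. -/
def dOsc (a : E² n → ℂ) (U : E n → ℂ) (w : E² n) : ℂ := osc (fun z => a (z, w.1) * U z) w.2

/-- The constant in the estimate of `dOsc`. -/
abbrev oscK (n : ℕ) (κ : ℝ) : ℝ := 2 ^ κ * ∫ z : E n, wt z

lemma oscK_nonneg : 0 ≤ oscK n κ := mul_nonneg pos! (integral_nonneg fun _ => (wt_pos _).le)

lemma norm_dOsc_le (P : Par n κ γ R) (ha : Tame κ γ R K a) (hU : Nice κ R N U) (w : E² n) :
    ‖dOsc a U w‖ ≤ K * N * oscK n κ * (ew κ γ ‖w.1‖ * ew κ (-(256 * γ)) ‖w.2‖) := by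
  have hR := P.hR
  have hs : C∞ fun z => a (z, w.1) := ha.smooth.comp (contDiff_id.prodMk contDiff_const)
  have h := norm_osc_le P.hκ.le (show 0 < 2 * (2 * R) by positivity) (hs.mul hU.smooth)
    (g := fun z => K * ew κ γ ‖w.1‖ * (N * wt z)) ((integrable_wt.const_mul N).const_mul _)
    (fun z => ((ha.bound (z, w.1)).slice pos! ha.smooth).mul P.hκ.le pos! hs hU.smooth (hU.bound z)) w.2
  refine h.trans ?_
  have hd : dec κ (2 * (2 * R)) w.2 ≤ _ := dec_le_ew (by linarith [P.hκ]) hR P.hγR pos!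
    (by have := (le_bigK (n := n) (by linarith [P.hκ] : 0 ≤ κ)).2.1; nlinarith) w.2
  have h1 := ha.nonneg
  have h2 := hU.nonneg
  have h3 := ew_pos κ γ ‖w.1‖
  rw [integral_const_mul, integral_const_mul]
  calc _ = 2 ^ κ * (K * ew κ γ ‖w.1‖ * (N * ∫ z : E n, wt z)) * dec κ (2 * (2 * R)) w.2 := rfl
    _ ≤ 2 ^ κ * (K * ew κ γ ‖w.1‖ * (N * ∫ z : E n, wt z)) * ew κ (-(256 * γ)) ‖w.2‖ := by
        have : 0 ≤ ∫ z : E n, wt z := integral_nonneg fun _ => (wt_pos _).le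
        gcongr
    _ = _ := by unfold oscK; ring

lemma Tame.norm_mul_le (ha : Tame κ γ R K a) (hU : Nice κ R N U) (z ζ : E n) :
    ‖a (z, ζ) * U z‖ ≤ K * ew κ γ ‖ζ‖ * (N * wt z) := by
  rw [norm_mul]
  have h3 := ew_pos κ γ ‖ζ‖
  have := ha.nonneg
  exact mul_le_mul (ha.norm_le _) (hU.bound z).norm_le (norm_nonneg _) pos!

lemma continuous_dOsc (P : Par n κ γ R) (ha : Tame κ γ R K a) (hU : Nice κ R N U) : Continuous (dOsc a U) := by
  have ca := ha.smooth.continuous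
  have cU := hU.smooth.continuous
  have hκ := P.hκ
  have ce := continuous_ec (V := E n)
  refine continuous_iff_continuousAt.mpr fun w₀ => ?_
  unfold dOsc osc
  refine continuousAt_of_dominated (bound := fun z => K * ew κ γ (‖w₀.1‖ + 1) * (N * wt z)) ?_ ?_
    ((integrable_wt.const_mul N).const_mul _) ?_
  · refine .of_forall fun w => Continuous.aestronglyMeasurable ?_
    exact (contDiff_ec w.2).continuous.mul fun!
  · have : ∀ᶠ w : E² n in 𝓝 w₀, ‖w.1‖ < ‖w₀.1‖ + 1 :=
      (continuous_fst.norm.tendsto w₀).eventually_lt_const lin!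
    filter_upwards [this] with w hw
    refine .of_forall fun z => ?_
    rw [norm_mul, norm_ec, one_mul]
    have h1 := ha.nonneg
    have h2 := hU.nonneg
    have h3 := wt_pos z
    refine (ha.norm_mul_le hU z w.1).trans ?_
    have := ew_mono (κ := κ) lin! P.hγ.le (norm_nonneg w.1) le_rfl hw.le
    gcongr
  · refine .of_forall fun z => Continuous.continuousAt ?_
    exact (ce.comp (continuous_const.prodMk continuous_snd)).mul fun!

lemma ec_add (x y ζ : E n) : ec (x + y) ζ = ec x ζ * ec y ζ := by
  unfold ec
  rw [← Complex.exp_add, inner_add_left]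
  push_cast
  ring_nf

lemma GB.comp_clm {V W : Type} [NormedAddCommGroup V] [NormedSpace ℝ V] [NormedAddCommGroup W] [NormedSpace ℝ W]
    (hr : 0 ≤ r) {f : V → ℂ} (hf : C∞ f) {T : W →L[ℝ] V} (hT : ‖T‖ ≤ t) {u : W} (h : GB κ f (T u) M r) :
    GB κ (fun v => f (T v)) u M (t * r) := by
  have := GB.comp_affine (a := (0 : V)) (T := T) (u := u) hr hf hT (by simpa using h)
  simpa using this

/-- The function `(2π)^n p(x,D) v`, where the Fourier transform of `v` is that of `a (·, ζ) U` at `ζ`. -/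
def tInt (p a : E² n → ℂ) (U : E n → ℂ) (y : E n) : ℂ := ∫ ζ, ec (-y) ζ * (p (y, ζ) * dOsc a U (ζ, ζ))

def tAmp (p a : E² n → ℂ) (U : E n → ℂ) (z : E n × E² n) : ℂ :=
  p (z.2.2, z.2.1) * (a (z.2.2 + z.1, z.2.1) * U (z.2.2 + z.1))

lemma osc_tAmp (y ζ : E n) : osc (fun P => tAmp p a U (P, ζ, y)) ζ = ec (-y) ζ * (p (y, ζ) * dOsc a U (ζ, ζ)) := by
  unfold dOsc osc tAmp
  rw [← integral_const_mul, ← integral_const_mul]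
  conv_rhs => rw [← integral_add_left_eq_self _ y]
  refine integral_congr_ae (.of_forall fun P => ?_)
  have : ec P ζ = ec (-y) ζ * ec (y + P) ζ := by rw [← ec_add, neg_add_cancel_left]
  simp only [this]
  ring

lemma GB_tAmp (P : Par n κ γ R) (hp : Tame κ γ R K p) (ha : Tame κ γ R K' a) (hU : Nice κ R N U) (z : E n × E² n) :
    C∞ (tAmp p a U) ∧
      GB κ (tAmp p a U) z (K * K' * N * ew κ (2 * γ) ‖z.2.1‖ * wt (z.2.2 + z.1)) (16 * R) := by
  have hR := P.hR
  let A1 : E n × E² n →L[ℝ] E n := fst ℝ _ _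
  let A2 : E n × E² n →L[ℝ] E n := (fst ℝ _ _).comp (snd ℝ (E n) _)
  let A3 : E n × E² n →L[ℝ] E n := (snd ℝ _ _).comp (snd ℝ (E n) _)
  have n1 : ∀ z, ‖A1 z‖ ≤ ‖z‖ := fun z => norm_fst_le z
  have n2 : ∀ z, ‖A2 z‖ ≤ ‖z‖ := fun z => (norm_fst_le z.2).trans (norm_snd_le z)
  have n3 : ∀ z, ‖A3 z‖ ≤ ‖z‖ := fun z => (norm_snd_le z.2).trans (norm_snd_le z)
  have t3 : ∀ z, ‖A3 z + A1 z‖ ≤ 2 * ‖z‖ := fun z => (norm_add_le _ _).trans (by linarith [n1 z, n3 z])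
  have b1 : ‖A3.prod A2‖ ≤ 1 := opNorm_le_bound _ zero_le_one fun z => by
    rw [one_mul]; exact max_le (n3 z) (n2 z)
  have b2 : ‖(A3 + A1).prod A2‖ ≤ 2 := opNorm_le_bound _ zero_le_two fun z =>
    max_le (t3 z) ((n2 z).trans (by linarith [norm_nonneg z]))
  have b3 : ‖A3 + A1‖ ≤ 2 := opNorm_le_bound _ zero_le_two t3
  have s1 : C∞ fun z => p (A3.prod A2 z) := hp.smooth.comp (A3.prod A2).contDiff
  have s2 : C∞ fun z => a ((A3 + A1).prod A2 z) := ha.smooth.comp ((A3 + A1).prod A2).contDiff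
  have s3 : C∞ fun z => U ((A3 + A1) z) := hU.smooth.comp (A3 + A1).contDiff
  have g1 := GB.comp_clm (u := z) pos! hp.smooth b1 (hp.bound _)
  have g2 := GB.comp_clm (u := z) pos! ha.smooth b2 (ha.bound _)
  have g3 := GB.comp_clm (u := z) pos! hU.smooth b3 (hU.bound _)
  refine ⟨s1.mul (s2.mul s3), ((g1.mono pos! le_rfl (show 1 * (2 * R) ≤ 2 * (2 * (2 * R)) by linarith)).mul P.hκ.le
    pos! s1 (s2.mul s3) (g2.mul P.hκ.le pos! s2 s3 g3)).mono pos! (le_of_eq ?_) lin!⟩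
  have : ew κ (2 * γ) ‖z.2.1‖ = ew κ γ ‖z.2.1‖ * ew κ γ ‖z.2.1‖ := by rw [ew_mul, two_mul]
  rw [this]
  change K * ew κ γ ‖z.2.1‖ * (K' * ew κ γ ‖z.2.1‖ * (N * wt (z.2.2 + z.1))) = _
  ring

lemma wt_add_le (y z : E n) : wt (y + z) ≤ (1 + ‖z‖) ^ (n + 1) * wt y := by
  unfold wt
  rw [← div_eq_mul_inv, inv_eq_one_div, div_le_div_iff₀ pos! pos!, one_mul, ← mul_pow]
  refine pow_le_pow_left₀ pos! ?_ _
  have h : ‖y‖ ≤ ‖y + z‖ + ‖z‖ := by simpa using norm_sub_le (y + z) z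
  nlinarith [norm_nonneg z, norm_nonneg (y + z)]

/-- The directions of the regularisation in the construction of `tInt`. -/
def tDir (n : ℕ) : List (E n × (E² n)) :=
  (stDirs (E n) ((n + 1) + (finrank ℝ (E n) + 1))).map fun e => (e, (e, 0))

lemma tDir_norm : ∀ e ∈ tDir n, ‖e.1‖ ≤ 1 ∧ ‖e.2‖ ≤ 1 := by
  intro e he
  simp only [tDir, List.mem_map] at he
  obtain ⟨a, ha, rfl⟩ := he
  have := stDirs_norm _ a ha
  exact ⟨this, max_le this (by simp)⟩

lemma finrank_V2 : finrank ℝ (V2 n) = 2 * n := by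
  rw [Module.finrank_eq_card_basis (eB n).toBasis]; simp; ring

lemma stDirs_length_le : (stDirs (E n) ((n + 1) + (finrank ℝ (E n) + 1))).length ≤ stN n := by
  rw [stDirs_length, stN, finrank_V2]
  simp only [finrank_euclideanSpace, card_fin]
  nlinarith [Nat.le_mul_self n]

lemma tInt_eq (P : Par n κ γ R) (hp : Tame κ γ R K p) (ha : Tame κ γ R K' a) (hU : Nice κ R N U) :
    tInt p a U = oscInt (StL (16 * R) (tDir n) (tAmp p a U)) (id : E n → E n) volume := by
  have hκ := P.hκ
  have hγ := P.hγ
  have hR := P.hR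
  funext y
  have hs := (GB_tAmp P hp ha hU 0).1
  set d := stDirs (E n) ((n + 1) + (finrank ℝ (E n) + 1)) with hd
  have e2 : StL (16 * R) (diagL d) (fun z : E² n => tAmp p a U (z.1, z.2, y)) = fun z => StL (16 * R) (tDir n) (tAmp p a U) (z.1, z.2, y) := by
    have := StL_comp_affine hs (16 * R) ((0 : E n), y) (inl ℝ (E n) (E n)) (diagL d)
    simp only [ContinuousLinearMap.inl_apply, mk_add_mk, zero_add, add_zero] at this
    rw [this, diagL, List.map_map]
    rfl
  have hsy : C∞ fun z : E² n => tAmp p a U (z.1, z.2, y) :=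
    hs.comp (contDiff_fst.prodMk (contDiff_snd.prodMk contDiff_const))
  let T : E² n →L[ℝ] E n × E² n := (fst ℝ _ _).prod ((snd ℝ _ _).prod 0)
  have hT : ‖T‖ ≤ 1 := opNorm_le_bound _ zero_le_one fun z => by
    rw [one_mul]; exact max_le (norm_fst_le z) (max_le (norm_snd_le z) (by change ‖(0 : E n)‖ ≤ ‖z‖; simp))
  have hw : Integrable fun z : E n => K * K' * N * wt (y + z) := (integrable_wt.comp_add_left y).const_mul _
  have key := integral_osc_StL hκ.le (s := 16 * R) pos! le_rfl hsy (τ := fun ζ => ew κ (2 * γ) ‖ζ‖) hw (by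
      unfold ew
      exact Real.continuous_exp.comp (continuous_const.mul (continuous_norm.rpow_const fun _ => Or.inr pos!))) (N := stN n) (by
      refine (integrable_ew (V := E n) (κ := κ) (γ := γ) lin! hγ).mono' ?_ (.of_forall fun ζ => ?_)
      · refine Continuous.aestronglyMeasurable (Continuous.mul ?_ (continuous_dec lin! _))
        unfold ew
        exact Real.continuous_exp.comp (continuous_const.mul (continuous_norm.rpow_const fun _ => Or.inr pos!))
      · have h1 := dec_le_ew (n := n) (γ := γ) lin! hR P.hγR (show 0 < (8 * 2 ^ κ) ^ stN n * (16 * R) by positivity) (by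
          have := (le_bigK (n := n) (by linarith : 0 ≤ κ)).2.2
          calc (8 * 2 ^ κ) ^ stN n * (16 * R) ≤ ((8 * 2 ^ κ) ^ stN n * 48) * R := by
                have : 0 < (8 * 2 ^ κ) ^ stN n * R := pos!
                linarith
            _ ≤ _ := mono!) ζ
        have p1 := ew_pos κ (2 * γ) ‖ζ‖
        have p2 := dec_pos κ ((8 * 2 ^ κ) ^ stN n * (16 * R)) ζ
        rw [norm_of_nonneg pos!]
        calc _ ≤ ew κ (2 * γ) ‖ζ‖ * ew κ (-(256 * γ)) ‖ζ‖ := mono!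
          _ = ew κ (-(254 * γ)) ‖ζ‖ := by rw [ew_mul]; ring_nf
          _ ≤ _ := exp_le_exp.mpr (mul_le_mul_of_nonneg_right lin! pos!))
    (fun P' ζ => by
      have h1 := GB.comp_affine (a := ((0, 0, y) : E n × E² n)) (T := T) (u := (P', ζ)) (M := _) (t := 1) pos! hs hT
        (GB_tAmp P hp ha hU _).2
      simp only [T, ContinuousLinearMap.prod_apply, ContinuousLinearMap.coe_fst', ContinuousLinearMap.coe_snd', mk_add_mk, zero_add,
        zero_apply, add_zero, one_mul] at h1
      exact h1.mono pos! (le_of_eq (by ring)) le_rfl)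
    d (stDirs_norm _) stDirs_length_le
  rw [e2] at key
  simp only [osc_tAmp] at key
  exact key

end TameSymbols

section TransformedFunctions

variable {a : E² n → ℂ} {U : E n → ℂ}

lemma exists_tInt (P : Par n κ γ R) : ∃ C : ℝ, 0 < C ∧ ∀ {K K' N : ℝ} {p a : E² n → ℂ} {U : E n → ℂ}, Tame κ γ R K p →
    Tame κ γ R K' a → Nice κ R N U → C∞ (tInt p a U) ∧
      ∀ y, GB κ (tInt p a U) y (C * (K * K' * N) * wt y) (2 ^ κ * (bigK κ n * R)) := by
  have hκ := P.hκ
  have hγ := P.hγ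
  have hR := P.hR
  set g : E n → ℝ := fun z => (1 + ‖z‖) ^ (n + 1) * stWL (16 * R) (tDir n) z
  have hg : Integrable g := by
    have := integrable_pow_mul_stWL (V := E n) (show 0 < 16 * R by positivity) (fun e => ((e, 0) : E² n)) (n + 1)
    exact this
  set S := stC κ (16 * R) (16 * R) (stN n)
  have hS : 0 < S := stC_pos _ pos! pos! _
  have hτ : Integrable fun Θ : E n => ew κ (-γ) ‖Θ‖ := integrable_ew lin! hγ
  have hg0 : ∀ z, 0 ≤ g z := fun z => mul_nonneg pos! (stWL_nonneg _ _ _)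
  have hI1 : 0 ≤ ∫ z, g z := integral_nonneg hg0
  have hI2 : 0 ≤ ∫ Θ : E n, ew κ (-γ) ‖Θ‖ := integral_nonneg fun _ => (ew_pos _ _ _).le
  have hK := bigK_pos κ n
  refine ⟨2 ^ κ * (∫ z, g z) * (S * ∫ Θ : E n, ew κ (-γ) ‖Θ‖) + 1, pos!, fun {K K' N p a U} hp ha hU => ?_⟩
  have h1 := hp.nonneg
  have h2 := ha.nonneg
  have h3 := hU.nonneg
  have hs := (GB_tAmp P hp ha hU 0).1
  rw [tInt_eq P hp ha hU]
  set G := StL (16 * R) (tDir n) (tAmp p a U)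
  have hG : C∞ G := contDiff_StL hs _ _
  have hGB : ∀ z ζ y, GB κ G (z, ζ, y) (g z * (S * (K * K' * N) * wt y * ew κ (2 * γ) ‖ζ‖)) (bigK κ n * R) := fun z ζ y => by
    refine ((GB_tAmp P hp ha hU (z, ζ, y)).2.StL' hκ.le (s := 16 * R) pos! le_rfl hs (tDir n) tDir_norm (N := stN n)
      (by rw [tDir, List.length_map]; exact stDirs_length_le)).mono pos! ?_ ?_
    · have q1 := stWL_nonneg (16 * R) (tDir n) z
      have q2 := ew_pos κ (2 * γ) ‖ζ‖
      calc _ ≤ S * stWL (16 * R) (tDir n) z * (K * K' * N * ew κ (2 * γ) ‖ζ‖ * ((1 + ‖z‖) ^ (n + 1) * wt y)) := by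
            gcongr; exact wt_add_le y z
        _ = _ := by simp only [g]; ring
    · have := (le_bigK (n := n) (by linarith : 0 ≤ κ)).2.2
      calc (8 * 2 ^ κ) ^ stN n * (16 * R) ≤ ((8 * 2 ^ κ) ^ stN n * 48) * R := by
            have : 0 < (8 * 2 ^ κ) ^ stN n * R := pos!
            linarith
        _ ≤ _ := mono!
  have hw1 : ∀ y : E n, wt y ≤ 1 := fun y => inv_le_one_of_one_le₀ (one_le_pow₀ (by linarith [norm_nonneg y]))
  have hew : ∀ ζ : E n, ew κ (2 * γ) ‖ζ‖ ≤ ew κ (-γ) ‖ζ‖ * ew κ (256 * γ) ‖ζ‖ := fun ζ => ew_le_ew_mul lin! (norm_nonneg ζ)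
  have hdom : ∀ u, OscDom κ G (id : E n → E n) volume u := by
    refine OscDom.of_ew lin! pos! P.hγR hg (J := fun _ => 0) continuous_const fun B => ?_
    refine ⟨fun Θ => S * (K * K' * N) * ew κ (-γ) ‖Θ‖, hτ.const_mul _, fun u _ z ζ => ?_⟩
    refine (GB.slice_mid pos! hG (hGB z ζ u)).mono pos! ?_ le_rfl
    have q1 := hg0 z
    have q2 := ew_pos κ (2 * γ) ‖ζ‖
    calc _ ≤ g z * (S * (K * K' * N) * 1 * (ew κ (-γ) ‖ζ‖ * ew κ (256 * γ) ‖ζ‖)) := by gcongr; exacts [hw1 u, hew ζ]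
      _ = _ := by simp only [id]; ring
  refine ⟨(contDiff_oscInt hκ.le hG continuous_id hdom).1, fun y => GB.of_translate ?_⟩
  have key := GB_oscInt_ew hκ.le pos! P.hγR one_pos hG continuous_id hdom (u₀ := y) (ContinuousLinearMap.id ℝ _) hg
    (τ := fun Θ => S * (K * K' * N) * wt y * ew κ (-γ) ‖Θ‖) (hτ.const_mul _)
    (.of_forall fun ζ z => by
      have h1 := (GB.slice_mid pos! hG (hGB z ζ y)).translate
      simp only [one_smul, id_apply]
      refine h1.mono pos! ?_ le_rfl
      have q1 := hg0 z
      have q3 := wt_pos y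
      calc _ ≤ g z * (S * (K * K' * N) * wt y * (ew κ (-γ) ‖ζ‖ * ew κ (256 * γ) ‖ζ‖)) := by gcongr; exact hew ζ
        _ = _ := by simp only [id, one_mul]; ring)
  simp only [id_apply] at key
  refine key.mono pos! ?_ le_rfl
  rw [integral_const_mul]
  have q3 := wt_pos y
  have : 0 ≤ K * K' * N * wt y := pos!
  calc _ = (2 ^ κ * (∫ z, g z) * (S * ∫ Θ : E n, ew κ (-γ) ‖Θ‖)) * (K * K' * N * wt y) := by ring
    _ ≤ _ := by rw [mul_assoc (_ + 1)]; gcongr; linarith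

/-- Functions with integrable bounds whose Fourier transform decays. -/
lemma norm_osc_le_of_GB (P : Par n κ γ R) {f : E n → ℂ} (hf : C∞ f)
    (h : ∀ y, GB κ f y (c * wt y) (2 * (2 ^ κ * (bigK κ n * R)))) (η : E n) : ‖osc f η‖ ≤ c * oscK n κ * ew κ (-(64 * γ)) ‖η‖ := by
  have hκ := P.hκ
  have hR := P.hR
  have hK := bigK_pos κ n
  have h2 : (2 : ℝ) ≤ 2 ^ κ := by simpa using rpow_le_rpow_of_exponent_le one_le_two hκ.le
  have hc : 0 ≤ c := nonneg_of_mul_nonneg_left (h 0).nonneg (wt_pos _)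
  refine (norm_osc_le hκ.le pos! hf (integrable_wt.const_mul c) h η).trans ?_
  have hd : dec κ (2 * (2 ^ κ * (bigK κ n * R))) η ≤ ew κ (-(64 * γ)) ‖η‖ := by
    have e := exp_dec_eq (κ := κ) (γ := γ / 4) (R := 2 ^ κ * (2 ^ κ * (bigK κ n * R))) (t := ‖η‖) lin! pos! (by
      have h4 : ((2 : ℝ) ^ κ) ^ (-(1 / κ)) = 1 / 2 := by
        rw [← rpow_mul zero_le_two, mul_neg, mul_one_div_cancel lin!, Real.rpow_neg_one]; norm_num
      rw [mul_rpow pos! pos!, mul_rpow pos! pos!, h4, ← P.hγR]; ring) (norm_nonneg _)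
    rw [show -(64 * γ) = -(256 * (γ / 4)) by ring, ← e]
    exact dec_mono lin! pos! mono! η
  rw [integral_const_mul]
  have := oscK_nonneg (n := n) (κ := κ)
  calc _ = c * oscK n κ * dec κ (2 * (2 ^ κ * (bigK κ n * R))) η := by unfold oscK dec; ring
    _ ≤ _ := mono!

lemma tendsto_dOsc {ι : Type} {l : Filter ι} [l.IsCountablyGenerated] (ha : Tame κ γ R K a) {V : ι → E n → ℂ}
    (hV : ∀ᶠ i in l, Continuous (V i) ∧ ∀ z, ‖V i z‖ ≤ N * wt z) (hl : ∀ z, Tendsto (fun i => V i z) l (𝓝 (U z))) (w : E² n) :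
    Tendsto (fun i => dOsc a (V i) w) l (𝓝 (dOsc a U w)) := by
  have ca := ha.smooth.continuous
  unfold dOsc osc
  refine tendsto_integral_filter_of_dominated_convergence (fun z => K * ew κ γ ‖w.1‖ * (N * wt z)) ?_ ?_
    ((integrable_wt.const_mul N).const_mul _) ?_
  · filter_upwards [hV] with i hi
    have := hi.1
    exact ((contDiff_ec w.2).continuous.mul fun!).aestronglyMeasurable
  · filter_upwards [hV] with i hi
    refine .of_forall fun z => ?_
    rw [norm_mul, norm_ec, one_mul, norm_mul]
    have := ha.nonneg
    have := ew_pos κ γ ‖w.1‖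
    exact mul_le_mul (ha.norm_le _) (hi.2 z) (norm_nonneg _) pos!
  · exact .of_forall fun z => ((hl z).const_mul _).const_mul _

/-- Fourier inversion for functions given by their Fourier transforms. -/
lemma osc_integral_ec {G : E n → ℂ} (hG : Continuous G) (hi : Integrable G) (hi' : Integrable fun x => ∫ ζ, ec (-x) ζ * G ζ) (ζ : E n) :
    osc (fun x => ∫ ζ, ec (-x) ζ * G ζ) ζ = ((2 * Real.pi) ^ n : ℝ) * G ζ := by
  have e : osc (fun ξ => G (ζ - ξ)) = fun x => ec x ζ * ∫ ζ, ec (-x) ζ * G ζ := funext fun x => by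
    unfold osc
    rw [← integral_const_mul, ← integral_sub_left_eq_self _ volume ζ]
    refine integral_congr_ae (.of_forall fun ξ => ?_)
    simp only [sub_sub_cancel]
    rw [← mul_assoc]
    congr 1
    unfold ec
    rw [← Complex.exp_add, inner_sub_left, inner_neg_left, real_inner_comm ζ x, real_inner_comm ξ x]
    push_cast
    ring_nf
  have h := integral_osc (f := fun ξ => G (ζ - ξ)) fun! (hi.comp_sub_left ζ) (by rw [e]; exact integrable_ec_mul hi' ζ)
  rw [finrank_euclideanSpace_fin, sub_zero] at h
  rw [← h, e]
  rfl

/-- The Fourier transform of a product is a convolution. -/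
lemma integral_osc_mul_osc_sub {f g : E n → ℂ} (hf : Continuous f) (hi : Integrable f) (hi' : Integrable (osc f)) (hg : Continuous g)
    (hgi : Integrable g) (ζ : E n) : ∫ τ, osc f τ * osc g (ζ - τ) = ((2 * Real.pi) ^ n : ℝ) * osc (fun z => f z * g z) ζ := by
  have h1 : ∀ z, ∫ τ, ec (-z) τ * osc f τ = ((2 * Real.pi) ^ n : ℝ) * f z := fun z => by
    have e : osc (fun y => f (z + y)) = fun τ => ec (-z) τ * osc f τ := funext fun τ => by
      unfold osc
      rw [← integral_const_mul]
      conv_rhs => rw [← integral_add_left_eq_self _ z]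
      refine integral_congr_ae (.of_forall fun y => ?_)
      have : ec y τ = ec (-z) τ * ec (z + y) τ := by rw [← ec_add, neg_add_cancel_left]
      simp only [this]
      ring
    have h := integral_osc (f := fun y => f (z + y)) fun! (hi.comp_add_left z) (by
      rw [e]; exact (integrable_ec_mul hi' (-z)).congr (.of_forall fun τ => by simp only [ec_comm]))
    rw [finrank_euclideanSpace_fin, add_zero] at h
    rw [← h, e]
  calc ∫ τ, osc f τ * osc g (ζ - τ) = ∫ τ, ∫ z, osc f τ * (ec z (ζ - τ) * g z) := by
        refine integral_congr_ae (.of_forall fun τ => ?_)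
        simp only [integral_const_mul]; rfl
    _ = ∫ z, ∫ τ, osc f τ * (ec z (ζ - τ) * g z) := by
        refine integral_integral_swap ?_
        refine (hi'.mul_prod hgi).norm.mono' ?_ (.of_forall fun w => ?_)
        · refine hi'.aestronglyMeasurable.comp_fst.mul (Continuous.aestronglyMeasurable ?_)
          have := continuous_ec (V := E n)
          exact (this.comp (continuous_snd.prodMk (continuous_const.sub continuous_fst))).mul (hg.comp continuous_snd)
        · simp only [uncurry, norm_mul, norm_ec, one_mul, le_refl]
    _ = ∫ z, ((2 * Real.pi) ^ n : ℝ) * (ec z ζ * (f z * g z)) := by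
        refine integral_congr_ae (.of_forall fun z => ?_)
        have : ∀ τ, osc f τ * (ec z (ζ - τ) * g z) = (ec z ζ * g z) * (ec (-z) τ * osc f τ) := fun τ => by
          have : ec z (ζ - τ) = ec z ζ * ec (-z) τ := by
            unfold ec; rw [← Complex.exp_add, inner_sub_right, inner_neg_left]; push_cast; ring_nf
          rw [this]; ring
        simp only [this]
        rw [integral_const_mul, h1]; ring
    _ = _ := by rw [integral_const_mul]; rfl

end TransformedFunctions

section Composition

variable {N₁ N₂ : ℝ} {e a : E² n → ℂ} {u ϕ : E n → ℂ}

lemma integral_V2 (f : E² n → ℂ) : ∫ Y : V2 n, f (pr1 Y, pr2 Y) = ∫ w, f w :=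
  (WithLp.volume_preserving_symm_measurableEquiv_toLp_prod (E n) (E n)).integral_comp
    (MeasurableEquiv.toLp 2 (E² n)).symm.measurableEmbedding f

lemma integrable_V2 {f : E² n → ℂ} (h : Integrable fun Y : V2 n => f (pr1 Y, pr2 Y)) : Integrable f :=
  ((WithLp.volume_preserving_symm_measurableEquiv_toLp_prod (E n) (E n)).integrable_comp_emb
    (MeasurableEquiv.toLp 2 (E² n)).symm.measurableEmbedding).mp h

lemma ec_V2 (Y Θ : V2 n) : ec Y Θ = ec (pr1 Y) (pr1 Θ) * ec (pr2 Y) (pr2 Θ) := by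
  unfold ec
  rw [← Complex.exp_add, WithLp.prod_inner_apply]
  change Complex.exp (-I * ((inner ℝ (pr1 Y) (pr1 Θ) + inner ℝ (pr2 Y) (pr2 Θ) : ℝ))) = _
  push_cast
  ring_nf

lemma ew_tri (hκ : 1 ≤ κ) (hγ : 0 < γ) {z : ℝ} (hx : 0 ≤ x) (hy : 0 ≤ y) (hz : 0 ≤ z) (h : x ≤ y + z) (hs : s ≤ 3 * γ)
    (ht : t ≤ -(50 * γ)) (hr : r ≤ -(50 * γ)) : ew κ s x * (ew κ t y * ew κ r z) ≤ ew κ (-γ) x * ew κ (-γ) y := by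
  have h1 : x ^ (1 / κ) ≤ y ^ (1 / κ) + z ^ (1 / κ) := (rpow_le_rpow hx h pos!).trans (rpow_add_le' hκ hy hz)
  have hX : 0 ≤ x ^ (1 / κ) := pos!
  have hY : 0 ≤ y ^ (1 / κ) := pos!
  have hZ : 0 ≤ z ^ (1 / κ) := pos!
  unfold ew
  rw [← exp_add, ← exp_add, ← exp_add]
  refine exp_le_exp.mpr ?_
  have i1 := mul_le_mul_of_nonneg_right hs hX
  have i2 := mul_le_mul_of_nonneg_right ht hY
  have i3 := mul_le_mul_of_nonneg_right hr hZ
  have i4 := mul_le_mul_of_nonneg_left h1 hγ.le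
  have := mul_nonneg hγ.le hY
  have := mul_nonneg hγ.le hZ
  linarith

lemma norm_mul_ew {f g : ℂ} (hf : ‖f‖ ≤ A * ew κ s x) (hg : ‖g‖ ≤ B * ew κ t x) (hx : 0 ≤ x)
    (h : s + t ≤ r) : ‖f * g‖ ≤ A * B * ew κ r x := by
  have hA : 0 ≤ A := nonneg_of_mul_nonneg_left ((norm_nonneg _).trans hf) (ew_pos _ _ _)
  have hB : 0 ≤ B := nonneg_of_mul_nonneg_left ((norm_nonneg _).trans hg) (ew_pos _ _ _)
  rw [norm_mul]
  calc _ ≤ A * ew κ s x * (B * ew κ t x) := mono!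
    _ = A * B * (ew κ s x * ew κ t x) := by ring
    _ ≤ _ := by rw [ew_mul]; exact mul_le_mul_of_nonneg_left (ew_le_ew hx h) (mul_nonneg hA hB)

lemma tame_one (P : Par n κ γ R) : Tame κ γ R 1 (fun _ : E² n => (1 : ℂ)) :=
  ⟨contDiff_const, fun q => (GB_const (by linarith [P.hR]) 1 q).mono (by linarith [P.hR]) (by
    rw [norm_one, one_mul]; exact one_le_ew P.hγ.le (norm_nonneg _)) le_rfl⟩

lemma osc_eq_dOsc (u : E n → ℂ) (ξ : E n) : osc u ξ = dOsc (fun _ => 1) u (0, ξ) := by simp [dOsc]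

lemma ew_zero (hκ : 0 < κ) (c : ℝ) : ew κ c 0 = 1 := by
  unfold ew; rw [Real.zero_rpow pos!, mul_zero, exp_zero]

lemma norm_osc_nice_le (P : Par n κ γ R) (hu : Nice κ R N u) (ξ : E n) : ‖osc u ξ‖ ≤ N * oscK n κ * ew κ (-(256 * γ)) ‖ξ‖ := by
  rw [osc_eq_dOsc]
  refine (norm_dOsc_le P (tame_one P) hu _).trans (le_of_eq ?_)
  simp only [norm_zero, ew_zero (zero_lt_one.trans P.hκ)]; ring

lemma continuous_osc_nice (P : Par n κ γ R) (hu : Nice κ R N u) : Continuous (osc u) := by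
  have h := continuous_dOsc P (tame_one P) hu
  have : osc u = fun ξ => dOsc (fun _ => 1) u (0, ξ) := funext (osc_eq_dOsc u)
  rw [this]
  fun_prop

lemma integrable_of_ew (P : Par n κ γ R) {f : E n → ℂ} (hf : AEStronglyMeasurable f) (h : ∀ ξ, ‖f ξ‖ ≤ C * ew κ (-γ) ‖ξ‖) : Integrable f :=
  ((integrable_ew (zero_lt_one.trans P.hκ) P.hγ).const_mul C).mono' hf (.of_forall h)

lemma integrable_prod_of_ew (P : Par n κ γ R) {f : E² n → ℂ} (hf : AEStronglyMeasurable f (volume.prod volume))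
    (h : ∀ w, ‖f w‖ ≤ C * (ew κ (-γ) ‖w.1‖ * ew κ (-γ) ‖w.2‖)) : Integrable f (volume.prod volume) :=
  (((integrable_ew (V := E n) (zero_lt_one.trans P.hκ) P.hγ).mul_prod (integrable_ew (V := E n) (zero_lt_one.trans P.hκ) P.hγ)).const_mul C).mono' hf
    (.of_forall h)

/-- The integral of a cut-off amplitude over the frequencies. -/
lemma integral_cut_amp (F : V2 n → ℂ) (ξ : E n) (hF : ∀ Θ, F Θ = osc (fun Y : V2 n => ϕ (pr1 Y) * ϕ (pr2 Y) *
      (e (0, ξ + pr2 Θ + pr1 Θ) * p (pr1 Y, ξ + pr2 Θ) * a (pr2 Y, ξ + pr2 Θ))) Θ) (hI : Integrable F) :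
    ∫ Θ, F Θ = ∫ ζ, dOsc a ϕ (ζ, ζ - ξ) * ∫ η, e (0, η) * dOsc p ϕ (ζ, η - ζ) := by
  set H : E² n → ℂ := fun w => e (0, ξ + w.2 + w.1) * (dOsc p ϕ (ξ + w.2, w.1) * dOsc a ϕ (ξ + w.2, w.2))
  have e1 : ∀ Θ, F Θ = H (pr1 Θ, pr2 Θ) := fun Θ => by
    rw [hF]
    unfold osc
    have := integral_V2 fun w : E² n => (ec w.1 (pr1 Θ) * (p (w.1, ξ + pr2 Θ) * ϕ w.1)) *
      (ec w.2 (pr2 Θ) * (a (w.2, ξ + pr2 Θ) * ϕ w.2))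
    rw [Measure.volume_eq_prod, integral_prod_mul (fun y => ec y (pr1 Θ) * (p (y, ξ + pr2 Θ) * ϕ y))
      fun z => ec z (pr2 Θ) * (a (z, ξ + pr2 Θ) * ϕ z)] at this
    refine Eq.trans ?_ (congrArg (e (0, ξ + pr2 Θ + pr1 Θ) * ·) this)
    beta_reduce
    rw [← integral_const_mul]
    refine integral_congr_ae (.of_forall fun Y => ?_)
    simp only [ec_V2]
    ring
  have hH : Integrable H := integrable_V2 (hI.congr (.of_forall e1))
  simp only [e1]
  rw [integral_V2 H, Measure.volume_eq_prod, integral_prod_symm _ hH]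
  conv_rhs => rw [← integral_add_left_eq_self _ ξ]
  refine integral_congr_ae (.of_forall fun τ => ?_)
  simp only [add_sub_cancel_left]
  conv_rhs => rw [← integral_add_left_eq_self _ (ξ + τ)]
  rw [← integral_const_mul]
  refine integral_congr_ae (.of_forall fun θ => ?_)
  simp only [add_sub_cancel_left, H]
  ring

lemma integral_dOsc_cut (P : Par n κ γ R) (hp : Tame κ γ R K₂ p) {G : E n → ℂ} (hG : Continuous G)
    (hGb : ∀ ζ, ‖G ζ‖ ≤ C * ew κ (-(100 * γ)) ‖ζ‖) (hϕ : Nice κ R N ϕ) (η : E n) :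
    ∫ ζ, dOsc p ϕ (ζ, η - ζ) * G ζ = osc (fun y => ϕ y * ∫ ζ, ec (-y) ζ * (p (y, ζ) * G ζ)) η := by
  have cp := hp.smooth.continuous
  have cϕ := hϕ.smooth.continuous
  have ce := continuous_ec (V := E n)
  calc ∫ ζ, dOsc p ϕ (ζ, η - ζ) * G ζ = ∫ ζ, ∫ y, ec y (η - ζ) * (p (y, ζ) * ϕ y) * G ζ := by
        simp only [integral_mul_const]; rfl
    _ = ∫ y, ∫ ζ, ec y (η - ζ) * (p (y, ζ) * ϕ y) * G ζ := by
        refine integral_integral_swap ?_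
        refine (((integrable_ew (V := E n) (γ := γ) (zero_lt_one.trans P.hκ) P.hγ).const_mul (K₂ * C)).mul_prod
          (hϕ.integrable.norm)).mono' (Continuous.aestronglyMeasurable ?_) (.of_forall fun w => ?_)
        · exact ((ce.comp (continuous_snd.prodMk (continuous_const.sub continuous_fst))).mul fun!).mul fun!
        · have := norm_mul_ew (r := -γ) (hp.norm_le (w.2, w.1)) (hGb w.1) (norm_nonneg _) (by linarith [P.hγ])
          simp only [uncurry, norm_mul, norm_ec, one_mul] at this ⊢
          rw [mul_right_comm]
          exact mul_le_mul_of_nonneg_right this (norm_nonneg _)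
    _ = _ := by
        unfold osc
        refine integral_congr_ae (.of_forall fun y => ?_)
        simp only [← integral_const_mul]
        refine integral_congr_ae (.of_forall fun ζ => ?_)
        have : ec y (η - ζ) = ec y η * ec (-y) ζ := by
          unfold ec; rw [← Complex.exp_add, inner_sub_right, inner_neg_left]; push_cast; ring_nf
        simp only [this]
        ring

/-- The composition formula for the cut-off operators. -/
lemma integral_osc_mul_cut_amp (P : Par n κ γ R) (he : Tame κ γ R K₁ e) (hp : Tame κ γ R K₂ p) (ha : Tame κ γ R K₃ a)
    (hu : Nice κ R N u) (hϕ : Nice κ R N₁ ϕ) (hϕu : Nice κ R N₂ fun z => ϕ z * u z) :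
    Integrable (fun ξ => osc u ξ * ∫ ζ, dOsc a ϕ (ζ, ζ - ξ) * ∫ η, e (0, η) * dOsc p ϕ (ζ, η - ζ)) ∧
    ∫ ξ, osc u ξ * ∫ ζ, dOsc a ϕ (ζ, ζ - ξ) * ∫ η, e (0, η) * dOsc p ϕ (ζ, η - ζ) =
      ((2 * Real.pi) ^ n : ℝ) * ∫ η, e (0, η) * osc (fun y => ϕ y * tInt p a (fun z => ϕ z * u z) y) η := by
  have hκ := P.hκ
  have hγ := P.hγ
  set A := dOsc p ϕ
  set B := dOsc a ϕ
  set G : E n → ℂ := fun ζ => dOsc a (fun z => ϕ z * u z) (ζ, ζ) with hGd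
  set Q : E n → ℂ := fun ζ => ∫ η, e (0, η) * A (ζ, η - ζ) with hQ
  have ce := he.smooth.continuous
  have cA : Continuous A := continuous_dOsc P hp hϕ
  have cB : Continuous B := continuous_dOsc P ha hϕ
  have cG : Continuous G := by have := continuous_dOsc P ha hϕu; fun_prop
  have cu := continuous_osc_nice P hu
  have p1 := he.nonneg
  have p2 := hp.nonneg
  have p3 := ha.nonneg
  have p4 := hu.nonneg
  have p5 := hϕ.nonneg
  have p6 := hϕu.nonneg
  have p7 := oscK_nonneg (n := n) (κ := κ)
  set I := ∫ η : E n, ew κ (-γ) ‖η‖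
  have hI : 0 ≤ I := integral_nonneg fun _ => (ew_pos _ _ _).le
  have hA := norm_dOsc_le P hp hϕ
  have hB := norm_dOsc_le P ha hϕ
  have hu' := norm_osc_nice_le P hu
  have hG : ∀ ζ, ‖G ζ‖ ≤ K₃ * N₂ * oscK n κ * ew κ (-(255 * γ)) ‖ζ‖ := fun ζ => by
    have := norm_dOsc_le P ha hϕu (ζ, ζ)
    rw [ew_mul] at this
    refine this.trans (le_of_eq ?_)
    ring_nf
  have cF : Continuous fun w : E² n => e (0, w.2) * A (w.1, w.2 - w.1) := fun!
  have hQm : StronglyMeasurable Q := cF.stronglyMeasurable.integral_prod_right (f := fun ζ η => e (0, η) * A (ζ, η - ζ))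
  have hQb : ∀ ζ, ‖Q ζ‖ ≤ K₁ * (K₂ * N₁ * oscK n κ) * I * ew κ (2 * γ) ‖ζ‖ := fun ζ => by
    have hi : Integrable fun η : E n => K₁ * (K₂ * N₁ * oscK n κ) * ew κ (2 * γ) ‖ζ‖ * ew κ (-γ) ‖η - ζ‖ :=
      ((integrable_ew (V := E n) (κ := κ) lin! hγ).comp_sub_right ζ).const_mul _
    refine (norm_integral_le_of_norm_le hi (.of_forall fun η => ?_)).trans (le_of_eq ?_)
    · rw [norm_mul]
      have i1 := hA (ζ, η - ζ)
      have i2 := he.norm_le (0, η)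
      have i3 := ew_add_le hκ.le hγ.le ζ (η - ζ)
      rw [add_sub_cancel] at i3
      simp only at i1 i2
      calc _ ≤ K₁ * (ew κ γ ‖ζ‖ * ew κ γ ‖η - ζ‖) * (K₂ * N₁ * oscK n κ * (ew κ γ ‖ζ‖ * ew κ (-(256 * γ)) ‖η - ζ‖)) := by
            refine mul_le_mul (i2.trans mono!) i1 (norm_nonneg _) pos!
        _ = K₁ * (K₂ * N₁ * oscK n κ) * (ew κ γ ‖ζ‖ * ew κ γ ‖ζ‖) * (ew κ γ ‖η - ζ‖ * ew κ (-(256 * γ)) ‖η - ζ‖) := by ring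
        _ ≤ _ := by rw [ew_mul, ew_mul, ← two_mul]; gcongr; linarith
    · rw [integral_const_mul, integral_sub_right_eq_self (fun η : E n => ew κ (-γ) ‖η‖) ζ]; ring
  have F2 : Integrable (uncurry fun ξ ζ => osc u ξ * (B (ζ, ζ - ξ) * Q ζ)) (volume.prod volume) := by
    refine integrable_prod_of_ew P (C := N * oscK n κ * (K₃ * N₁ * oscK n κ) * (K₁ * (K₂ * N₁ * oscK n κ) * I)) ?_ fun w => ?_
    · exact (cu.comp continuous_fst).aestronglyMeasurable.mul ((show Continuous fun w : E² n => B (w.2, w.2 - w.1) by fun_prop).aestronglyMeasurable.mul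
        hQm.aestronglyMeasurable.comp_snd)
    · have i1 := hB (w.2, w.2 - w.1)
      have t := ew_tri (κ := κ) hκ.le hγ (s := 3 * γ) (t := -(256 * γ)) (r := -(256 * γ)) (norm_nonneg w.2) (norm_nonneg w.1) (norm_nonneg (w.2 - w.1))
        (by simpa using norm_add_le w.1 (w.2 - w.1)) le_rfl lin! lin!
      simp only [uncurry, norm_mul] at i1 ⊢
      calc _ ≤ N * oscK n κ * ew κ (-(256 * γ)) ‖w.1‖ * ((K₃ * N₁ * oscK n κ * (ew κ γ ‖w.2‖ * ew κ (-(256 * γ)) ‖w.2 - w.1‖)) *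
            (K₁ * (K₂ * N₁ * oscK n κ) * I * ew κ (2 * γ) ‖w.2‖)) := by
            gcongr; exacts [hu' _, hQb _]
        _ = N * oscK n κ * (K₃ * N₁ * oscK n κ) * (K₁ * (K₂ * N₁ * oscK n κ) * I) * ((ew κ γ ‖w.2‖ * ew κ (2 * γ) ‖w.2‖) *
            (ew κ (-(256 * γ)) ‖w.1‖ * ew κ (-(256 * γ)) ‖w.2 - w.1‖)) := by ring
        _ ≤ _ := by
            rw [ew_mul, show γ + 2 * γ = 3 * γ by ring, mul_comm (ew κ (-γ) ‖w.1‖)]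
            gcongr
  have F3 : Integrable (uncurry fun ζ η => e (0, η) * (A (ζ, η - ζ) * G ζ)) (volume.prod volume) := by
    refine integrable_prod_of_ew P (C := K₁ * (K₂ * N₁ * oscK n κ) * (K₃ * N₂ * oscK n κ)) ?_ fun w => ?_
    · refine Continuous.aestronglyMeasurable ?_
      simp only [uncurry_def]
      fun_prop
    · have i1 := hA (w.1, w.2 - w.1)
      have i2 := he.norm_le (0, w.2)
      have t := ew_tri (κ := κ) hκ.le hγ (s := γ) (t := -(254 * γ)) (r := -(256 * γ)) (norm_nonneg w.2) (norm_nonneg w.1) (norm_nonneg (w.2 - w.1))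
        (by simpa using norm_add_le w.1 (w.2 - w.1)) lin! lin! lin!
      simp only [uncurry, norm_mul] at i1 i2 ⊢
      calc _ ≤ K₁ * ew κ γ ‖w.2‖ * ((K₂ * N₁ * oscK n κ * (ew κ γ ‖w.1‖ * ew κ (-(256 * γ)) ‖w.2 - w.1‖)) *
            (K₃ * N₂ * oscK n κ * ew κ (-(255 * γ)) ‖w.1‖)) := by
            gcongr; exact hG _
        _ = K₁ * (K₂ * N₁ * oscK n κ) * (K₃ * N₂ * oscK n κ) * (ew κ γ ‖w.2‖ * ((ew κ γ ‖w.1‖ * ew κ (-(255 * γ)) ‖w.1‖) *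
            ew κ (-(256 * γ)) ‖w.2 - w.1‖)) := by ring
        _ ≤ _ := by
            rw [ew_mul κ γ, show γ + -(255 * γ) = -(254 * γ) by ring, mul_comm (ew κ (-γ) ‖w.1‖)]
            gcongr
  have hconv : ∀ ζ, ∫ ξ, osc u ξ * B (ζ, ζ - ξ) = ((2 * Real.pi) ^ n : ℝ) * G ζ := fun ζ => by
    have cs : C∞ fun z => a (z, ζ) := ha.smooth.comp (contDiff_id.prodMk contDiff_const)
    have ca := cs.continuous
    have cϕ := hϕ.smooth.continuous
    have h := integral_osc_mul_osc_sub (f := u) (g := fun z => a (z, ζ) * ϕ z) hu.smooth.continuous hu.integrable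
      (integrable_of_ew P cu.aestronglyMeasurable (C := N * oscK n κ) fun ξ => (hu' ξ).trans (by gcongr; linarith)) (ca.mul cϕ)
      ((integrable_wt.const_mul N₁).const_mul (K₃ * ew κ γ ‖ζ‖) |>.mono' (ca.mul cϕ).aestronglyMeasurable (.of_forall fun z => ha.norm_mul_le hϕ z ζ)) ζ
    refine h.trans ?_
    simp only [hGd, dOsc]
    congr 2
    funext z
    ring
  refine ⟨by simpa only [uncurry, integral_const_mul] using F2.integral_prod_left, ?_⟩
  calc _ = ∫ ξ, ∫ ζ, osc u ξ * (B (ζ, ζ - ξ) * Q ζ) := by simp only [integral_const_mul]; rfl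
    _ = ∫ ζ, ∫ ξ, osc u ξ * (B (ζ, ζ - ξ) * Q ζ) := integral_integral_swap F2
    _ = ∫ ζ, ((2 * Real.pi) ^ n : ℝ) * ∫ η, e (0, η) * (A (ζ, η - ζ) * G ζ) := by
        refine integral_congr_ae (.of_forall fun ζ => ?_)
        simp only [← mul_assoc]
        rw [integral_mul_const, hconv, integral_mul_const]
        ring
    _ = ((2 * Real.pi) ^ n : ℝ) * ∫ η, ∫ ζ, e (0, η) * (A (ζ, η - ζ) * G ζ) := by
        rw [integral_const_mul, integral_integral_swap F3]
    _ = _ := by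
        congr 1
        refine integral_congr_ae (.of_forall fun η => ?_)
        simp only [integral_const_mul]
        congr 1
        exact integral_dOsc_cut P hp cG (C := K₃ * N₂ * oscK n κ) (fun ζ => (hG ζ).trans (by gcongr; linarith)) hϕ η

end Composition

section Operators

variable {e a : E² n → ℂ} {u ϕ : E n → ℂ}

lemma Nice.of_half (hR : 0 ≤ R) (hu : Nice κ (R / 2) N u) : Nice κ R N u :=
  ⟨hu.smooth, fun x => (hu.bound x).mono lin! le_rfl lin!⟩

lemma Nice.mul (hκ : 1 ≤ κ) (hR : 0 ≤ R) (hu : Nice κ (R / 2) N u) (hϕ : C∞ ϕ) (hϕb : ∀ x, GB κ ϕ x C R) :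
    Nice κ R (C * N) fun z => ϕ z * u z :=
  ⟨hϕ.mul hu.smooth, fun x => ((hϕb x).mul hκ hR hϕ hu.smooth ((hu.bound x).mono lin! le_rfl lin!)).mono
    pos! (le_of_eq (by ring)) le_rfl⟩

lemma IsCutoff.nice (hR : 0 ≤ R) (hϕ : IsCutoff κ C R ϕ) (hε : 0 < ε) (hε1 : ε ≤ 1) : ∃ N, Nice κ R N fun z => ϕ (ε • z) := by
  obtain ⟨c, hc⟩ := hϕ.scale hR
  have hC := (hϕ.bound 0).nonneg
  refine ⟨C * (1 + |c / ε|) ^ (n + 1), hϕ.contDiff_scale ε, fun x => (hc ε hε hε1 x).mono hR ?_ lin!⟩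
  by_cases hx : x ∈ closedBall (0 : E n) (c / ε)
  · rw [indicator_of_mem hx, ← div_eq_mul_inv, le_div_iff₀ pos!]
    have : ‖x‖ ≤ |c / ε| := (mem_closedBall_zero_iff.mp hx).trans (le_abs_self _)
    gcongr
  · rw [indicator_of_notMem hx]; positivity

lemma norm_dOsc_diag_le (P : Par n κ γ R) (ha : Tame κ γ R K a) (hu : Nice κ R N u) (ζ : E n) :
    ‖dOsc a u (ζ, ζ)‖ ≤ K * N * oscK n κ * ew κ (-(255 * γ)) ‖ζ‖ := by
  have := norm_dOsc_le P ha hu (ζ, ζ)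
  rw [ew_mul] at this
  refine this.trans (le_of_eq ?_)
  ring_nf

lemma tInt_nice (P : Par n κ γ R) (hp : Tame κ γ R K₂ p) (ha : Tame κ γ R K₃ a) (hu : Nice κ R N u) :
    Continuous (tInt p a u) ∧ Integrable (tInt p a u) ∧ ∃ c, ∀ η, ‖osc (tInt p a u) η‖ ≤ c * ew κ (-(64 * γ)) ‖η‖ := by
  obtain ⟨C, -, hC⟩ := exists_tInt P
  obtain ⟨h1, h2⟩ := hC hp ha hu
  have hR := P.hR
  refine ⟨h1.continuous, (integrable_wt.const_mul _).mono' h1.continuous.aestronglyMeasurable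
    (.of_forall fun y => (h2 y).norm_le), _, norm_osc_le_of_GB P h1 fun y => (h2 y).mono pos! le_rfl ?_⟩
  have : 0 < 2 ^ κ * (bigK κ n * R) := pos!
  linarith

lemma continuous_osc {f : E n → ℂ} (hf : Continuous f) (hi : Integrable f) : Continuous (osc f) := by
  unfold osc
  have ce := continuous_ec (V := E n)
  refine continuous_of_dominated (bound := fun z => ‖f z‖) (fun η =>
    ((contDiff_ec η).continuous.mul hf).aestronglyMeasurable) (fun η => .of_forall fun z => by rw [norm_mul, norm_ec, one_mul]) hi.norm
    (.of_forall fun z => (ce.comp (continuous_const.prodMk continuous_id)).mul continuous_const)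

lemma tendsto_tInt (P : Par n κ γ R) (hp : Tame κ γ R K₂ p) (ha : Tame κ γ R K₃ a) {V : ℝ → E n → ℂ}
    (hV : ∀ᶠ ε in 𝓝[>] (0 : ℝ), Nice κ R N (V ε)) (hl : ∀ z, Tendsto (fun ε => V ε z) (𝓝[>] 0) (𝓝 (u z))) (y : E n) :
    Tendsto (fun ε => tInt p a (V ε) y) (𝓝[>] 0) (𝓝 (tInt p a u y)) := by
  have hκ := P.hκ
  have hγ := P.hγ
  have cp := hp.smooth.continuous
  unfold tInt
  refine tendsto_integral_filter_of_dominated_convergence (fun ζ => K₂ * (K₃ * N * oscK n κ) * ew κ (-γ) ‖ζ‖) ?_ ?_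
    ((integrable_ew lin! hγ).const_mul _) (.of_forall fun ζ => ?_)
  · filter_upwards [hV] with ε hε
    have := continuous_dOsc P ha hε
    have ce := (continuous_ec (V := E n)).comp (Continuous.prodMk_right (-y))
    exact (ce.mul fun!).aestronglyMeasurable
  · refine hV.mono fun ε hε => .of_forall fun ζ => ?_
    rw [norm_mul, norm_ec, one_mul]
    exact norm_mul_ew (hp.norm_le (y, ζ)) (norm_dOsc_diag_le P ha hε ζ) (norm_nonneg _) lin!
  · exact ((tendsto_dOsc ha (hV.mono fun ε h => ⟨h.smooth.continuous, fun z => (h.bound z).norm_le⟩) hl _).const_mul _).const_mul _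

/-- The composition formula. -/
lemma integral_osc_mul_symbol (P : Par n κ γ R) (he : Tame κ γ R K₁ e) (hp : Tame κ γ R K₂ p) (ha : Tame κ γ R K₃ a)
    (hu : Nice κ (R / 2) N u) (hϕ : IsCutoff κ C R ϕ) {I : ℝ → E n → ℂ} {S : E n → ℂ}
    (hI : ∀ ε : ℝ, 0 < ε → ε ≤ 1 → ∀ ξ, I ε ξ = ∫ ζ, dOsc a (fun z => ϕ (ε • z)) (ζ, ζ - ξ) *
      ∫ η, e (0, η) * dOsc p (fun z => ϕ (ε • z)) (ζ, η - ζ))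
    (hb : ∀ ε : ℝ, 0 < ε → ε ≤ 1 → ∀ ξ, ‖I ε ξ‖ ≤ K * ew κ (2 * γ) ‖ξ‖) (hS : ∀ ξ, Tendsto (fun ε => I ε ξ) (𝓝[>] 0) (𝓝 (S ξ))) :
    ∫ ξ, osc u ξ * S ξ = ((2 * Real.pi) ^ n : ℝ) * ∫ η, e (0, η) * osc (tInt p a u) η := by
  have hκ := P.hκ
  have hγ := P.hγ
  have hR := P.hR
  have hu' := hu.of_half hR.le
  have hev : ∀ᶠ ε in 𝓝[>] (0 : ℝ), 0 < ε ∧ ε ≤ 1 := Ioc_mem_nhdsGT zero_lt_one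
  have hN : ∀ ε : ℝ, 0 < ε → ε ≤ 1 → Nice κ R (C * N) fun z => ϕ (ε • z) * u z := fun ε h0 h1 =>
    hu.mul hκ.le hR.le (hϕ.contDiff_scale ε) (hϕ.GB_scale hR.le h0 h1)
  have key : ∀ ε : ℝ, 0 < ε → ε ≤ 1 → Integrable (fun ξ => osc u ξ * I ε ξ) ∧ ∫ ξ, osc u ξ * I ε ξ =
      ((2 * Real.pi) ^ n : ℝ) * ∫ η, e (0, η) * osc (fun y => ϕ (ε • y) * tInt p a (fun z => ϕ (ε • z) * u z) y) η := fun ε h0 h1 => by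
    obtain ⟨N₁, h2⟩ := hϕ.nice hR.le h0 h1
    simp only [hI ε h0 h1]
    exact integral_osc_mul_cut_amp P he hp ha hu' h2 (hN ε h0 h1)
  have hlϕ : ∀ z, Tendsto (fun ε : ℝ => ϕ (ε • z)) (𝓝[>] 0) (𝓝 1) := fun z => by
    have h : Continuous fun ε : ℝ => ϕ (ε • z) := hϕ.smooth.continuous.comp (continuous_id.smul continuous_const)
    have := h.tendsto 0
    rw [zero_smul, hϕ.at_zero] at this
    exact this.mono_left nhdsWithin_le_nhds
  have L1 : Tendsto (fun ε => ∫ ξ, osc u ξ * I ε ξ) (𝓝[>] 0) (𝓝 (∫ ξ, osc u ξ * S ξ)) := by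
    refine tendsto_integral_filter_of_dominated_convergence (fun ξ => N * oscK n κ * K * ew κ (-γ) ‖ξ‖) ?_ ?_
      ((integrable_ew lin! hγ).const_mul _) (.of_forall fun ξ => (hS ξ).const_mul _)
    · filter_upwards [hev] with ε hε using (key ε hε.1 hε.2).1.aestronglyMeasurable
    · exact hev.mono fun ε hε => .of_forall fun ξ =>
        norm_mul_ew (norm_osc_nice_le P hu' ξ) (hb ε hε.1 hε.2 ξ) (norm_nonneg _) lin!
  obtain ⟨c, hc, hT⟩ := exists_tInt P
  have hTε : ∀ ε : ℝ, 0 < ε → ε ≤ 1 → _ ∧ _ := fun ε h0 h1 => hT hp ha (hN ε h0 h1)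
  set c' := C * (c * (K₂ * K₃ * (C * N)))
  have hr : R ≤ 2 ^ κ * (bigK κ n * R) := by
    have := one_le_two_rpow (show 0 ≤ κ by linarith)
    have := (le_bigK (n := n) (by linarith : 0 ≤ κ)).2.1
    have : 1 ≤ 2 ^ κ * bigK κ n := by nlinarith
    nlinarith
  have hTb : ∀ ε : ℝ, 0 < ε → ε ≤ 1 → ∀ y, GB κ (fun y => ϕ (ε • y) * tInt p a (fun z => ϕ (ε • z) * u z) y) y (c' * wt y)
      (2 * (2 ^ κ * (bigK κ n * R))) := fun ε h0 h1 y =>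
    (((hϕ.GB_scale hR.le h0 h1 y).mono hR.le le_rfl hr).mul hκ.le pos! (hϕ.contDiff_scale ε) (hTε ε h0 h1).1
      ((hTε ε h0 h1).2 y)).mono pos! (le_of_eq (by simp only [c']; ring)) le_rfl
  have cs : ∀ ε : ℝ, 0 < ε → ε ≤ 1 → C∞ fun y => ϕ (ε • y) * tInt p a (fun z => ϕ (ε • z) * u z) y := fun ε h0 h1 =>
    (hϕ.contDiff_scale ε).mul (hTε ε h0 h1).1
  have L2 : Tendsto (fun ε : ℝ => ∫ η, e (0, η) * osc (fun y => ϕ (ε • y) * tInt p a (fun z => ϕ (ε • z) * u z) y) η) (𝓝[>] 0)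
      (𝓝 (∫ η, e (0, η) * osc (tInt p a u) η)) := by
    refine tendsto_integral_filter_of_dominated_convergence (fun η => K₁ * (c' * oscK n κ) * ew κ (-γ) ‖η‖) ?_ ?_
      ((integrable_ew lin! hγ).const_mul _) (.of_forall fun η => Tendsto.const_mul _ ?_)
    · filter_upwards [hev] with ε hε
      have ce := he.smooth.continuous
      have := continuous_osc (cs ε hε.1 hε.2).continuous ((integrable_wt.const_mul c').mono'
        (cs ε hε.1 hε.2).continuous.aestronglyMeasurable (.of_forall fun y => (hTb ε hε.1 hε.2 y).norm_le))
      exact (Continuous.mul fun! this).aestronglyMeasurable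
    · exact hev.mono fun ε hε => .of_forall fun η => norm_mul_ew (he.norm_le (0, η))
        (norm_osc_le_of_GB P (cs ε hε.1 hε.2) (hTb ε hε.1 hε.2) η) (norm_nonneg _) lin!
    · unfold osc
      refine tendsto_integral_filter_of_dominated_convergence (fun y => c' * wt y) ?_ ?_ (integrable_wt.const_mul _)
        (.of_forall fun y => Tendsto.const_mul _ ?_)
      · filter_upwards [hev] with ε hε using ((contDiff_ec η).continuous.mul (cs ε hε.1 hε.2).continuous).aestronglyMeasurable
      · exact hev.mono fun ε hε => .of_forall fun y => by
          rw [norm_mul, norm_ec, one_mul]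
          exact (hTb ε hε.1 hε.2 y).norm_le
      · have := (hlϕ y).mul (tendsto_tInt P hp ha (N := C * N) (u := u) (hev.mono fun ε h => hN ε h.1 h.2) (fun z => by
          simpa using (hlϕ z).mul_const (u z)) y)
        rwa [one_mul] at this
  refine tendsto_nhds_unique L1 (Tendsto.congr' ?_ (L2.const_mul _))
  filter_upwards [hev] with ε hε using ((key ε hε.1 hε.2).2).symm

end Operators

section SymbolClasses

lemma jap_le (hh : 0 ≤ h) (ξ : E n) : jap h ξ ≤ h + ‖ξ‖ :=
  Real.sqrt_le_iff.mpr ⟨pos!, by nlinarith [mul_nonneg hh (norm_nonneg ξ)]⟩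

lemma ew_jap_le (hκ : 1 ≤ κ) (hγ : 0 ≤ γ) (hh : 0 ≤ h) (ξ : E n) : ew κ γ (jap h ξ) ≤ ew κ γ h * ew κ γ ‖ξ‖ := by
  unfold ew
  rw [← exp_add, ← mul_add]
  exact exp_le_exp.mpr (mul_le_mul_of_nonneg_left ((rpow_le_rpow (sqrt_nonneg _) (jap_le hh ξ) pos!).trans
    (rpow_add_le' hκ hh (norm_nonneg _))) hγ)

lemma SymBd.GB {F : Type} [NormedAddCommGroup F] [NormedSpace ℝ F] (hR : 0 ≤ R) (hh : 1 ≤ h) {p : E² n → F}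
    (hp : SymBd κ R M m h p) (q : E² n) : GevreyConj.GB κ p q (M * jap h q.2 ^ m) R := by
  have hb := one_le_jap hh q.2
  refine GB_unscale hR hp.smooth (scl n (jap h q.2)) (scl n (jap h q.2)⁻¹) (fun z => ?_) ?_ (hp.bound q)
  · rw [scl_apply, scl_apply]
    simp [smul_smul, mul_inv_cancel₀ (by linarith : jap h q.2 ≠ 0)]
  · refine opNorm_le_bound _ zero_le_one fun z => ?_
    rw [scl_apply, one_mul, norm_def, norm_def]
    refine max_le_max le_rfl ?_
    rw [norm_smul, norm_of_nonneg pos!]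
    exact mul_le_of_le_one_left (norm_nonneg _) (inv_le_one_of_one_le₀ hb)

lemma SymBd.tame (P : Par n κ γ R) (hh : 1 ≤ h) (hp : SymBd κ R M m h p) : ∃ K, Tame κ γ R K p := by
  obtain ⟨hκ, hγ, hR, -⟩ := P
  obtain ⟨C, hC, hb⟩ := rpow_le_ew (κ := κ) lin! hγ m
  have hM : 0 ≤ M := nonneg_of_mul_nonneg_left (hp.bound 0).nonneg (rpow_pos_of_pos (zero_lt_one.trans_le (one_le_jap hh _)) _)
  refine ⟨M * (C * ew κ γ h), hp.smooth, fun q => (hp.GB hR.le hh q).mono hR.le ?_ lin!⟩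
  have := (hb _ (one_le_jap hh q.2)).trans (mul_le_mul_of_nonneg_left (ew_jap_le hκ.le hγ.le lin! q.2) hC.le)
  calc M * jap h q.2 ^ m ≤ M * (C * (ew κ γ h * ew κ γ ‖q.2‖)) := mono!
    _ = _ := by ring

lemma SymBd.tame_exp (P : Par n κ γ R) (hh : 1 ≤ h) (hρ : 0 ≤ ρ) (h2 : 2 * ρ ≤ γ) {g : E² n → ℝ} (hg : SymBd κ R ρ (1 / κ) h g) :
    ∃ K, Tame κ γ R K fun q => ((exp (g q) : ℝ) : ℂ) := by
  obtain ⟨hκ, hγ, hR, -⟩ := P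
  refine ⟨ew κ γ h, ofRealCLM.contDiff.comp (contDiff_exp.comp hg.smooth), fun q => ?_⟩
  have hb := one_le_jap hh q.2
  have h0 := hg.GB hR.le hh q
  have hJ : 0 ≤ jap h q.2 ^ (1 / κ) := pos!
  have h1 := GB.exp (m := ρ * jap h q.2 ^ (1 / κ)) hκ.le hR pos! hg.smooth fun k _ => h0 k
  refine (h1.mono pos! ?_ le_rfl).ofReal (contDiff_exp.comp hg.smooth)
  refine le_trans (exp_le_exp.mpr ?_) (ew_jap_le hκ.le hγ.le lin! q.2)
  have := (le_abs_self _).trans h0.norm_le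
  nlinarith

lemma SymBd.neg {g : E² n → ℝ} (hg : SymBd κ R M m h g) : SymBd κ R M m h fun q => -g q :=
  ⟨hg.smooth.neg, fun q k => by
    have h2 : 𝒟 k (fun u => -g (q + scl n (jap h q.2) u)) 0 =
      -𝒟 k (fun u => g (q + scl n (jap h q.2) u)) 0 := iteratedFDeriv_neg_apply (f := fun u => g (q + scl n (jap h q.2) u))
    rw [h2, norm_neg]
    exact hg.bound q k⟩

lemma Tame.translate {a : E² n → ℂ} (hR : 0 ≤ R) (ha : Tame κ γ R K a) (x : E n) : Tame κ γ R K fun q => a (x + q.1, q.2) := by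
  have e : (fun q : E² n => a (x + q.1, q.2)) = fun q => a ((x, 0) + ContinuousLinearMap.id ℝ (E² n) q) := by
    funext q; congr 1; ext <;> simp
  refine ⟨ha.smooth.comp fun!, fun q => ?_⟩
  rw [e]
  refine (GB.comp_affine (t := 1) pos! ha.smooth norm_id_le
    (ha.bound ((x, 0) + ContinuousLinearMap.id ℝ (E² n) q))).mono pos! ?_ lin!
  simp

lemma Nice.translate {u : E n → ℂ} (hR : 0 ≤ R) (hu : Nice κ R N u) (x : E n) :
    Nice κ R (N * (1 + ‖x‖) ^ (n + 1)) fun z => u (x + z) := by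
  refine ⟨hu.smooth.comp fun!, fun z => ?_⟩
  refine (GB.comp_affine (T := ContinuousLinearMap.id ℝ (E n)) (t := 1) pos! hu.smooth norm_id_le
    (hu.bound (x + z))).mono pos! ?_ lin!
  have h1 := wt_add_le z x
  have h2 := hu.nonneg
  rw [add_comm z x] at h1
  unfold wt at h1
  rw [mul_assoc]
  gcongr

lemma osc_translate (u : E n → ℂ) (x ξ : E n) : osc (fun z => u (x + z)) ξ = ec (-x) ξ * osc u ξ := by
  unfold osc
  rw [← integral_const_mul, ← integral_add_left_eq_self (μ := volume) (fun z => ec (-x) ξ * (ec z ξ * u z)) x]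
  refine integral_congr_ae (.of_forall fun z => ?_)
  simp only []
  rw [← mul_assoc, ← ec_add, neg_add_cancel_left]

lemma tInt_translate (p a : E² n → ℂ) (u : E n → ℂ) (x y : E n) :
    tInt (fun q => p (x + q.1, q.2)) (fun q => a (x + q.1, q.2)) (fun z => u (x + z)) y = tInt p a u (x + y) := by
  unfold tInt
  refine integral_congr_ae (.of_forall fun ζ => ?_)
  have : dOsc (fun q => a (x + q.1, q.2)) (fun z => u (x + z)) (ζ, ζ) = ec (-x) ζ * dOsc a u (ζ, ζ) :=
    osc_translate (fun z => a (z, ζ) * u z) x ζ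
  simp only []
  rw [this, neg_add, ec_add]
  ring

lemma chr_eq (x ξ : E n) : chr x ξ = ec (-x) ξ := by
  unfold chr ec
  simp

lemma ft_eq (u : E n → ℂ) : ft u = osc u := by
  funext ξ
  simp only [ft, osc, chr_eq, neg_neg]

lemma cst_mul_cancel (n : ℕ) : cst n * ((2 * Real.pi) ^ n : ℝ) = 1 := by
  unfold cst
  push_cast
  exact inv_mul_cancel₀ (pow_ne_zero _ (by simp [Real.pi_ne_zero]))

lemma nrm_mul_pow (n : ℕ) : nrm n * ((2 * Real.pi) ^ n : ℝ) = cst n := by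
  unfold nrm cst
  push_cast
  rw [two_mul n, pow_add, mul_inv, mul_assoc, inv_mul_cancel₀ (pow_ne_zero _ (by simp [Real.pi_ne_zero])), mul_one]

end SymbolClasses

section GelfandShilov

lemma GB_of_mderiv (hκ : 0 ≤ κ) (hA : 0 ≤ A) (hB : 0 ≤ B) {u : E n → ℂ} (hu : C∞ u) {x : E n}
    (h : ∀ α : MIdx n, ‖mderiv α u x‖ ≤ B * A ^ len α * mfact α ^ κ) : GB κ u x B ((2 * n + 1) * A) := by
  have hf : C∞ fun q : E² n => u (fst ℝ (E n) (E n) q) := hu.comp (ContinuousLinearMap.contDiff _)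
  have key : GB κ (fun q : E² n => u (fst ℝ (E n) (E n) q)) ((0 : E² n) + inl ℝ (E n) (E n) x) B ((2 * n + 1) * A) := by
    refine GB_of_mdd hκ hA hB hf fun α β => ?_
    have h1 : mdd ex β (fun q : E² n => u (fst ℝ (E n) (E n) q)) =
        fun q => mderiv β u (fst ℝ (E n) (E n) q) := mdd_comp_linear hu _ _ _
    have h2 := mdd_comp_linear (f := mderiv β u) (contDiff_mdd _ β hu) (fst ℝ (E n) (E n)) eξ α
    have h3 : (fun i => fst ℝ (E n) (E n) (eξ i)) = fun i : Fin n => (0 : ℝ) • (single i 1 : E n) := by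
      funext i; simp [eξ]
    have h4 := mdd_smul_dir 0 (fun i : Fin n => (single i 1 : E n)) α (f := mderiv β u) (contDiff_mdd _ β hu)
    rw [h1, h2, h3, h4]
    have hr : 0 ≤ B * A ^ (len α + len β) * mfact α ^ κ * mfact β ^ κ := by
      have := mfact_pos α; have := mfact_pos β; positivity
    rcases Nat.eq_zero_or_pos (len α) with h0 | h0
    · have : α = 0 := by
        funext i; exact (Finset.sum_eq_zero_iff.mp h0) i (mem_univ i)
      subst this
      simpa [len_zero, mfact_zero, mdd_zero] using h β
    · simpa [zero_pow h0.ne'] using hr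
  have := GB.comp_affine (t := 1) pos! hf (ContinuousLinearMap.norm_inl_le_one ℝ (E n) (E n)) key
  rw [one_mul] at this
  simpa using this

lemma one_add_norm_pow_le (x : E n) : (1 + ‖x‖) ^ (n + 1) ≤ 2 ^ n * (1 + (n : ℝ) ^ n * ∑ i, |x i| ^ (n + 1)) := by
  have h1 : ‖x‖ ≤ ∑ i, |x i| := by
    rw [EuclideanSpace.norm_eq]
    refine Real.sqrt_le_iff.mpr ⟨pos!, ?_⟩
    simpa only [norm_eq_abs] using Finset.sum_sq_le_sq_sum_of_nonneg fun i _ => abs_nonneg (x i)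
  have h2 : (1 + ‖x‖) ^ (n + 1) ≤ 2 ^ n * (1 ^ (n + 1) + ‖x‖ ^ (n + 1)) := add_pow_le zero_le_one (norm_nonneg _) _
  have h3 : (∑ i, |x i|) ^ (n + 1) ≤ (n : ℝ) ^ n * ∑ i, |x i| ^ (n + 1) := by
    have := pow_sum_div_card_le_sum_pow (s := univ) (f := fun i => |x i|) (fun i _ => abs_nonneg _) n
    rw [card_univ, card_fin] at this
    rcases Nat.eq_zero_or_pos n with h0 | h0
    · subst h0; simp
    · rwa [div_le_iff₀' pos!] at this
  rw [one_pow] at h2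
  have h4 : ‖x‖ ^ (n + 1) ≤ (∑ i, |x i|) ^ (n + 1) := mono!
  refine h2.trans ?_
  gcongr
  exact h4.trans h3

lemma IsSigma.nice (hκ : 0 ≤ κ) (hR : 0 < R) {u : E n → ℂ} (hu : IsSigma κ u) : ∃ N, Nice κ (R / 2) N u := by
  set A := R / (2 * n + 1)
  have hA : 0 < A := pos!
  obtain ⟨C, hC⟩ := hu.2 A hA
  have m0 : ∀ x : E n, monom 0 x = 1 := fun x => by simp [monom]
  have hC0 : 0 ≤ C := by
    have := hC 0 0 0
    simp only [m0, len_zero, mfact_zero, abs_one, one_mul, add_zero, pow_zero, one_rpow, mul_one] at this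
    exact (norm_nonneg _).trans this
  obtain ⟨D, hD⟩ : ∃ D, D = C * A ^ (n + 1) * ((n + 1)! : ℝ) ^ κ := ⟨_, rfl⟩
  have hD0 : 0 ≤ D := by rw [hD]; positivity
  refine ⟨2 ^ n * (C + (n : ℝ) ^ n * (n * D)), hu.1, fun x => ?_⟩
  have hr : (2 * (R / 2)) = (2 * n + 1) * A := by simp only [A]; field_simp
  rw [hr]
  refine GB_of_mderiv hκ hA.le pos! hu.1 fun α => ?_
  have hm := mfact_pos α
  have b0 : ‖mderiv α u x‖ ≤ C * (A ^ len α * mfact α ^ κ) := by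
    have := hC α 0 x
    simpa [m0, len_zero, mfact_zero, mul_assoc] using this
  have b1 : ∀ i, |x i| ^ (n + 1) * ‖mderiv α u x‖ ≤ D * (A ^ len α * mfact α ^ κ) := fun i => by
    have := hC α (Pi.single i (n + 1)) x
    have e1 : monom (Pi.single i (n + 1)) x = x i ^ (n + 1) := by
      unfold monom
      rw [Finset.prod_eq_single i (fun j _ hj => by simp [Pi.single_eq_of_ne hj]) (by simp), Pi.single_eq_same]
    have e2 : len (Pi.single i (n + 1) : MIdx n) = n + 1 := by
      unfold len
      rw [Finset.sum_eq_single i (fun j _ hj => Pi.single_eq_of_ne hj _) (by simp), Pi.single_eq_same]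
    have e3 : mfact (Pi.single i (n + 1) : MIdx n) = ((n + 1)! : ℝ) := by
      unfold mfact
      rw [Finset.prod_eq_single i (fun j _ hj => ?_) (by simp), Pi.single_eq_same]
      rw [Pi.single_eq_of_ne hj, Nat.factorial_zero, cast_one]
    rw [e1, e2, e3, abs_pow] at this
    refine this.trans (le_of_eq ?_)
    rw [hD]; ring
  have key : (1 + ‖x‖) ^ (n + 1) * ‖mderiv α u x‖ ≤ 2 ^ n * (C + (n : ℝ) ^ n * (n * D)) * (A ^ len α * mfact α ^ κ) := by
    calc _ ≤ 2 ^ n * (1 + (n : ℝ) ^ n * ∑ i, |x i| ^ (n + 1)) * ‖mderiv α u x‖ := by gcongr; exact one_add_norm_pow_le x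
      _ = 2 ^ n * (‖mderiv α u x‖ + (n : ℝ) ^ n * ∑ i, |x i| ^ (n + 1) * ‖mderiv α u x‖) := by rw [← sum_mul]; ring
      _ ≤ 2 ^ n * (C * (A ^ len α * mfact α ^ κ) + (n : ℝ) ^ n * ∑ _i : Fin n, D * (A ^ len α * mfact α ^ κ)) := by
          exact mul_le_mul_of_nonneg_left (add_le_add b0 (mul_le_mul_of_nonneg_left (sum_le_sum fun i _ => b1 i) pos!)) pos!
      _ = _ := by rw [sum_const, card_univ, card_fin, nsmul_eq_mul]; ring
  have hw : (0 : ℝ) < (1 + ‖x‖) ^ (n + 1) := pos!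
  rw [mul_assoc, mul_right_comm, ← div_eq_mul_inv, le_div_iff₀ hw]
  linarith

end GelfandShilov

section Adjoint

variable {e a : E² n → ℂ} {u : E n → ℂ}

lemma IsGelfandShilov₂.GB {χ : E n → E n → ℂ} (hκ : 0 ≤ κ) (hχ : IsGelfandShilov₂ κ χ) :
    ∃ C r : ℝ, 0 ≤ C ∧ 0 < r ∧ ∀ q, GevreyConj.GB κ (unc χ) q C r := by
  obtain ⟨hs, A, hA, C, hC⟩ := hχ
  have m0 : ∀ x : E n, monom 0 x = 1 := fun x => by simp [monom]
  refine ⟨max C 0, (2 * n + 1) * A, le_max_right _ _, pos!, fun q => GB_of_mdd hκ hA.le (le_max_right _ _) hs fun α β => ?_⟩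
  have := hC α β 0 0 q.1 q.2
  rw [dξ_dx_eq hs] at this
  have h1 := mfact_pos α
  have h2 := mfact_pos β
  simp only [m0, len_zero, mfact_zero, abs_one, one_mul, mul_one, add_zero, one_rpow] at this
  refine this.trans ?_
  gcongr
  exact le_max_left _ _

lemma GB_scaled_cutoff {χ : E² n → ℂ} (hχ : C∞ χ) (hr : 0 < r) (h : ∀ q, GB κ χ q C r)
    (hε : 0 < ε) (hεr : ε * r ≤ R) (ξ z : E n) : GB κ (fun y => χ (ε • y, ξ)) z C R := by
  have h1 : ‖ε • inl ℝ (E n) (E n)‖ ≤ ε := by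
    rw [norm_smul, norm_of_nonneg hε.le]
    exact mul_le_of_le_one_right hε.le (ContinuousLinearMap.norm_inl_le_one ℝ (E n) (E n))
  have e1 : (fun y => χ (ε • y, ξ)) = fun y => χ ((0, ξ) + (ε • inl ℝ (E n) (E n)) y) := by
    funext y; congr 1; ext <;> simp
  rw [e1]
  exact (GB.comp_affine (t := ε) hr.le hχ h1 (h _)).mono pos! le_rfl hεr

/-- The adjoint operator. -/
lemma isAdjOp_tInt (P : Par n κ γ R) {Λ : E n → E n → ℝ} (ha : Tame κ γ R K fun q => ((exp (-unc Λ q) : ℝ) : ℂ))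
    (hu : Nice κ (R / 2) N u) :
    IsAdjOp κ (expSym (-Λ)) u fun x => cst n * tInt (fun _ => 1) (fun q => ((exp (-unc Λ q) : ℝ) : ℂ)) u x := by
  intro χ hχ hχ0 x
  have hκ := P.hκ
  have hγ := P.hγ
  have hR := P.hR
  obtain ⟨C, r, hC, hr, hb⟩ := hχ.GB lin!
  have hs : C∞ (unc χ) := hχ.1
  set a : E² n → ℂ := fun q => ((exp (-unc Λ q) : ℝ) : ℂ) with ha'
  set U : ℝ → E n → E n → ℂ := fun ε ξ y => unc χ (ε • y, ε • ξ) * u y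
  have hev : ∀ᶠ ε in 𝓝[>] (0 : ℝ), 0 < ε ∧ ε * r ≤ R :=
    Eventually.mono (Ioc_mem_nhdsGT (div_pos hR hr)) fun ε h => ⟨h.1, (le_div_iff₀ hr).mp h.2⟩
  have hU : ∀ ε : ℝ, 0 < ε → ε * r ≤ R → ∀ ξ, Nice κ R (C * N) (U ε ξ) := fun ε h0 h1 ξ =>
    hu.mul hκ.le hR.le (hs.comp fun!) (GB_scaled_cutoff hs hr hb h0 h1 _)
  have e1 : ∀ ε ξ y, adjIntegrand (expSym (-Λ)) χ u ε x y ξ = ec (-x) ξ * (ec y ξ * (a (y, ξ) * U ε ξ y)) := fun ε ξ y => by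
    simp only [adjIntegrand, chr_eq, neg_sub, sub_eq_neg_add y x, ec_add, expSym, unc, U, ha', Pi.neg_apply]
    ring
  have e2 : ∀ ε ξ, ∫ y, adjIntegrand (expSym (-Λ)) χ u ε x y ξ = ec (-x) ξ * dOsc a (U ε ξ) (ξ, ξ) := fun ε ξ => by
    simp only [e1, integral_const_mul]
    rfl
  have ca := ha.smooth.continuous
  have cu := hu.smooth.continuous
  have cs := hs.continuous
  have ce := continuous_ec (V := E n)
  have cx : Continuous fun ξ => ec (-x) ξ := ce.comp (Continuous.prodMk_right (-x))
  have hm : ∀ ε, StronglyMeasurable fun ξ => ec (-x) ξ * dOsc a (U ε ξ) (ξ, ξ) := fun ε => by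
    refine cx.stronglyMeasurable.mul ?_
    have : Continuous fun w : E² n => ec w.2 w.1 * (a (w.2, w.1) * (unc χ (ε • w.2, ε • w.1) * u w.2)) :=
      (ce.comp (continuous_snd.prodMk continuous_fst)).mul fun!
    exact this.stronglyMeasurable.integral_prod_right
  have hB : ∀ ε : ℝ, 0 < ε → ε * r ≤ R → ∀ ξ, ‖ec (-x) ξ * dOsc a (U ε ξ) (ξ, ξ)‖ ≤ K * (C * N) * oscK n κ * ew κ (-γ) ‖ξ‖ :=
    fun ε h0 h1 ξ => by
      have q0 := ha.nonneg
      have q1 := (hU ε h0 h1 0).nonneg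
      have q2 := oscK_nonneg (n := n) (κ := κ)
      rw [norm_mul, norm_ec, one_mul]
      refine (norm_dOsc_diag_le P ha (hU ε h0 h1 ξ) ξ).trans ?_
      gcongr
      linarith
  refine ⟨?_, Tendsto.const_mul _ ?_⟩
  · filter_upwards [hev] with ε hε
    refine ⟨fun ξ => ?_, ?_⟩
    · simp only [e1]
      refine Integrable.const_mul (integrable_ec_mul (f := fun y => a (y, ξ) * U ε ξ y) ?_ ξ |>.congr ?_) _
      · exact (integrable_wt.const_mul (K * ew κ γ ‖ξ‖ * (C * N))).mono' fun! (.of_forall fun y =>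
          (ha.norm_mul_le (hU ε hε.1 hε.2 ξ) y ξ).trans (le_of_eq (by ring)))
      · exact .of_forall fun y => rfl
    · simp only [e2]
      exact integrable_of_ew P (hm ε).aestronglyMeasurable (hB ε hε.1 hε.2)
  · simp only [e2]
    refine tendsto_integral_filter_of_dominated_convergence (fun ξ => K * (C * N) * oscK n κ * ew κ (-γ) ‖ξ‖) ?_ ?_
      ((integrable_ew lin! hγ).const_mul _) (.of_forall fun ξ => Tendsto.const_mul _ ?_)
    · exact .of_forall fun ε => (hm ε).aestronglyMeasurable
    · filter_upwards [hev] with ε hε using .of_forall (hB ε hε.1 hε.2)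
    · rw [one_mul]
      refine tendsto_dOsc (N := C * N) ha (hev.mono fun ε hε => ⟨(hU ε hε.1 hε.2 ξ).smooth.continuous, fun z =>
        ((hU ε hε.1 hε.2 ξ).bound z).norm_le⟩) (fun z => ?_) _
      have h : Continuous fun ε : ℝ => unc χ (ε • z, ε • ξ) * u z := fun!
      have := h.tendsto 0
      simp only [zero_smul] at this
      rw [show unc χ ((0 : E n), (0 : E n)) = 1 from hχ0, one_mul] at this
      exact this.mono_left nhdsWithin_le_nhds

lemma continuous_chr (x : E n) : Continuous (chr x) := by
  simp only [funext (chr_eq x)]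
  exact (continuous_ec (V := E n)).comp (Continuous.prodMk_right (-x))

/-- Operators with symbols of exponential type. -/
lemma isOp_of_bound (P : Par n κ γ R) (hu : Nice κ R N u) {s : E n → E n → ℂ} (hc : ∀ x, Continuous (s x))
    (hb : ∀ x, ∃ C, ∀ ξ, ‖s x ξ‖ ≤ C * ew κ (2 * γ) ‖ξ‖) : IsOp s u fun x => cst n * ∫ ξ, chr x ξ * s x ξ * ft u ξ := by
  refine ⟨hu.integrable, fun x => ⟨?_, rfl⟩⟩
  obtain ⟨C, hC⟩ := hb x
  have hγ := P.hγ
  have ce := continuous_chr x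
  rw [ft_eq]
  refine integrable_of_ew P (C := C * (N * oscK n κ)) ((ce.mul (hc x)).mul (continuous_osc_nice P hu)).aestronglyMeasurable fun ξ => ?_
  rw [mul_assoc, norm_mul, chr_eq, norm_ec, one_mul]
  exact norm_mul_ew (hC ξ) (norm_osc_nice_le P hu ξ) (norm_nonneg _) lin!

lemma osc_const_mul (c : ℂ) (f : E n → ℂ) (η : E n) : osc (fun y => c * f y) η = c * osc f η := by
  unfold osc
  rw [← integral_const_mul]
  exact integral_congr_ae (.of_forall fun y => by simp only []; ring)

lemma ft_adjoint (P : Par n κ γ R) (ha : Tame κ γ R K a) (hu : Nice κ R N u) (ζ : E n) :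
    ft (fun x => cst n * tInt (fun _ => 1) a u x) ζ = dOsc a u (ζ, ζ) := by
  have hc : Continuous fun ζ => dOsc a u (ζ, ζ) := (continuous_dOsc P ha hu).comp (continuous_id.prodMk continuous_id)
  have hκ := P.hκ
  have hγ := P.hγ
  have h1 : tInt (fun _ => 1) a u = fun x => ∫ ζ, ec (-x) ζ * dOsc a u (ζ, ζ) := by
    funext x; simp only [tInt, one_mul]
  have hi := (tInt_nice P (tame_one P) ha hu).2.1
  have h2 : Integrable fun ζ => dOsc a u (ζ, ζ) := by
    refine integrable_of_ew P (C := K * N * oscK n κ) hc.aestronglyMeasurable fun ξ => (norm_dOsc_diag_le P ha hu ξ).trans ?_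
    have q0 := ha.nonneg
    have q1 := hu.nonneg
    have q2 := oscK_nonneg (n := n) (κ := κ)
    gcongr
    linarith
  rw [ft_eq, osc_const_mul, h1, osc_integral_ec hc h2 (by rwa [h1] at hi), ← mul_assoc, cst_mul_cancel, one_mul]

lemma isOp_adjoint (P : Par n κ γ R) (hp : Tame κ γ R K₂ p) (ha : Tame κ γ R K a) (hu : Nice κ R N u) :
    IsOp (fun x ξ => p (x, ξ)) (fun x => cst n * tInt (fun _ => 1) a u x) (fun x => cst n * tInt p a u x) := by
  have hc : Continuous fun ζ => dOsc a u (ζ, ζ) := (continuous_dOsc P ha hu).comp (continuous_id.prodMk continuous_id)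
  have cp := hp.smooth.continuous
  have hγ := P.hγ
  refine ⟨(tInt_nice P (tame_one P) ha hu).2.1.const_mul _, fun x => ?_⟩
  have e : (fun ξ => chr x ξ * p (x, ξ) * ft (fun x => cst n * tInt (fun _ => 1) a u x) ξ) =
      fun ξ => ec (-x) ξ * (p (x, ξ) * dOsc a u (ξ, ξ)) := by
    funext ξ; rw [ft_adjoint P ha hu, chr_eq, mul_assoc]
  rw [e]
  refine ⟨?_, rfl⟩
  have ce := (continuous_ec (V := E n)).comp (Continuous.prodMk_right (-x))
  refine integrable_of_ew P (C := K₂ * (K * N * oscK n κ)) (ce.mul fun!).aestronglyMeasurable fun ξ => ?_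
  rw [norm_mul, norm_ec, one_mul]
  exact norm_mul_ew (hp.norm_le (x, ξ)) (norm_dOsc_diag_le P ha hu ξ) (norm_nonneg _) lin!

lemma integrable_outer (P : Par n κ γ R) (he : Tame κ γ R K₁ e) (hp : Tame κ γ R K₂ p) (ha : Tame κ γ R K a) (hu : Nice κ R N u)
    (x : E n) : Integrable fun ξ => chr x ξ * e (x, ξ) * ft (fun x => cst n * tInt p a u x) ξ := by
  obtain ⟨hc, hi, c, hb⟩ := tInt_nice P hp ha hu
  have ce := he.smooth.continuous
  have hγ := P.hγ
  have cx := continuous_chr x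
  have := continuous_osc hc hi
  simp only [ft_eq, osc_const_mul]
  refine integrable_of_ew P (C := K₁ * (‖cst n‖ * c)) (Continuous.mul fun! fun!).aestronglyMeasurable fun ξ => ?_
  rw [mul_assoc, norm_mul, chr_eq, norm_ec, one_mul]
  refine norm_mul_ew (t := -(64 * γ)) (he.norm_le (x, ξ)) ?_ (norm_nonneg _) lin!
  rw [norm_mul, mul_assoc]
  exact mul_le_mul_of_nonneg_left (hb ξ) (norm_nonneg _)

end Adjoint

section Conjugation

variable {u : E n → ℂ} {ψ : V2 n → ℂ} {X : V2 n × E n → ℂ}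

lemma exists_product_cutoff (n : ℕ) (hκ : 1 < κ) (hR : 0 < R) : ∃ (C C' : ℝ) (ϕ : E n → ℂ), IsCutoff κ C R ϕ ∧
    IsCutoff κ C' (48 * R) (fun Y : V2 n => ϕ (pr1 Y) * ϕ (pr2 Y)) ∧ ∀ᶠ Y : V2 n in 𝓝 0, ϕ (pr1 Y) * ϕ (pr2 Y) = 1 := by
  obtain ⟨C, ϕ, hϕ, h1, h0⟩ := exists_cutoff (E n) hκ hR
  have n1 := opNorm_le_bound (pr1 : V2 n →L[ℝ] E n) zero_le_one fun Y => (norm_pr1_le Y).trans_eq (one_mul _).symm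
  have n2 := opNorm_le_bound (pr2 : V2 n →L[ℝ] E n) zero_le_one fun Y => (norm_pr2_le Y).trans_eq (one_mul _).symm
  have s1 : C∞ fun Y : V2 n => ϕ (pr1 Y) := hϕ.smooth.comp pr1.contDiff
  have s2 : C∞ fun Y : V2 n => ϕ (pr2 Y) := hϕ.smooth.comp pr2.contDiff
  refine ⟨C, C * C, ϕ, hϕ, ⟨s1.mul s2, fun Y => ?_, ⟨2, fun Y hY => ?_⟩, ?_⟩, ?_⟩
  · have b1 := GB.comp_clm hR.le hϕ.smooth n1 (hϕ.bound (pr1 Y))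
    have b2 := GB.comp_clm hR.le hϕ.smooth n2 (hϕ.bound (pr2 Y))
    rw [one_mul] at b1 b2
    exact (b1.mul hκ.le hR.le s1 s2 b2).mono pos! le_rfl lin!
  · have : ‖Y‖ ^ 2 = ‖pr1 Y‖ ^ 2 + ‖pr2 Y‖ ^ 2 := WithLp.prod_norm_sq_eq_of_L2 Y
    rcases le_or_gt 1 ‖pr1 Y‖ with h | h
    · rw [h0 _ h, zero_mul]
    · rcases le_or_gt 1 ‖pr2 Y‖ with h' | h'
      · rw [h0 _ h', mul_zero]
      · nlinarith [norm_nonneg (pr1 Y), norm_nonneg (pr2 Y)]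
  · simp [hϕ.at_zero]
  · filter_upwards [Metric.ball_mem_nhds (0 : V2 n) (show (0 : ℝ) < 1 / 2 by norm_num)] with Y hY
    rw [mem_ball_zero_iff] at hY
    have i1 := norm_pr1_le Y
    have i2 := norm_pr2_le Y
    rw [h1 _ (by nlinarith [norm_nonneg (pr1 Y)]), h1 _ (by nlinarith [norm_nonneg (pr2 Y)]), one_mul]

lemma Data.tame (P : Par n κ γ R) (D : Data κ γ R ρ M m h Λ p) : ∃ K₁ K₂ K₃,
    Tame κ γ R K₁ (fun q => ((exp (Λ q) : ℝ) : ℂ)) ∧ Tame κ γ R K₂ p ∧ Tame κ γ R K₃ fun q => ((exp (-Λ q) : ℝ) : ℂ) := by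
  have h : 2 * ρ ≤ γ := by nlinarith [D.small, D.hρ, mul_nonneg (Nat.cast_nonneg (α := ℝ) n) D.hρ]
  obtain ⟨K₁, he⟩ := D.phase.sym.tame_exp P D.hh D.hρ h
  obtain ⟨K₃, ha⟩ := D.phase.sym.neg.tame_exp P D.hh D.hρ h
  obtain ⟨K₂, hp⟩ := D.sym.tame P D.hh
  exact ⟨K₁, K₂, K₃, he, hp, ha⟩

/-- The composition formula for the oscillatory integral of the amplitude. -/
lemma integral_compSym (P : Par n κ γ R) (D : Data κ γ R ρ M m h Λ p) (hC : 0 ≤ C)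
    (hc : Cuts n κ R C h ψ X) (hu : Nice κ (R / 2) N u) (x : E n) :
    cst n * ∫ ξ, chr x ξ * compSym R ψ X Λ p (x, ξ) * ft u ξ = cst n * ∫ η, chr x η * ((exp (Λ (x, η)) : ℝ) : ℂ) *
      ft (fun x => cst n * tInt p (fun q => ((exp (-Λ q) : ℝ) : ℂ)) u x) η := by
  have hκ := P.hκ
  have hγ := P.hγ
  have hR := P.hR
  obtain ⟨K₁, K₂, K₃, he, hp, ha⟩ := D.tame P
  obtain ⟨C₁, C₂, ϕ, hϕ, hχ, hχ1⟩ := exists_product_cutoff n hκ hR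
  obtain ⟨K, hK⟩ := tendsto_cutInt_amp P.hγR hχ hχ1 D hC hc
  obtain ⟨C₃, -, hC₃⟩ := GB_amp_frozen hκ hγ m n
  have key := integral_osc_mul_symbol P (he.translate hR.le x) (hp.translate hR.le x) (ha.translate hR.le x)
    (hu.translate (by linarith : 0 ≤ R / 2) x) hϕ (K := K * ew κ (2 * γ) h)
    (I := fun ε ξ => cutInt (fun Y : V2 n => ϕ (pr1 Y) * ϕ (pr2 Y)) (amp Λ p) (x, ξ) ε) (fun ε h0 h1 ξ => ?_) (fun ε h0 h1 ξ => ?_)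
    fun ξ => (hK (x, ξ)).2
  · have l1 : ∫ ξ, chr x ξ * compSym R ψ X Λ p (x, ξ) * ft u ξ = nrm n * ∫ ξ, osc (fun z => u (x + z)) ξ *
        (nearInt ψ X Λ p (x, ξ) + midInt ψ X Λ p (x, ξ) + farInt R X Λ p (x, ξ)) := by
      rw [← integral_const_mul]
      refine integral_congr_ae (.of_forall fun ξ => ?_)
      simp only [compSym, chr_eq, ft_eq, osc_translate]
      ring
    have l2 : ∫ η, chr x η * ((exp (Λ (x, η)) : ℝ) : ℂ) * ft (fun x => cst n * tInt p (fun q => ((exp (-Λ q) : ℝ) : ℂ)) u x) η =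
        cst n * ∫ η, ((exp (Λ (x + 0, η)) : ℝ) : ℂ) * osc (tInt (fun q => p (x + q.1, q.2))
          (fun q => ((exp (-Λ (x + q.1, q.2)) : ℝ) : ℂ)) fun z => u (x + z)) η := by
      rw [← integral_const_mul]
      refine integral_congr_ae (.of_forall fun η => ?_)
      have : tInt (fun q => p (x + q.1, q.2)) (fun q => ((exp (-Λ (x + q.1, q.2)) : ℝ) : ℂ)) (fun z => u (x + z)) =
          fun y => tInt p (fun q => ((exp (-Λ q) : ℝ) : ℂ)) u (x + y) :=
        funext fun y => tInt_translate p (fun q => ((exp (-Λ q) : ℝ) : ℂ)) u x y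
      simp only [this, osc_translate, chr_eq, ft_eq, osc_const_mul, add_zero]
      ring
    rw [l1, l2, key, ← mul_assoc (nrm n), nrm_mul_pow]
  · have hi := integrable_cutInt hκ hγ hR P.hγR hχ D.contDiff_amp (q := (x, ξ))
      (fun Y Θ => (hC₃ D (x, ξ) Y Θ).mono pos! le_rfl lin!) h0 h1
    refine integral_cut_amp (e := fun q => ((exp (Λ (x + q.1, q.2)) : ℝ) : ℂ)) (p := fun q => p (x + q.1, q.2))
      (a := fun q => ((exp (-Λ (x + q.1, q.2)) : ℝ) : ℂ)) (ϕ := fun z => ϕ (ε • z)) _ ξ (fun Θ => ?_) hi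
    refine congrArg (fun f => osc f Θ) (funext fun Y => ?_)
    simp only [amp, pathL_apply, shiftL_apply, sub_eq_add_neg, exp_add, map_smul, zero_smul, one_smul, add_zero]
    push_cast
    ring
  · refine ((hK (x, ξ)).1 ε h0 h1).trans ?_
    have hK0 : 0 ≤ K := nonneg_of_mul_nonneg_left ((norm_nonneg _).trans ((hK (x, ξ)).1 ε h0 h1)) (ew_pos _ _ _)
    rw [mul_assoc]
    exact mul_le_mul_of_nonneg_left (ew_jap_le hκ.le pos! (by linarith [D.hh]) ξ) hK0

lemma norm_compSym_le (P : Par n κ γ R) (D : Data κ γ R ρ M m h Λ p) (hC : 0 ≤ C)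
    (hc : Cuts n κ R C h ψ X) : ∃ K, ∀ q, ‖compSym R ψ X Λ p q‖ ≤ K * ew κ (2 * γ) ‖q.2‖ := by
  have hκ := P.hκ
  have hγ := P.hγ
  have hR := P.hR
  obtain ⟨C₁, C₂, ϕ, hϕ, hχ, hχ1⟩ := exists_product_cutoff n hκ hR
  obtain ⟨K, hK⟩ := tendsto_cutInt_amp P.hγR hχ hχ1 D hC hc
  refine ⟨K * ew κ (2 * γ) h, fun q => ?_⟩
  obtain ⟨hb, ht⟩ := hK q
  have h1 := le_of_tendsto ht.norm (by
    filter_upwards [Ioc_mem_nhdsGT zero_lt_one] with ε h using hb ε h.1 h.2)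
  have hK0 : 0 ≤ K := nonneg_of_mul_nonneg_left ((norm_nonneg _).trans h1) (ew_pos _ _ _)
  rw [compSym, norm_mul]
  refine (mul_le_of_le_one_left (norm_nonneg _) (norm_nrm_le n)).trans (h1.trans ?_)
  rw [mul_assoc]
  exact mul_le_mul_of_nonneg_left (ew_jap_le hκ.le pos! (by linarith [D.hh]) q.2) hK0

lemma continuous_expansion {Λ : E n → E n → ℝ} {p : E n → E n → ℂ} (hΛ : C∞ (unc Λ)) (hp : C∞ (unc p)) (k : ℕ)
    (x : E n) : Continuous (expansion Λ p (k + 1) x) := by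
  have : expansion Λ p (k + 1) x = fun ξ => ∑ j ∈ range (k + 1), (j ! : ℂ)⁻¹ *
      (dmix (eB n))^[j] (amp (unc Λ) (unc p)) (0, 0, (x, ξ)) - unc p (x, ξ) := by
    funext ξ
    rw [sum_dmix_eq hΛ hp k (x, ξ)]
    exact (add_sub_cancel_left _ _).symm
  rw [this]
  refine (continuous_finsetSum _ fun j _ => continuous_const.mul ?_).sub (hp.continuous.comp (Continuous.prodMk_right x))
  have h1 : Continuous fun ξ : E n => ((0, 0, (x, ξ)) : Z3 n) := fun!
  exact Continuous.comp (g := (dmix (eB n))^[j] (amp (unc Λ) (unc p)))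
    (contDiff_dmix_iterate (eB n) (contDiff_amp hΛ hp) j).continuous h1

lemma integral_add₄ {f₀ f₁ f₂ f₃ : E n → ℂ} (h₀ : Integrable f₀) (h₁ : Integrable f₁) (h₂ : Integrable f₂) (h₃ : Integrable f₃) :
    ∫ ξ, f₀ ξ + f₁ ξ + f₂ ξ + f₃ ξ = (∫ ξ, f₀ ξ) + (∫ ξ, f₁ ξ) + (∫ ξ, f₂ ξ) + ∫ ξ, f₃ ξ := by
  have h₀₁ : Integrable fun ξ => f₀ ξ + f₁ ξ := h₀.add h₁
  have h₀₂ : Integrable fun ξ => f₀ ξ + f₁ ξ + f₂ ξ := h₀₁.add h₂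
  rw [integral_add h₀₂ h₃, integral_add h₀₁ h₂, integral_add h₀ h₁]

/-- The operator identity. -/
lemma operator_identity (P : Par n κ γ R) {Λ : E n → E n → ℝ} {p : E n → E n → ℂ} (D : Data κ γ R ρ M m h (unc Λ) (unc p)) (hC : 0 ≤ C)
    (hc : Cuts n κ R C h ψ X) (k : ℕ) (hu : IsSigma κ u) {rN rinf : E n → E n → ℂ}
    (hN : rN = fun x ξ => remFin ψ X (unc Λ) (unc p) k (x, ξ)) (hinf : rinf = fun x ξ => remInf R ψ X (unc Λ) (unc p) k (x, ξ))
    (cN : Continuous (unc rN)) (cinf : Continuous (unc rinf)) (hNb : ∀ x ξ, ‖rN x ξ‖ ≤ B * jap h ξ ^ s)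
    (hinfb : ∀ x ξ, ‖rinf x ξ‖ ≤ B) :
    ∃ v w f₀ f₁ f₂ f₃ : E n → ℂ, IsAdjOp κ (expSym (-Λ)) u v ∧ IsOp p v w ∧ IsOp p u f₀ ∧ IsOp (expansion Λ p (k + 1)) u f₁ ∧
      IsOp rN u f₂ ∧ IsOp rinf u f₃ ∧ IsOp (toC (expSym Λ)) w (f₀ + f₁ + f₂ + f₃) := by
  have hκ := P.hκ
  have hγ := P.hγ
  have hR := P.hR
  have hh := D.hh
  obtain ⟨K₁, K₂, K₃, he, hp, ha⟩ := D.tame P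
  obtain ⟨N, hU⟩ := hu.nice (by linarith : 0 ≤ κ) hR
  have hU' := hU.of_half hR.le
  have hsum : ∀ x ξ, p x ξ + expansion Λ p (k + 1) x ξ + rN x ξ + rinf x ξ = compSym R ψ X (unc Λ) (unc p) (x, ξ) := fun x ξ => by
    rw [compSym_eq P.hγR D hC hc k, sum_dmix_eq D.phase.sym.smooth D.sym.smooth k (x, ξ), hN, hinf]
  have c0 : ∀ x, Continuous (p x) := fun x => hp.smooth.continuous.comp (Continuous.prodMk_right x)
  have cE := continuous_expansion D.phase.sym.smooth D.sym.smooth k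
  have e2 : ∀ ξ : E n, 1 ≤ ew κ (2 * γ) ‖ξ‖ := fun ξ => one_le_ew pos! (norm_nonneg _)
  have b0 : ∀ x, ∃ C, ∀ ξ, ‖p x ξ‖ ≤ C * ew κ (2 * γ) ‖ξ‖ := fun x => ⟨K₂, fun ξ => (hp.norm_le (x, ξ)).trans
    (mul_le_mul_of_nonneg_left (ew_le_ew (norm_nonneg _) lin!) hp.nonneg)⟩
  have b2 : ∀ x, ∃ C, ∀ ξ, ‖rN x ξ‖ ≤ C * ew κ (2 * γ) ‖ξ‖ := fun x => by
    obtain ⟨c, hc0, hcb⟩ := rpow_le_ew (κ := κ) lin! (by positivity : 0 < 2 * γ) s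
    have hB : 0 ≤ B := (norm_nonneg _).trans (hinfb 0 0)
    refine ⟨B * (c * ew κ (2 * γ) h), fun ξ => (hNb x ξ).trans ?_⟩
    rw [mul_assoc, mul_assoc]
    exact mul_le_mul_of_nonneg_left ((hcb _ (one_le_jap hh ξ)).trans
      (mul_le_mul_of_nonneg_left (ew_jap_le hκ.le pos! lin! ξ) hc0.le)) hB
  have b3 : ∀ x, ∃ C, ∀ ξ, ‖rinf x ξ‖ ≤ C * ew κ (2 * γ) ‖ξ‖ := fun x => ⟨B, fun ξ => (hinfb x ξ).trans
    (le_mul_of_one_le_right ((norm_nonneg _).trans (hinfb 0 0)) (e2 ξ))⟩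
  have b1 : ∀ x, ∃ C, ∀ ξ, ‖expansion Λ p (k + 1) x ξ‖ ≤ C * ew κ (2 * γ) ‖ξ‖ := fun x => by
    obtain ⟨K, hK⟩ := norm_compSym_le P D hC hc
    obtain ⟨k0, h0⟩ := b0 x
    obtain ⟨k2, h2⟩ := b2 x
    obtain ⟨k3, h3⟩ := b3 x
    refine ⟨K + k0 + k2 + k3, fun ξ => ?_⟩
    have : expansion Λ p (k + 1) x ξ = compSym R ψ X (unc Λ) (unc p) (x, ξ) - p x ξ - rN x ξ - rinf x ξ := by
      rw [← hsum]; ring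
    rw [this]
    refine (norm_sub_le _ _).trans ((add_le_add ((norm_sub_le _ _).trans (add_le_add ((norm_sub_le _ _).trans
      (add_le_add (hK (x, ξ)) (h0 ξ))) (h2 ξ))) (h3 ξ)).trans (le_of_eq (by ring)))
  have o0 := isOp_of_bound P hU' c0 b0
  have o1 := isOp_of_bound P hU' cE b1
  have o2 := isOp_of_bound (s := rN) P hU' (fun x => cN.comp (Continuous.prodMk_right x)) b2
  have o3 := isOp_of_bound (s := rinf) P hU' (fun x => cinf.comp (Continuous.prodMk_right x)) b3
  obtain ⟨a, ea⟩ : ∃ a : E² n → ℂ, a = fun q => ((exp (-unc Λ q) : ℝ) : ℂ) := ⟨_, rfl⟩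
  have j1 := isAdjOp_tInt P ha hU
  have j3 := integral_compSym P D hC hc hU
  rw [← ea] at ha j1 j3
  have j2 : IsOp p (fun x => cst n * tInt (fun _ => 1) a u x) fun x => cst n * tInt (unc p) a u x := isOp_adjoint (p := unc p) P hp ha hU'
  have j4 : ∀ x, Integrable fun ξ => chr x ξ * toC (expSym Λ) x ξ * ft (fun x => cst n * tInt (unc p) a u x) ξ :=
    fun x => integrable_outer (e := fun q => ((exp (unc Λ q) : ℝ) : ℂ)) (p := unc p) P he hp ha hU' x
  refine ⟨_, _, _, _, _, _, j1, j2, o0, o1, o2, o3, (tInt_nice P hp ha hU').2.1.const_mul _, fun x => ⟨j4 x, ?_⟩⟩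
  refine Eq.trans ?_ (j3 x)
  simp only [Pi.add_apply, ← mul_add, ← hsum]
  rw [← integral_add₄ (o0.2 x).1 (o1.2 x).1 (o2.2 x).1 (o3.2 x).1]
  refine congrArg _ (integral_congr_ae (.of_forall fun ξ => ?_))
  simp only []
  ring

end Conjugation

section Constants

/-- The ratio of the radius of the symbols to `A`. -/
def radK (κ : ℝ) (n : ℕ) : ℝ := 2 ^ κ * (2 * n + 1)

lemma radK_pos (κ : ℝ) (n : ℕ) : 0 < radK κ n := by unfold radK; positivity

/-- The growth constant of the remainders. -/
def growK (κ : ℝ) (n : ℕ) : ℝ := max (derK κ n * radK κ n) (((2 : ℝ) ^ κ) ^ (n + 1) * (2 ^ κ * (bigK κ n * radK κ n)))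

lemma growK_pos (κ : ℝ) (n : ℕ) : 0 < growK κ n := lt_max_of_lt_left (mul_pos (derK_pos κ n) (radK_pos κ n))

/-- The decay constant of the regularizing remainder. -/
def decK (κ : ℝ) (n : ℕ) : ℝ := (bigK κ n * radK κ n) ^ (-(1 / κ)) / 256

lemma decK_pos (κ : ℝ) (n : ℕ) : 0 < decK κ n :=
  div_pos (rpow_pos_of_pos (mul_pos (bigK_pos κ n) (radK_pos κ n)) _) num!

lemma expansion_zero (Λ : E n → E n → ℝ) (p : E n → E n → ℂ) (N : ℕ) : expansion Λ p N = expansion Λ p (N - 1 + 1) := by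
  rcases N with _ | N
  · have h : ∀ k, k ≤ 1 → pairs n k = ∅ := fun k hk => by
      refine Finset.filter_eq_empty_iff.mpr fun q _ h => ?_
      omega
    unfold expansion
    rw [h 0 num!, h (0 - 1 + 1) num!]
  · rfl

lemma dξ_dx_zero (a : E n → E n → ℂ) (x ξ : E n) : dξ 0 (dx 0 a) x ξ = a x ξ := by
  simp only [dξ, dx, mderiv_eq_mdd, mdd_zero]

lemma rem_fin_le {J : ℝ} (hκ : 1 < κ) (hb : 0 < b) (hJ : 1 ≤ J) (N : ℕ) :
    b ^ (2 * (N - 1 + 1)) * ((N - 1 + 1)! : ℝ) ^ (2 * κ - 1) * J ^ (m - (1 - 1 / κ) * ((N - 1 + 1 : ℕ) : ℝ) - s) ≤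
      (1 + b ^ 2 + (b ^ 2)⁻¹) * b ^ (2 * N) * (N ! : ℝ) ^ (2 * κ - 1) * J ^ (m - (1 - 1 / κ) * N - s) := by
  have hb2 : 0 < (b ^ 2)⁻¹ := pos!
  have hJ0 : 0 < J := lin!
  rcases N with _ | N
  · have h1 : 1 / κ ≤ 1 := (div_le_one lin!).mpr hκ.le
    have : J ^ (m - (1 - 1 / κ) * ((1 : ℕ) : ℝ) - s) ≤ J ^ (m - (1 - 1 / κ) * ((0 : ℕ) : ℝ) - s) :=
      rpow_le_rpow_of_exponent_le hJ (by push_cast; linarith)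
    simp only [Nat.zero_sub, zero_add, mul_one, Nat.factorial_one, Nat.factorial_zero, cast_one, one_rpow, mul_zero, pow_zero]
    simp only [cast_one, mul_one] at this
    exact mul_le_mul lin! this pos! pos!
  · have h1 : (1 : ℝ) ≤ 1 + b ^ 2 + (b ^ 2)⁻¹ := by nlinarith [sq_nonneg b]
    rw [Nat.add_sub_cancel, mul_assoc (_ * _), mul_assoc (1 + b ^ 2 + (b ^ 2)⁻¹), mul_assoc (b ^ _)]
    exact le_mul_of_one_le_left pos! h1

lemma rem_inf_le (hκ : 1 < κ) (hb : 0 < b) (N : ℕ) :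
    b ^ (2 * (N - 1)) * ((N - 1)! : ℝ) ^ (2 * κ - 1) ≤ (1 + b ^ 2 + (b ^ 2)⁻¹) * b ^ (2 * N) * (N ! : ℝ) ^ (2 * κ - 1) := by
  have hb2 : 0 < (b ^ 2)⁻¹ := pos!
  rcases N with _ | N
  · simp only [Nat.zero_sub, mul_zero, pow_zero, mul_one, Nat.factorial_zero, cast_one, one_rpow]
    nlinarith [sq_nonneg b]
  · have h1 : b ^ (2 * N) = (b ^ 2)⁻¹ * b ^ (2 * (N + 1)) := by
      rw [mul_add, pow_add, mul_one, mul_comm (b ^ (2 * N)), ← mul_assoc, inv_mul_cancel₀ pos!, one_mul]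
    have h2 : ((N ! : ℕ) : ℝ) ≤ ((N + 1)! : ℕ) := by exact_mod_cast Nat.factorial_le (Nat.le_succ N)
    have h3 : 0 ≤ 2 * κ - 1 := lin!
    rw [Nat.add_sub_cancel, h1]
    gcongr
    nlinarith [sq_nonneg b]

lemma isRegularizing_of_bound {r : E n → E n → ℂ} {G : ℝ} (hB : 0 ≤ B) (hG : 0 ≤ G) (hc : 0 < c) (hκ : 0 < κ) (hr : Smooth₂ r)
    (hb : ∀ (α β : MIdx n) (x ξ : E n), ‖dξ α (dx β r) x ξ‖ ≤ B * G ^ (len α + len β) * mfact α ^ κ * mfact β ^ κ *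
      exp (-c * jap h ξ ^ (1 / κ))) : IsRegularizing κ r := by
  refine ⟨hr, B + G + 1, pos!, c, hc, fun α β x ξ => (hb α β x ξ).trans ?_⟩
  have h1 := mfact_pos α
  have h2 := mfact_pos β
  have h3 := norm_le_jap h ξ
  have h4 : B * G ^ (len α + len β) ≤ (B + G + 1) ^ (len α + len β + 1) := by
    rw [pow_succ']
    gcongr <;> linarith
  have h5 : exp (-c * jap h ξ ^ (1 / κ)) ≤ exp (-c * ‖ξ‖ ^ (1 / κ)) := by
    rw [exp_le_exp, neg_mul, neg_mul, neg_le_neg_iff]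
    gcongr
  gcongr

lemma exists_parameters (n : ℕ) (hκ : 1 < κ) (hA : 0 < A) : ∃ γ δ : ℝ, Par n κ γ (radK κ n * A) ∧ 0 < δ ∧
    4 * γ = decK κ n * A ^ (-(1 / κ)) ∧ ∀ ρ : ℝ, ρ ≤ δ * A ^ (-(1 / κ)) → 8 * (n + 1) * (ρ * (1 + (2 * n + 1) * A)) ≤ γ := by
  have hr := radK_pos κ n
  have hK := bigK_pos κ n
  have hD := decK_pos κ n
  have hAκ : 0 < A ^ (-(1 / κ)) := rpow_pos_of_pos hA _
  refine ⟨decK κ n * A ^ (-(1 / κ)) / 4, decK κ n / (32 * (n + 1) * (1 + (2 * n + 1) * A)),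
    ⟨hκ, pos!, pos!, ?_⟩, pos!, by ring, fun ρ hρ => ?_⟩
  · rw [← mul_assoc, mul_rpow pos! hA.le, decK]
    ring
  · calc 8 * (n + 1) * (ρ * (1 + (2 * n + 1) * A)) ≤ 8 * (n + 1) * (decK κ n / (32 * (n + 1) * (1 + (2 * n + 1) * A)) *
          A ^ (-(1 / κ)) * (1 + (2 * n + 1) * A)) := mono!
      _ = _ := by field_simp; ring

end Constants

end GevreyConj

end

theorem mainTheorem2 (n : ℕ) (κ : ℝ) (hκ : 1 < κ) :
    ∃ Cκ > 0, ∃ cκ > 0, ∀ A : ℝ, 0 < A →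
    ∃ δ > 0, ∃ h₀ : ℝ, 1 ≤ h₀ ∧ ∀ ρ₀ : ℝ, ρ₀ ≤ δ * A ^ (-(1 / κ)) →
    ∀ m Cp : ℝ, ∃ C > 0, ∀ h : ℝ, h₀ ≤ h →
    ∀ (p : GevreyConj.E n → GevreyConj.E n → ℂ) (Λ : GevreyConj.E n → GevreyConj.E n → ℝ),
      GevreyConj.IsGevreySymbol κ A Cp m h p →
      GevreyConj.IsAdmissiblePhase κ A ρ₀ h Λ →
      ∀ N : ℕ, ∃ rN rinf : GevreyConj.E n → GevreyConj.E n → ℂ,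
        -- the operator identity, on the Gelfand-Shilov space of order `κ`
        (∀ u : GevreyConj.E n → ℂ, GevreyConj.IsSigma κ u →
          ∃ v w f₀ f₁ f₂ f₃ : GevreyConj.E n → ℂ,
            GevreyConj.IsAdjOp κ (GevreyConj.expSym (-Λ)) u v ∧
            GevreyConj.IsOp p v w ∧
            GevreyConj.IsOp p u f₀ ∧
            GevreyConj.IsOp (GevreyConj.expansion Λ p N) u f₁ ∧
            GevreyConj.IsOp rN u f₂ ∧
            GevreyConj.IsOp rinf u f₃ ∧
            GevreyConj.IsOp (GevreyConj.toC (GevreyConj.expSym Λ)) w (f₀ + f₁ + f₂ + f₃)) ∧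
        -- the estimates of the remainders
        GevreyConj.Smooth₂ rN ∧
        (∀ (α β : GevreyConj.MIdx n) (x ξ : GevreyConj.E n),
          ‖GevreyConj.dξ α (GevreyConj.dx β rN) x ξ‖ ≤
            C * (Cκ * A) ^ (GevreyConj.len α + GevreyConj.len β + 2 * N) *
              GevreyConj.mfact α ^ κ * GevreyConj.mfact β ^ κ * (N ! : ℝ) ^ (2 * κ - 1) *
              GevreyConj.jap h ξ ^ (m - (1 - 1 / κ) * N - (GevreyConj.len α : ℝ))) ∧
        GevreyConj.Smooth₂ rinf ∧
        (∀ (α β : GevreyConj.MIdx n) (x ξ : GevreyConj.E n),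
          ‖GevreyConj.dξ α (GevreyConj.dx β rinf) x ξ‖ ≤
            C * (Cκ * A) ^ (GevreyConj.len α + GevreyConj.len β + 2 * N) *
              GevreyConj.mfact α ^ κ * GevreyConj.mfact β ^ κ * (N ! : ℝ) ^ (2 * κ - 1) *
              Real.exp (-cκ * A ^ (-(1 / κ)) * GevreyConj.jap h ξ ^ (1 / κ))) ∧
        GevreyConj.IsRegularizing κ rinf := by
  open GevreyConj in
  refine ⟨growK κ n, growK_pos κ n, decK κ n, decK_pos κ n, fun A hA => ?_⟩
  obtain ⟨γ, δ, P, hδ, h4γ, hsmall⟩ := exists_parameters n hκ hA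
  refine ⟨δ, hδ, 1, le_rfl, fun ρ₀ hρ₀ m Cp => ?_⟩
  have hγ := P.hγ
  have hR := P.hR
  obtain ⟨C₁, hC₁, hcuts⟩ := exists_cuts n hκ hR
  obtain ⟨C', hC', hrem⟩ := exists_remainder_bounds n hκ hγ hR P.hγR m C₁ hC₁
  have hb : 0 < derK κ n * (radK κ n * A) := mul_pos (derK_pos κ n) hR
  have hq : 0 < ((derK κ n * (radK κ n * A)) ^ 2)⁻¹ := pos!
  have hG : 0 < growK κ n * A := mul_pos (growK_pos κ n) hA
  have hb1 : derK κ n * (radK κ n * A) ≤ growK κ n * A := by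
    rw [← mul_assoc]; exact mul_le_mul_of_nonneg_right (le_max_left _ _) hA.le
  have hb2 : ((2 : ℝ) ^ κ) ^ (n + 1) * (2 ^ κ * (bigK κ n * (radK κ n * A))) ≤ growK κ n * A := by
    calc _ = ((2 : ℝ) ^ κ) ^ (n + 1) * (2 ^ κ * (bigK κ n * radK κ n)) * A := by ring
      _ ≤ _ := mul_le_mul_of_nonneg_right (le_max_right _ _) hA.le
  have hK := bigK_pos κ n
  refine ⟨C' * (|Cp| + 1) * (1 + (derK κ n * (radK κ n * A)) ^ 2 + ((derK κ n * (radK κ n * A)) ^ 2)⁻¹), pos!,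
    fun h hh p Λ hp hΛ N => ?_⟩
  have hκ0 : 0 ≤ κ := lin!
  obtain ⟨hp', hCp⟩ := SymBd.of_isGevreySymbol hκ0 hA.le hh hp
  obtain ⟨hΛ', hρ0⟩ := PhaseBd.of_isAdmissiblePhase hκ.le hA hh hΛ
  have eR : radK κ n * A = 2 ^ κ * ((2 * n + 1) * A) := by rw [radK]; ring
  have hrA : (2 * n + 1) * A ≤ radK κ n * A := by
    rw [eR]
    exact le_mul_of_one_le_left pos! (one_le_two_rpow hκ0)
  rw [← eR] at hΛ'
  have D : Data κ γ (radK κ n * A) (ρ₀ * (1 + (2 * n + 1) * A)) Cp m h (unc Λ) (unc p) :=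
    ⟨hκ, hR, hγ, pos!, hsmall ρ₀ hρ₀, hh, hΛ', hp'.mono pos! hrA le_rfl hh, hCp⟩
  obtain ⟨ψ, X, hc⟩ := hcuts h hh
  obtain ⟨sN, sinf, hbd⟩ := hrem D hc (N - 1)
  have hCpa : Cp ≤ |Cp| + 1 := by linarith [le_abs_self Cp]
  generalize hbe : derK κ n * (radK κ n * A) = b at hb hq hb1 hbd ⊢
  generalize hge : ((2 : ℝ) ^ κ) ^ (n + 1) * (2 ^ κ * (bigK κ n * (radK κ n * A))) = g at hb2 hbd
  have hg : 0 ≤ g := by rw [← hge]; positivity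
  have bN : ∀ (α β : MIdx n) (x ξ : E n), ‖dξ α (dx β fun x ξ => remFin ψ X (unc Λ) (unc p) (N - 1) (x, ξ)) x ξ‖ ≤
      C' * (|Cp| + 1) * (1 + b ^ 2 + (b ^ 2)⁻¹) * (growK κ n * A) ^ (len α + len β + 2 * N) * mfact α ^ κ * mfact β ^ κ *
        (N ! : ℝ) ^ (2 * κ - 1) * jap h ξ ^ (m - (1 - 1 / κ) * N - (len α : ℝ)) := fun α β x ξ => by
    have h1 := mfact_pos α
    have h2 := mfact_pos β
    have hJ := one_le_jap hh ξ
    have hJ0 : 0 < jap h ξ := lin!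
    have h3 := rem_fin_le (m := m) (s := (len α : ℝ)) hκ hb hJ N
    calc _ ≤ _ := (hbd α β x ξ).1
      _ = C' * Cp * (g ^ (len α + len β) * mfact α ^ κ * mfact β ^ κ) * (b ^ (2 * (N - 1 + 1)) * ((N - 1 + 1)! : ℝ) ^ (2 * κ - 1) *
          jap h ξ ^ (m - (1 - 1 / κ) * ((N - 1 + 1 : ℕ) : ℝ) - len α)) := by ring
      _ ≤ C' * (|Cp| + 1) * ((growK κ n * A) ^ (len α + len β) * mfact α ^ κ * mfact β ^ κ) * ((1 + b ^ 2 + (b ^ 2)⁻¹) *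
          (growK κ n * A) ^ (2 * N) * (N ! : ℝ) ^ (2 * κ - 1) * jap h ξ ^ (m - (1 - 1 / κ) * N - len α)) := by
          refine mul_le_mul mono! (h3.trans mono!) pos! pos!
      _ = _ := by rw [pow_add]; ring
  have binf : ∀ (α β : MIdx n) (x ξ : E n), ‖dξ α (dx β fun x ξ => remInf (radK κ n * A) ψ X (unc Λ) (unc p) (N - 1) (x, ξ)) x ξ‖ ≤
      C' * (|Cp| + 1) * (1 + b ^ 2 + (b ^ 2)⁻¹) * (growK κ n * A) ^ (len α + len β + 2 * N) * mfact α ^ κ * mfact β ^ κ *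
        (N ! : ℝ) ^ (2 * κ - 1) * Real.exp (-decK κ n * A ^ (-(1 / κ)) * jap h ξ ^ (1 / κ)) := fun α β x ξ => by
    have h1 := mfact_pos α
    have h2 := mfact_pos β
    have h3 := rem_inf_le hκ hb N
    have h5 := ew_pos κ (-(4 * γ)) (jap h ξ)
    have h4 : Real.exp (-decK κ n * A ^ (-(1 / κ)) * jap h ξ ^ (1 / κ)) = ew κ (-(4 * γ)) (jap h ξ) := by
      rw [ew, h4γ, neg_mul]
    rw [h4]
    calc _ ≤ _ := (hbd α β x ξ).2
      _ = C' * Cp * (g ^ (len α + len β) * mfact α ^ κ * mfact β ^ κ) * (b ^ (2 * (N - 1)) * ((N - 1)! : ℝ) ^ (2 * κ - 1)) *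
          ew κ (-(4 * γ)) (jap h ξ) := by ring
      _ ≤ C' * (|Cp| + 1) * ((growK κ n * A) ^ (len α + len β) * mfact α ^ κ * mfact β ^ κ) * ((1 + b ^ 2 + (b ^ 2)⁻¹) *
          (growK κ n * A) ^ (2 * N) * (N ! : ℝ) ^ (2 * κ - 1)) * ew κ (-(4 * γ)) (jap h ξ) := by
          refine mul_le_mul_of_nonneg_right (mul_le_mul mono! (h3.trans mono!) pos! pos!) h5.le
      _ = _ := by rw [pow_add]; ring
  have hcA : 0 < decK κ n * A ^ (-(1 / κ)) := mul_pos (decK_pos κ n) (Real.rpow_pos_of_pos hA _)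
  have cb := fun x ξ => binf 0 0 x ξ
  have cN := fun x ξ => bN 0 0 x ξ
  simp only [dξ_dx_zero, len_zero, mfact_zero, Real.one_rpow, mul_one] at cb cN
  refine ⟨fun x ξ => remFin ψ X (unc Λ) (unc p) (N - 1) (x, ξ), fun x ξ => remInf (radK κ n * A) ψ X (unc Λ) (unc p) (N - 1) (x, ξ),
    fun u hu => ?_, sN, bN, sinf, binf, ?_⟩
  · rw [expansion_zero Λ p N]
    refine operator_identity P D hC₁ hc (N - 1) hu rfl rfl sN.continuous sinf.continuous cN fun x ξ => (cb x ξ).trans ?_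
    refine mul_le_of_le_one_right pos! (Real.exp_le_one_iff.mpr ?_)
    rw [neg_mul, neg_mul]
    have : 0 ≤ jap h ξ ^ (1 / κ) := Real.rpow_nonneg (by linarith [one_le_jap hh ξ]) _
    exact neg_nonpos.mpr (mul_nonneg hcA.le this)
  · refine isRegularizing_of_bound (G := growK κ n * A) (h := h)
      (B := C' * (|Cp| + 1) * (1 + b ^ 2 + (b ^ 2)⁻¹) * (growK κ n * A) ^ (2 * N) * (N ! : ℝ) ^ (2 * κ - 1))
      pos! hG.le hcA lin! sinf fun α β x ξ => (binf α β x ξ).trans (le_of_eq ?_)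
    rw [pow_add, ← neg_mul]
    ring
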